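/- **Setting.** Two quadrotors ($j=1,2$) of mass $m_Q$ and symmetric positive definite inertia matrix $J_Q$ carry, by cables of length $L_c$, a rod of mass $m_r$ and length $2L_r$; $m_Q,m_r,L_r,L_c,g>0$. The state consists of $x_r,v_r\in\mathbb R^3$, $q_r,q_j\in S^2$, $\omega_r\perp q_r$, $\omega_j\perp q_j$, $R_j\in SO(3)$, $\Omega_j\in\mathbb R^3$. With $m_{\rm eff}=2m_Q+m_r$, $I_{\rm eff}=(2m_Q+\tfrac23m_r)L_r$ and forces $T_j=f_jR_je_3$, the reduced model is $$\dot x_r=v_r,\quad m_{\rm eff}(\dot v_r+ge_3)=T_1+T_2+m_QL_c(\ddot q_1+\ddot q_2),\quad \dot q_r=\omega_r\times q_r,\quad I_{\rm eff}\dot\omega_r=q_r\times[T_2-T_1+m_QL_c(\ddot q_2-\ddot q_1)],$$ $$\dot q_j=\omega_j\times q_j,\quad m_QL_c\dot\omega_j=m_Qq_j\times(\dot v_r+(-1)^jL_r\ddot q_r+ge_3)-q_j\times T_j,\quad \dot R_j=R_j\hat\Omega_j,\quad J_Q\dot\Omega_j=J_Q\Omega_j\times\Omega_j+M_j .$$ **Controls.**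 Let $\tilde x_r:\mathbb R\to\mathbb R^3$, $\tilde q_r:\mathbb R\to S^2$, $b^1_j:\mathbb R\to S^2$ be smooth, $\tilde v_r=\dot{\tilde x}_r$, $\tilde\omega_r=\tilde q_r\times\dot{\tilde q}_r$, and let $k_{x_r},k_{v_r},k_{q_r},k_{\omega_r},k_{q_j},k_{\omega_j}>0$ be gains. Put $e_{x_r}=x_r-\tilde x_r$, $e_{v_r}=v_r-\tilde v_r$, $e_{q_r}=\tilde q_r\times q_r$, $e_{\omega_r}=\omega_r+\hat q_r^2\tilde\omega_r$, define $\tilde\mu_1,\tilde\mu_2$ by $$\tilde\mu_1+\tilde\mu_2=m_r(\dot{\tilde v}_r+ge_3-k_{v_r}e_{v_r}-k_{x_r}e_{x_r}),$$ $$\tilde\mu_2-\tilde\mu_1=\tfrac23m_rL_r\big[-\hat q_r\dot{\tilde\omega}_r+(q_r^T\tilde\omega_r)\hat q_r^2\tilde\omega_r-(q_r^T\tilde\omega_r)e_{\omega_r}+k_{\omega_r}\hat q_re_{\omega_r}+k_{q_r}\hat q_re_{q_r}\big],$$ and $\mu_j=(I+\hat q_j^2)\tilde\mu_j$, $\tilde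 q_j=-\tilde\mu_j/\|\tilde\mu_j\|$. The force $u_j$ is designed for the model in which it can be applied in any direction, i.e. $\dot x_r=v_r$, $m_r(\dot v_r+ge_3)=\mu_1+\mu_2$, $\dot q_r=\omega_r\times q_r$, $\tfrac23m_rL_r\dot\omega_r=q_r\times(\mu_2-\mu_1)$, $\dot q_j=\omega_j\times q_j$; let $a_x,a_q$ denote the accelerations $\ddot x_r,\ddot q_r$ given by this design model, and let $\tilde\omega_j=\tilde q_j\times\dot{\tilde q}_j$ and $\dot{\tilde\omega}_j$ be formed with time derivatives along it (all are functions of time and state). With $A_j=a_x+(-1)^jL_ra_q+ge_3$, $e_{q_j}=\tilde q_j\times q_j$, $e_{\omega_j}=\omega_j+\hat q_j^2\tilde\omega_j$, put $$u_j=\mu_j+m_Q\big((A_j^Tq_j)q_j+L_c\|\omega_j\|^2q_j\big)-m_Q\hat q_j^2\big[A_j+L_c\hat q_j\dot{\tilde\omega}_j-L_c(q_j^T\tilde\omega_j)\omega_j\big]-m_QL_c\hat q_j\big[k_{q_j}e_{q_j}+k_{\omega_j}e_{\omega_j}\big].$$ With $b^3_j=u_j/\|u_j\|$ let $$R_{j,d}=\Big[-\tfrac{(\hat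 b^3_j)^2b^1_j}{\|(\hat b^3_j)^2b^1_j\|},\ \tfrac{\hat b^3_jb^1_j}{\|\hat b^3_jb^1_j\|},\ b^3_j\Big]\in SO(3),\quad \Omega_{j,d}=(R_{j,d}^T\dot R_{j,d})^\vee,$$ $e_{R_j}=\tfrac12(R_{j,d}^TR_j-R_j^TR_{j,d})^\vee$, $e_{\Omega_j}=\Omega_j-R_j^TR_{j,d}\Omega_{j,d}$, where $\dot R_{j,d},\dot\Omega_{j,d}$ are derivatives along the actual motion. The inputs are, with $k_R,k_\Omega,\epsilon>0$, $$f_j=u_j\cdot R_je_3,\qquad M_j=-\tfrac{k_R}{\epsilon^2}e_{R_j}-\tfrac{k_\Omega}{\epsilon}e_{\Omega_j}+\Omega_j\times J_Q\Omega_j-J_Q(\hat\Omega_jR_j^TR_{j,d}\Omega_{j,d}-R_j^TR_{j,d}\dot\Omega_{j,d}).$$ **Assumptions on the desired motion.** On $[0,\infty)$ the derivatives of $\tilde x_r$ of orders $2,3,4$ and those of $\tilde q_r$ of orders $1,\dots,4$ are bounded. On the exact desired motion of the rod, put $\mu^d_j=\tfrac12\big(m_r(\ddot{\tilde x}_r+ge_3)-(-1)^j\tfrac23m_rL_r\,\tilde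 q_r\times\dot{\tilde\omega}_r\big)$, $q^d_j=-\mu^d_j/\|\mu^d_j\|$ and $u^d_j=\mu^d_j+m_Q(\ddot{\tilde x}_r+(-1)^jL_r\ddot{\tilde q}_r-L_c\ddot q^d_j+ge_3)$ (the values of $\tilde\mu_j,\tilde q_j,u_j$ at zero error); the numbers $\|\mu^d_j\|$, $\|u^d_j\|$, $\big\|\tfrac{u^d_j}{\|u^d_j\|}\times b^1_j\big\|$ are bounded below by a positive constant for $t\ge0$, $j=1,2$. **Corollary 4.3.** There are gains $k_{x_r},k_{v_r},k_{q_r},k_{\omega_r},k_{q_1},k_{\omega_1},k_{q_2},k_{\omega_2}>0$ such that for all $k_R,k_\Omega>0$ there is $\delta>0$ such that for all $0<\epsilon<\delta$ the zero equilibrium of the tracking errors $$e=(e_{x_r},e_{v_r},e_{q_r},e_{\omega_r},e_{q_1},e_{\omega_1},e_{q_2},e_{\omega_2},e_{R_1},e_{\Omega_1},e_{R_2},e_{\Omega_2})$$ is exponentially stable: there are $\rho,C,\lambda>0$ such that for every $t_0\ge0$, all initial data at $t_0$ with $\|e(t_0)\|<\rho$ and with configuration errors $1-\tilde q_r^Tq_r$,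 $1-\tilde q_j^Tq_j$, $\tfrac12\mathrm{tr}(I-R_{j,d}^TR_j)$ less than $1$ admit a solution on $[t_0,\infty)$, and every solution on an interval $[t_0,T)$, $t_0<T\le\infty$, with such initial data keeps these configuration errors below $1$ and satisfies $\|e(t)\|\le C\|e(t_0)\|e^{-\lambda(t-t_0)}$ for all $t\in[t_0,T)$. -/

import Mathlib

open scoped Matrix ContDiff

noncomputable section

namespace RodTransport

/-! ### Vectors in `ℝ³` -/

abbrev V3 := Fin 3 → ℝ
abbrev M3 := Matrix (Fin 3) (Fin 3) ℝ

/-- Euclidean length (the instance norm on `Fin 3 → ℝ` is the sup norm). -/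
def len (v : V3) : ℝ := Real.sqrt (v ⬝ᵥ v)

def e3 : V3 := ![0, 0, 1]

/-- The hat isomorphism `ℝ³ → so(3)`. -/
def hat (v : V3) : M3 := !![0, -v 2, v 1; v 2, 0, -v 0; -v 1, v 0, 0]

/-- The inverse of the hat map (on skew-symmetric matrices). -/
def vee (A : M3) : V3 := ![A 2 1, A 0 2, A 1 0]

/-- `(-1)^j` for `j = 1, 2`; the quadrotors `1, 2` are the elements `0, 1` of `Fin 2`. -/
def sgn (j : Fin 2) : ℝ := (-1) ^ ((j : ℕ) + 1)

/-! ### Data -/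

/-- Physical parameters: masses of a quadrotor and of the rod, half length of the rod, length of
the cables, gravity, inertia matrix of a quadrotor. -/
structure Params where
  mQ : ℝ
  mr : ℝ
  Lr : ℝ
  Lc : ℝ
  g : ℝ
  J : M3
  mQ_pos : 0 < mQ
  mr_pos : 0 < mr
  Lr_pos : 0 < Lr
  Lc_pos : 0 < Lc
  g_pos : 0 < g
  J_posDef : J.PosDef

def Params.mEff (P : Params) : ℝ := 2 * P.mQ + P.mr
def Params.IEff (P : Params) : ℝ := (2 * P.mQ + 2 / 3 * P.mr) * P.Lr

/-- Positive gains of the thrust controller: `kx, kv` for the position of the rod, `kq, kw` for its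
attitude, `kqc j, kwc j` for the attitude of cable `j`. -/
structure Gains where
  kx : ℝ
  kv : ℝ
  kq : ℝ
  kw : ℝ
  kqc : Fin 2 → ℝ
  kwc : Fin 2 → ℝ
  kx_pos : 0 < kx
  kv_pos : 0 < kv
  kq_pos : 0 < kq
  kw_pos : 0 < kw
  kqc_pos : ∀ j, 0 < kqc j
  kwc_pos : ∀ j, 0 < kwc j

/-- Desired motion: position `x` and attitude `q` of the rod, and the desired directions `b j` of
the first body-fixed axes of the quadrotors. -/
structure Desired where
  x : ℝ → V3
  q : ℝ → V3
  b : Fin 2 → ℝ → V3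
  x_smooth : ContDiff ℝ ∞ x
  q_smooth : ContDiff ℝ ∞ q
  b_smooth : ∀ j, ContDiff ℝ ∞ (b j)
  q_unit : ∀ t, q t ⬝ᵥ q t = 1
  b_unit : ∀ j t, b j t ⬝ᵥ b j t = 1

namespace Desired

def v (D : Desired) : ℝ → V3 := deriv D.x
def a (D : Desired) : ℝ → V3 := deriv D.v

/-- Desired angular velocity of the rod: `q' = w ⨯ q` and `w ⬝ q = 0`. -/
def w (D : Desired) (t : ℝ) : V3 := D.q t ⨯₃ deriv D.q t
def wdot (D : Desired) : ℝ → V3 := deriv D.w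

/-- Bounded derivatives of the desired motion. -/
def Bounded (D : Desired) : Prop :=
  ∃ B : ℝ, ∀ t, 0 ≤ t →
    (∀ n, 2 ≤ n → n ≤ 4 → ‖iteratedDeriv n D.x t‖ ≤ B) ∧
    (∀ n, 1 ≤ n → n ≤ 4 → ‖iteratedDeriv n D.q t‖ ≤ B)

/-- The part of the cable force on the rod assigned to cable `j` when the rod is exactly on its
desired motion. -/
def mu (D : Desired) (P : Params) (j : Fin 2) (t : ℝ) : V3 :=
  (1 / 2 : ℝ) • (P.mr • (D.a t + P.g • e3)
    + sgn j • (2 / 3 * P.mr * P.Lr) • (-(D.q t ⨯₃ D.wdot t)))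

/-- Direction of cable `j` on the desired motion. -/
def qc (D : Desired) (P : Params) (j : Fin 2) (t : ℝ) : V3 :=
  -((len (D.mu P j t))⁻¹ • D.mu P j t)

/-- Thrust force of quadrotor `j` on the desired motion, on which the quadrotor is at
`x + (-1)^j Lr q - Lc qc`. -/
def u (D : Desired) (P : Params) (j : Fin 2) (t : ℝ) : V3 :=
  D.mu P j t + P.mQ • (deriv (deriv D.x) t + (sgn j * P.Lr) • deriv (deriv D.q) t
    - P.Lc • deriv (deriv (D.qc P j)) t + P.g • e3)

/-- The desired cable directions and the desired quadrotor attitudes are well defined, uniformly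
in time, on the desired motion: the vectors that are normalised to define them stay away from
zero. -/
def Nondegenerate (D : Desired) (P : Params) : Prop :=
  ∃ c : ℝ, 0 < c ∧ ∀ t, 0 ≤ t → ∀ j,
    c ≤ len (D.mu P j t) ∧
    c ≤ len (D.u P j t) ∧
    c ≤ len (((len (D.u P j t))⁻¹ • D.u P j t) ⨯₃ D.b j t)

end Desired

/-! ### The thrust controller

`Rod` collects `(x_r, v_r, q_r, ω_r)`; the cable directions `(q_1, q_2)` and the cable angular
velocities `(ω_1, ω_2)` are separate arguments `qc`, `wc`. All quantities are functions of time and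
of the state. -/

abbrev Rod := V3 × V3 × V3 × V3

abbrev xR (r : Rod) : V3 := r.1
abbrev vR (r : Rod) : V3 := r.2.1
abbrev qR (r : Rod) : V3 := r.2.2.1
abbrev wR (r : Rod) : V3 := r.2.2.2

section Controller

variable (P : Params) (K : Gains) (D : Desired)

def exr (t : ℝ) (r : Rod) : V3 := xR r - D.x t
def evr (t : ℝ) (r : Rod) : V3 := vR r - D.v t
def eqr (t : ℝ) (r : Rod) : V3 := D.q t ⨯₃ qR r
def ewr (t : ℝ) (r : Rod) : V3 := wR r + qR r ⨯₃ (qR r ⨯₃ D.w t)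

/-- `μ̃₁ + μ̃₂`. -/
def muSum (t : ℝ) (r : Rod) : V3 :=
  P.mr • (D.a t + P.g • e3 - K.kv • evr D t r - K.kx • exr D t r)

/-- `μ̃₂ - μ̃₁`. -/
def muDiff (t : ℝ) (r : Rod) : V3 :=
  (2 / 3 * P.mr * P.Lr) •
    (-(qR r ⨯₃ D.wdot t)
      + (qR r ⬝ᵥ D.w t) • (qR r ⨯₃ (qR r ⨯₃ D.w t))
      - (qR r ⬝ᵥ D.w t) • ewr D t r
      + K.kw • (qR r ⨯₃ ewr D t r)
      + K.kq • (qR r ⨯₃ eqr D t r))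

/-- `μ̃_j`. -/
def muTilde (j : Fin 2) (t : ℝ) (r : Rod) : V3 :=
  (1 / 2 : ℝ) • (muSum P K D t r + sgn j • muDiff P K D t r)

/-- Desired cable direction `q̃_j`. -/
def qTilde (j : Fin 2) (t : ℝ) (r : Rod) : V3 :=
  -((len (muTilde P K D j t r))⁻¹ • muTilde P K D j t r)

/-- `μ_j = (I + q̂_j²) μ̃_j`. -/
def mu (j : Fin 2) (t : ℝ) (r : Rod) (qc : Fin 2 → V3) : V3 :=
  muTilde P K D j t r + qc j ⨯₃ (qc j ⨯₃ muTilde P K D j t r)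

/-- `ẍ_r` in the design model `m_r (v̇_r + g e₃) = μ₁ + μ₂`. -/
def accX (t : ℝ) (r : Rod) (qc : Fin 2 → V3) : V3 :=
  (1 / P.mr) • (mu P K D 0 t r qc + mu P K D 1 t r qc) - P.g • e3

/-- `ω̇_r` in the design model `(2/3) m_r L_r ω̇_r = q_r × (μ₂ - μ₁)`. -/
def accW (t : ℝ) (r : Rod) (qc : Fin 2 → V3) : V3 :=
  (1 / (2 / 3 * P.mr * P.Lr)) • (qR r ⨯₃ (mu P K D 1 t r qc - mu P K D 0 t r qc))

/-- `q̈_r` in the design model, from `q̇_r = ω_r × q_r`. -/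
def accQ (t : ℝ) (r : Rod) (qc : Fin 2 → V3) : V3 :=
  accW P K D t r qc ⨯₃ qR r + wR r ⨯₃ (wR r ⨯₃ qR r)

/-- Right-hand side of the rod equations of the design model. -/
def rodField (t : ℝ) (r : Rod) (qc : Fin 2 → V3) : Rod :=
  (vR r, accX P K D t r qc, wR r ⨯₃ qR r, accW P K D t r qc)

/-- Desired angular velocity `ω̃_j = q̃_j × dq̃_j/dt` of cable `j`, the time derivative being the
one along the design model. -/
def wTilde (j : Fin 2) (t : ℝ) (r : Rod) (qc : Fin 2 → V3) : V3 :=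
  qTilde P K D j t r ⨯₃
    fderiv ℝ (fun p : ℝ × Rod => qTilde P K D j p.1 p.2) (t, r) (1, rodField P K D t r qc)

/-- `dω̃_j/dt` along the design model. -/
def wTildeDot (j : Fin 2) (t : ℝ) (r : Rod) (qc wc : Fin 2 → V3) : V3 :=
  fderiv ℝ (fun p : ℝ × Rod × (Fin 2 → V3) => wTilde P K D j p.1 p.2.1 p.2.2) (t, r, qc)
    (1, rodField P K D t r qc, fun i => wc i ⨯₃ qc i)

def eqc (j : Fin 2) (t : ℝ) (r : Rod) (qc : Fin 2 → V3) : V3 := qTilde P K D j t r ⨯₃ qc j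

def ewc (j : Fin 2) (t : ℝ) (r : Rod) (qc wc : Fin 2 → V3) : V3 :=
  wc j + qc j ⨯₃ (qc j ⨯₃ wTilde P K D j t r qc)

/-- Component of the designed force parallel to `q_j`. -/
def uPar (j : Fin 2) (t : ℝ) (r : Rod) (qc wc : Fin 2 → V3) : V3 :=
  mu P K D j t r qc
    + P.mQ • (((accX P K D t r qc + P.g • e3 + (sgn j * P.Lr) • accQ P K D t r qc) ⬝ᵥ qc j) • qc j
        + (P.Lc * (wc j ⬝ᵥ wc j)) • qc j)

/-- Component of the designed force perpendicular to `q_j`. -/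
def uPerp (j : Fin 2) (t : ℝ) (r : Rod) (qc wc : Fin 2 → V3) : V3 :=
  -(P.mQ • (qc j ⨯₃ (qc j ⨯₃
      (accX P K D t r qc + (sgn j * P.Lr) • accQ P K D t r qc + P.g • e3
        + P.Lc • (qc j ⨯₃ wTildeDot P K D j t r qc wc)
        - (P.Lc * (qc j ⬝ᵥ wTilde P K D j t r qc)) • wc j))))
  - (P.mQ * P.Lc) • (qc j ⨯₃
      (K.kqc j • eqc P K D j t r qc + K.kwc j • ewc P K D j t r qc wc))

/-- The designed force `u_j`. -/
def uCtrl (j : Fin 2) (t : ℝ) (r : Rod) (qc wc : Fin 2 → V3) : V3 :=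
  uPar P K D j t r qc wc + uPerp P K D j t r qc wc

end Controller

/-- The rotation whose third column is the direction `b₃` of `u` and whose first column is the
normalised projection of `b₁` to the plane orthogonal to `b₃`. -/
def attitude (u b1 : V3) : M3 :=
  let b3 : V3 := (len u)⁻¹ • u
  (Matrix.of ![-((len (b3 ⨯₃ (b3 ⨯₃ b1)))⁻¹ • (b3 ⨯₃ (b3 ⨯₃ b1))),
    (len (b3 ⨯₃ b1))⁻¹ • (b3 ⨯₃ b1), b3])ᵀ

section Errors

variable (P : Params) (K : Gains) (D : Desired)

/-- Desired attitude `R_{j,d}` of quadrotor `j`. -/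
def RDes (j : Fin 2) (t : ℝ) (r : Rod) (qc wc : Fin 2 → V3) : M3 :=
  attitude (uCtrl P K D j t r qc wc) (D.b j t)

/-- Attitude error `e_{R_j}`, for the attitude `R` of quadrotor `j`. -/
def eRot (j : Fin 2) (t : ℝ) (r : Rod) (qc wc : Fin 2 → V3) (R : M3) : V3 :=
  (1 / 2 : ℝ) • vee ((RDes P K D j t r qc wc)ᵀ * R - Rᵀ * RDes P K D j t r qc wc)

/-- Euclidean norm of the vector of all tracking errors; `η j` is the value of `e_{Ω_j}`. -/
def errNorm (t : ℝ) (r : Rod) (qc wc : Fin 2 → V3) (R : Fin 2 → M3) (η : Fin 2 → V3) : ℝ :=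
  Real.sqrt (
    len (exr D t r) ^ 2 + len (evr D t r) ^ 2 + len (eqr D t r) ^ 2 + len (ewr D t r) ^ 2
    + ∑ j, (len (eqc P K D j t r qc) ^ 2 + len (ewc P K D j t r qc wc) ^ 2
      + len (eRot P K D j t r qc wc (R j)) ^ 2 + len (η j) ^ 2))

/-- The attitudes are on the side of the desired attitudes, i.e. the configuration errors
`1 - q̃ ⬝ q` and `(1/2) tr (1 - R_dᵀ R)` are less than `1`. This separates the zero equilibrium from
the antipodal attitudes, at which `e_q` or `e_R` vanish as well. -/
def NearState (t : ℝ) (r : Rod) (qc wc : Fin 2 → V3) (R : Fin 2 → M3) : Prop :=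
  1 - D.q t ⬝ᵥ qR r < 1 ∧
  (∀ j, 1 - qTilde P K D j t r ⬝ᵥ qc j < 1) ∧
  (∀ j, 1 / 2 * (1 - (RDes P K D j t r qc wc)ᵀ * R j).trace < 1)

/-- The constraints `q_r, q_j ∈ S²`, `ω ⬝ q = 0`, `R_j ∈ SO(3)`. -/
def StateMem (r : Rod) (qc wc : Fin 2 → V3) (R : Fin 2 → M3) : Prop :=
  qR r ⬝ᵥ qR r = 1 ∧ wR r ⬝ᵥ qR r = 0 ∧
  (∀ j, qc j ⬝ᵥ qc j = 1 ∧ wc j ⬝ᵥ qc j = 0) ∧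
  ∀ j, R j ∈ Matrix.specialOrthogonalGroup (Fin 3) ℝ

end Errors

/-! ### The closed loop -/

/-- A motion of the reduced model (rod, cable attitudes, quadrotor attitudes). -/
structure Motion where
  x : ℝ → V3
  v : ℝ → V3
  q : ℝ → V3
  w : ℝ → V3
  qc : Fin 2 → ℝ → V3
  wc : Fin 2 → ℝ → V3
  R : Fin 2 → ℝ → M3
  Om : Fin 2 → ℝ → V3

/-- Second derivative on the time interval `I`. -/
def ddot (I : Set ℝ) (f : ℝ → V3) (t : ℝ) : V3 := derivWithin (derivWithin f I) I t

namespace Motion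

variable (y : Motion) (P : Params) (K : Gains) (D : Desired)

def rod (t : ℝ) : Rod := (y.x t, y.v t, y.q t, y.w t)
def qcs (t : ℝ) : Fin 2 → V3 := fun j => y.qc j t
def wcs (t : ℝ) : Fin 2 → V3 := fun j => y.wc j t
def Rs (t : ℝ) : Fin 2 → M3 := fun j => y.R j t

/-- The designed force along the motion. -/
def u (j : Fin 2) (t : ℝ) : V3 := uCtrl P K D j t (y.rod t) (y.qcs t) (y.wcs t)

/-- Thrust magnitude `f_j = u_j · R_j e₃`. -/
def f (j : Fin 2) (t : ℝ) : ℝ := y.u P K D j t ⬝ᵥ (y.R j t *ᵥ e3)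

/-- The force `f_j R_j e₃` that the quadrotor really exerts. -/
def thrust (j : Fin 2) (t : ℝ) : V3 := y.f P K D j t • (y.R j t *ᵥ e3)

/-- Desired attitude `R_{j,d}`. -/
def Rd (j : Fin 2) (t : ℝ) : M3 :=
  RDes P K D j t (y.rod t) (y.qcs t) (y.wcs t)

/-- Desired angular velocity `Ω_{j,d} = (R_{j,d}ᵀ dR_{j,d}/dt)^∨`. -/
def Omd (I : Set ℝ) (j : Fin 2) (t : ℝ) : V3 :=
  vee ((y.Rd P K D j t)ᵀ *
    Matrix.of fun a b => derivWithin (fun s => y.Rd P K D j s a b) I t)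

def eR (j : Fin 2) (t : ℝ) : V3 :=
  eRot P K D j t (y.rod t) (y.qcs t) (y.wcs t) (y.R j t)

def eOm (I : Set ℝ) (j : Fin 2) (t : ℝ) : V3 :=
  y.Om j t - ((y.R j t)ᵀ * y.Rd P K D j t) *ᵥ y.Omd P K D I j t

/-- The control moment `M_j`. -/
def moment (kR kOm ε : ℝ) (I : Set ℝ) (j : Fin 2) (t : ℝ) : V3 :=
  -((kR / ε ^ 2) • y.eR P K D j t) - (kOm / ε) • y.eOm P K D I j t
    + y.Om j t ⨯₃ (P.J *ᵥ y.Om j t)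
    - P.J *ᵥ (hat (y.Om j t) *ᵥ (((y.R j t)ᵀ * y.Rd P K D j t) *ᵥ y.Omd P K D I j t)
        - ((y.R j t)ᵀ * y.Rd P K D j t) *ᵥ derivWithin (y.Omd P K D I j) I t)

/-- `y` is a motion of the reduced model on the time interval `I` under the thrusts `f_j R_j e₃`
and the moments `M_j`. -/
structure IsSolution (kR kOm ε : ℝ) (I : Set ℝ) : Prop where
  mem : ∀ t ∈ I, StateMem (y.rod t) (y.qcs t) (y.wcs t) (y.Rs t)
  x_kin : ∀ t ∈ I, HasDerivWithinAt y.x (y.v t) I t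
  v_diff : DifferentiableOn ℝ y.v I
  v_dyn : ∀ t ∈ I, P.mEff • (derivWithin y.v I t + P.g • e3) =
    y.thrust P K D 0 t + y.thrust P K D 1 t
      + (P.mQ * P.Lc) • (ddot I (y.qc 0) t + ddot I (y.qc 1) t)
  q_kin : ∀ t ∈ I, HasDerivWithinAt y.q (y.w t ⨯₃ y.q t) I t
  w_diff : DifferentiableOn ℝ y.w I
  w_dyn : ∀ t ∈ I, P.IEff • derivWithin y.w I t =
    y.q t ⨯₃ (y.thrust P K D 1 t - y.thrust P K D 0 t
      + (P.mQ * P.Lc) • (ddot I (y.qc 1) t - ddot I (y.qc 0) t))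
  qc_kin : ∀ t ∈ I, ∀ j, HasDerivWithinAt (y.qc j) (y.wc j t ⨯₃ y.qc j t) I t
  wc_diff : ∀ j, DifferentiableOn ℝ (y.wc j) I
  wc_dyn : ∀ t ∈ I, ∀ j, (P.mQ * P.Lc) • derivWithin (y.wc j) I t =
    P.mQ • (y.qc j t ⨯₃
        (derivWithin y.v I t + (sgn j * P.Lr) • ddot I y.q t + P.g • e3))
      - y.qc j t ⨯₃ y.thrust P K D j t
  R_kin : ∀ t ∈ I, ∀ j a b,
    HasDerivWithinAt (fun s => y.R j s a b) ((y.R j t * hat (y.Om j t)) a b) I t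
  Om_diff : ∀ j, DifferentiableOn ℝ (y.Om j) I
  Om_dyn : ∀ t ∈ I, ∀ j, P.J *ᵥ derivWithin (y.Om j) I t =
    (P.J *ᵥ y.Om j t) ⨯₃ y.Om j t + y.moment P K D kR kOm ε I j t
  /-- The derivatives in the control moments exist. -/
  Rd_diff : ∀ j a b, DifferentiableOn ℝ (fun s => y.Rd P K D j s a b) I
  Omd_diff : ∀ j, DifferentiableOn ℝ (y.Omd P K D I j) I

/-- Norm of the tracking errors along a motion on `I`. -/
def err (I : Set ℝ) (t : ℝ) : ℝ :=
  errNorm P K D t (y.rod t) (y.qcs t) (y.wcs t) (y.Rs t) (fun j => y.eOm P K D I j t)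

def Near (t : ℝ) : Prop := NearState P K D t (y.rod t) (y.qcs t) (y.wcs t) (y.Rs t)

end Motion

/-- The zero equilibrium of the tracking errors is exponentially stable, uniformly in the initial
time: every motion that starts at a time `t₀ ≥ 0` with small errors satisfies the exponential
estimate as long as it exists, and all initial data with small errors are the initial data of a
motion on `[t₀, ∞)`. The initial angular velocity of quadrotor `j` is prescribed through the initial
error `η j = e_{Ω_j}(t₀)`, which corresponds bijectively to it once the other data are fixed. -/
def ExponentiallyStable (P : Params) (K : Gains) (D : Desired) (kR kOm ε : ℝ) : Prop :=
  ∃ ρ C lam : ℝ, 0 < ρ ∧ 0 < C ∧ 0 < lam ∧ ∀ t₀ : ℝ, 0 ≤ t₀ →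
    (∀ (I : Set ℝ) (y : Motion), (I = Set.Ici t₀ ∨ ∃ T, t₀ < T ∧ I = Set.Ico t₀ T) →
      y.IsSolution P K D kR kOm ε I → y.Near P K D t₀ → y.err P K D I t₀ < ρ →
      ∀ t ∈ I, y.Near P K D t ∧
        y.err P K D I t ≤ C * y.err P K D I t₀ * Real.exp (-lam * (t - t₀))) ∧
    (∀ (r : Rod) (qc wc : Fin 2 → V3) (R : Fin 2 → M3) (η : Fin 2 → V3),
      StateMem r qc wc R → NearState P K D t₀ r qc wc R →
      errNorm P K D t₀ r qc wc R η < ρ →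
      ∃ y : Motion, y.IsSolution P K D kR kOm ε (Set.Ici t₀) ∧
        y.rod t₀ = r ∧ y.qcs t₀ = qc ∧ y.wcs t₀ = wc ∧ y.Rs t₀ = R ∧
        ∀ j, y.eOm P K D (Set.Ici t₀) j t₀ = η j)

end RodTransport

end

open scoped Topology

namespace RodTransport

noncomputable section

/-! ### Euclidean length, dot and cross products -/

/-! In the right variables the closed loop is a cascade. The moments cancel the inertial and
feedforward terms, so the relative rotation `E = R_dᵀ R` and the error `η = e_Ω` satisfy the
autonomous system `E' = E hat η`, `J η' = -k₁ e_R - k₂ η` with `k₁ = k_R/ε²`, `k₂ = k_Ω/ε`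
(`moment_iff`). The force exerted by a quadrotor is the projection of `u` on its third body axis and
deviates from `u` by `O(|u| |e_R|)` (`len_projThrust_sub`).

The equations of the rod and the cables are implicit in the accelerations. Their unknown is the
excess `ν j` of the tension of cable `j` over the designed tension. It solves a linear system whose
matrix is the identity plus a nonnegative Gram matrix, so it is unique and is bounded by the force
deviations, uniformly in the configuration (`DesignData.implicit_iff_explicit`, `abs_excess_le`).
Hence rod and cables follow the design model up to terms `O(|e_R|)`. In the design model each cable
obeys a tracking law on the sphere without further input (`cableAcc_eq`), and the rod obeys a
tracking law disturbed by the misalignment of the cables (`rodRate_vel`, `rodRate_ang`). So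
attitudes drive cables, both drive the rod, and nothing acts backwards except through bounded
coefficients.

Each layer has a Lyapunov function with a cross term (`posV`, `sphereV`, `rotV`) whose derivative is
at most a negative multiple of the squared errors of the layer plus a multiple of the squared errors
of the layers above it in the cascade. Taking the weight of the cables large, and then the weight of
the attitudes larger still, makes the weighted sum a strict Lyapunov function (`weighted_decay`,
`exists_isLyapunov`). This works for all positive `k₁`, `k₂`, so no separation of time scales is
used and every `ε > 0` is admissible. The gains have to be adapted only to a gyroscopic term that
the rod controller leaves over; it is of first order in the attitude error and is dominated by large
`kq = kw`.

Uniformity in time comes from compactness. Relative to the desired position and velocity, the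
controller sees time only through a jet of the desired motion and the directions `b j`. The jet
involves exactly the derivatives assumed bounded, so its values lie in a compact set
(`isCompact_prmSet`), to which the nondegeneracy extends (`prmSet_nondegenerate`). Zero error
characterises the desired motion, so a whole tube of fixed radius is nondegenerate (`exists_tube`).
There the controller is smooth, and all its constants are uniform.

A continuation argument keeps small motions in the tube and gives the decay
(`IsLyapunov.loop_decay`). Global existence is obtained from a cut-off field, which agrees with the
true one in the tube (`exists_isLoop`). Motions of the model and of the closed loop in relative
coordinates are translated into each other by `Motion.IsSolution.toLoop_rate` and
`Motion.isSolution_ofLoop`. -/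

theorem len_eq_norm (v : V3) : len v = ‖(WithLp.toLp 2 v : EuclideanSpace ℝ (Fin 3))‖ := by
  rw [len, EuclideanSpace.norm_eq]
  congr 1
  simp [dotProduct, sq]

theorem dot_eq_inner (v w : V3) :
    v ⬝ᵥ w = inner ℝ (WithLp.toLp 2 v : EuclideanSpace ℝ (Fin 3)) (WithLp.toLp 2 w) := by
  simp [PiLp.inner_apply, dotProduct, mul_comm]

theorem len_nonneg (v : V3) : 0 ≤ len v := Real.sqrt_nonneg _

theorem dot_self_nonneg (v : V3) : 0 ≤ v ⬝ᵥ v := by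
  rw [dot_eq_inner]; exact real_inner_self_nonneg

theorem len_sq (v : V3) : len v ^ 2 = v ⬝ᵥ v := Real.sq_sqrt (dot_self_nonneg v)

@[simp] theorem len_zero : len 0 = 0 := by simp [len]

theorem len_eq_zero {v : V3} : len v = 0 ↔ v = 0 := by
  rw [len_eq_norm, norm_eq_zero]; simp

theorem len_pos {v : V3} : 0 < len v ↔ v ≠ 0 := by
  rw [(len_nonneg v).lt_iff_ne', ne_eq, len_eq_zero]

theorem len_eq_one {v : V3} (h : v ⬝ᵥ v = 1) : len v = 1 := by simp [len, h]

theorem len_smul (c : ℝ) (v : V3) : len (c • v) = |c| * len v := by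
  simp [len_eq_norm, norm_smul]

theorem len_neg (v : V3) : len (-v) = len v := by simp [len_eq_norm]

theorem len_add_le (v w : V3) : len (v + w) ≤ len v + len w := by
  simp only [len_eq_norm, WithLp.toLp_add]; exact norm_add_le _ _

theorem len_sub_le (v w : V3) : len (v - w) ≤ len v + len w := by
  simp only [len_eq_norm, WithLp.toLp_sub]; exact norm_sub_le _ _

theorem abs_dot_le (v w : V3) : |v ⬝ᵥ w| ≤ len v * len w := by
  rw [dot_eq_inner, len_eq_norm, len_eq_norm]; exact abs_real_inner_le_norm _ _

theorem dot_le (v w : V3) : v ⬝ᵥ w ≤ len v * len w := (le_abs_self _).trans (abs_dot_le v w)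

theorem neg_dot_le (v w : V3) : -(len v * len w) ≤ v ⬝ᵥ w := (abs_le.1 (abs_dot_le v w)).1

theorem norm_le_len (v : V3) : ‖v‖ ≤ len v := by
  refine (pi_norm_le_iff_of_nonneg (len_nonneg v)).2 fun i => ?_
  rw [len_eq_norm]
  exact PiLp.norm_apply_le (WithLp.toLp 2 v : EuclideanSpace ℝ (Fin 3)) i

/-- The sharp constant is `√3`; any constant serves the estimates of operator norms below. -/
theorem len_le_norm (v : V3) : len v ≤ 2 * ‖v‖ := by
  have h : ∀ i, v i ^ 2 ≤ ‖v‖ ^ 2 := fun i => by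
    rw [← sq_abs, ← Real.norm_eq_abs]
    exact pow_le_pow_left₀ (norm_nonneg _) (norm_le_pi_norm v i) 2
  refine Real.sqrt_le_iff.2 ⟨by positivity, ?_⟩
  have h0 := h 0
  have h1 := h 1
  have h2 := h 2
  simp only [dotProduct, Fin.sum_univ_three]
  nlinarith [sq_nonneg ‖v‖]

theorem len_cross_sq (v w : V3) : len (v ⨯₃ w) ^ 2 = len v ^ 2 * len w ^ 2 - (v ⬝ᵥ w) ^ 2 := by
  simp only [len_sq, cross_dot_cross]
  rw [dotProduct_comm w v]; ring

theorem len_cross_le (v w : V3) : len (v ⨯₃ w) ≤ len v * len w := by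
  refine (sq_le_sq₀ (len_nonneg _) (mul_nonneg (len_nonneg _) (len_nonneg _))).1 ?_
  rw [len_cross_sq, mul_pow]
  nlinarith [sq_nonneg (v ⬝ᵥ w)]

theorem cross_cross_left (u v w : V3) :
    u ⨯₃ v ⨯₃ w = (u ⬝ᵥ w) • v - (v ⬝ᵥ w) • u := by
  rw [cross_cross_eq_smul_sub_smul]

theorem cross_cross_right (u v w : V3) :
    u ⨯₃ (v ⨯₃ w) = (u ⬝ᵥ w) • v - (u ⬝ᵥ v) • w := by
  rw [cross_cross_eq_smul_sub_smul', dotProduct_comm v u]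

theorem cross_neg_right (u v : V3) : u ⨯₃ (-v) = -(u ⨯₃ v) := map_neg _ _

theorem cross_sub_right (u v w : V3) : u ⨯₃ (v - w) = u ⨯₃ v - u ⨯₃ w := map_sub _ _ _

theorem cross_add_right (u v w : V3) : u ⨯₃ (v + w) = u ⨯₃ v + u ⨯₃ w := map_add _ _ _

theorem cross_smul_right (c : ℝ) (u v : V3) : u ⨯₃ (c • v) = c • (u ⨯₃ v) := map_smul _ _ _

theorem cross_sub_left (u v w : V3) : (u - v) ⨯₃ w = u ⨯₃ w - v ⨯₃ w := by simp

theorem cross_add_left (u v w : V3) : (u + v) ⨯₃ w = u ⨯₃ w + v ⨯₃ w := by simp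

theorem cross_smul_left (c : ℝ) (u v : V3) : (c • u) ⨯₃ v = c • (u ⨯₃ v) := by simp

theorem cross_dot_left (v w : V3) : v ⨯₃ w ⬝ᵥ v = 0 := by rw [dotProduct_comm]; simp

theorem cross_dot_right (v w : V3) : v ⨯₃ w ⬝ᵥ w = 0 := by rw [dotProduct_comm]; simp

/-- The component of `v` orthogonal to the unit vector `n` has the length of `n ⨯₃ v`. -/
theorem len_sub_proj {n : V3} (hn : n ⬝ᵥ n = 1) (v : V3) :
    len (v - (n ⬝ᵥ v) • n) = len (n ⨯₃ v) := by
  rw [len, len]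
  congr 1
  simp only [cross_dot_cross, dotProduct_sub, sub_dotProduct, dotProduct_smul, smul_dotProduct,
    smul_eq_mul, hn, dotProduct_comm v n]
  ring

/-- Dot products against a vector orthogonal to the unit vector `n` only see the component
orthogonal to `n`. -/
theorem abs_dot_le_cross {n : V3} (hn : n ⬝ᵥ n = 1) {v : V3} (w : V3) (hv : v ⬝ᵥ n = 0) :
    |v ⬝ᵥ w| ≤ len v * len (n ⨯₃ w) := by
  have : v ⬝ᵥ w = v ⬝ᵥ (w - (n ⬝ᵥ w) • n) := by simp [dotProduct_sub, dotProduct_smul, hv]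
  rw [this, ← len_sub_proj hn]
  exact abs_dot_le _ _

theorem unit_dot_le_one {p q : V3} (hp : p ⬝ᵥ p = 1) (hq : q ⬝ᵥ q = 1) : p ⬝ᵥ q ≤ 1 := by
  simpa [len_eq_one hp, len_eq_one hq] using dot_le p q

theorem len_cross_unit_sq {p q : V3} (hp : p ⬝ᵥ p = 1) (hq : q ⬝ᵥ q = 1) :
    len (p ⨯₃ q) ^ 2 = 1 - (p ⬝ᵥ q) ^ 2 := by
  rw [len_cross_sq, len_eq_one hp, len_eq_one hq]; ring

theorem len_cross_unit_le_one {p q : V3} (hp : p ⬝ᵥ p = 1) (hq : q ⬝ᵥ q = 1) :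
    len (p ⨯₃ q) ≤ 1 := by
  simpa [len_eq_one hp, len_eq_one hq] using len_cross_le p q

/-- On the hemisphere the configuration error is comparable with the attitude error. -/
theorem configError_le {p q : V3} (hp : p ⬝ᵥ p = 1) (hq : q ⬝ᵥ q = 1) (h : 0 ≤ p ⬝ᵥ q) :
    1 - p ⬝ᵥ q ≤ len (p ⨯₃ q) ^ 2 := by
  rw [len_cross_unit_sq hp hq]
  nlinarith [unit_dot_le_one hp hq]

/-- Unlike the converse estimate this holds on the whole sphere, so lower bounds of the Lyapunov
functions need no sign condition. -/
theorem le_configError {p q : V3} (hp : p ⬝ᵥ p = 1) (hq : q ⬝ᵥ q = 1) :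
    len (p ⨯₃ q) ^ 2 ≤ 2 * (1 - p ⬝ᵥ q) := by
  rw [len_cross_unit_sq hp hq]
  nlinarith [sq_nonneg (1 - p ⬝ᵥ q)]

/-- A vanishing sine leaves the cosines `±1`; the sign condition excludes the antipode. -/
theorem eq_of_cross_eq_zero {p q : V3} (hp : p ⬝ᵥ p = 1) (hq : q ⬝ᵥ q = 1)
    (h : p ⨯₃ q = 0) (h0 : 0 ≤ p ⬝ᵥ q) : q = p := by
  have h1 : p ⬝ᵥ q = 1 := by
    have := len_cross_unit_sq hp hq
    rw [h, len_zero] at this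
    nlinarith
  have h2 := len_sub_proj hp q
  rw [h, len_zero, len_eq_zero, h1, one_smul, sub_eq_zero] at h2
  exact h2

/-! ### Calculus of dot and cross products -/

section Calculus

variable {E : Type*} [NormedAddCommGroup E] [NormedSpace ℝ E]

theorem _root_.HasDerivWithinAt.cross {f g : ℝ → V3} {f' g' : V3} {s : Set ℝ} {t : ℝ}
    (hf : HasDerivWithinAt f f' s t) (hg : HasDerivWithinAt g g' s t) :
    HasDerivWithinAt (fun x => f x ⨯₃ g x) (f' ⨯₃ g t + f t ⨯₃ g') s t := by
  have hf := hasDerivWithinAt_pi.1 hf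
  have hg := hasDerivWithinAt_pi.1 hg
  refine hasDerivWithinAt_pi.2 fun i => ?_
  fin_cases i
  · have := ((hf 1).mul (hg 2)).sub ((hf 2).mul (hg 1))
    refine (this.congr_deriv ?_).congr_of_eventuallyEq ?_ ?_
    · simp [cross_apply]; ring
    · exact Filter.Eventually.of_forall fun x => by simp [cross_apply]
    · simp [cross_apply]
  · have := ((hf 2).mul (hg 0)).sub ((hf 0).mul (hg 2))
    refine (this.congr_deriv ?_).congr_of_eventuallyEq ?_ ?_
    · simp [cross_apply]; ring
    · exact Filter.Eventually.of_forall fun x => by simp [cross_apply]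
    · simp [cross_apply]
  · have := ((hf 0).mul (hg 1)).sub ((hf 1).mul (hg 0))
    refine (this.congr_deriv ?_).congr_of_eventuallyEq ?_ ?_
    · simp [cross_apply]; ring
    · exact Filter.Eventually.of_forall fun x => by simp [cross_apply]
    · simp [cross_apply]

theorem _root_.HasDerivAt.cross {f g : ℝ → V3} {f' g' : V3} {t : ℝ}
    (hf : HasDerivAt f f' t) (hg : HasDerivAt g g' t) :
    HasDerivAt (fun x => f x ⨯₃ g x) (f' ⨯₃ g t + f t ⨯₃ g') t := by
  rw [← hasDerivWithinAt_univ] at *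
  exact HasDerivWithinAt.cross hf hg

theorem _root_.HasDerivWithinAt.dot {f g : ℝ → V3} {f' g' : V3} {s : Set ℝ} {t : ℝ}
    (hf : HasDerivWithinAt f f' s t) (hg : HasDerivWithinAt g g' s t) :
    HasDerivWithinAt (fun x => f x ⬝ᵥ g x) (f' ⬝ᵥ g t + f t ⬝ᵥ g') s t := by
  have hf := hasDerivWithinAt_pi.1 hf
  have hg := hasDerivWithinAt_pi.1 hg
  have := HasDerivWithinAt.fun_sum (u := Finset.univ) fun i _ => (hf i).mul (hg i)
  simpa [dotProduct, Finset.sum_add_distrib] using this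

theorem _root_.HasDerivAt.dot {f g : ℝ → V3} {f' g' : V3} {t : ℝ}
    (hf : HasDerivAt f f' t) (hg : HasDerivAt g g' t) :
    HasDerivAt (fun x => f x ⬝ᵥ g x) (f' ⬝ᵥ g t + f t ⬝ᵥ g') t := by
  rw [← hasDerivWithinAt_univ] at *
  exact HasDerivWithinAt.dot hf hg

@[fun_prop]
theorem _root_.ContDiffAt.cross {n : WithTop ℕ∞} {f g : E → V3} {x : E}
    (hf : ContDiffAt ℝ n f x) (hg : ContDiffAt ℝ n g x) :
    ContDiffAt ℝ n (fun y => f y ⨯₃ g y) x := by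
  have hf := contDiffAt_pi.1 hf
  have hg := contDiffAt_pi.1 hg
  refine contDiffAt_pi.2 fun i => ?_
  have h : (fun y => (f y ⨯₃ g y) i) = fun y =>
      ![f y 1 * g y 2 - f y 2 * g y 1, f y 2 * g y 0 - f y 0 * g y 2,
        f y 0 * g y 1 - f y 1 * g y 0] i := by
    funext y; rw [cross_apply]
  rw [h]
  fin_cases i
  · exact ((hf 1).mul (hg 2)).sub ((hf 2).mul (hg 1))
  · exact ((hf 2).mul (hg 0)).sub ((hf 0).mul (hg 2))
  · exact ((hf 0).mul (hg 1)).sub ((hf 1).mul (hg 0))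

@[fun_prop]
theorem _root_.ContDiffAt.dot {n : WithTop ℕ∞} {f g : E → V3} {x : E}
    (hf : ContDiffAt ℝ n f x) (hg : ContDiffAt ℝ n g x) :
    ContDiffAt ℝ n (fun y => f y ⬝ᵥ g y) x := by
  have hf := contDiffAt_pi.1 hf
  have hg := contDiffAt_pi.1 hg
  exact ContDiffAt.sum fun i _ => (hf i).mul (hg i)

theorem _root_.ContDiffAt.len {n : WithTop ℕ∞} {f : E → V3} {x : E}
    (hf : ContDiffAt ℝ n f x) (h : f x ≠ 0) : ContDiffAt ℝ n (fun y => len (f y)) x :=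
  (hf.dot hf).sqrt (by rw [← len_sq]; exact pow_ne_zero 2 (len_pos.2 h).ne')

/-! ### Continuity of cross products, dot products and lengths. -/

section Continuity

variable {X : Type*} [TopologicalSpace X]

@[fun_prop]
theorem _root_.Continuous.cross {f g : X → V3} (hf : Continuous f) (hg : Continuous g) :
    Continuous (fun y => f y ⨯₃ g y) := by
  have h : Continuous fun p : V3 × V3 => p.1 ⨯₃ p.2 := by
    have : ContDiff ℝ 0 fun p : V3 × V3 => p.1 ⨯₃ p.2 :=
      contDiff_iff_contDiffAt.2 fun x => by fun_prop
    exact this.continuous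
  exact h.comp (hf.prodMk hg)

@[fun_prop]
theorem _root_.ContinuousOn.cross {f g : X → V3} {s : Set X} (hf : ContinuousOn f s)
    (hg : ContinuousOn g s) : ContinuousOn (fun y => f y ⨯₃ g y) s := by
  have h : Continuous fun p : V3 × V3 => p.1 ⨯₃ p.2 := by fun_prop
  exact h.comp_continuousOn (hf.prodMk hg)

@[fun_prop]
theorem _root_.ContinuousWithinAt.cross {f g : X → V3} {s : Set X} {x : X}
    (hf : ContinuousWithinAt f s x) (hg : ContinuousWithinAt g s x) :
    ContinuousWithinAt (fun y => f y ⨯₃ g y) s x := by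
  have h : Continuous fun p : V3 × V3 => p.1 ⨯₃ p.2 := by fun_prop
  exact h.continuousAt.comp_continuousWithinAt (hf.prodMk hg)

@[fun_prop]
theorem _root_.ContinuousWithinAt.dot {f g : X → V3} {s : Set X} {x : X}
    (hf : ContinuousWithinAt f s x) (hg : ContinuousWithinAt g s x) :
    ContinuousWithinAt (fun y => f y ⬝ᵥ g y) s x := by
  have h : Continuous fun p : V3 × V3 => p.1 ⬝ᵥ p.2 := by fun_prop
  exact h.continuousAt.comp_continuousWithinAt (hf.prodMk hg)

@[fun_prop]
theorem _root_.ContinuousOn.dot {f g : X → V3} {s : Set X} (hf : ContinuousOn f s)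
    (hg : ContinuousOn g s) : ContinuousOn (fun y => f y ⬝ᵥ g y) s :=
  fun x hx => (hf x hx).dot (hg x hx)

@[fun_prop]
theorem continuous_len : Continuous len := by
  unfold len; fun_prop

end Continuity

end Calculus

/-! ### The controller as a function of the jet of the desired motion

The thrust controller depends on time only through `(a, q, q', q'')` and the first two
derivatives of this curve, once the position and velocity of the rod are measured relative to the
desired ones. -/

/-- Values of `(a, q, q', q'')`. -/
abbrev Jet := V3 × V3 × V3 × V3

abbrev Cables := Fin 2 → V3

/-- The curve `(a, q, q', q'')` of a desired motion. -/
def jet (D : Desired) (t : ℝ) : Jet := (D.a t, D.q t, deriv D.q t, deriv (deriv D.q) t)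

/-- Position and velocity of the rod relative to the desired ones. -/
def shift (D : Desired) (t : ℝ) (r : Rod) : Rod := (xR r - D.x t, vR r - D.v t, qR r, wR r)

def jetW (g : Jet) : V3 := g.2.1 ⨯₃ g.2.2.1

/-- The product rule for `q ⨯₃ q'` has a vanishing first term, so the desired angular acceleration
is determined by `q` and `q''`. -/
def jetWdot (g : Jet) : V3 := g.2.1 ⨯₃ g.2.2.2

/-- The attitude error of the angular velocity of the rod. -/
def jetEw (g : Jet) (z : Rod) : V3 := wR z + qR z ⨯₃ (qR z ⨯₃ jetW g)

section Hats

variable (P : Params) (K : Gains)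

/-- Here `xR z` and `vR z` are the position and velocity errors; the desired position and velocity,
which may be unbounded, no longer occur. -/
def jetMuTilde (j : Fin 2) (g : Jet) (z : Rod) : V3 :=
  (1 / 2 : ℝ) • (P.mr • (g.1 + P.g • e3 - K.kv • vR z - K.kx • xR z)
    + sgn j • ((2 / 3 * P.mr * P.Lr) •
      (-(qR z ⨯₃ jetWdot g)
        + (qR z ⬝ᵥ jetW g) • (qR z ⨯₃ (qR z ⨯₃ jetW g))
        - (qR z ⬝ᵥ jetW g) • jetEw g z
        + K.kw • (qR z ⨯₃ jetEw g z)
        + K.kq • (qR z ⨯₃ (g.2.1 ⨯₃ qR z)))))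

def jetQTilde (j : Fin 2) (y : Jet × Rod) : V3 :=
  -((len (jetMuTilde P K j y.1 y.2))⁻¹ • jetMuTilde P K j y.1 y.2)

def jetMu (j : Fin 2) (g : Jet) (z : Rod) (qc : Cables) : V3 :=
  jetMuTilde P K j g z + qc j ⨯₃ (qc j ⨯₃ jetMuTilde P K j g z)

def jetAccX (g : Jet) (z : Rod) (qc : Cables) : V3 :=
  (1 / P.mr) • (jetMu P K 0 g z qc + jetMu P K 1 g z qc) - P.g • e3

def jetAccW (g : Jet) (z : Rod) (qc : Cables) : V3 :=
  (1 / (2 / 3 * P.mr * P.Lr)) • (qR z ⨯₃ (jetMu P K 1 g z qc - jetMu P K 0 g z qc))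

def jetAccQ (g : Jet) (z : Rod) (qc : Cables) : V3 :=
  jetAccW P K g z qc ⨯₃ qR z + wR z ⨯₃ (wR z ⨯₃ qR z)

/-- The design field of the rod in relative coordinates. -/
def jetRodField (g : Jet) (z : Rod) (qc : Cables) : Rod :=
  (vR z, jetAccX P K g z qc - g.1, wR z ⨯₃ qR z, jetAccW P K g z qc)

/-- The second component of the argument is the time derivative of the jet. Together with the
relative rod field it is the direction in which time flows along the design model. -/
def jetWTilde (j : Fin 2) (y : Jet × Jet × Rod × Cables) : V3 :=
  jetQTilde P K j (y.1, y.2.2.1) ⨯₃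
    fderiv ℝ (jetQTilde P K j) (y.1, y.2.2.1) (y.2.1, jetRodField P K y.1 y.2.2.1 y.2.2.2)

/-- The jet of order two, the relative state of the rod, the directions and the angular velocities
of the cables. -/
abbrev CtrlArg := (Jet × Jet × Jet) × Rod × Cables × Cables

def jetWTildeDot (j : Fin 2) (y : CtrlArg) : V3 :=
  fderiv ℝ (jetWTilde P K j) (y.1.1, y.1.2.1, y.2.1, y.2.2.1)
    (y.1.2.1, y.1.2.2, jetRodField P K y.1.1 y.2.1 y.2.2.1, fun i => y.2.2.2 i ⨯₃ y.2.2.1 i)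

/-- Design acceleration (plus gravity) of the end of the rod at cable `j`. -/
def jetEndAcc (j : Fin 2) (y : CtrlArg) : V3 :=
  jetAccX P K y.1.1 y.2.1 y.2.2.1 + (sgn j * P.Lr) • jetAccQ P K y.1.1 y.2.1 y.2.2.1 + P.g • e3

def jetEqc (j : Fin 2) (y : CtrlArg) : V3 := jetQTilde P K j (y.1.1, y.2.1) ⨯₃ y.2.2.1 j

/-- The desired angular velocity of cable `j` at a controller argument. -/
def jetWc (j : Fin 2) (y : CtrlArg) : V3 := jetWTilde P K j (y.1.1, y.1.2.1, y.2.1, y.2.2.1)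

def jetEwc (j : Fin 2) (y : CtrlArg) : V3 :=
  y.2.2.2 j + y.2.2.1 j ⨯₃ (y.2.2.1 j ⨯₃ jetWc P K j y)

def jetU (j : Fin 2) (y : CtrlArg) : V3 :=
  jetMu P K j y.1.1 y.2.1 y.2.2.1
    + P.mQ • ((jetEndAcc P K j y ⬝ᵥ y.2.2.1 j) • y.2.2.1 j
        + (P.Lc * (y.2.2.2 j ⬝ᵥ y.2.2.2 j)) • y.2.2.1 j)
    + (-(P.mQ • (y.2.2.1 j ⨯₃ (y.2.2.1 j ⨯₃
      (jetEndAcc P K j y + P.Lc • (y.2.2.1 j ⨯₃ jetWTildeDot P K j y)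
        - (P.Lc * (y.2.2.1 j ⬝ᵥ jetWc P K j y)) • y.2.2.2 j))))
  - (P.mQ * P.Lc) • (y.2.2.1 j ⨯₃ (K.kqc j • jetEqc P K j y + K.kwc j • jetEwc P K j y)))

/-! ### Smoothness -/

variable {P K}
variable {E : Type*} [NormedAddCommGroup E] [NormedSpace ℝ E] {x : E}

theorem contDiffAt_jetW {f : E → Jet} (hf : ContDiffAt ℝ ∞ f x) :
    ContDiffAt ℝ ∞ (fun y => jetW (f y)) x := by
  unfold jetW; fun_prop

theorem contDiffAt_jetEw {f : E → Jet} {z : E → Rod} (hf : ContDiffAt ℝ ∞ f x)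
    (hz : ContDiffAt ℝ ∞ z x) : ContDiffAt ℝ ∞ (fun y => jetEw (f y) (z y)) x := by
  have := contDiffAt_jetW hf
  unfold jetEw; fun_prop

theorem contDiffAt_jetMuTilde (j : Fin 2) {f : E → Jet} {z : E → Rod} (hf : ContDiffAt ℝ ∞ f x)
    (hz : ContDiffAt ℝ ∞ z x) :
    ContDiffAt ℝ ∞ (fun y => jetMuTilde P K j (f y) (z y)) x := by
  have h1 := contDiffAt_jetW hf
  have h2 := contDiffAt_jetEw hf hz
  unfold jetMuTilde jetWdot; fun_prop

theorem continuous_jetMuTilde (j : Fin 2) :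
    Continuous fun y : Jet × Rod => jetMuTilde P K j y.1 y.2 :=
  (contDiff_iff_contDiffAt.2 fun _ =>
    contDiffAt_jetMuTilde (P := P) (K := K) j contDiffAt_fst contDiffAt_snd).continuous

theorem _root_.Continuous.jetMuTilde {X : Type*} [TopologicalSpace X] {f : X → Jet} {z : X → Rod}
    (hf : Continuous f) (hz : Continuous z) (j : Fin 2) :
    Continuous fun y => jetMuTilde P K j (f y) (z y) :=
  (continuous_jetMuTilde (P := P) (K := K) j).comp (hf.prodMk hz)

theorem contDiffAt_jetMu (j : Fin 2) {f : E → Jet} {z : E → Rod} {c : E → Cables}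
    (hf : ContDiffAt ℝ ∞ f x) (hz : ContDiffAt ℝ ∞ z x) (hc : ContDiffAt ℝ ∞ c x) :
    ContDiffAt ℝ ∞ (fun y => jetMu P K j (f y) (z y) (c y)) x := by
  have h1 := contDiffAt_jetMuTilde (P := P) (K := K) j hf hz
  unfold jetMu; fun_prop

theorem contDiffAt_jetAccX {f : E → Jet} {z : E → Rod} {c : E → Cables}
    (hf : ContDiffAt ℝ ∞ f x) (hz : ContDiffAt ℝ ∞ z x) (hc : ContDiffAt ℝ ∞ c x) :
    ContDiffAt ℝ ∞ (fun y => jetAccX P K (f y) (z y) (c y)) x := by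
  have h0 := contDiffAt_jetMu (P := P) (K := K) 0 hf hz hc
  have h1 := contDiffAt_jetMu (P := P) (K := K) 1 hf hz hc
  unfold jetAccX; fun_prop

theorem contDiffAt_jetAccW {f : E → Jet} {z : E → Rod} {c : E → Cables}
    (hf : ContDiffAt ℝ ∞ f x) (hz : ContDiffAt ℝ ∞ z x) (hc : ContDiffAt ℝ ∞ c x) :
    ContDiffAt ℝ ∞ (fun y => jetAccW P K (f y) (z y) (c y)) x := by
  have h0 := contDiffAt_jetMu (P := P) (K := K) 0 hf hz hc
  have h1 := contDiffAt_jetMu (P := P) (K := K) 1 hf hz hc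
  unfold jetAccW; fun_prop

theorem contDiffAt_jetAccQ {f : E → Jet} {z : E → Rod} {c : E → Cables}
    (hf : ContDiffAt ℝ ∞ f x) (hz : ContDiffAt ℝ ∞ z x) (hc : ContDiffAt ℝ ∞ c x) :
    ContDiffAt ℝ ∞ (fun y => jetAccQ P K (f y) (z y) (c y)) x := by
  have h0 := contDiffAt_jetAccW (P := P) (K := K) hf hz hc
  unfold jetAccQ; fun_prop

theorem contDiffAt_jetRodField {f : E → Jet} {z : E → Rod} {c : E → Cables}
    (hf : ContDiffAt ℝ ∞ f x) (hz : ContDiffAt ℝ ∞ z x) (hc : ContDiffAt ℝ ∞ c x) :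
    ContDiffAt ℝ ∞ (fun y => jetRodField P K (f y) (z y) (c y)) x := by
  have h0 := contDiffAt_jetAccW (P := P) (K := K) hf hz hc
  have h1 := contDiffAt_jetAccX (P := P) (K := K) hf hz hc
  unfold jetRodField; fun_prop

/-- Normalisation is the only singular operation in the thrust controller, so `jetMuTilde ≠ 0` is
the hypothesis of all smoothness statements that follow, up to the normalisations in the desired
attitude. -/
theorem contDiffAt_jetQTilde (j : Fin 2) {y : Jet × Rod} (h : jetMuTilde P K j y.1 y.2 ≠ 0) :
    ContDiffAt ℝ ∞ (jetQTilde P K j) y := by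
  have h1 : ContDiffAt ℝ ∞ (fun y : Jet × Rod => jetMuTilde P K j y.1 y.2) y :=
    contDiffAt_jetMuTilde j contDiffAt_fst contDiffAt_snd
  exact (((h1.len h).inv (len_pos.2 h).ne').smul h1).neg

theorem contDiffAt_jetWTilde (j : Fin 2) {y : Jet × Jet × Rod × Cables}
    (h : jetMuTilde P K j y.1 y.2.2.1 ≠ 0) : ContDiffAt ℝ ∞ (jetWTilde P K j) y := by
  have h1 : ContDiffAt ℝ ∞ (jetQTilde P K j) (y.1, y.2.2.1) := contDiffAt_jetQTilde j h
  have h2 : ContDiffAt ℝ ∞ (fderiv ℝ (jetQTilde P K j)) (y.1, y.2.2.1) :=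
    h1.fderiv_right (by simp)
  have h3 : ContDiffAt ℝ ∞ (fun y : Jet × Jet × Rod × Cables => (y.1, y.2.2.1)) y := by fun_prop
  have h4 : ContDiffAt ℝ ∞ (fun y : Jet × Jet × Rod × Cables =>
      jetRodField P K y.1 y.2.2.1 y.2.2.2) y :=
    contDiffAt_jetRodField (by fun_prop) (by fun_prop) (by fun_prop)
  have h5 : ContDiffAt ℝ ∞ (fun y : Jet × Jet × Rod × Cables => y.2.1) y := by fun_prop
  exact (h1.comp y h3).cross ((h2.comp y h3).clm_apply (h5.prodMk h4))

theorem contDiffAt_jetWc (j : Fin 2) {y : CtrlArg}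
    (h : jetMuTilde P K j y.1.1 y.2.1 ≠ 0) : ContDiffAt ℝ ∞ (jetWc P K j) y := by
  have h3 : ContDiffAt ℝ ∞ (fun y : CtrlArg => (y.1.1, y.1.2.1, y.2.1, y.2.2.1)) y := by fun_prop
  exact (contDiffAt_jetWTilde (y := (y.1.1, y.1.2.1, y.2.1, y.2.2.1)) j h).comp y h3

theorem contDiffAt_jetWTildeDot (j : Fin 2) {y : CtrlArg}
    (h : jetMuTilde P K j y.1.1 y.2.1 ≠ 0) : ContDiffAt ℝ ∞ (jetWTildeDot P K j) y := by
  have h1 : ContDiffAt ℝ ∞ (jetWTilde P K j) (y.1.1, y.1.2.1, y.2.1, y.2.2.1) :=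
    contDiffAt_jetWTilde j h
  have h2 : ContDiffAt ℝ ∞ (fderiv ℝ (jetWTilde P K j)) (y.1.1, y.1.2.1, y.2.1, y.2.2.1) :=
    h1.fderiv_right (by simp)
  have h3 : ContDiffAt ℝ ∞ (fun y : CtrlArg => (y.1.1, y.1.2.1, y.2.1, y.2.2.1)) y := by fun_prop
  have h4 : ContDiffAt ℝ ∞ (fun y : CtrlArg => jetRodField P K y.1.1 y.2.1 y.2.2.1) y :=
    contDiffAt_jetRodField (by fun_prop) (by fun_prop) (by fun_prop)
  have h5 : ContDiffAt ℝ ∞ (fun y : CtrlArg => fun i => y.2.2.2 i ⨯₃ y.2.2.1 i) y :=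
    contDiffAt_pi.2 fun i => by fun_prop
  have h6 : ContDiffAt ℝ ∞ (fun y : CtrlArg => y.1.2.1) y := by fun_prop
  have h7 : ContDiffAt ℝ ∞ (fun y : CtrlArg => y.1.2.2) y := by fun_prop
  exact (h2.comp y h3).clm_apply (h6.prodMk (h7.prodMk (h4.prodMk h5)))

theorem contDiffAt_jetEndAcc (j : Fin 2) (y : CtrlArg) :
    ContDiffAt ℝ ∞ (jetEndAcc P K j) y := by
  have h1 : ContDiffAt ℝ ∞ (fun y : CtrlArg => jetAccX P K y.1.1 y.2.1 y.2.2.1) y :=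
    contDiffAt_jetAccX (by fun_prop) (by fun_prop) (by fun_prop)
  have h2 : ContDiffAt ℝ ∞ (fun y : CtrlArg => jetAccQ P K y.1.1 y.2.1 y.2.2.1) y :=
    contDiffAt_jetAccQ (by fun_prop) (by fun_prop) (by fun_prop)
  unfold jetEndAcc; fun_prop

theorem contDiffAt_jetEqc (j : Fin 2) {y : CtrlArg}
    (h : jetMuTilde P K j y.1.1 y.2.1 ≠ 0) : ContDiffAt ℝ ∞ (jetEqc P K j) y := by
  have h3 : ContDiffAt ℝ ∞ (fun y : CtrlArg => (y.1.1, y.2.1)) y := by fun_prop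
  have h4 := (contDiffAt_jetQTilde (y := (y.1.1, y.2.1)) j h).comp y h3
  exact h4.cross (by fun_prop)

theorem contDiffAt_jetEwc (j : Fin 2) {y : CtrlArg}
    (h : jetMuTilde P K j y.1.1 y.2.1 ≠ 0) : ContDiffAt ℝ ∞ (jetEwc P K j) y := by
  have h3 := contDiffAt_jetWc j h
  have h3 : ContDiffAt ℝ ∞ (fun y => jetWc P K j y) y := h3
  unfold jetEwc; fun_prop

theorem contDiffAt_jetU (j : Fin 2) {y : CtrlArg}
    (h : jetMuTilde P K j y.1.1 y.2.1 ≠ 0) : ContDiffAt ℝ ∞ (jetU P K j) y := by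
  have h1 : ContDiffAt ℝ ∞ (fun y => jetWc P K j y) y := contDiffAt_jetWc j h
  have h2 : ContDiffAt ℝ ∞ (fun y => jetEqc P K j y) y := contDiffAt_jetEqc j h
  have h3 : ContDiffAt ℝ ∞ (fun y => jetEwc P K j y) y := contDiffAt_jetEwc j h
  have h4 : ContDiffAt ℝ ∞ (fun y => jetWTildeDot P K j y) y := contDiffAt_jetWTildeDot j h
  have h5 : ContDiffAt ℝ ∞ (fun y => jetEndAcc P K j y) y := contDiffAt_jetEndAcc j y
  have h6 : ContDiffAt ℝ ∞ (fun y : CtrlArg => jetMu P K j y.1.1 y.2.1 y.2.2.1) y :=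
    contDiffAt_jetMu j (by fun_prop) (by fun_prop) (by fun_prop)
  unfold jetU; fun_prop

end Hats

/-! ### The jet of the desired motion -/

theorem contDiff_deriv {F : Type*} [NormedAddCommGroup F] [NormedSpace ℝ F] {f : ℝ → F}
    (h : ContDiff ℝ ∞ f) : ContDiff ℝ ∞ (deriv f) := (contDiff_infty_iff_deriv.1 h).2

theorem _root_.ContDiff.hasDerivAt_infty {F : Type*} [NormedAddCommGroup F] [NormedSpace ℝ F]
    {f : ℝ → F} (h : ContDiff ℝ ∞ f) (t : ℝ) : HasDerivAt f (deriv f t) t :=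
  ((contDiff_infty_iff_deriv.1 h).1 t).hasDerivAt

theorem _root_.ContDiffAt.hasFDerivAt_infty {E F : Type*} [NormedAddCommGroup E] [NormedSpace ℝ E]
    [NormedAddCommGroup F] [NormedSpace ℝ F] {f : E → F} {x : E} (h : ContDiffAt ℝ ∞ f x) :
    HasFDerivAt f (fderiv ℝ f x) x := (h.differentiableAt (by simp)).hasFDerivAt

namespace Desired

variable (D : Desired)

theorem contDiff_v : ContDiff ℝ ∞ D.v := contDiff_deriv D.x_smooth

theorem contDiff_a : ContDiff ℝ ∞ D.a := contDiff_deriv D.contDiff_v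

theorem contDiff_jet : ContDiff ℝ ∞ (jet D) :=
  D.contDiff_a.prodMk (D.q_smooth.prodMk ((contDiff_deriv D.q_smooth).prodMk
    (contDiff_deriv (contDiff_deriv D.q_smooth))))

theorem hasDerivAt_w (t : ℝ) : HasDerivAt D.w (jetWdot (jet D t)) t := by
  have h := (D.q_smooth.hasDerivAt_infty t).cross
    ((contDiff_deriv D.q_smooth).hasDerivAt_infty t)
  rw [cross_self, zero_add] at h
  exact h

theorem wdot_eq (t : ℝ) : D.wdot t = jetWdot (jet D t) := (D.hasDerivAt_w t).deriv

theorem q_dot_deriv (t : ℝ) : D.q t ⬝ᵥ deriv D.q t = 0 := by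
  have h := (D.q_smooth.hasDerivAt_infty t).dot (D.q_smooth.hasDerivAt_infty t)
  have h1 : (fun x => D.q x ⬝ᵥ D.q x) = fun _ => (1 : ℝ) := funext D.q_unit
  rw [h1] at h
  have := h.unique (hasDerivAt_const t 1)
  rw [dotProduct_comm (deriv D.q t)] at this
  linarith

end Desired

/-- The jet of order two of the curve `jet D`. -/
def jets (D : Desired) (t : ℝ) : Jet × Jet × Jet := (jet D t, deriv (jet D) t, deriv (deriv (jet D)) t)

def ctrlArg (D : Desired) (t : ℝ) (r : Rod) (qc wc : Cables) : CtrlArg :=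
  (jets D t, shift D t r, qc, wc)

theorem contDiff_jets (D : Desired) : ContDiff ℝ ∞ (jets D) :=
  D.contDiff_jet.prodMk ((contDiff_deriv D.contDiff_jet).prodMk
    (contDiff_deriv (contDiff_deriv D.contDiff_jet)))

/-! ### The controller in terms of jets -/

section Correspondence

variable (P : Params) (K : Gains) (D : Desired)

theorem muTilde_eq (j : Fin 2) (t : ℝ) (r : Rod) :
    muTilde P K D j t r = jetMuTilde P K j (jet D t) (shift D t r) := by
  rw [muTilde, muDiff, D.wdot_eq]; rfl

theorem qTilde_eq (j : Fin 2) (t : ℝ) (r : Rod) :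
    qTilde P K D j t r = jetQTilde P K j (jet D t, shift D t r) := by
  rw [qTilde, muTilde_eq]; rfl

theorem mu_eq (j : Fin 2) (t : ℝ) (r : Rod) (qc : Cables) :
    mu P K D j t r qc = jetMu P K j (jet D t) (shift D t r) qc := by
  rw [mu, muTilde_eq]; rfl

theorem accX_eq (t : ℝ) (r : Rod) (qc : Cables) :
    accX P K D t r qc = jetAccX P K (jet D t) (shift D t r) qc := by
  rw [accX, mu_eq, mu_eq]; rfl

theorem accW_eq (t : ℝ) (r : Rod) (qc : Cables) :
    accW P K D t r qc = jetAccW P K (jet D t) (shift D t r) qc := by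
  rw [accW, mu_eq, mu_eq]; rfl

theorem accQ_eq (t : ℝ) (r : Rod) (qc : Cables) :
    accQ P K D t r qc = jetAccQ P K (jet D t) (shift D t r) qc := by
  rw [accQ, accW_eq]; rfl

theorem contDiff_shift : ContDiff ℝ ∞ fun p : ℝ × Rod => shift D p.1 p.2 := by
  have h1 := D.x_smooth
  have h2 := D.contDiff_v
  unfold shift; fun_prop

/-- Directional derivative of a composition, from the derivative of the inner map along a line. -/
theorem fderiv_comp_line {E F G : Type*} [NormedAddCommGroup E] [NormedSpace ℝ E]
    [NormedAddCommGroup F] [NormedSpace ℝ F] [NormedAddCommGroup G] [NormedSpace ℝ G]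
    {f : F → G} {φ : E → F} {x v : E} {w : F} (hf : DifferentiableAt ℝ f (φ x))
    (hφ : DifferentiableAt ℝ φ x) (hw : HasDerivAt (fun s : ℝ => φ (x + s • v)) w 0) :
    fderiv ℝ (fun y => f (φ y)) x v = fderiv ℝ f (φ x) w := by
  have h1 : fderiv ℝ (fun y => f (φ y)) x = (fderiv ℝ f (φ x)).comp (fderiv ℝ φ x) :=
    (hf.hasFDerivAt.comp x hφ.hasFDerivAt).fderiv
  have h2 : fderiv ℝ φ x v = w := by
    have h3 : HasFDerivAt φ (fderiv ℝ φ x) (x + (0 : ℝ) • v) := by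
      simpa using hφ.hasFDerivAt
    have h4 : HasDerivAt (fun s : ℝ => x + s • v) v 0 := by
      simpa using ((hasDerivAt_id (0 : ℝ)).smul_const v).const_add x
    exact (h3.comp_hasDerivAt (0 : ℝ) h4).unique hw
  rw [h1, ContinuousLinearMap.comp_apply, h2]

theorem hasDerivAt_line {F : Type*} [NormedAddCommGroup F] [NormedSpace ℝ F] (a b : F) :
    HasDerivAt (fun s : ℝ => a + s • b) b 0 := by
  simpa using ((hasDerivAt_id (0 : ℝ)).smul_const b).const_add a

theorem hasDerivAt_comp_add {F : Type*} [NormedAddCommGroup F] [NormedSpace ℝ F] {f : ℝ → F}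
    (h : ContDiff ℝ ∞ f) (t : ℝ) : HasDerivAt (fun s : ℝ => f (t + s)) (deriv f t) 0 := by
  refine HasDerivAt.comp_const_add t 0 ?_
  rw [add_zero]
  exact h.hasDerivAt_infty t

theorem hasDerivAt_shift_line (t : ℝ) (r v : Rod) :
    HasDerivAt (fun s : ℝ => shift D (t + s) (r + s • v))
      (xR v - D.v t, vR v - D.a t, qR v, wR v) 0 :=
  ((hasDerivAt_line (xR r) (xR v)).sub (hasDerivAt_comp_add D.x_smooth t)).prodMk
    (((hasDerivAt_line (vR r) (vR v)).sub (hasDerivAt_comp_add D.contDiff_v t)).prodMk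
      ((hasDerivAt_line (qR r) (qR v)).prodMk (hasDerivAt_line (wR r) (wR v))))

/-- Time runs with unit speed in the direction `(1, v)`. The explicit dependence on time contributes
the derivative of the jet and, through the shift, subtracts the desired velocity and acceleration,
as `jetRodField` does. -/
theorem fderiv_comp_jet_shift {f : Jet × Rod → V3} {t : ℝ} {r : Rod} (v : Rod)
    (hf : DifferentiableAt ℝ f (jet D t, shift D t r)) :
    fderiv ℝ (fun p : ℝ × Rod => f (jet D p.1, shift D p.1 p.2)) (t, r) (1, v) =
      fderiv ℝ f (jet D t, shift D t r)
        (deriv (jet D) t, xR v - D.v t, vR v - D.a t, qR v, wR v) := by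
  have hφ : ContDiff ℝ ∞ fun p : ℝ × Rod => (jet D p.1, shift D p.1 p.2) :=
    (D.contDiff_jet.comp contDiff_fst).prodMk (contDiff_shift D)
  refine fderiv_comp_line (φ := fun p : ℝ × Rod => (jet D p.1, shift D p.1 p.2)) hf
    (hφ.contDiffAt.differentiableAt (by simp)) ?_
  have he : (fun s : ℝ => (jet D ((t, r) + s • ((1 : ℝ), v)).1,
      shift D ((t, r) + s • ((1 : ℝ), v)).1 ((t, r) + s • ((1 : ℝ), v)).2)) =
      fun s => (jet D (t + s), shift D (t + s) (r + s • v)) := by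
    funext s
    simp only [Prod.smul_mk, Prod.mk_add_mk, smul_eq_mul, mul_one]
  rw [he]
  exact (hasDerivAt_comp_add D.contDiff_jet t).prodMk (hasDerivAt_shift_line D t r v)

theorem fderiv_comp_jets_shift {f : Jet × Jet × Rod × Cables → V3} {t : ℝ} {r : Rod} {c : Cables}
    (v : Rod) (w : Cables)
    (hf : DifferentiableAt ℝ f (jet D t, deriv (jet D) t, shift D t r, c)) :
    fderiv ℝ (fun p : ℝ × Rod × Cables =>
        f (jet D p.1, deriv (jet D) p.1, shift D p.1 p.2.1, p.2.2)) (t, r, c) (1, v, w) =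
      fderiv ℝ f (jet D t, deriv (jet D) t, shift D t r, c)
        (deriv (jet D) t, deriv (deriv (jet D)) t,
          (xR v - D.v t, vR v - D.a t, qR v, wR v), w) := by
  have hs : ContDiff ℝ ∞ fun p : ℝ × Rod × Cables => shift D p.1 p.2.1 :=
    (contDiff_shift D).comp (contDiff_fst.prodMk (contDiff_fst.comp contDiff_snd))
  have hφ : ContDiff ℝ ∞ fun p : ℝ × Rod × Cables =>
      (jet D p.1, deriv (jet D) p.1, shift D p.1 p.2.1, p.2.2) :=
    (D.contDiff_jet.comp contDiff_fst).prodMk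
      (((contDiff_deriv D.contDiff_jet).comp contDiff_fst).prodMk
        (hs.prodMk (contDiff_snd.comp contDiff_snd)))
  refine fderiv_comp_line (φ := fun p : ℝ × Rod × Cables =>
      (jet D p.1, deriv (jet D) p.1, shift D p.1 p.2.1, p.2.2)) hf
    (hφ.contDiffAt.differentiableAt (by simp)) ?_
  have he : (fun s : ℝ => (jet D ((t, r, c) + s • ((1 : ℝ), v, w)).1,
      deriv (jet D) ((t, r, c) + s • ((1 : ℝ), v, w)).1,
      shift D ((t, r, c) + s • ((1 : ℝ), v, w)).1 ((t, r, c) + s • ((1 : ℝ), v, w)).2.1,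
      ((t, r, c) + s • ((1 : ℝ), v, w)).2.2)) =
      fun s => (jet D (t + s), deriv (jet D) (t + s), shift D (t + s) (r + s • v), c + s • w) := by
    funext s
    simp only [Prod.smul_mk, Prod.mk_add_mk, smul_eq_mul, mul_one]
  rw [he]
  exact (hasDerivAt_comp_add D.contDiff_jet t).prodMk
    ((hasDerivAt_comp_add (contDiff_deriv D.contDiff_jet) t).prodMk
      ((hasDerivAt_shift_line D t r v).prodMk (hasDerivAt_line c w)))

theorem jetRodField_eq (t : ℝ) (r : Rod) (qc : Cables) :
    jetRodField P K (jet D t) (shift D t r) qc =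
      (xR (rodField P K D t r qc) - D.v t, vR (rodField P K D t r qc) - D.a t,
        qR (rodField P K D t r qc), wR (rodField P K D t r qc)) := by
  simp only [rodField, accX_eq, accW_eq]; rfl

theorem wTilde_eq (j : Fin 2) (t : ℝ) (r : Rod) (qc : Cables)
    (h : jetMuTilde P K j (jet D t) (shift D t r) ≠ 0) :
    wTilde P K D j t r qc =
      jetWTilde P K j (jet D t, deriv (jet D) t, shift D t r, qc) := by
  have h1 := fderiv_comp_jet_shift D (rodField P K D t r qc)
    ((contDiffAt_jetQTilde (y := (jet D t, shift D t r)) j h).differentiableAt (by simp))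
  rw [← jetRodField_eq] at h1
  simp only [wTilde, qTilde_eq]
  rw [h1, jetWTilde]

theorem wTildeDot_eq (j : Fin 2) (t : ℝ) (r : Rod) (qc wc : Cables)
    (h : jetMuTilde P K j (jet D t) (shift D t r) ≠ 0) :
    wTildeDot P K D j t r qc wc = jetWTildeDot P K j (ctrlArg D t r qc wc) := by
  -- To be differentiated, the formula for the desired angular velocity is needed in a
  -- neighbourhood; it holds there because nonvanishing of the force is an open condition.
  have hev : (fun p : ℝ × Rod × Cables => wTilde P K D j p.1 p.2.1 p.2.2) =ᶠ[nhds (t, r, qc)]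
      fun p => jetWTilde P K j (jet D p.1, deriv (jet D) p.1, shift D p.1 p.2.1, p.2.2) := by
    have hs : ContDiff ℝ ∞ fun p : ℝ × Rod × Cables => shift D p.1 p.2.1 :=
      (contDiff_shift D).comp (contDiff_fst.prodMk (contDiff_fst.comp contDiff_snd))
    have hc : Continuous fun p : ℝ × Rod × Cables =>
        jetMuTilde P K j (jet D p.1) (shift D p.1 p.2.1) :=
      (D.contDiff_jet.continuous.comp continuous_fst).jetMuTilde hs.continuous j
    filter_upwards [hc.continuousAt.eventually_ne h] with p hp
    exact wTilde_eq P K D j _ _ _ hp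
  have h1 := fderiv_comp_jets_shift D (rodField P K D t r qc) (fun i => wc i ⨯₃ qc i)
    ((contDiffAt_jetWTilde (y := (jet D t, deriv (jet D) t, shift D t r, qc)) j
      h).differentiableAt (by simp))
  rw [← jetRodField_eq] at h1
  rw [wTildeDot, hev.fderiv_eq, h1, jetWTildeDot]
  rfl

theorem eqc_eq (j : Fin 2) (t : ℝ) (r : Rod) (qc wc : Cables) :
    eqc P K D j t r qc = jetEqc P K j (ctrlArg D t r qc wc) := by
  rw [eqc, qTilde_eq]; rfl

theorem ewc_eq (j : Fin 2) (t : ℝ) (r : Rod) (qc wc : Cables)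
    (h : jetMuTilde P K j (jet D t) (shift D t r) ≠ 0) :
    ewc P K D j t r qc wc = jetEwc P K j (ctrlArg D t r qc wc) := by
  rw [ewc, wTilde_eq P K D j t r qc h]; rfl

theorem uCtrl_eq (j : Fin 2) (t : ℝ) (r : Rod) (qc wc : Cables)
    (h : jetMuTilde P K j (jet D t) (shift D t r) ≠ 0) :
    uCtrl P K D j t r qc wc = jetU P K j (ctrlArg D t r qc wc) := by
  rw [uCtrl, uPar, uPerp, ewc_eq P K D j t r qc wc h, eqc_eq P K D j t r qc wc,
    wTildeDot_eq P K D j t r qc wc h, wTilde_eq P K D j t r qc h, accX_eq, accQ_eq, mu_eq,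
    add_right_comm (jetAccX P K (jet D t) (shift D t r) qc)]
  rfl

end Correspondence

/-! ### The controller on the desired motion -/

/-- The relative state of the rod on the desired motion. -/
def jetRest (g : Jet) : Rod := (0, 0, g.2.1, jetW g)

section Rest

variable (P : Params) (K : Gains)

/-- The argument of the controller on the desired motion. -/
def restArg (p : Jet × Jet × Jet) : CtrlArg :=
  (p, jetRest p.1, fun j => jetQTilde P K j (p.1, jetRest p.1),
    fun j => jetWTilde P K j (p.1, p.2.1, jetRest p.1,
      fun i => jetQTilde P K i (p.1, jetRest p.1)))

variable {P K}

theorem jetQTilde_unit {j : Fin 2} {y : Jet × Rod} (h : jetMuTilde P K j y.1 y.2 ≠ 0) :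
    jetQTilde P K j y ⬝ᵥ jetQTilde P K j y = 1 := by
  have h1 := (len_pos.2 h).ne'
  simp only [jetQTilde, neg_dotProduct, dotProduct_neg, smul_dotProduct, dotProduct_smul,
    smul_eq_mul, ← len_sq]
  field_simp

theorem jetMuTilde_eq_smul {j : Fin 2} {y : Jet × Rod} (h : jetMuTilde P K j y.1 y.2 ≠ 0) :
    jetMuTilde P K j y.1 y.2 = (-len (jetMuTilde P K j y.1 y.2)) • jetQTilde P K j y := by
  have h1 := (len_pos.2 h).ne'
  rw [jetQTilde, smul_neg, neg_smul, neg_neg, smul_smul, mul_inv_cancel₀ h1, one_smul]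

/-- The design derivative of the desired direction of a cable is orthogonal to it. -/
theorem jetQTilde_dot_fderiv {j : Fin 2} {y : Jet × Rod} (h : jetMuTilde P K j y.1 y.2 ≠ 0)
    (v : Jet × Rod) : jetQTilde P K j y ⬝ᵥ fderiv ℝ (jetQTilde P K j) y v = 0 := by
  have h1 := (contDiffAt_jetQTilde j h).hasFDerivAt_infty
  have hl : HasDerivAt (fun s : ℝ => y + s • v) v 0 := by
    simpa using ((hasDerivAt_id (0 : ℝ)).smul_const v).const_add y
  have h1' : HasFDerivAt (jetQTilde P K j) (fderiv ℝ (jetQTilde P K j) y) (y + (0 : ℝ) • v) := by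
    simpa using h1
  have h2 := h1'.comp_hasDerivAt (0 : ℝ) hl
  have h3 := h2.dot h2
  have hc : ContinuousAt (fun s : ℝ => jetMuTilde P K j (y + s • v).1 (y + s • v).2) 0 :=
    ((continuous_jetMuTilde (P := P) (K := K) j).comp
      (by fun_prop : Continuous fun s : ℝ => y + s • v)).continuousAt
  have h4 : (fun s : ℝ => (jetQTilde P K j ∘ fun s : ℝ => y + s • v) s ⬝ᵥ
      (jetQTilde P K j ∘ fun s : ℝ => y + s • v) s) =ᶠ[nhds 0] fun _ => 1 := by
    filter_upwards [hc.eventually_ne (by simpa using h)] with s hs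
    exact jetQTilde_unit hs
  have h5 := h3.unique ((hasDerivAt_const (0 : ℝ) (1 : ℝ)).congr_of_eventuallyEq h4)
  simp only [Function.comp, zero_smul, add_zero] at h5
  rw [dotProduct_comm (fderiv ℝ (jetQTilde P K j) y v)] at h5
  linarith

theorem cross_self_cross {q : V3} (hq : q ⬝ᵥ q = 1) {v : V3} (hv : q ⬝ᵥ v = 0) :
    (q ⨯₃ v) ⨯₃ q = v := by
  rw [cross_cross_left, hq, one_smul, dotProduct_comm v q, hv, zero_smul, sub_zero]

theorem cross_cross_unit {q : V3} (hq : q ⬝ᵥ q = 1) (v : V3) :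
    q ⨯₃ (q ⨯₃ v) = (q ⬝ᵥ v) • q - v := by
  rw [cross_cross_right, hq, one_smul]

/-- The desired angular velocity of a cable generates the design derivative of its desired
direction. -/
theorem jetWTilde_cross {j : Fin 2} {y : Jet × Jet × Rod × Cables}
    (h : jetMuTilde P K j y.1 y.2.2.1 ≠ 0) :
    jetWTilde P K j y ⨯₃ jetQTilde P K j (y.1, y.2.2.1) =
      fderiv ℝ (jetQTilde P K j) (y.1, y.2.2.1)
        (y.2.1, jetRodField P K y.1 y.2.2.1 y.2.2.2) :=
  cross_self_cross (jetQTilde_unit (y := (y.1, y.2.2.1)) h)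
    (jetQTilde_dot_fderiv (y := (y.1, y.2.2.1)) h _)

theorem jetWTilde_dot {j : Fin 2} (y : Jet × Jet × Rod × Cables) :
    jetWTilde P K j y ⬝ᵥ jetQTilde P K j (y.1, y.2.2.1) = 0 := cross_dot_left _ _

theorem jetEw_rest {g : Jet} (hg : g.2.1 ⬝ᵥ g.2.1 = 1) : jetEw g (jetRest g) = 0 := by
  simp only [jetEw, jetRest]
  rw [cross_cross_unit hg, jetW, dot_self_cross, zero_smul, zero_sub, add_neg_cancel]

/-- All feedback terms vanish at zero error, so the value does not depend on the gains.
Nondegeneracy of the desired motion can therefore be assumed before the gains are chosen. -/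
theorem jetMuTilde_rest (j : Fin 2) {g : Jet} (hg : g.2.1 ⬝ᵥ g.2.1 = 1) :
    jetMuTilde P K j g (jetRest g) = (1 / 2 : ℝ) • (P.mr • (g.1 + P.g • e3)
      + sgn j • (2 / 3 * P.mr * P.Lr) • (-(g.2.1 ⨯₃ jetWdot g))) := by
  have h : qR (jetRest g) ⬝ᵥ jetW g = 0 := dot_self_cross _ _
  rw [jetMuTilde, jetEw_rest hg, h]
  simp [jetRest, xR, vR]

/-- The cables point along the assigned forces, so the projection loses nothing. -/
theorem jetMu_rest (j : Fin 2) {g : Jet} (h : jetMuTilde P K j g (jetRest g) ≠ 0) :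
    jetMu P K j g (jetRest g) (fun i => jetQTilde P K i (g, jetRest g)) =
      jetMuTilde P K j g (jetRest g) := by
  have h1 : jetQTilde P K j (g, jetRest g) ⨯₃ jetMuTilde P K j g (jetRest g) = 0 := by
    have := jetMuTilde_eq_smul (y := (g, jetRest g)) h
    simp only at this
    rw [this, cross_smul_right, cross_self, smul_zero]
  simp [jetMu, h1]

theorem sgn_zero : sgn 0 = -1 := by simp [sgn]

theorem sgn_one : sgn 1 = 1 := by simp [sgn]

theorem jetAccX_rest {g : Jet} (hg : g.2.1 ⬝ᵥ g.2.1 = 1)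
    (h : ∀ j, jetMuTilde P K j g (jetRest g) ≠ 0) :
    jetAccX P K g (jetRest g) (fun i => jetQTilde P K i (g, jetRest g)) = g.1 := by
  have h0 := P.mr_pos.ne'
  rw [jetAccX, jetMu_rest 0 (h 0), jetMu_rest 1 (h 1), jetMuTilde_rest 0 hg, jetMuTilde_rest 1 hg,
    sgn_zero, sgn_one]
  match_scalars <;> field_simp <;> ring

theorem jetAccW_rest {g : Jet} (hg : g.2.1 ⬝ᵥ g.2.1 = 1)
    (h : ∀ j, jetMuTilde P K j g (jetRest g) ≠ 0) :
    jetAccW P K g (jetRest g) (fun i => jetQTilde P K i (g, jetRest g)) = jetWdot g := by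
  have h0 := P.mr_pos.ne'
  have h1 := P.Lr_pos.ne'
  have h2 : jetMuTilde P K 1 g (jetRest g) - jetMuTilde P K 0 g (jetRest g) =
      (2 / 3 * P.mr * P.Lr) • (-(g.2.1 ⨯₃ jetWdot g)) := by
    rw [jetMuTilde_rest 0 hg, jetMuTilde_rest 1 hg, sgn_zero, sgn_one]
    module
  have h3 : qR (jetRest g) = g.2.1 := rfl
  rw [jetAccW, jetMu_rest 0 (h 0), jetMu_rest 1 (h 1), h2, cross_smul_right, smul_smul, h3,
    cross_neg_right, cross_cross_unit hg, jetWdot, dot_self_cross, one_div,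
    inv_mul_cancel₀ (by positivity)]
  simp

/-- The desired motion of the rod solves the design model. Derivatives along the design model are
therefore true time derivatives on the desired motion. -/
theorem jetRodField_rest {g : Jet} (hg : g.2.1 ⬝ᵥ g.2.1 = 1) (hg1 : g.2.1 ⬝ᵥ g.2.2.1 = 0)
    (h : ∀ j, jetMuTilde P K j g (jetRest g) ≠ 0) :
    jetRodField P K g (jetRest g) (fun i => jetQTilde P K i (g, jetRest g)) =
      (0, 0, g.2.2.1, jetWdot g) := by
  rw [jetRodField, jetAccX_rest hg h, jetAccW_rest hg h, sub_self]
  simp only [jetRest, jetW, cross_self_cross hg hg1]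

variable (P K) (D : Desired)

theorem mu_rest (j : Fin 2) (t : ℝ) :
    D.mu P j t = jetMuTilde P K j (jet D t) (jetRest (jet D t)) := by
  rw [jetMuTilde_rest j (D.q_unit t), Desired.mu, D.wdot_eq]; rfl

theorem qc_rest (j : Fin 2) (t : ℝ) :
    D.qc P j t = jetQTilde P K j (jet D t, jetRest (jet D t)) := by
  rw [Desired.qc, mu_rest P K]; rfl

theorem hasDerivAt_jetRest (t : ℝ) :
    HasDerivAt (fun s => jetRest (jet D s)) (0, 0, deriv D.q t, jetWdot (jet D t)) t :=
  (hasDerivAt_const t 0).prodMk ((hasDerivAt_const t 0).prodMk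
    ((D.q_smooth.hasDerivAt_infty t).prodMk (D.hasDerivAt_w t)))

theorem continuous_jetRest : Continuous jetRest := by
  unfold jetRest jetW; fun_prop

theorem continuous_mu (j : Fin 2) : Continuous (D.mu P j) := by
  have h : D.mu P j = fun s => (1 / 2 : ℝ) • (P.mr • (D.a s + P.g • e3)
    + sgn j • (2 / 3 * P.mr * P.Lr) • (-(D.q s ⨯₃ jetWdot (jet D s)))) := by
    funext s; rw [Desired.mu, D.wdot_eq]
  have h1 := D.contDiff_jet.continuous
  have h2 := D.contDiff_a.continuous
  have h3 := D.q_smooth.continuous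
  have h4 := (contDiff_deriv (contDiff_deriv D.q_smooth)).continuous
  rw [h]
  unfold jetWdot
  fun_prop

variable {D}

theorem hasDerivAt_qc_rest {t : ℝ} (h : ∀ j, D.mu P j t ≠ 0) (j : Fin 2) :
    HasDerivAt (D.qc P j)
      ((restArg P K (jets D t)).2.2.2 j ⨯₃ (restArg P K (jets D t)).2.2.1 j) t := by
  have h' : ∀ j, jetMuTilde P K j (jet D t) (jetRest (jet D t)) ≠ 0 := fun j => by
    rw [← mu_rest]; exact h j
  have h1 := (contDiffAt_jetQTilde (y := (jet D t, jetRest (jet D t))) j (h' j)).hasFDerivAt_infty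
  have h2 := h1.comp_hasDerivAt t
    ((D.contDiff_jet.hasDerivAt_infty t).prodMk (hasDerivAt_jetRest D t))
  have h3 := jetWTilde_cross (j := j) (y := (jet D t, deriv (jet D) t, jetRest (jet D t),
      fun i => jetQTilde P K i (jet D t, jetRest (jet D t)))) (h' j)
  simp only at h3
  rw [jetRodField_rest (D.q_unit t) (D.q_dot_deriv t) h'] at h3
  have h4 : D.qc P j = jetQTilde P K j ∘ fun s => (jet D s, jetRest (jet D s)) :=
    funext fun s => qc_rest P K D j s
  rw [h4]
  refine h2.congr_deriv ?_
  exact h3.symm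

/-- Both the rod and the cables move by the design model on the desired motion, so the derivative
along the design model is the derivative of the desired angular velocity as a function of time. -/
theorem hasDerivAt_wc_rest {t : ℝ} (h : ∀ j, D.mu P j t ≠ 0) (j : Fin 2) :
    HasDerivAt (fun s => (restArg P K (jets D s)).2.2.2 j)
      (jetWTildeDot P K j (restArg P K (jets D t))) t := by
  have h' : ∀ j, jetMuTilde P K j (jet D t) (jetRest (jet D t)) ≠ 0 := fun j => by
    rw [← mu_rest]; exact h j
  have h1 := (contDiffAt_jetWTilde (y := (jet D t, deriv (jet D) t, jetRest (jet D t),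
      fun i => jetQTilde P K i (jet D t, jetRest (jet D t)))) j (h' j)).hasFDerivAt_infty
  have h2 : HasDerivAt (fun s => fun i => jetQTilde P K i (jet D s, jetRest (jet D s)))
      (fun i => (restArg P K (jets D t)).2.2.2 i ⨯₃ (restArg P K (jets D t)).2.2.1 i) t :=
    hasDerivAt_pi.2 fun i => by
      have := hasDerivAt_qc_rest P K h i
      rwa [funext (qc_rest P K D i)] at this
  have h3 := h1.comp_hasDerivAt t
    ((D.contDiff_jet.hasDerivAt_infty t).prodMk
      (((contDiff_deriv D.contDiff_jet).hasDerivAt_infty t).prodMk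
        ((hasDerivAt_jetRest D t).prodMk h2)))
  refine h3.congr_deriv ?_
  have h4 := jetRodField_rest (D.q_unit t) (D.q_dot_deriv t) h'
  simp only [jetWTildeDot, restArg, jets]
  rw [h4]
  rfl

theorem deriv_deriv_q (t : ℝ) :
    deriv (deriv D.q) t = jetWdot (jet D t) ⨯₃ D.q t + D.w t ⨯₃ (D.w t ⨯₃ D.q t) := by
  have h1 : deriv D.q = fun s => D.w s ⨯₃ D.q s := funext fun s =>
    (cross_self_cross (D.q_unit s) (D.q_dot_deriv s)).symm
  have h2 := (D.hasDerivAt_w t).cross (D.q_smooth.hasDerivAt_infty t)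
  rw [← h1] at h2
  rw [h2.deriv]
  conv_lhs => rw [congrFun h1 t]

/-- On the desired motion the controller produces the desired thrust. -/
theorem jetU_rest {t : ℝ} (h : ∀ j, D.mu P j t ≠ 0) (j : Fin 2) :
    jetU P K j (restArg P K (jets D t)) = D.u P j t := by
  have h' : ∀ j, jetMuTilde P K j (jet D t) (jetRest (jet D t)) ≠ 0 := fun j => by
    rw [← mu_rest]; exact h j
  have hev : ∀ᶠ s in nhds t, ∀ j, D.mu P j s ≠ 0 :=
    Filter.eventually_all.2 fun i => (continuous_mu P D i).continuousAt.eventually_ne (h i)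
  have h1 : deriv (D.qc P j) =ᶠ[nhds t] fun s =>
      (restArg P K (jets D s)).2.2.2 j ⨯₃ D.qc P j s := by
    filter_upwards [hev] with s hs
    rw [(hasDerivAt_qc_rest P K hs j).deriv, qc_rest P K]
    rfl
  -- Since `q' = ω ⨯₃ q` near `t`, a second differentiation gives `q'' = ω' ⨯₃ q + ω ⨯₃ (ω ⨯₃ q)`,
  -- the cable acceleration in the desired thrust.
  have h2 := (hasDerivAt_wc_rest P K h j).cross (hasDerivAt_qc_rest P K h j)
  have h3 : deriv (deriv (D.qc P j)) t = _ := (h2.congr_of_eventuallyEq h1).deriv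
  have hq : D.qc P j t = (restArg P K (jets D t)).2.2.1 j := qc_rest P K D j t
  have hqq : (restArg P K (jets D t)).2.2.1 j ⬝ᵥ (restArg P K (jets D t)).2.2.1 j = 1 :=
    jetQTilde_unit (y := (jet D t, jetRest (jet D t))) (h' j)
  have hwq : (restArg P K (jets D t)).2.2.1 j ⬝ᵥ (restArg P K (jets D t)).2.2.2 j = 0 :=
    dot_self_cross _ _
  have hmu : jetMu P K j (restArg P K (jets D t)).1.1 (restArg P K (jets D t)).2.1
      (restArg P K (jets D t)).2.2.1 = D.mu P j t := by
    rw [mu_rest P K]; exact jetMu_rest j (h' j)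
  have hacc : jetEndAcc P K j (restArg P K (jets D t)) =
      deriv (deriv D.x) t + (sgn j * P.Lr) • deriv (deriv D.q) t + P.g • e3 := by
    have hx := jetAccX_rest (D.q_unit t) h'
    have hw := jetAccW_rest (D.q_unit t) h'
    simp only [jetEndAcc, jetAccQ, restArg, jets]
    rw [hx, hw, deriv_deriv_q]
    rfl
  have heq : jetEqc P K j (restArg P K (jets D t)) = 0 := cross_self _
  have hwc : jetWc P K j (restArg P K (jets D t)) = (restArg P K (jets D t)).2.2.2 j := rfl
  have hew : jetEwc P K j (restArg P K (jets D t)) = 0 := by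
    rw [jetEwc, hwc, cross_cross_unit hqq, hwq, zero_smul, zero_sub, add_neg_cancel]
  rw [jetU, hmu, hacc, heq, hew, hwc, Desired.u, h3, hq]
  generalize (restArg P K (jets D t)).2.2.1 j = q at *
  generalize (restArg P K (jets D t)).2.2.2 j = w at *
  generalize jetWTildeDot P K j (restArg P K (jets D t)) = wd
  generalize hA : deriv (deriv D.x) t + (sgn j * P.Lr) • deriv (deriv D.q) t + P.g • e3 = A at *
  rw [hwq, mul_zero, zero_smul, sub_zero, smul_zero, smul_zero, add_zero, map_zero, smul_zero,
    sub_zero, cross_cross_unit hqq, dotProduct_add, dotProduct_smul, dot_self_cross,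
    cross_cross_right w w q, dotProduct_comm w q, hwq, ← cross_anticomm q wd, dotProduct_comm q A]
  rw [← hA, smul_zero]
  module

end Rest

attribute [local irreducible] jetMuTilde jetQTilde jetWTilde jetWTildeDot jetU

/-! ### Compactness of the set of jets -/

/-- Jets of order two together with the directions `b j`. -/
abbrev Prm := (Jet × Jet × Jet) × Cables

def prm (D : Desired) (t : ℝ) : Prm := (jets D t, fun j => D.b j t)

theorem contDiff_prm (D : Desired) : ContDiff ℝ ∞ (prm D) :=
  (contDiff_jets D).prodMk (contDiff_pi.2 D.b_smooth)

/-- The closure of the set of parameters of the desired motion. -/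
def prmSet (D : Desired) : Set Prm := closure (prm D '' Set.Ici 0)

theorem prm_mem (D : Desired) {t : ℝ} (ht : 0 ≤ t) : prm D t ∈ prmSet D :=
  subset_closure ⟨t, ht, rfl⟩

theorem deriv_jet (D : Desired) :
    deriv (jet D) = fun t => (deriv D.a t, deriv D.q t, deriv (deriv D.q) t,
      deriv (deriv (deriv D.q)) t) := funext fun t =>
  (HasDerivAt.prodMk (D.contDiff_a.hasDerivAt_infty t) ((D.q_smooth.hasDerivAt_infty t).prodMk
    (((contDiff_deriv D.q_smooth).hasDerivAt_infty t).prodMk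
      ((contDiff_deriv (contDiff_deriv D.q_smooth)).hasDerivAt_infty t)))).deriv

theorem deriv_deriv_jet (D : Desired) :
    deriv (deriv (jet D)) = fun t => (deriv (deriv D.a) t, deriv (deriv D.q) t,
      deriv (deriv (deriv D.q)) t, deriv (deriv (deriv (deriv D.q))) t) := funext fun t => by
  have h1 := contDiff_deriv D.q_smooth
  have h2 := contDiff_deriv h1
  rw [deriv_jet]
  exact (HasDerivAt.prodMk ((contDiff_deriv D.contDiff_a).hasDerivAt_infty t)
    ((h1.hasDerivAt_infty t).prodMk ((h2.hasDerivAt_infty t).prodMk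
      ((contDiff_deriv h2).hasDerivAt_infty t)))).deriv

theorem norm_le_one_of_unit {v : V3} (h : v ⬝ᵥ v = 1) : ‖v‖ ≤ 1 :=
  (norm_le_len v).trans (len_eq_one h).le

/-- The jet of order two of `(x'', q, q', q'')` contains the derivatives of `x` of orders two to
four and those of `q` up to order four. The undifferentiated `q` and the `b j` are unit vectors, and
no derivative of `b j` occurs. -/
theorem isCompact_prmSet {D : Desired} (hD : D.Bounded) : IsCompact (prmSet D) := by
  obtain ⟨B, hB⟩ := hD
  refine (isBounded_iff_forall_norm_le.2 ⟨max B 1, ?_⟩).isCompact_closure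
  rintro _ ⟨t, ht, rfl⟩
  obtain ⟨hx, hq⟩ := hB t ht
  have x2 := hx 2 (by norm_num) (by norm_num)
  have x3 := hx 3 (by norm_num) (by norm_num)
  have x4 := hx 4 (by norm_num) (by norm_num)
  have q1 := hq 1 (by norm_num) (by norm_num)
  have q2 := hq 2 (by norm_num) (by norm_num)
  have q3 := hq 3 (by norm_num) (by norm_num)
  have q4 := hq 4 (by norm_num) (by norm_num)
  simp only [iteratedDeriv_succ, iteratedDeriv_zero] at x2 x3 x4 q1 q2 q3 q4
  have q0 := norm_le_one_of_unit (D.q_unit t)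
  have b0 : ‖fun j => D.b j t‖ ≤ 1 :=
    (pi_norm_le_iff_of_nonneg zero_le_one).2 fun j => norm_le_one_of_unit (D.b_unit j t)
  simp only [prm, jets, deriv_deriv_jet]
  rw [deriv_jet]
  simp only [jet, Prod.norm_mk, max_le_iff]
  have hl : B ≤ max B 1 := le_max_left _ _
  have hr : 1 ≤ max B 1 := le_max_right _ _
  exact ⟨⟨⟨x2.trans hl, q0.trans hr, q1.trans hl, q2.trans hl⟩,
    ⟨x3.trans hl, q1.trans hl, q2.trans hl, q3.trans hl⟩,
    ⟨x4.trans hl, q2.trans hl, q3.trans hl, q4.trans hl⟩⟩, b0.trans hr⟩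

section Facts

variable {D : Desired} {p : Prm}

theorem prmSet_unit (hp : p ∈ prmSet D) : p.1.1.2.1 ⬝ᵥ p.1.1.2.1 = 1 := by
  have : IsClosed {p : Prm | p.1.1.2.1 ⬝ᵥ p.1.1.2.1 = 1} :=
    isClosed_eq (by fun_prop) continuous_const
  refine closure_minimal ?_ this hp
  rintro _ ⟨t, _, rfl⟩
  exact D.q_unit t

theorem prmSet_mu {P : Params} {K : Gains} {c : ℝ}
    (hc : ∀ t, 0 ≤ t → ∀ j, c ≤ len (D.mu P j t)) (hp : p ∈ prmSet D) (j : Fin 2) :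
    c ≤ len (jetMuTilde P K j p.1.1 (jetRest p.1.1)) := by
  have hcont : Continuous fun p : Prm => len (jetMuTilde P K j p.1.1 (jetRest p.1.1)) := by
    have h1 : Continuous fun p : Prm => p.1.1 := by fun_prop
    exact continuous_len.comp (h1.jetMuTilde (continuous_jetRest.comp h1) j)
  refine closure_minimal ?_ (isClosed_le continuous_const hcont) hp
  rintro _ ⟨t, ht, rfl⟩
  have := hc t ht j
  rw [mu_rest P K] at this
  exact this

theorem continuousAt_restArg {P : Params} {K : Gains} {p : Jet × Jet × Jet}
    (h : ∀ j, jetMuTilde P K j p.1 (jetRest p.1) ≠ 0) : ContinuousAt (restArg P K) p := by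
  have h1 : ContinuousAt (fun p : Jet × Jet × Jet => (p.1, jetRest p.1)) p :=
    (continuous_fst.prodMk (continuous_jetRest.comp continuous_fst)).continuousAt
  have h2 : ContinuousAt (fun p : Jet × Jet × Jet => fun j =>
      jetQTilde P K j (p.1, jetRest p.1)) p := continuousAt_pi.2 fun j =>
    (contDiffAt_jetQTilde (y := (p.1, jetRest p.1)) j (h j)).continuousAt.comp_of_eq h1 rfl
  have h3 : ContinuousAt (fun p : Jet × Jet × Jet => (p.1, p.2.1, jetRest p.1,
      fun j => jetQTilde P K j (p.1, jetRest p.1))) p :=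
    continuousAt_fst.prodMk ((continuousAt_fst.comp continuousAt_snd).prodMk
      ((continuous_jetRest.comp continuous_fst).continuousAt.prodMk h2))
  have h4 : ContinuousAt (fun p : Jet × Jet × Jet => fun j =>
      jetWTilde P K j (p.1, p.2.1, jetRest p.1, fun j => jetQTilde P K j (p.1, jetRest p.1))) p :=
    continuousAt_pi.2 fun j =>
      (contDiffAt_jetWTilde (y := (p.1, p.2.1, jetRest p.1,
        fun j => jetQTilde P K j (p.1, jetRest p.1))) j (h j)).continuousAt.comp_of_eq h3 rfl
  exact continuousAt_id.prodMk
    ((continuous_jetRest.comp continuous_fst).continuousAt.prodMk (h2.prodMk h4))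

/-- The lower bounds are uniform in time, so they pass to the closure by continuity of the
controller. A single vector is tracked for each quadrotor: `|u ⨯₃ b| = |u| |(u/|u|) ⨯₃ b| ≥ c²`
covers both the thrust and its angle to `b`. -/
theorem prmSet_nondegenerate {P : Params} (K : Gains) (hnd : D.Nondegenerate P)
    (hp : p ∈ prmSet D) :
    (∀ j, jetMuTilde P K j p.1.1 (jetRest p.1.1) ≠ 0) ∧
      ∀ j, jetU P K j (restArg P K p.1) ⨯₃ p.2 j ≠ 0 := by
  obtain ⟨c, hc, h⟩ := hnd
  have hmu : ∀ p ∈ prmSet D, ∀ j, jetMuTilde P K j p.1.1 (jetRest p.1.1) ≠ 0 := fun p hp j =>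
    len_pos.1 (hc.trans_le (prmSet_mu (fun t ht j => (h t ht j).1) hp j))
  refine ⟨hmu p hp, fun j => len_pos.1 ((mul_pos hc hc).trans_le ?_)⟩
  have hcont : ContinuousOn (fun p : Prm => len (jetU P K j (restArg P K p.1) ⨯₃ p.2 j))
      (prmSet D) := by
    intro p hp
    have h1 : ContinuousAt (fun p : Prm => restArg P K p.1) p :=
      (continuousAt_restArg (hmu p hp)).comp_of_eq continuousAt_fst rfl
    have h2 : ContinuousAt (fun p : Prm => jetU P K j (restArg P K p.1)) p :=
      (contDiffAt_jetU (y := restArg P K p.1) j (hmu p hp j)).continuousAt.comp_of_eq h1 rfl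
    have h3 : ContinuousWithinAt (fun p : Prm => p.2 j) (prmSet D) p := by fun_prop
    exact continuous_len.continuousAt.comp_continuousWithinAt
      (h2.continuousWithinAt.cross h3)
  refine le_on_closure (f := fun _ => c * c) ?_ continuousOn_const hcont hp
  rintro _ ⟨t, ht, rfl⟩
  obtain ⟨-, h2, h3⟩ := h t ht j
  have h4 : ∀ i, D.mu P i t ≠ 0 := fun i => len_pos.1 (hc.trans_le (h t ht i).1)
  have h5 := jetU_rest P K h4 j
  have h6 : jetU P K j (restArg P K (prm D t).1) = D.u P j t := h5
  simp only [h6]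
  have hu : 0 < len (D.u P j t) := hc.trans_le h2
  rw [cross_smul_left, len_smul, abs_of_pos (inv_pos.2 hu)] at h3
  have h7 : len (D.u P j t ⨯₃ D.b j t) =
      len (D.u P j t) * ((len (D.u P j t))⁻¹ * len (D.u P j t ⨯₃ D.b j t)) := by
    field_simp
  calc c * c ≤ _ := mul_le_mul h2 h3 hc.le hu.le
    _ = _ := h7.symm

end Facts

/-! ### Uniform tubes around the desired motion -/

theorem isCompact_inter_preimage {X Y : Type*} [TopologicalSpace X] [T2Space X]
    [TopologicalSpace Y] {S : Set X} (hS : IsCompact S) {f : X → Y} (hf : ContinuousOn f S)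
    {C : Set Y} (hC : IsClosed C) : IsCompact (S ∩ f ⁻¹' C) :=
  hS.of_isClosed_subset (hf.preimage_isClosed_of_isClosed hS.isClosed hC) Set.inter_subset_left

/-- On the compact set where `h ≤ 0` the function `φ` attains a minimum, which is positive by
assumption; half of it is a valid radius. This turns a property of zero error into a property of a
tube. -/
theorem exists_pos_of_compact {X : Type*} [TopologicalSpace X] [T2Space X] {S : Set X} (hS : IsCompact S)
    {φ h : X → ℝ} (hφ : ContinuousOn φ S) (hh : ContinuousOn h S)
    (H : ∀ x ∈ S, φ x ≤ 0 → 0 < h x) : ∃ r, 0 < r ∧ ∀ x ∈ S, φ x ≤ r → 0 < h x := by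
  have hcl : IsCompact (S ∩ h ⁻¹' Set.Iic 0) := isCompact_inter_preimage hS hh isClosed_Iic
  rcases (S ∩ h ⁻¹' Set.Iic 0).eq_empty_or_nonempty with he | hne
  · refine ⟨1, one_pos, fun x hx _ => ?_⟩
    by_contra hcon
    have : x ∈ S ∩ h ⁻¹' Set.Iic 0 := ⟨hx, not_lt.1 hcon⟩
    simp [he] at this
  · obtain ⟨x₀, hx₀, hmin⟩ := hcl.exists_isMinOn hne (hφ.mono Set.inter_subset_left)
    have hpos : 0 < φ x₀ := by
      by_contra hcon
      exact absurd (H x₀ hx₀.1 (not_lt.1 hcon)) (not_lt.2 hx₀.2)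
    refine ⟨φ x₀ / 2, by linarith, fun x hx hle => ?_⟩
    by_contra hcon
    have : φ x₀ ≤ φ x := hmin ⟨hx, not_lt.1 hcon⟩
    linarith

/-- The state of the rod with prescribed errors. -/
def ofErr (g : Jet) (e : Rod) : Rod :=
  (xR e, vR e, qR e, wR e - qR e ⨯₃ (qR e ⨯₃ jetW g))

theorem continuous_ofErr : Continuous fun x : Jet × Rod => ofErr x.1 x.2 := by
  unfold ofErr jetW; fun_prop

theorem ofErr_toErr (g : Jet) (z : Rod) : ofErr g (xR z, vR z, qR z, jetEw g z) = z := by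
  simp [ofErr, jetEw, xR, vR, qR, wR]

/-- The rod has errors at most `r` and its attitude is on the side of the desired one. -/
def RodSmall (r : ℝ) (g : Jet) (z : Rod) : Prop :=
  qR z ⬝ᵥ qR z = 1 ∧ 0 ≤ g.2.1 ⬝ᵥ qR z ∧ len (xR z) ≤ r ∧ len (vR z) ≤ r ∧
    len (g.2.1 ⨯₃ qR z) ≤ r ∧ len (jetEw g z) ≤ r

/-- Rod and cables have errors at most `r` and are on the side of the desired attitudes. -/
def Small (P : Params) (K : Gains) (r : ℝ) (y : CtrlArg) : Prop :=
  RodSmall r y.1.1 y.2.1 ∧ ∀ j, y.2.2.1 j ⬝ᵥ y.2.2.1 j = 1 ∧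
    0 ≤ jetQTilde P K j (y.1.1, y.2.1) ⬝ᵥ y.2.2.1 j ∧
    len (jetEqc P K j y) ≤ r ∧ len (jetEwc P K j y) ≤ r

theorem RodSmall.mono {r s : ℝ} {g : Jet} {z : Rod} (h : RodSmall r g z) (hrs : r ≤ s) :
    RodSmall s g z :=
  ⟨h.1, h.2.1, h.2.2.1.trans hrs, h.2.2.2.1.trans hrs, h.2.2.2.2.1.trans hrs, h.2.2.2.2.2.trans hrs⟩

theorem Small.mono {P : Params} {K : Gains} {r s : ℝ} {y : CtrlArg} (h : Small P K r y)
    (hrs : r ≤ s) : Small P K s y :=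
  ⟨h.1.mono hrs, fun j => ⟨(h.2 j).1, (h.2 j).2.1, (h.2 j).2.2.1.trans hrs,
    (h.2 j).2.2.2.trans hrs⟩⟩

section Tube

variable {P : Params} {K : Gains} {D : Desired}

/-- Error coordinates of the rod in the unit box. -/
def rodBox (D : Desired) : Set (Prm × Rod) :=
  {x | x.1 ∈ prmSet D ∧ qR x.2 ⬝ᵥ qR x.2 = 1 ∧ 0 ≤ x.1.1.1.2.1 ⬝ᵥ qR x.2 ∧ len (xR x.2) ≤ 1 ∧
    len (vR x.2) ≤ 1 ∧ len (wR x.2) ≤ 1}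

def rodErrSum (x : Prm × Rod) : ℝ :=
  len (xR x.2) + len (vR x.2) + len (x.1.1.1.2.1 ⨯₃ qR x.2) + len (wR x.2)

theorem continuous_rodErrSum : Continuous rodErrSum := by
  unfold rodErrSum
  have := continuous_len
  fun_prop

theorem isCompact_rodBox (hD : D.Bounded) : IsCompact (rodBox D) := by
  refine ((isCompact_prmSet hD).prod (isCompact_closedBall (0 : Rod) 1)).of_isClosed_subset ?_ ?_
  · have := continuous_len
    refine (isClosed_closure.preimage continuous_fst).inter ?_
    refine (isClosed_eq (f := fun x : Prm × Rod => qR x.2 ⬝ᵥ qR x.2) (by fun_prop)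
      continuous_const).inter ?_
    refine (isClosed_le (f := fun _ : Prm × Rod => (0 : ℝ)) continuous_const
      (by fun_prop)).inter ?_
    refine (isClosed_le (g := fun _ : Prm × Rod => (1 : ℝ)) (by fun_prop)
      continuous_const).inter ?_
    exact (isClosed_le (g := fun _ : Prm × Rod => (1 : ℝ)) (by fun_prop) continuous_const).inter
      (isClosed_le (g := fun _ : Prm × Rod => (1 : ℝ)) (by fun_prop) continuous_const)
  · rintro x ⟨h0, h1, -, h3, h4, h5⟩
    refine ⟨h0, ?_⟩
    rw [mem_closedBall_zero_iff, Prod.norm_def, Prod.norm_def, Prod.norm_def]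
    simp only [max_le_iff]
    exact ⟨(norm_le_len _).trans h3, (norm_le_len _).trans h4, norm_le_one_of_unit h1,
      (norm_le_len _).trans h5⟩

theorem ofErr_eq_rest {p : Prm} {e : Rod} (hp : p ∈ prmSet D) (hq : qR e ⬝ᵥ qR e = 1)
    (h0 : 0 ≤ p.1.1.2.1 ⬝ᵥ qR e) (hs : rodErrSum (p, e) ≤ 0) : ofErr p.1.1 e = jetRest p.1.1 := by
  simp only [rodErrSum] at hs
  have a1 := len_nonneg (xR e)
  have a2 := len_nonneg (vR e)
  have a3 := len_nonneg (p.1.1.2.1 ⨯₃ qR e)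
  have a4 := len_nonneg (wR e)
  have b1 : xR e = 0 := len_eq_zero.1 (by linarith)
  have b2 : vR e = 0 := len_eq_zero.1 (by linarith)
  have b3 : p.1.1.2.1 ⨯₃ qR e = 0 := len_eq_zero.1 (by linarith)
  have b4 : wR e = 0 := len_eq_zero.1 (by linarith)
  have hu := prmSet_unit hp
  have b5 := eq_of_cross_eq_zero hu hq b3 h0
  simp only [ofErr, b1, b2, b4, b5, jetRest, zero_sub]
  rw [cross_cross_unit hu, jetW, dot_self_cross, zero_smul, zero_sub, neg_neg]

/-- Near the desired motion of the rod the forces assigned to the cables do not vanish. -/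
theorem exists_rodTube (K : Gains) (hD : D.Bounded) (hnd : D.Nondegenerate P) :
    ∃ r, 0 < r ∧ ∀ x ∈ rodBox D, rodErrSum x ≤ r →
      ∀ j, jetMuTilde P K j x.1.1.1 (ofErr x.1.1.1 x.2) ≠ 0 := by
  have hc : ∀ j, Continuous fun x : Prm × Rod =>
      len (jetMuTilde P K j x.1.1.1 (ofErr x.1.1.1 x.2)) := fun j => by
    have h1 : Continuous fun x : Prm × Rod => x.1.1.1 := by fun_prop
    exact continuous_len.comp (h1.jetMuTilde (continuous_ofErr.comp (h1.prodMk continuous_snd)) j)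
  -- The product of the two lengths is used so that one radius serves both cables.
  obtain ⟨r, hr, h⟩ := exists_pos_of_compact (isCompact_rodBox hD)
    continuous_rodErrSum.continuousOn ((hc 0).mul (hc 1)).continuousOn (by
      rintro ⟨p, e⟩ ⟨h0, h1, h2, -⟩ hs
      have := (prmSet_nondegenerate K hnd h0).1
      rw [← ofErr_eq_rest h0 h1 h2 hs] at this
      exact mul_pos (len_pos.2 (this 0)) (len_pos.2 (this 1)))
  refine ⟨r, hr, fun x hx hs j => ?_⟩
  have h1 := (mul_ne_zero_iff.1 (h x hx hs).ne')
  fin_cases j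
  · exact fun h0 => h1.1 (len_eq_zero.2 h0)
  · exact fun h0 => h1.2 (len_eq_zero.2 h0)

/-- Parameters and states of rod and cables. -/
abbrev TubeArg := Prm × Rod × Cables × Cables

def TubeArg.arg (x : TubeArg) : CtrlArg := (x.1.1, x.2)

variable (P K) in
/-- States of rod and cables with prescribed errors. -/
def tubeOfErr (x : TubeArg) : TubeArg :=
  (x.1, ofErr x.1.1.1 x.2.1, x.2.2.1, fun j => x.2.2.2 j - x.2.2.1 j ⨯₃ (x.2.2.1 j ⨯₃
    jetWTilde P K j (x.1.1.1, x.1.1.2.1, ofErr x.1.1.1 x.2.1, x.2.2.1)))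

variable (P K) in
def cableErrSum (x : TubeArg) : ℝ :=
  ∑ j, (len (jetQTilde P K j (x.1.1.1, ofErr x.1.1.1 x.2.1) ⨯₃ x.2.2.1 j) + len (x.2.2.2 j))

theorem continuousOn_tubeOfErr {S : Set TubeArg}
    (hS : ∀ x ∈ S, ∀ j, jetMuTilde P K j x.1.1.1 (ofErr x.1.1.1 x.2.1) ≠ 0) :
    (∀ j, ContinuousOn (fun x : TubeArg =>
      jetQTilde P K j (x.1.1.1, ofErr x.1.1.1 x.2.1)) S) ∧ ContinuousOn (tubeOfErr P K) S := by
  have h1 : Continuous fun x : TubeArg => ofErr x.1.1.1 x.2.1 :=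
    continuous_ofErr.comp (by fun_prop : Continuous fun x : TubeArg => (x.1.1.1, x.2.1))
  have hq : ∀ j, ContinuousOn (fun x : TubeArg =>
      jetQTilde P K j (x.1.1.1, ofErr x.1.1.1 x.2.1)) S := fun j x hx => by
    have h2 : ContinuousAt (fun x : TubeArg => (x.1.1.1, ofErr x.1.1.1 x.2.1)) x := by fun_prop
    exact ((contDiffAt_jetQTilde (y := (x.1.1.1, ofErr x.1.1.1 x.2.1)) j
      (hS x hx j)).continuousAt.comp_of_eq h2 rfl).continuousWithinAt
  refine ⟨hq, ?_⟩
  have hw : ∀ j, ContinuousOn (fun x : TubeArg =>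
      jetWTilde P K j (x.1.1.1, x.1.1.2.1, ofErr x.1.1.1 x.2.1, x.2.2.1)) S := fun j x hx => by
    have h2 : ContinuousAt (fun x : TubeArg =>
      (x.1.1.1, x.1.1.2.1, ofErr x.1.1.1 x.2.1, x.2.2.1)) x := by fun_prop
    exact ((contDiffAt_jetWTilde (y := (x.1.1.1, x.1.1.2.1, ofErr x.1.1.1 x.2.1, x.2.2.1)) j
      (hS x hx j)).continuousAt.comp_of_eq h2 rfl).continuousWithinAt
  unfold tubeOfErr
  refine continuousOn_fst.prodMk (h1.continuousOn.prodMk (ContinuousOn.prodMk (by fun_prop) ?_))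
  refine continuousOn_pi.2 fun j => ?_
  have := hw j
  fun_prop

/-- Error coordinates of rod and cables in the unit box. -/
def tubeBox (D : Desired) (r : ℝ) : Set TubeArg :=
  {x | (x.1, x.2.1) ∈ rodBox D} ∩ {x | rodErrSum (x.1, x.2.1) ≤ r} ∩
    ⋂ j, ({x | x.2.2.1 j ⬝ᵥ x.2.2.1 j = 1} ∩ {x | len (x.2.2.2 j) ≤ 1})

theorem mem_tubeBox {r : ℝ} {x : TubeArg} : x ∈ tubeBox D r ↔
    ((x.1, x.2.1) ∈ rodBox D ∧ rodErrSum (x.1, x.2.1) ≤ r) ∧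
      ∀ j, x.2.2.1 j ⬝ᵥ x.2.2.1 j = 1 ∧ len (x.2.2.2 j) ≤ 1 := by
  simp [tubeBox]

theorem isCompact_tubeBox (hD : D.Bounded) (r : ℝ) : IsCompact (tubeBox D r) := by
  have hbig : IsCompact ((fun y : (Prm × Rod) × Cables × Cables => (y.1.1, y.1.2, y.2)) ''
      (rodBox D ×ˢ Metric.closedBall (0 : Cables × Cables) 1)) :=
    ((isCompact_rodBox hD).prod (isCompact_closedBall _ _)).image (by fun_prop)
  refine hbig.of_isClosed_subset ?_ ?_
  · have := continuous_len
    have hp : Continuous fun x : TubeArg => (x.1, x.2.1) := by fun_prop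
    refine IsClosed.inter (IsClosed.inter ((isCompact_rodBox hD).isClosed.preimage hp) ?_) ?_
    · exact isClosed_le (continuous_rodErrSum.comp hp) continuous_const
    · refine isClosed_iInter fun j => IsClosed.inter ?_ ?_
      · exact isClosed_eq (f := fun x : TubeArg => x.2.2.1 j ⬝ᵥ x.2.2.1 j) (by fun_prop)
          continuous_const
      · exact isClosed_le (g := fun _ : TubeArg => (1 : ℝ)) (by fun_prop) continuous_const
  · rintro ⟨p, e, qc, w⟩ hx
    obtain ⟨⟨hb, -⟩, hc⟩ := mem_tubeBox.1 hx
    refine ⟨((p, e), qc, w), ⟨hb, ?_⟩, rfl⟩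
    simp only [mem_closedBall_zero_iff, Prod.norm_mk, max_le_iff]
    exact ⟨(pi_norm_le_iff_of_nonneg zero_le_one).2 fun j => norm_le_one_of_unit (hc j).1,
      (pi_norm_le_iff_of_nonneg zero_le_one).2 fun j => (norm_le_len _).trans (hc j).2⟩

variable (P K) in
/-- The part of `tubeBox` where the cables are on the side of their desired directions. -/
def tubeNear (D : Desired) (r : ℝ) : Set TubeArg :=
  tubeBox D r ∩ (fun (x : TubeArg) (j : Fin 2) =>
    jetQTilde P K j (x.1.1.1, ofErr x.1.1.1 x.2.1) ⬝ᵥ x.2.2.1 j) ⁻¹' Set.Ici (0 : Fin 2 → ℝ)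

variable (P K) in
def tubeErrSum (x : TubeArg) : ℝ := rodErrSum (x.1, x.2.1) + cableErrSum P K x

theorem rodErrSum_nonneg (x : Prm × Rod) : 0 ≤ rodErrSum x :=
  add_nonneg (add_nonneg (add_nonneg (len_nonneg _) (len_nonneg _)) (len_nonneg _)) (len_nonneg _)

/-- Zero errors characterise the desired motion. -/
theorem tubeOfErr_eq_rest {r : ℝ} (hnd : D.Nondegenerate P) {x : TubeArg}
    (hx : x ∈ tubeNear P K D r) (hs : tubeErrSum P K x ≤ 0) :
    (tubeOfErr P K x).arg = restArg P K x.1.1 := by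
  obtain ⟨p, e, qc, w⟩ := x
  obtain ⟨hxb, hd⟩ := hx
  obtain ⟨⟨hb, hb'⟩, hc⟩ := mem_tubeBox.1 hxb
  obtain ⟨hp, hq, h0, -⟩ := hb
  have hs1 : 0 ≤ rodErrSum (p, e) := rodErrSum_nonneg _
  have hs2 : ∀ j, 0 ≤ len (jetQTilde P K j (p.1.1, ofErr p.1.1 e) ⨯₃ qc j) + len (w j) :=
    fun j => add_nonneg (len_nonneg _) (len_nonneg _)
  have hs3 : 0 ≤ cableErrSum P K (p, e, qc, w) := Finset.sum_nonneg fun j _ => hs2 j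
  simp only [tubeErrSum] at hs
  have hrest := ofErr_eq_rest hp hq h0 (by linarith)
  have hs4 : cableErrSum P K (p, e, qc, w) = 0 := by linarith
  have hs5 := (Finset.sum_eq_zero_iff_of_nonneg fun j _ => hs2 j).1 hs4
  have hmu := (prmSet_nondegenerate K hnd hp).1
  have hqcj : qc = fun j => jetQTilde P K j (p.1.1, jetRest p.1.1) := funext fun j => by
    have h3 := hs5 j (Finset.mem_univ j)
    have h4 : jetQTilde P K j (p.1.1, ofErr p.1.1 e) ⨯₃ qc j = 0 := by
      refine len_eq_zero.1 (le_antisymm ?_ (len_nonneg _))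
      have := len_nonneg (w j)
      linarith
    have h5 : 0 ≤ jetQTilde P K j (p.1.1, ofErr p.1.1 e) ⬝ᵥ qc j := hd j
    rw [hrest] at h4 h5
    exact eq_of_cross_eq_zero (jetQTilde_unit (y := (p.1.1, jetRest p.1.1)) (hmu j))
      (hc j).1 h4 h5
  have hw : ∀ j, w j = 0 := fun j => by
    have h3 := hs5 j (Finset.mem_univ j)
    refine len_eq_zero.1 (le_antisymm ?_ (len_nonneg _))
    have := len_nonneg (jetQTilde P K j (p.1.1, ofErr p.1.1 e) ⨯₃ qc j)
    linarith
  simp only [tubeOfErr, TubeArg.arg, restArg, hrest, hw, zero_sub]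
  subst hqcj
  refine Prod.ext rfl (Prod.ext rfl (Prod.ext rfl (funext fun j => ?_)))
  have hwq : jetQTilde P K j (p.1.1, jetRest p.1.1) ⬝ᵥ jetWTilde P K j (p.1.1, p.1.2.1,
      jetRest p.1.1, fun i => jetQTilde P K i (p.1.1, jetRest p.1.1)) = 0 := by
    rw [dotProduct_comm]
    exact jetWTilde_dot (p.1.1, p.1.2.1, jetRest p.1.1, _)
  simp only
  rw [cross_cross_unit (jetQTilde_unit (y := (p.1.1, jetRest p.1.1)) (hmu j)), hwq, zero_smul,
    zero_sub, neg_neg]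

variable (P K) in
-- Positive exactly if both desired attitudes are defined.
def tubeNondeg (x : TubeArg) : ℝ :=
  ∏ j, len (jetU P K j (tubeOfErr P K x).arg ⨯₃ (tubeOfErr P K x).1.2 j)

theorem continuousOn_tubeNondeg {S : Set TubeArg}
    (hS : ∀ x ∈ S, ∀ j, jetMuTilde P K j x.1.1.1 (ofErr x.1.1.1 x.2.1) ≠ 0) :
    ContinuousOn (tubeNondeg P K) S := by
  have hTc := (continuousOn_tubeOfErr hS).2
  refine continuousOn_finsetProd _ fun j _ => continuous_len.comp_continuousOn
    (ContinuousOn.cross ?_ ?_)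
  · intro x hx
    have h1 : ContinuousWithinAt (fun x => (tubeOfErr P K x).arg) S x := by
      have : Continuous TubeArg.arg := by unfold TubeArg.arg; fun_prop
      exact this.continuousAt.comp_continuousWithinAt (hTc x hx)
    exact ContinuousAt.comp_continuousWithinAt (g := jetU P K j)
      (f := fun x => (tubeOfErr P K x).arg) (contDiffAt_jetU j (hS x hx j)).continuousAt h1
  · unfold tubeOfErr; fun_prop

theorem continuousOn_tubeErrSum {S : Set TubeArg}
    (hS : ∀ x ∈ S, ∀ j, jetMuTilde P K j x.1.1.1 (ofErr x.1.1.1 x.2.1) ≠ 0) :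
    ContinuousOn (tubeErrSum P K) S := by
  have hqc := (continuousOn_tubeOfErr hS).1
  refine ContinuousOn.add ?_ ?_
  · exact (continuous_rodErrSum.comp
      (by fun_prop : Continuous fun x : TubeArg => (x.1, x.2.1))).continuousOn
  · refine continuousOn_finsetSum _ fun j _ => ContinuousOn.add ?_ ?_
    · exact continuous_len.comp_continuousOn ((hqc j).cross (by fun_prop))
    · exact continuous_len.comp_continuousOn (by fun_prop)

theorem mem_rodBox_of_small {p : Prm} (hp : p ∈ prmSet D) {z : Rod} {s : ℝ} (hs : s ≤ 1)
    (hz : RodSmall s p.1.1 z) : (p, (xR z, vR z, qR z, jetEw p.1.1 z)) ∈ rodBox D ∧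
      rodErrSum (p, (xR z, vR z, qR z, jetEw p.1.1 z)) ≤ 4 * s := by
  obtain ⟨c1, c2, c3, c4, c5, c6⟩ := hz
  refine ⟨⟨hp, c1, c2, c3.trans hs, c4.trans hs, c6.trans hs⟩, ?_⟩
  simp only [rodErrSum]
  linarith

/-- Error coordinates are the true coordinates with the angular velocities replaced by their errors,
so every small state has a preimage. The sums run over four rod errors and four cable errors, whence
`4 * s` and `8 * s`. -/
theorem exists_mem_tubeNear_of_small {p : Prm} (hp : p ∈ prmSet D) {z : Rod × Cables × Cables}
    {s r : ℝ} (hs : s ≤ 1) (hr : 4 * s ≤ r) (hz : Small P K s (p.1, z)) :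
    ∃ x ∈ tubeNear P K D r, tubeErrSum P K x ≤ 8 * s ∧ tubeOfErr P K x = (p, z) := by
  obtain ⟨z, qc, wc⟩ := z
  obtain ⟨hz, hc⟩ := hz
  simp only at hz hc
  obtain ⟨m1, m2⟩ := mem_rodBox_of_small hp hs hz
  refine ⟨(p, (xR z, vR z, qR z, jetEw p.1.1 z), qc,
    fun j => jetEwc P K j (p.1, z, qc, wc)), ⟨mem_tubeBox.2 ⟨⟨m1, m2.trans hr⟩, fun j =>
      ⟨(hc j).1, (hc j).2.2.2.trans hs⟩⟩, fun j => ?_⟩, ?_, ?_⟩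
  · simp only [ofErr_toErr]
    exact (hc j).2.1
  · have h3 : cableErrSum P K (p, (xR z, vR z, qR z, jetEw p.1.1 z), qc,
        fun j => jetEwc P K j (p.1, z, qc, wc)) ≤ 4 * s := by
      have c0 := (hc 0).2.2
      have c1 := (hc 1).2.2
      simp only [jetEqc] at c0 c1
      simp only [cableErrSum, ofErr_toErr, Fin.sum_univ_two]
      linarith [c0.1, c0.2, c1.1, c1.2]
    simp only [tubeErrSum]
    linarith
  · simp only [tubeOfErr, ofErr_toErr]
    refine Prod.ext rfl (Prod.ext rfl (Prod.ext rfl (funext fun j => ?_)))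
    simp [jetEwc, jetWc]

/-- A compact neighbourhood of the desired motion on which the controller is smooth. -/
theorem exists_tube (K : Gains) (hD : D.Bounded) (hnd : D.Nondegenerate P) :
    ∃ r, 0 < r ∧ r ≤ 1 ∧ ∃ S : Set TubeArg, IsCompact S ∧
      (∀ x ∈ S, (∀ j, jetMuTilde P K j x.arg.1.1 x.arg.2.1 ≠ 0) ∧
        ∀ j, jetU P K j x.arg ⨯₃ x.1.2 j ≠ 0) ∧
      (∀ p ∈ prmSet D, ∀ z, RodSmall r p.1.1 z → ∀ j, jetMuTilde P K j p.1.1 z ≠ 0) ∧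
      ∀ p ∈ prmSet D, ∀ z, Small P K r (p.1, z) → (p, z) ∈ S := by
  -- Two radii are needed: the cable errors are continuous functions only where the assigned forces
  -- do not vanish, and this is first secured by small errors of the rod.
  obtain ⟨r₁, hr₁, h₁⟩ := exists_rodTube K hD hnd
  have hAmu : ∀ x ∈ tubeBox D r₁, ∀ j, jetMuTilde P K j x.1.1.1 (ofErr x.1.1.1 x.2.1) ≠ 0 :=
    fun x hx => h₁ _ (mem_tubeBox.1 hx).1.1 (mem_tubeBox.1 hx).1.2
  have hBA : tubeNear P K D r₁ ⊆ tubeBox D r₁ := Set.inter_subset_left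
  have hBmu := fun x (hx : x ∈ tubeNear P K D r₁) => hAmu x (hBA hx)
  have hBc : IsCompact (tubeNear P K D r₁) :=
    isCompact_inter_preimage (isCompact_tubeBox hD r₁)
      (continuousOn_pi.2 fun j => ((continuousOn_tubeOfErr hAmu).1 j).dot (by fun_prop))
      isClosed_Ici
  have hφc := continuousOn_tubeErrSum hBmu
  obtain ⟨r₂, hr₂, h₂⟩ := exists_pos_of_compact hBc hφc (continuousOn_tubeNondeg hBmu) (by
    intro x hx hs
    refine Finset.prod_pos fun j _ => len_pos.2 ?_
    rw [tubeOfErr_eq_rest hnd hx hs]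
    exact (prmSet_nondegenerate K hnd (mem_tubeBox.1 hx.1).1.1.1).2 j)
  have hs1 : min 1 (min (r₁ / 4) (r₂ / 8)) ≤ 1 := min_le_left _ _
  have hs2 : min 1 (min (r₁ / 4) (r₂ / 8)) ≤ r₁ / 4 := (min_le_right _ _).trans (min_le_left _ _)
  have hs3 : min 1 (min (r₁ / 4) (r₂ / 8)) ≤ r₂ / 8 := (min_le_right _ _).trans (min_le_right _ _)
  refine ⟨min 1 (min (r₁ / 4) (r₂ / 8)), by positivity, hs1,
    tubeOfErr P K '' (tubeNear P K D r₁ ∩ tubeErrSum P K ⁻¹' Set.Iic r₂),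
    (isCompact_inter_preimage hBc hφc isClosed_Iic).image_of_continuousOn
      ((continuousOn_tubeOfErr hBmu).2.mono Set.inter_subset_left), ?_, ?_, ?_⟩
  · rintro _ ⟨x, ⟨hxB, hxφ⟩, rfl⟩
    refine ⟨fun j => hBmu x hxB j, fun j h0 => ?_⟩
    exact Finset.prod_ne_zero_iff.1 (h₂ x hxB hxφ).ne' j (Finset.mem_univ j) (len_eq_zero.2 h0)
  · intro p hp z hz j
    obtain ⟨m1, m2⟩ := mem_rodBox_of_small hp hs1 hz
    have := h₁ _ m1 (by linarith) j
    simp only [ofErr_toErr] at this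
    exact this
  · intro p hp z hz
    obtain ⟨x, hx, h3, h4⟩ := exists_mem_tubeNear_of_small (r := r₁) hp hs1 (by linarith) hz
    exact ⟨x, ⟨hx, h3.trans (by linarith)⟩, h4⟩

end Tube

/-! ### Lyapunov functions for tracking on the sphere -/

/-- Error of the angular velocity `w` of `q` relative to the desired angular velocity `wt`. -/
def sphereEw (q w wt : V3) : V3 := w + q ⨯₃ (q ⨯₃ wt)

theorem sphereEw_eq {q : V3} (hq : q ⬝ᵥ q = 1) (w wt : V3) :
    sphereEw q w wt = w - wt + (q ⬝ᵥ wt) • q := by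
  rw [sphereEw, cross_cross_unit hq]; abel

theorem sphereEw_dot {q w : V3} (hw : w ⬝ᵥ q = 0) (wt : V3) : sphereEw q w wt ⬝ᵥ q = 0 := by
  rw [sphereEw, add_dotProduct, hw, cross_dot_left, zero_add]

/-- Lyapunov function of a point `q` of the sphere tracking `qt`. -/
def sphereV (kq c : ℝ) (q w qt wt : V3) : ℝ :=
  1 / 2 * (sphereEw q w wt ⬝ᵥ sphereEw q w wt) + kq * (1 - qt ⬝ᵥ q)
    + c * ((qt ⨯₃ q) ⬝ᵥ sphereEw q w wt)

/-- The derivative of the angular velocity error under the tracking law. -/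
theorem sphereEw_deriv {q w qt wt A pw w' : V3} {kq kw : ℝ}
    (hw' : w' = -(q ⨯₃ (q ⨯₃ A)) + (q ⬝ᵥ wt) • (q ⨯₃ w) - kq • (qt ⨯₃ q)
      - kw • sphereEw q w wt + pw) :
    w' + ((w ⨯₃ q) ⨯₃ (q ⨯₃ wt) + q ⨯₃ ((w ⨯₃ q) ⨯₃ wt + q ⨯₃ A)) =
      -(kq • (qt ⨯₃ q)) - kw • sphereEw q w wt + pw + ((w ⨯₃ q) ⬝ᵥ wt) • q := by
  have h1 : (w ⨯₃ q) ⨯₃ (q ⨯₃ wt) = ((w ⨯₃ q) ⬝ᵥ wt) • q := by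
    rw [cross_cross_right, cross_dot_right, zero_smul, sub_zero]
  have h2 : q ⨯₃ ((w ⨯₃ q) ⨯₃ wt) = -((q ⬝ᵥ wt) • (q ⨯₃ w)) := by
    rw [cross_cross_right, dot_cross_self, zero_smul, sub_zero, ← cross_anticomm q w, smul_neg]
  rw [hw', cross_add_right, h1, h2]
  module

/-- The vector `sphereEw q w wt` differs from `w - wt` by a multiple of `q`, which is orthogonal to
`qt ⨯₃ q`. The resulting product with the angular velocity error is what the proportional feedback
cancels in the Lyapunov function. -/
theorem sphere_config_deriv {q w qt wt pq : V3} (hq : q ⬝ᵥ q = 1) :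
    (wt ⨯₃ qt + pq) ⬝ᵥ q + qt ⬝ᵥ (w ⨯₃ q) =
      -((qt ⨯₃ q) ⬝ᵥ sphereEw q w wt) + pq ⬝ᵥ q := by
  rw [sphereEw_eq hq]
  simp only [cross_apply, dotProduct, Fin.sum_univ_three, Pi.add_apply, Pi.sub_apply,
    Pi.smul_apply, smul_eq_mul, Matrix.cons_val_zero, Matrix.cons_val_one, Matrix.cons_val]
  ring

/-- This is the cost of the cross term of the Lyapunov function. When `wt` is orthogonal to `qt`,
the product `(wt ⬝ᵥ q) * (sphereEw q w wt ⬝ᵥ qt)` is of second order in the attitude error. -/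
theorem sphere_eq_deriv_dot {q w qt wt pq : V3} (hq : q ⬝ᵥ q = 1) (hw : w ⬝ᵥ q = 0) :
    ((wt ⨯₃ qt + pq) ⨯₃ q + qt ⨯₃ (w ⨯₃ q)) ⬝ᵥ sphereEw q w wt =
      (qt ⬝ᵥ q) * (sphereEw q w wt ⬝ᵥ sphereEw q w wt)
        + (wt ⬝ᵥ q) * (sphereEw q w wt ⬝ᵥ qt) + (pq ⨯₃ q) ⬝ᵥ sphereEw q w wt := by
  have h0 := sphereEw_dot hw wt
  have h1 := sphereEw_eq hq w wt
  have h2 : w = sphereEw q w wt + wt - (q ⬝ᵥ wt) • q := by rw [h1]; abel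
  generalize sphereEw q w wt = e at *
  rw [cross_add_left, cross_cross_left, cross_cross_right]
  simp only [add_dotProduct, sub_dotProduct, smul_dotProduct, smul_eq_mul]
  rw [dotProduct_comm q e, h0]
  have h3 : w ⬝ᵥ e = e ⬝ᵥ e + wt ⬝ᵥ e := by
    rw [h2]
    simp only [add_dotProduct, sub_dotProduct, smul_dotProduct, smul_eq_mul]
    rw [dotProduct_comm q e, h0]; ring
  rw [h3, dotProduct_comm qt e]
  ring

/-- Derivative of the Lyapunov function under the tracking law with perturbations `pq`, `pw`. -/
theorem hasDerivWithinAt_sphereV {q w qt wt : ℝ → V3} {A pq pw w' : V3} {kq kw c t : ℝ}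
    {s : Set ℝ} (hc : 0 ≤ c) (hkq : 0 ≤ kq) (hkw : 0 ≤ kw)
    (hq : q t ⬝ᵥ q t = 1) (hwq : w t ⬝ᵥ q t = 0) (hqt : qt t ⬝ᵥ qt t = 1)
    (hwt : wt t ⬝ᵥ qt t = 0) (hpq : pq ⬝ᵥ qt t = 0)
    (dq : HasDerivWithinAt q (w t ⨯₃ q t) s t)
    (dqt : HasDerivWithinAt qt (wt t ⨯₃ qt t + pq) s t)
    (dw : HasDerivWithinAt w w' s t) (dwt : HasDerivWithinAt wt A s t)
    (hw' : w' = -(q t ⨯₃ (q t ⨯₃ A)) + (q t ⬝ᵥ wt t) • (q t ⨯₃ w t) - kq • (qt t ⨯₃ q t)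
      - kw • sphereEw (q t) (w t) (wt t) + pw) :
    ∃ V', HasDerivWithinAt (fun τ => sphereV kq c (q τ) (w τ) (qt τ) (wt τ)) V' s t ∧
      V' ≤ -kw * len (sphereEw (q t) (w t) (wt t)) ^ 2
        + len pw * len (sphereEw (q t) (w t) (wt t)) + kq * (len pq * len (qt t ⨯₃ q t))
        + c * (len (sphereEw (q t) (w t) (wt t)) ^ 2
          + len (wt t) * len (qt t ⨯₃ q t) ^ 2 * len (sphereEw (q t) (w t) (wt t))
          + len pq * len (sphereEw (q t) (w t) (wt t)) - kq * len (qt t ⨯₃ q t) ^ 2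
          + kw * (len (qt t ⨯₃ q t) * len (sphereEw (q t) (w t) (wt t)))
          + len pw * len (qt t ⨯₃ q t)) := by
  have dew : HasDerivWithinAt (fun τ => sphereEw (q τ) (w τ) (wt τ))
      (-(kq • (qt t ⨯₃ q t)) - kw • sphereEw (q t) (w t) (wt t) + pw
        + ((w t ⨯₃ q t) ⬝ᵥ wt t) • q t) s t := by
    rw [← sphereEw_deriv hw']
    exact dw.add (dq.cross (dq.cross dwt))
  have deq := dqt.cross dq
  have dV := (((dew.dot dew).const_mul (1 / 2 : ℝ)).add
    (((dqt.dot dq).const_sub 1).const_mul kq)).add ((deq.dot dew).const_mul c)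
  refine ⟨_, dV, ?_⟩
  rw [sphere_eq_deriv_dot hq hwq, sphere_config_deriv hq]
  have e0 := sphereEw_dot hwq (wt t)
  generalize sphereEw (q t) (w t) (wt t) = e at *
  have e1 : (qt t ⨯₃ q t) ⬝ᵥ q t = 0 := cross_dot_right _ _
  -- The vector `wt` is orthogonal to `qt` and `e` to `q`, so each factor sees only the component of
  -- the other direction orthogonal to it and gains a factor `|qt ⨯₃ q|`.
  have f1 : (wt t ⬝ᵥ q t) * (e ⬝ᵥ qt t) ≤ len (wt t) * len (qt t ⨯₃ q t) ^ 2 * len e := by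
    have g1 := abs_dot_le_cross hqt (q t) hwt
    have g2 := abs_dot_le_cross hq (qt t) e0
    rw [← cross_anticomm, len_neg] at g2
    calc (wt t ⬝ᵥ q t) * (e ⬝ᵥ qt t) ≤ |wt t ⬝ᵥ q t| * |e ⬝ᵥ qt t| := by
          rw [← abs_mul]; exact le_abs_self _
      _ ≤ (len (wt t) * len (qt t ⨯₃ q t)) * (len e * len (qt t ⨯₃ q t)) :=
          mul_le_mul g1 g2 (abs_nonneg _) (mul_nonneg (len_nonneg _) (len_nonneg _))
      _ = _ := by ring
  have f2 : -(pq ⬝ᵥ q t) ≤ len pq * len (qt t ⨯₃ q t) :=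
    (neg_le_abs _).trans (abs_dot_le_cross hqt (q t) hpq)
  have f3 : (pq ⨯₃ q t) ⬝ᵥ e ≤ len pq * len e := by
    refine (dot_le _ _).trans (mul_le_mul_of_nonneg_right ?_ (len_nonneg _))
    simpa [len_eq_one hq] using len_cross_le pq (q t)
  have f4 : (qt t ⬝ᵥ q t) * (e ⬝ᵥ e) ≤ len e ^ 2 := by
    rw [len_sq]
    nlinarith [unit_dot_le_one hqt hq, dot_self_nonneg e]
  have f5 := neg_dot_le (qt t ⨯₃ q t) e
  have f6 := dot_le pw e
  have f7 := dot_le pw (qt t ⨯₃ q t)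
  have f8 := len_sq e
  have f9 := len_sq (qt t ⨯₃ q t)
  generalize hE : qt t ⨯₃ q t = E at *
  simp only [add_dotProduct, sub_dotProduct, neg_dotProduct, smul_dotProduct, dotProduct_add,
    dotProduct_sub, dotProduct_neg, dotProduct_smul, smul_eq_mul]
  rw [dotProduct_comm (q t) e, e0, e1, dotProduct_comm e E, dotProduct_comm e pw,
    dotProduct_comm E pw, ← f8, ← f9]
  have g1 := mul_le_mul_of_nonneg_left f2 hkq
  have g2 : c * ((qt t ⬝ᵥ q t) * len e ^ 2 + (wt t ⬝ᵥ q t) * (e ⬝ᵥ qt t) + (pq ⨯₃ q t) ⬝ᵥ e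
      + (-(kq * len E ^ 2) - kw * (E ⬝ᵥ e) + pw ⬝ᵥ E)) ≤
      c * (len e ^ 2 + len (wt t) * len E ^ 2 * len e + len pq * len e - kq * len E ^ 2
        + kw * (len E * len e) + len pw * len E) := by
    refine mul_le_mul_of_nonneg_left ?_ hc
    rw [← f8] at f4
    have := mul_le_mul_of_nonneg_left f5 hkw
    linarith
  linarith

theorem sphereV_le {kq c : ℝ} {q w qt wt : V3} (hkq : 0 ≤ kq) (hc : 0 ≤ c) (hq : q ⬝ᵥ q = 1)
    (hqt : qt ⬝ᵥ qt = 1) (h0 : 0 ≤ qt ⬝ᵥ q) :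
    sphereV kq c q w qt wt ≤ (1 / 2 + kq + c) * (len (qt ⨯₃ q) ^ 2 + len (sphereEw q w wt) ^ 2) := by
  have h1 := configError_le hqt hq h0
  have h2 := dot_le (qt ⨯₃ q) (sphereEw q w wt)
  rw [sphereV, ← len_sq]
  have h3 := mul_le_mul_of_nonneg_left h1 hkq
  have h4 := mul_le_mul_of_nonneg_left h2 hc
  nlinarith [sq_nonneg (len (qt ⨯₃ q) - len (sphereEw q w wt)), sq_nonneg (len (qt ⨯₃ q)),
    sq_nonneg (len (sphereEw q w wt)),
    mul_nonneg hc (sq_nonneg (len (qt ⨯₃ q) - len (sphereEw q w wt))),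
    mul_nonneg hc (sq_nonneg (len (qt ⨯₃ q))), mul_nonneg hc (sq_nonneg (len (sphereEw q w wt))),
    mul_nonneg hkq (sq_nonneg (len (sphereEw q w wt)))]

theorem le_sphereV {kq c : ℝ} {q w qt wt : V3} (hkq : 0 ≤ kq) (hc : 0 ≤ c) (hq : q ⬝ᵥ q = 1)
    (hqt : qt ⬝ᵥ qt = 1) :
    1 / 2 * len (sphereEw q w wt) ^ 2 + kq / 2 * len (qt ⨯₃ q) ^ 2
      - c * (len (qt ⨯₃ q) * len (sphereEw q w wt)) ≤ sphereV kq c q w qt wt := by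
  have h1 := le_configError hqt hq
  have h2 := neg_dot_le (qt ⨯₃ q) (sphereEw q w wt)
  rw [sphereV, ← len_sq]
  have h3 := mul_le_mul_of_nonneg_left h1 hkq
  have h4 := mul_le_mul_of_nonneg_left h2 hc
  linarith

/-! ### The Lyapunov function of the position -/

/-- Adapted to the gains one: along `x' = v`, `v' = -x - v` its derivative is `-posV x v`. -/
def posV (x v : V3) : ℝ := x ⬝ᵥ x + v ⬝ᵥ v + x ⬝ᵥ v

theorem hasDerivWithinAt_posV {x v : ℝ → V3} {pv : V3} {s : Set ℝ} {t : ℝ}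
    (dx : HasDerivWithinAt x (v t) s t) (dv : HasDerivWithinAt v (-x t - v t + pv) s t) :
    ∃ V', HasDerivWithinAt (fun τ => posV (x τ) (v τ)) V' s t ∧
      V' ≤ -(1 / 2) * (len (x t) ^ 2 + len (v t) ^ 2)
        + len pv * (2 * len (v t) + len (x t)) := by
  refine ⟨_, ((dx.dot dx).add (dv.dot dv)).add (dx.dot dv), ?_⟩
  simp only [add_dotProduct, sub_dotProduct, neg_dotProduct, dotProduct_add, dotProduct_sub,
    dotProduct_neg]
  have h1 := dot_le pv (v t)
  have h2 := dot_le pv (x t)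
  have h3 := neg_dot_le (x t) (v t)
  rw [dotProduct_comm (v t) (x t), dotProduct_comm (v t) pv, dotProduct_comm (x t) pv, ← len_sq,
    ← len_sq]
  nlinarith [sq_nonneg (len (x t) - len (v t))]

theorem posV_le (x v : V3) : posV x v ≤ 2 * (len x ^ 2 + len v ^ 2) := by
  rw [posV, ← len_sq, ← len_sq]
  nlinarith [dot_le x v, sq_nonneg (len x - len v)]

theorem le_posV (x v : V3) : 1 / 2 * (len x ^ 2 + len v ^ 2) ≤ posV x v := by
  rw [posV, ← len_sq, ← len_sq]
  nlinarith [neg_dot_le x v, sq_nonneg (len x - len v)]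

/-! ### Rotations -/

abbrev SO3 := Matrix.specialOrthogonalGroup (Fin 3) ℝ

section Rotation

variable {E : M3}

theorem SO3.mul_transpose (h : E ∈ SO3) : E * Eᵀ = 1 :=
  (Matrix.mem_orthogonalGroup_iff (Fin 3) ℝ).1 (Matrix.mem_specialOrthogonalGroup_iff.1 h).1

theorem SO3.transpose_mul (h : E ∈ SO3) : Eᵀ * E = 1 :=
  (Matrix.mem_orthogonalGroup_iff' (Fin 3) ℝ).1 (Matrix.mem_specialOrthogonalGroup_iff.1 h).1

theorem SO3.of_mul_transpose (h : E * Eᵀ = 1) (hd : E.det = 1) : E ∈ SO3 :=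
  Matrix.mem_specialOrthogonalGroup_iff.2 ⟨(Matrix.mem_orthogonalGroup_iff (Fin 3) ℝ).2 h, hd⟩

theorem SO3.transpose_mem (h : E ∈ SO3) : Eᵀ ∈ SO3 :=
  SO3.of_mul_transpose (by rw [Matrix.transpose_transpose]; exact SO3.transpose_mul h)
    (by rw [Matrix.det_transpose]; exact (Matrix.mem_specialOrthogonalGroup_iff.1 h).2)

theorem SO3.adjugate (h : E ∈ SO3) : E.adjugate = Eᵀ := by
  have hd : E.det = 1 := (Matrix.mem_specialOrthogonalGroup_iff.1 h).2
  have h1 : E.adjugate * E = 1 := by rw [Matrix.adjugate_mul, hd, one_smul]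
  calc E.adjugate = E.adjugate * (E * Eᵀ) := by rw [SO3.mul_transpose h, mul_one]
    _ = Eᵀ := by rw [← mul_assoc, h1, one_mul]

/-- A polynomial identity for arbitrary matrices, with the cofactor matrix on the right. For
rotations the cofactor matrix is `E` itself. -/
theorem conj_hat (E : M3) (w : V3) : E * hat w * Eᵀ = hat (E.adjugateᵀ *ᵥ w) := by
  rw [Matrix.adjugate_fin_three]
  ext i j
  fin_cases i <;> fin_cases j <;>
    simp [hat, Matrix.mul_apply, Fin.sum_univ_three, Matrix.mulVec, dotProduct] <;> ring

theorem SO3.conj_hat (h : E ∈ SO3) (w : V3) : E * hat w * Eᵀ = hat (E *ᵥ w) := by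
  rw [RodTransport.conj_hat, SO3.adjugate h, Matrix.transpose_transpose]

/-- `E` intertwines `hat (Eᵀ w)` and `hat w`. -/
theorem SO3.mul_hat (h : E ∈ SO3) (w : V3) : E * hat (Eᵀ *ᵥ w) = hat w * E := by
  have h1 := SO3.conj_hat h (Eᵀ *ᵥ w)
  rw [Matrix.mulVec_mulVec, SO3.mul_transpose h, Matrix.one_mulVec] at h1
  rw [← h1, mul_assoc, SO3.transpose_mul h, mul_one]

theorem dot_mulVec_transpose (A : M3) (v w : V3) : v ⬝ᵥ (A *ᵥ w) = (Aᵀ *ᵥ v) ⬝ᵥ w := by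
  rw [Matrix.dotProduct_mulVec, Matrix.mulVec_transpose]

theorem SO3.dot_mulVec (h : E ∈ SO3) (v w : V3) : (E *ᵥ v) ⬝ᵥ (E *ᵥ w) = v ⬝ᵥ w := by
  rw [dot_mulVec_transpose, Matrix.mulVec_mulVec, SO3.transpose_mul h, Matrix.one_mulVec]

theorem SO3.len_mulVec (h : E ∈ SO3) (v : V3) : len (E *ᵥ v) = len v := by
  rw [len, len, SO3.dot_mulVec h]

theorem SO3.row_sq (h : E ∈ SO3) (i : Fin 3) : E i 0 ^ 2 + E i 1 ^ 2 + E i 2 ^ 2 = 1 := by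
  have := congrFun (congrFun (SO3.mul_transpose h) i) i
  simp only [Matrix.mul_apply, Fin.sum_univ_three, Matrix.transpose_apply,
    Matrix.one_apply_eq] at this
  linarith

theorem SO3.abs_le_one (h : E ∈ SO3) (i j : Fin 3) : |E i j| ≤ 1 := by
  have := SO3.row_sq h i
  rw [← sq_le_one_iff_abs_le_one]
  fin_cases j <;> simp only [Fin.zero_eta, Fin.mk_one, Fin.reduceFinMk] <;>
    nlinarith [sq_nonneg (E i 0), sq_nonneg (E i 1), sq_nonneg (E i 2)]

/-! ### The attitude error -/

/-- The attitude error of a relative rotation. -/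
def rotErr (E : M3) : V3 := (1 / 2 : ℝ) • vee (E - Eᵀ)

/-- The configuration error of a relative rotation. -/
def rotConfig (E : M3) : ℝ := 1 / 2 * (1 - E).trace

theorem rotConfig_eq (E : M3) : rotConfig E = 1 / 2 * (3 - (E 0 0 + E 1 1 + E 2 2)) := by
  simp only [rotConfig, Matrix.trace, Matrix.diag, Fin.sum_univ_three, Matrix.sub_apply,
    Matrix.one_apply_eq]
  ring

/-- For a rotation by the angle `θ` the configuration error is `1 - cos θ` and the attitude error
has length `|sin θ|`. Algebraically it follows from the unit rows and from the diagonal entries of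
`adjugate E = Eᵀ`. -/
theorem SO3.len_rotErr_sq (h : E ∈ SO3) :
    len (rotErr E) ^ 2 = rotConfig E * (2 - rotConfig E) := by
  have ha := SO3.adjugate h
  rw [Matrix.adjugate_fin_three] at ha
  have a0 := congrFun (congrFun ha 0) 0
  have a1 := congrFun (congrFun ha 1) 1
  have a2 := congrFun (congrFun ha 2) 2
  simp at a0 a1 a2
  have r0 := SO3.row_sq h 0
  have r1 := SO3.row_sq h 1
  have r2 := SO3.row_sq h 2
  rw [len_sq, rotConfig_eq]
  simp [rotErr, vee, dotProduct, Fin.sum_univ_three]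
  linear_combination (1 / 4 : ℝ) * (r0 + r1 + r2) + (1 / 2 : ℝ) * (a0 + a1 + a2)

theorem SO3.diag_le (h : E ∈ SO3) (i : Fin 3) : E i i ≤ 1 := (abs_le.1 (SO3.abs_le_one h i i)).2

theorem SO3.rotConfig_nonneg (h : E ∈ SO3) : 0 ≤ rotConfig E := by
  rw [rotConfig_eq]
  linarith [SO3.diag_le h 0, SO3.diag_le h 1, SO3.diag_le h 2]

theorem SO3.rotConfig_le (h : E ∈ SO3) (h1 : rotConfig E ≤ 1) :
    rotConfig E ≤ len (rotErr E) ^ 2 := by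
  rw [SO3.len_rotErr_sq h]
  nlinarith [SO3.rotConfig_nonneg h]

theorem SO3.le_rotConfig (h : E ∈ SO3) : len (rotErr E) ^ 2 ≤ 2 * rotConfig E := by
  rw [SO3.len_rotErr_sq h]
  nlinarith [sq_nonneg (rotConfig E)]

/-- Projection of the force on the third body axis. -/
def projThrust (u : V3) (R : M3) : V3 := (u ⬝ᵥ (R *ᵥ e3)) • (R *ᵥ e3)

/-- The deviation is `|u|` times the sine of the angle between the two third axes, whose cosine is
`E 2 2`. The other diagonal entries are at most one, so `1 - E 2 2 ≤ 2 * rotConfig E`, and the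
configuration error is at most the squared attitude error up to a right angle. -/
theorem len_projThrust_sub {u : V3} {Rd : M3} (hE : E ∈ SO3) (hRd : Rd ∈ SO3)
    (hu : u = len u • (Rd *ᵥ e3)) (h1 : rotConfig E ≤ 1) :
    len (projThrust u (Rd * E) - u) ≤ 2 * len u * len (rotErr E) := by
  have he : e3 ⬝ᵥ e3 = 1 := by simp [e3, dotProduct, Fin.sum_univ_three]
  set n := (Rd * E) *ᵥ e3 with hn
  have hn' : n = Rd *ᵥ (E *ᵥ e3) := by rw [hn, Matrix.mulVec_mulVec]
  have hnn : n ⬝ᵥ n = 1 := by rw [hn', SO3.dot_mulVec hRd, SO3.dot_mulVec hE, he]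
  have hun : u ⬝ᵥ n = len u * E 2 2 := by
    conv_lhs => rw [hu, hn']
    rw [smul_dotProduct, SO3.dot_mulVec hRd, smul_eq_mul]
    congr 1
    simp [e3, Matrix.mulVec, dotProduct, Fin.sum_univ_three]
  refine (sq_le_sq₀ (len_nonneg _) (by have := len_nonneg u; have := len_nonneg (rotErr E); positivity)).1 ?_
  have h2 : len (projThrust u (Rd * E) - u) ^ 2 = len u ^ 2 * (1 - E 2 2 ^ 2) := by
    rw [len_sq, projThrust, ← hn]
    simp only [dotProduct_sub, sub_dotProduct, dotProduct_smul, smul_dotProduct, smul_eq_mul, hnn]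
    rw [dotProduct_comm n u, ← len_sq, hun]
    ring
  have h3 : 1 - E 2 2 ^ 2 ≤ 4 * len (rotErr E) ^ 2 := by
    have h4 := SO3.rotConfig_le hE h1
    have h5 := rotConfig_eq E
    have := SO3.diag_le hE 0
    have := SO3.diag_le hE 1
    nlinarith [sq_nonneg (1 - E 2 2)]
  rw [h2]
  calc len u ^ 2 * (1 - E 2 2 ^ 2) ≤ len u ^ 2 * (4 * len (rotErr E) ^ 2) :=
        mul_le_mul_of_nonneg_left h3 (sq_nonneg _)
    _ = _ := by ring

end Rotation

/-! ### The desired attitude -/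

theorem frame_mem_SO3 {c a : V3} (hc : c ⬝ᵥ c = 1) (ha : a ⬝ᵥ a = 1) (hca : c ⬝ᵥ a = 0) :
    (Matrix.of ![c ⨯₃ a, c, a])ᵀ ∈ SO3 := by
  refine SO3.transpose_mem (SO3.of_mul_transpose ?_ ?_)
  · have hac : a ⬝ᵥ c = 0 := by rw [dotProduct_comm, hca]
    have h1 : (c ⨯₃ a) ⬝ᵥ (c ⨯₃ a) = 1 := by rw [cross_dot_cross, hc, ha, hca]; simp
    have key : ∀ i j, (Matrix.of ![c ⨯₃ a, c, a] * (Matrix.of ![c ⨯₃ a, c, a])ᵀ) i j =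
        (![c ⨯₃ a, c, a] i) ⬝ᵥ (![c ⨯₃ a, c, a] j) := fun i j => rfl
    ext i j
    rw [key]
    fin_cases i <;> fin_cases j <;>
      simp [h1, hc, ha, hca, hac, cross_dot_left, cross_dot_right]
  · have h := triple_product_eq_det (c ⨯₃ a) c a
    rw [cross_dot_cross, hc, ha, hca] at h
    have h' : (Matrix.of ![c ⨯₃ a, c, a]).det = Matrix.det ![c ⨯₃ a, c, a] := rfl
    rw [h', ← h]
    simp

theorem len_cross_cross {a : V3} (ha : a ⬝ᵥ a = 1) (b : V3) :
    len (a ⨯₃ (a ⨯₃ b)) = len (a ⨯₃ b) := by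
  rw [len, len, cross_dot_cross, ha, dot_self_cross, one_mul, zero_mul, sub_zero]

section Attitude

variable {u b : V3}

/-- The double cross product has the length of the simple one, so the first column is the cross
product of the other two. The single condition `u ⨯₃ b ≠ 0` controls all normalisations, since it
also excludes `u = 0`. -/
theorem attitude_eq (h : u ⨯₃ b ≠ 0) : attitude u b =
    (Matrix.of ![((len (u ⨯₃ b))⁻¹ • (u ⨯₃ b)) ⨯₃ ((len u)⁻¹ • u),
      (len (u ⨯₃ b))⁻¹ • (u ⨯₃ b), (len u)⁻¹ • u])ᵀ := by
  have hu : u ≠ 0 := fun h0 => h (by simp [h0])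
  have hl := len_pos.2 hu
  have hb := len_pos.2 h
  have ha : ((len u)⁻¹ • u) ⬝ᵥ ((len u)⁻¹ • u) = 1 := by
    simp only [smul_dotProduct, dotProduct_smul, smul_eq_mul, ← len_sq]; field_simp
  have hc : (len (((len u)⁻¹ • u) ⨯₃ b))⁻¹ • (((len u)⁻¹ • u) ⨯₃ b) =
      (len (u ⨯₃ b))⁻¹ • (u ⨯₃ b) := by
    rw [cross_smul_left, len_smul, abs_of_pos (inv_pos.2 hl), smul_smul]
    congr 1
    field_simp
  have hlen : len (((len u)⁻¹ • u) ⨯₃ (((len u)⁻¹ • u) ⨯₃ b)) =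
      len (((len u)⁻¹ • u) ⨯₃ b) := len_cross_cross ha b
  simp only [attitude, hlen, hc]
  rw [← hc, ← cross_anticomm ((len u)⁻¹ • u), cross_smul_right]

theorem attitude_mem (h : u ⨯₃ b ≠ 0) : attitude u b ∈ SO3 := by
  have hu : u ≠ 0 := fun h0 => h (by simp [h0])
  have hl := len_pos.2 hu
  have hb := len_pos.2 h
  rw [attitude_eq h]
  refine frame_mem_SO3 ?_ ?_ ?_
  · simp only [smul_dotProduct, dotProduct_smul, smul_eq_mul]; rw [← len_sq]; field_simp
  · simp only [smul_dotProduct, dotProduct_smul, smul_eq_mul]; rw [← len_sq]; field_simp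
  · simp only [smul_dotProduct, dotProduct_smul, smul_eq_mul, cross_dot_left, mul_zero]

theorem attitude_e3 (h : u ⨯₃ b ≠ 0) : u = len u • (attitude u b *ᵥ e3) := by
  have hu : u ≠ 0 := fun h0 => h (by simp [h0])
  have hl := (len_pos.2 hu).ne'
  have h1 : attitude u b *ᵥ e3 = (len u)⁻¹ • u := by
    funext i
    simp [attitude, e3, Matrix.mulVec, dotProduct, Fin.sum_univ_three]
  rw [h1, smul_smul, mul_inv_cancel₀ hl, one_smul]

theorem contDiffAt_attitude {F : Type*} [NormedAddCommGroup F] [NormedSpace ℝ F] {f g : F → V3}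
    {x : F} (hf : ContDiffAt ℝ ∞ f x) (hg : ContDiffAt ℝ ∞ g x) (h : f x ⨯₃ g x ≠ 0)
    (i j : Fin 3) : ContDiffAt ℝ ∞ (fun y => attitude (f y) (g y) i j) x := by
  have hu : f x ≠ 0 := fun h0 => h (by simp [h0])
  have h1 := hf.cross hg
  have h2 := (h1.len h).inv (len_pos.2 h).ne'
  have h3 := (hf.len hu).inv (len_pos.2 hu).ne'
  have hev : (fun y => attitude (f y) (g y) i j) =ᶠ[nhds x] fun y =>
      ![((len (f y ⨯₃ g y))⁻¹ • (f y ⨯₃ g y)) ⨯₃ ((len (f y))⁻¹ • f y),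
        (len (f y ⨯₃ g y))⁻¹ • (f y ⨯₃ g y), (len (f y))⁻¹ • f y] j i := by
    filter_upwards [h1.continuousAt.eventually_ne h] with y hy
    rw [attitude_eq hy]
    rfl
  refine ContDiffAt.congr_of_eventuallyEq ?_ hev
  have c2 := h2.smul h1
  have c3 := h3.smul hf
  fin_cases j
  · exact contDiffAt_pi.1 (c2.cross c3) i
  · exact contDiffAt_pi.1 c2 i
  · exact contDiffAt_pi.1 c3 i

end Attitude

/-! ### Lyapunov function of the attitudes -/

/-- Extrema over the unit sphere and homogeneity; the upper constant is increased by one only to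
make it visibly positive. -/
theorem exists_inertia_bounds {J : M3} (hJ : J.PosDef) : ∃ j₁ j₂ : ℝ, 0 < j₁ ∧ 0 < j₂ ∧
    ∀ v : V3, j₁ * len v ^ 2 ≤ v ⬝ᵥ (J *ᵥ v) ∧ len (J *ᵥ v) ≤ j₂ * len v := by
  have hpos : ∀ v : V3, v ≠ 0 → 0 < v ⬝ᵥ (J *ᵥ v) := fun v hv => by
    simpa using hJ.dotProduct_mulVec_pos hv
  have hcomp : IsCompact {v : V3 | len v = 1} := by
    refine (isCompact_closedBall (0 : V3) 1).of_isClosed_subset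
      (isClosed_eq continuous_len continuous_const) fun v hv => ?_
    rw [mem_closedBall_zero_iff]
    exact (norm_le_len v).trans (le_of_eq hv)
  have hne : {v : V3 | len v = 1}.Nonempty :=
    ⟨e3, len_eq_one (by simp [e3, dotProduct, Fin.sum_univ_three])⟩
  have hJc : Continuous fun v : V3 => J *ᵥ v := continuous_const.matrix_mulVec continuous_id
  obtain ⟨v₁, hv₁, h₁⟩ := hcomp.exists_isMinOn hne
    (f := fun v : V3 => v ⬝ᵥ (J *ᵥ v)) (by fun_prop)
  obtain ⟨v₂, hv₂, h₂⟩ := hcomp.exists_isMaxOn hne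
    (f := fun v : V3 => len (J *ᵥ v)) (continuous_len.comp hJc).continuousOn
  have hv₁0 : v₁ ≠ 0 := len_pos.1 (by rw [hv₁]; exact one_pos)
  refine ⟨v₁ ⬝ᵥ (J *ᵥ v₁), len (J *ᵥ v₂) + 1, hpos v₁ hv₁0,
    by linarith [len_nonneg (J *ᵥ v₂)], fun v => ?_⟩
  by_cases hv : v = 0
  · subst hv; simp
  have hl := len_pos.2 hv
  have hmem : (len v)⁻¹ • v ∈ {v : V3 | len v = 1} := by
    rw [Set.mem_ofPred_eq, len_smul, abs_of_pos (inv_pos.2 hl), inv_mul_cancel₀ hl.ne']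
  have a1 : v₁ ⬝ᵥ (J *ᵥ v₁) ≤ ((len v)⁻¹ • v) ⬝ᵥ (J *ᵥ ((len v)⁻¹ • v)) := h₁ hmem
  have a2 : len (J *ᵥ ((len v)⁻¹ • v)) ≤ len (J *ᵥ v₂) := h₂ hmem
  rw [Matrix.mulVec_smul] at a1 a2
  rw [len_smul, abs_of_pos (inv_pos.2 hl)] at a2
  simp only [smul_dotProduct, dotProduct_smul, smul_eq_mul] at a1
  constructor
  · have := mul_le_mul_of_nonneg_right a1 (sq_nonneg (len v))
    have e : (len v)⁻¹ * ((len v)⁻¹ * v ⬝ᵥ (J *ᵥ v)) * len v ^ 2 = v ⬝ᵥ (J *ᵥ v) := by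
      field_simp
    linarith
  · have := mul_le_mul_of_nonneg_right a2 hl.le
    have e : (len v)⁻¹ * len (J *ᵥ v) * len v = len (J *ᵥ v) := by field_simp
    nlinarith

theorem _root_.HasDerivWithinAt.mulVec_const (J : M3) {η : ℝ → V3} {η' : V3} {s : Set ℝ} {t : ℝ}
    (h : HasDerivWithinAt η η' s t) : HasDerivWithinAt (fun τ => J *ᵥ η τ) (J *ᵥ η') s t :=
  ((Matrix.mulVecLin J).toContinuousLinearMap.hasFDerivAt).comp_hasDerivWithinAt t h

/-- Lyapunov function of a relative rotation `E` with angular velocity error `η`. -/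
def rotV (J : M3) (k c : ℝ) (E : M3) (η : V3) : ℝ :=
  1 / 2 * (η ⬝ᵥ (J *ᵥ η)) + k * rotConfig E + c * (rotErr E ⬝ᵥ (J *ᵥ η))

theorem hasDerivWithinAt_rotErr {E : ℝ → M3} {η : V3} {s : Set ℝ} {t : ℝ}
    (dE : ∀ a b, HasDerivWithinAt (fun τ => E τ a b) ((E t * hat η) a b) s t) :
    HasDerivWithinAt (fun τ => rotErr (E τ))
      ((1 / 2 : ℝ) • ((E t).trace • η - (E t)ᵀ *ᵥ η)) s t := by
  refine hasDerivWithinAt_pi.2 fun i => ?_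
  have h := fun a b => ((dE a b).sub (dE b a)).const_mul (1 / 2 : ℝ)
  fin_cases i
  · refine (h 2 1).congr_deriv ?_
    simp [Matrix.mul_apply, hat, Fin.sum_univ_three, Matrix.trace, Matrix.mulVec, dotProduct]
    ring
  · refine (h 0 2).congr_deriv ?_
    simp [Matrix.mul_apply, hat, Fin.sum_univ_three, Matrix.trace, Matrix.mulVec, dotProduct]
    ring
  · refine (h 1 0).congr_deriv ?_
    simp [Matrix.mul_apply, hat, Fin.sum_univ_three, Matrix.trace, Matrix.mulVec, dotProduct]
    ring

/-- The configuration error is a potential for the attitude error: its derivative, multiplied by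
`k₁`, cancels the power of the proportional moment. -/
theorem hasDerivWithinAt_rotConfig {E : ℝ → M3} {η : V3} {s : Set ℝ} {t : ℝ}
    (dE : ∀ a b, HasDerivWithinAt (fun τ => E τ a b) ((E t * hat η) a b) s t) :
    HasDerivWithinAt (fun τ => rotConfig (E τ)) (rotErr (E t) ⬝ᵥ η) s t := by
  have h := ((((dE 0 0).add (dE 1 1)).add (dE 2 2)).const_sub 3).const_mul (1 / 2 : ℝ)
  simp only [rotConfig_eq]
  refine h.congr_deriv ?_
  simp [Matrix.mul_apply, hat, Fin.sum_univ_three, rotErr, vee, dotProduct]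
  ring

/-- The trace is at most three in absolute value and `Eᵀ` is an isometry, giving `(3 + 1) / 2`. -/
theorem SO3.len_rotErr_deriv {E : M3} (h : E ∈ SO3) (η : V3) :
    len ((1 / 2 : ℝ) • (E.trace • η - Eᵀ *ᵥ η)) ≤ 2 * len η := by
  have h1 : |E.trace| ≤ 3 := by
    have a0 := abs_le.1 (SO3.abs_le_one h 0 0)
    have a1 := abs_le.1 (SO3.abs_le_one h 1 1)
    have a2 := abs_le.1 (SO3.abs_le_one h 2 2)
    simp only [Matrix.trace, Matrix.diag, Fin.sum_univ_three]
    exact abs_le.2 ⟨by linarith, by linarith⟩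
  have h2 := len_sub_le (E.trace • η) (Eᵀ *ᵥ η)
  rw [SO3.len_mulVec (SO3.transpose_mem h), len_smul] at h2
  rw [len_smul, abs_of_pos (by norm_num : (0 : ℝ) < 1 / 2)]
  nlinarith [len_nonneg η]

theorem hasDerivWithinAt_rotV {J : M3} (hJ : J.PosDef) {j₂ k₁ k₂ c : ℝ} (hk₂ : 0 ≤ k₂)
    (hc : 0 ≤ c) (hj : ∀ v : V3, len (J *ᵥ v) ≤ j₂ * len v)
    {E : ℝ → M3} {η : ℝ → V3} {η' : V3} {s : Set ℝ} {t : ℝ} (hE : E t ∈ SO3)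
    (dE : ∀ a b, HasDerivWithinAt (fun τ => E τ a b) ((E t * hat (η t)) a b) s t)
    (dη : HasDerivWithinAt η η' s t) (hη' : J *ᵥ η' = -(k₁ • rotErr (E t)) - k₂ • η t) :
    ∃ V', HasDerivWithinAt (fun τ => rotV J k₁ c (E τ) (η τ)) V' s t ∧
      V' ≤ -k₂ * len (η t) ^ 2 + c * (2 * j₂ * len (η t) ^ 2 - k₁ * len (rotErr (E t)) ^ 2
        + k₂ * (len (rotErr (E t)) * len (η t))) := by
  have dJ := dη.mulVec_const J
  have dR := hasDerivWithinAt_rotErr dE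
  refine ⟨_, (((dη.dot dJ).const_mul (1 / 2 : ℝ)).add
    ((hasDerivWithinAt_rotConfig dE).const_mul k₁)).add ((dR.dot dJ).const_mul c), ?_⟩
  have hsym : η' ⬝ᵥ (J *ᵥ η t) = η t ⬝ᵥ (J *ᵥ η') := by
    have hT : J.IsSymm := by simpa using hJ.isHermitian
    rw [dot_mulVec_transpose, hT.eq, dotProduct_comm]
  rw [hsym, hη']
  have h1 : ((1 / 2 : ℝ) • ((E t).trace • η t - (E t)ᵀ *ᵥ η t)) ⬝ᵥ (J *ᵥ η t) ≤
      2 * j₂ * len (η t) ^ 2 := by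
    refine (dot_le _ _).trans ?_
    calc _ ≤ (2 * len (η t)) * (j₂ * len (η t)) :=
          mul_le_mul (SO3.len_rotErr_deriv hE _) (hj _) (len_nonneg _)
            (mul_nonneg zero_le_two (len_nonneg _))
      _ = _ := by ring
  have h2 := neg_dot_le (rotErr (E t)) (η t)
  have h3 := len_sq (η t)
  have h4 := len_sq (rotErr (E t))
  simp only [dotProduct_sub, dotProduct_neg, dotProduct_smul, smul_eq_mul]
  rw [dotProduct_comm (η t) (rotErr (E t)), ← h3, ← h4]
  have h5 : c * (((1 / 2 : ℝ) • ((E t).trace • η t - (E t)ᵀ *ᵥ η t)) ⬝ᵥ (J *ᵥ η t)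
      + (-(k₁ * len (rotErr (E t)) ^ 2) - k₂ * (rotErr (E t) ⬝ᵥ η t))) ≤
      c * (2 * j₂ * len (η t) ^ 2 - k₁ * len (rotErr (E t)) ^ 2
        + k₂ * (len (rotErr (E t)) * len (η t))) := by
    refine mul_le_mul_of_nonneg_left ?_ hc
    have := mul_le_mul_of_nonneg_left h2 hk₂
    linarith
  linarith

/-- The Lyapunov function of the attitudes is comparable with the squared errors and decays. -/
theorem exists_rotV_const {J : M3} (hJ : J.PosDef) {k₁ k₂ : ℝ} (hk₁ : 0 < k₁) (hk₂ : 0 < k₂) :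
    ∃ c a b d : ℝ, 0 ≤ c ∧ 0 < a ∧ 0 < b ∧ 0 < d ∧
      (∀ (E : M3) (η : V3), E ∈ SO3 → rotConfig E ≤ 1 →
        a * (len (rotErr E) ^ 2 + len η ^ 2) ≤ rotV J k₁ c E η ∧
        rotV J k₁ c E η ≤ b * (len (rotErr E) ^ 2 + len η ^ 2)) ∧
      ∀ (E : ℝ → M3) (η : ℝ → V3) (η' : V3) (s : Set ℝ) (t : ℝ), E t ∈ SO3 →
        (∀ a b, HasDerivWithinAt (fun τ => E τ a b) ((E t * hat (η t)) a b) s t) →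
        HasDerivWithinAt η η' s t → J *ᵥ η' = -(k₁ • rotErr (E t)) - k₂ • η t →
        ∃ V', HasDerivWithinAt (fun τ => rotV J k₁ c (E τ) (η τ)) V' s t ∧
          V' ≤ -d * (len (rotErr (E t)) ^ 2 + len (η t) ^ 2) := by
  obtain ⟨j₁, j₂, hj₁, hj₂, hj⟩ := exists_inertia_bounds hJ
  set m := min j₁ k₁ with hm
  have hm0 : 0 < m := lt_min hj₁ hk₁
  -- `M` is the coefficient of `|η|²` produced by the cross term once Young's inequality has moved
  -- half of `k₁ |e_R|²` against the mixed product.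
  set M := 2 * j₂ + k₂ ^ 2 / (2 * k₁) with hM
  have hM0 : 0 < M := by positivity
  -- The first bound keeps half of the damping `k₂ |η|²`; the second keeps the Lyapunov function
  -- positive definite in spite of its cross term.
  set c := min (k₂ / (2 * M)) (m / (2 * j₂)) with hc
  have hc0 : 0 < c := lt_min (by positivity) (by positivity)
  have hc1 : c * M ≤ k₂ / 2 := by
    have : c ≤ k₂ / (2 * M) := min_le_left _ _
    calc c * M ≤ k₂ / (2 * M) * M := mul_le_mul_of_nonneg_right this hM0.le
      _ = k₂ / 2 := by field_simp
  have hc2 : c * j₂ ≤ m / 2 := by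
    have : c ≤ m / (2 * j₂) := min_le_right _ _
    calc c * j₂ ≤ m / (2 * j₂) * j₂ := mul_le_mul_of_nonneg_right this hj₂.le
      _ = m / 2 := by field_simp
  have hmj : m ≤ j₁ := min_le_left _ _
  have hmk : m ≤ k₁ := min_le_right _ _
  refine ⟨c, m / 4, j₂ / 2 + k₁ + m / 4, min (c * k₁ / 2) (k₂ / 2), hc0.le, by positivity,
    by positivity, by positivity, ?_, ?_⟩
  · intro E η hE hE1
    obtain ⟨b1, b2⟩ := hj η
    have q0 := len_nonneg (rotErr E)
    have w0 := len_nonneg η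
    have b3 := SO3.le_rotConfig hE
    have b4 := SO3.rotConfig_le hE hE1
    have b5 : |rotErr E ⬝ᵥ (J *ᵥ η)| ≤ len (rotErr E) * (j₂ * len η) :=
      (abs_dot_le _ _).trans (mul_le_mul_of_nonneg_left b2 q0)
    have b6 : c * |rotErr E ⬝ᵥ (J *ᵥ η)| ≤ m / 4 * (len (rotErr E) ^ 2 + len η ^ 2) := by
      calc c * |rotErr E ⬝ᵥ (J *ᵥ η)| ≤ c * (len (rotErr E) * (j₂ * len η)) :=
            mul_le_mul_of_nonneg_left b5 hc0.le
        _ = (c * j₂) * (len (rotErr E) * len η) := by ring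
        _ ≤ m / 2 * (len (rotErr E) * len η) := mul_le_mul_of_nonneg_right hc2 (by positivity)
        _ ≤ _ := by nlinarith [sq_nonneg (len (rotErr E) - len η)]
    have b7 := abs_le.1 (le_refl |rotErr E ⬝ᵥ (J *ᵥ η)|)
    have b8 : η ⬝ᵥ (J *ᵥ η) ≤ j₂ * len η ^ 2 := by
      refine (dot_le _ _).trans ?_
      nlinarith
    have b9 := mul_le_mul_of_nonneg_left b7.1 hc0.le
    have b10 := mul_le_mul_of_nonneg_left b7.2 hc0.le
    have b11 := mul_le_mul_of_nonneg_left b3 hk₁.le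
    have b12 := mul_le_mul_of_nonneg_left b4 hk₁.le
    have b13 := mul_le_mul_of_nonneg_right hmj (sq_nonneg (len η))
    have b14 := mul_le_mul_of_nonneg_right hmk (sq_nonneg (len (rotErr E)))
    rw [rotV]
    constructor
    · linarith
    · have := mul_nonneg hj₂.le (sq_nonneg (len (rotErr E)))
      have := mul_nonneg hk₁.le (sq_nonneg (len η))
      linarith
  · intro E η η' s t hE dE dη hη'
    obtain ⟨V', hV', hle⟩ := hasDerivWithinAt_rotV hJ hk₂.le hc0.le (fun v => (hj v).2) hE dE dη hη'
    refine ⟨V', hV', hle.trans ?_⟩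
    generalize len (rotErr (E t)) = Q
    generalize len (η t) = W
    have h1 : k₂ * (Q * W) ≤ k₁ / 2 * Q ^ 2 + k₂ ^ 2 / (2 * k₁) * W ^ 2 := by
      have : k₁ / 2 * Q ^ 2 + k₂ ^ 2 / (2 * k₁) * W ^ 2 - k₂ * (Q * W) =
          (k₁ * Q - k₂ * W) ^ 2 / (2 * k₁) := by field_simp; ring
      have h2 : 0 ≤ (k₁ * Q - k₂ * W) ^ 2 / (2 * k₁) := by positivity
      linarith
    have h2 : c * (2 * j₂ * W ^ 2 - k₁ * Q ^ 2 + k₂ * (Q * W)) ≤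
        c * (M * W ^ 2 - k₁ / 2 * Q ^ 2) := by
      refine mul_le_mul_of_nonneg_left ?_ hc0.le
      rw [hM]; linarith
    have h3 := mul_le_mul_of_nonneg_right hc1 (sq_nonneg W)
    have h4 := mul_le_mul_of_nonneg_right (min_le_left (c * k₁ / 2) (k₂ / 2)) (sq_nonneg Q)
    have h5 := mul_le_mul_of_nonneg_right (min_le_right (c * k₁ / 2) (k₂ / 2)) (sq_nonneg W)
    linarith

/-! ### Solving the equations of motion for the accelerations

The tension excess `ν j` of cable `j` over the designed one solves a linear system whose matrix is
the identity plus a Gram matrix. -/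

section Mechanics

variable (P : Params)

/-- The entry `(i, j)` is the acceleration along `qc i` of the end of the rod at cable `i` caused by
a unit excess of tension in cable `j` (`dot_excessA`). The two summands come from translation and
rotation of the rod. -/
def gram (qr : V3) (qc : Cables) (i j : Fin 2) : ℝ :=
  1 / P.mr * (qc i ⬝ᵥ qc j)
    + 3 / (2 * P.mr) * (sgn i * sgn j) * ((qr ⨯₃ qc i) ⬝ᵥ (qr ⨯₃ qc j))

def sysM (qr : V3) (qc : Cables) (i j : Fin 2) : ℝ :=
  (if i = j then 1 else 0) + P.mQ * gram P qr qc i j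

def sysDet (qr : V3) (qc : Cables) : ℝ :=
  sysM P qr qc 0 0 * sysM P qr qc 1 1 - sysM P qr qc 0 1 * sysM P qr qc 0 1

/-- Tension excesses caused by force deviations with components `δ j` along the cables. -/
def excess (qr : V3) (qc : Cables) (δ : Fin 2 → ℝ) : Fin 2 → ℝ :=
  ![(sysM P qr qc 1 1 * δ 0 - sysM P qr qc 0 1 * δ 1) * (sysDet P qr qc)⁻¹,
    (sysM P qr qc 0 0 * δ 1 - sysM P qr qc 0 1 * δ 0) * (sysDet P qr qc)⁻¹]

/-- Change of the acceleration of the rod due to tension excesses. -/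
def excessV (qc : Cables) (ν : Fin 2 → ℝ) : V3 := (1 / P.mr) • (ν 0 • qc 0 + ν 1 • qc 1)

/-- Change of the angular acceleration of the rod due to tension excesses. -/
def excessW (qr : V3) (qc : Cables) (ν : Fin 2 → ℝ) : V3 :=
  (1 / (2 / 3 * P.mr * P.Lr)) • (qr ⨯₃ (ν 1 • qc 1 - ν 0 • qc 0))

/-- Change of the acceleration of the end of the rod due to tension excesses. -/
def excessA (qr : V3) (qc : Cables) (ν : Fin 2 → ℝ) (j : Fin 2) : V3 :=
  excessV P qc ν + (sgn j * P.Lr) • (excessW P qr qc ν ⨯₃ qr)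

variable {P} {qr : V3} {qc : Cables}

theorem gram_comm (i j : Fin 2) : gram P qr qc i j = gram P qr qc j i := by
  rw [gram, gram, dotProduct_comm (qc i), dotProduct_comm (qr ⨯₃ qc i), mul_comm (sgn i)]

/-- The form is a positive combination of `|x q₀ + y q₁|²` and `|x (qr ⨯₃ q₀) - y (qr ⨯₃ q₁)|²`; the
minus sign reflects the opposite ends of the rod. -/
theorem gram_quad_nonneg (x y : ℝ) :
    0 ≤ x ^ 2 * gram P qr qc 0 0 + 2 * x * y * gram P qr qc 0 1 + y ^ 2 * gram P qr qc 1 1 := by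
  have h1 := dot_self_nonneg (x • qc 0 + y • qc 1)
  have h2 := dot_self_nonneg (x • (qr ⨯₃ qc 0) - y • (qr ⨯₃ qc 1))
  simp only [dotProduct_add, add_dotProduct, dotProduct_sub, sub_dotProduct, smul_dotProduct,
    dotProduct_smul, smul_eq_mul] at h1 h2
  rw [dotProduct_comm (qc 1) (qc 0)] at h1
  rw [dotProduct_comm (qr ⨯₃ qc 1) (qr ⨯₃ qc 0)] at h2
  have h3 := P.mr_pos
  have h4 := mul_nonneg (one_div_pos.2 h3).le h1
  have h5 := mul_nonneg (div_pos (by norm_num : (0 : ℝ) < 3) (mul_pos two_pos h3)).le h2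
  simp only [gram, sgn_zero, sgn_one]
  linarith

theorem sysDet_pos : 0 < sysDet P qr qc := by
  have hq := fun x y => mul_nonneg P.mQ_pos.le (gram_quad_nonneg (P := P) (qr := qr) (qc := qc) x y)
  have h11 : 1 ≤ sysM P qr qc 1 1 := by
    have := hq 0 1
    simp only [sysM, if_true]
    linarith
  -- At this vector the quadratic form equals `M₁₁ det - M₁₁² - M₀₁²`, where `M` is the system
  -- matrix. So the determinant inherits the sign of `M₁₁ ≥ 1`.
  have h := hq (sysM P qr qc 1 1) (-sysM P qr qc 0 1)
  have e00 : P.mQ * gram P qr qc 0 0 = sysM P qr qc 0 0 - 1 := by simp [sysM]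
  have e01 : P.mQ * gram P qr qc 0 1 = sysM P qr qc 0 1 := by simp [sysM]
  have e11 : P.mQ * gram P qr qc 1 1 = sysM P qr qc 1 1 - 1 := by simp [sysM]
  have h' : 0 ≤ sysM P qr qc 1 1 ^ 2 * (P.mQ * gram P qr qc 0 0)
      + 2 * sysM P qr qc 1 1 * -sysM P qr qc 0 1 * (P.mQ * gram P qr qc 0 1)
      + (-sysM P qr qc 0 1) ^ 2 * (P.mQ * gram P qr qc 1 1) := by linarith
  rw [e00, e01, e11] at h'
  have h2 : 0 < sysM P qr qc 1 1 * sysDet P qr qc := by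
    rw [sysDet]
    nlinarith [sq_nonneg (sysM P qr qc 0 1)]
  exact pos_of_mul_pos_right h2 (by linarith)

theorem excess_iff (δ ν : Fin 2 → ℝ) : ν = excess P qr qc δ ↔
    ∀ j, ν j + P.mQ * (gram P qr qc j 0 * ν 0 + gram P qr qc j 1 * ν 1) = δ j := by
  have hd := (sysDet_pos (P := P) (qr := qr) (qc := qc)).ne'
  have e00 : P.mQ * gram P qr qc 0 0 = sysM P qr qc 0 0 - 1 := by simp [sysM]
  have e01 : P.mQ * gram P qr qc 0 1 = sysM P qr qc 0 1 := by simp [sysM]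
  have e11 : P.mQ * gram P qr qc 1 1 = sysM P qr qc 1 1 - 1 := by simp [sysM]
  have key : (∀ j, ν j + P.mQ * (gram P qr qc j 0 * ν 0 + gram P qr qc j 1 * ν 1) = δ j) ↔
      sysM P qr qc 0 0 * ν 0 + sysM P qr qc 0 1 * ν 1 = δ 0 ∧
      sysM P qr qc 0 1 * ν 0 + sysM P qr qc 1 1 * ν 1 = δ 1 := by
    rw [Fin.forall_fin_two, gram_comm 1 0]
    constructor
    · rintro ⟨h0, h1⟩
      exact ⟨by linear_combination h0 - ν 0 * e00 - ν 1 * e01,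
        by linear_combination h1 - ν 0 * e01 - ν 1 * e11⟩
    · rintro ⟨h0, h1⟩
      exact ⟨by linear_combination h0 + ν 0 * e00 + ν 1 * e01,
        by linear_combination h1 + ν 0 * e01 + ν 1 * e11⟩
  rw [key]
  constructor
  · rintro rfl
    simp only [excess, Matrix.cons_val_zero, Matrix.cons_val_one]
    constructor
    · rw [← mul_assoc, ← mul_assoc, ← add_mul, mul_inv_eq_iff_eq_mul₀ hd, sysDet]; ring
    · rw [← mul_assoc, ← mul_assoc, ← add_mul, mul_inv_eq_iff_eq_mul₀ hd, sysDet]; ring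
  · rintro ⟨h0, h1⟩
    funext j
    fin_cases j
    · simp only [excess, Fin.zero_eta, Matrix.cons_val_zero]
      rw [eq_mul_inv_iff_mul_eq₀ hd, sysDet, ← h0, ← h1]; ring
    · change ν 1 = (sysM P qr qc 0 0 * δ 1 - sysM P qr qc 0 1 * δ 0) * (sysDet P qr qc)⁻¹
      rw [eq_mul_inv_iff_mul_eq₀ hd, sysDet, ← h0, ← h1]; ring

/-- Pairing the system with its solution and dropping the nonnegative Gram part gives `|ν|² ≤ ν ⬝
δ`, hence `|ν| ≤ |δ|`. The bound does not depend on the configuration or on the parameters. -/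
theorem abs_excess_le (δ : Fin 2 → ℝ) (j : Fin 2) : |excess P qr qc δ j| ≤ |δ 0| + |δ 1| := by
  set ν := excess P qr qc δ with hν
  have h := (excess_iff δ ν).1 hν
  have h0 := h 0
  have h1 := h 1
  rw [gram_comm 1 0] at h1
  have hq := mul_nonneg P.mQ_pos.le
    (gram_quad_nonneg (P := P) (qr := qr) (qc := qc) (ν 0) (ν 1))
  have h2 : ν 0 ^ 2 + ν 1 ^ 2 ≤ ν 0 * δ 0 + ν 1 * δ 1 := by
    rw [← h0, ← h1]; nlinarith
  have h3 : ν 0 ^ 2 + ν 1 ^ 2 ≤ δ 0 ^ 2 + δ 1 ^ 2 := by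
    nlinarith [sq_nonneg (ν 0 - δ 0), sq_nonneg (ν 1 - δ 1)]
  have h4 : ν j ^ 2 ≤ (|δ 0| + |δ 1|) ^ 2 := by
    have : ν j ^ 2 ≤ ν 0 ^ 2 + ν 1 ^ 2 := by
      fin_cases j
      · simp [sq_nonneg]
      · simp [sq_nonneg]
    have e0 := sq_abs (δ 0)
    have e1 := sq_abs (δ 1)
    have := mul_nonneg (abs_nonneg (δ 0)) (abs_nonneg (δ 1))
    nlinarith
  exact abs_le_of_sq_le_sq h4 (by positivity)

theorem dot_excessA (ν : Fin 2 → ℝ) (j : Fin 2) :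
    qc j ⬝ᵥ excessA P qr qc ν j = gram P qr qc j 0 * ν 0 + gram P qr qc j 1 * ν 1 := by
  have h1 := P.mr_pos.ne'
  have h2 := P.Lr_pos.ne'
  have hc : ∀ i, qc j ⬝ᵥ ((qr ⨯₃ qc i) ⨯₃ qr) = (qr ⨯₃ qc j) ⬝ᵥ (qr ⨯₃ qc i) := fun i => by
    rw [triple_product_permutation, dotProduct_comm]
  simp only [excessA, excessV, excessW, cross_sub_right, cross_smul_right, cross_smul_left,
    cross_sub_left, dotProduct_add, dotProduct_sub, dotProduct_smul, smul_eq_mul, hc, gram,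
    sgn_zero, sgn_one]
  field_simp
  ring

/-- Acceleration of a cable direction in terms of the tension. -/
theorem cable_acc {P : Params} {q w w' a T : V3} (hq : q ⬝ᵥ q = 1) (hw : w ⬝ᵥ q = 0)
    (h : (P.mQ * P.Lc) • w' = P.mQ • (q ⨯₃ a) - q ⨯₃ T) :
    (P.mQ * P.Lc) • (w' ⨯₃ q + w ⨯₃ (w ⨯₃ q)) = P.mQ • a - T
      + (q ⬝ᵥ T - P.mQ * (q ⬝ᵥ a) - P.mQ * P.Lc * (w ⬝ᵥ w)) • q := by
  have h1 : (P.mQ * P.Lc) • (w' ⨯₃ q) = P.mQ • (a - (q ⬝ᵥ a) • q) - (T - (q ⬝ᵥ T) • q) := by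
    rw [← cross_smul_left, h, cross_sub_left, cross_smul_left, cross_cross_left, cross_cross_left,
      hq, one_smul, one_smul, dotProduct_comm a, dotProduct_comm T]
  rw [smul_add, h1, cross_cross_right, hw]
  module

/-- Data of the rod and the cables at one instant: attitudes, angular velocities, designed
accelerations, designed tensions `lam` and forces `u`. -/
structure DesignData (P : Params) where
  qr : V3
  wr : V3
  qc : Cables
  wc : Cables
  acc : V3
  accW : V3
  lam : Fin 2 → ℝ
  u : Cables
  qr_unit : qr ⬝ᵥ qr = 1
  wr_dot : wr ⬝ᵥ qr = 0
  qc_unit : ∀ j, qc j ⬝ᵥ qc j = 1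
  wc_dot : ∀ j, wc j ⬝ᵥ qc j = 0
  acc_eq : acc = (1 / P.mr) • (lam 0 • qc 0 + lam 1 • qc 1) - P.g • e3
  accW_eq : accW = (1 / (2 / 3 * P.mr * P.Lr)) • (qr ⨯₃ (lam 1 • qc 1 - lam 0 • qc 0))
  u_dot : ∀ j, qc j ⬝ᵥ u j = lam j + P.mQ * (qc j ⬝ᵥ
    (acc + (sgn j * P.Lr) • (accW ⨯₃ qr + wr ⨯₃ (wr ⨯₃ qr)) + P.g • e3)
      + P.Lc * (wc j ⬝ᵥ wc j))

namespace DesignData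

variable (X : DesignData P) (T : Cables)

/-- Designed acceleration (plus gravity) of the end of the rod. -/
def endAcc (j : Fin 2) : V3 :=
  X.acc + (sgn j * P.Lr) • (X.accW ⨯₃ X.qr + X.wr ⨯₃ (X.wr ⨯₃ X.qr)) + P.g • e3

/-- Tension excesses under the forces `T`. -/
def nu : Fin 2 → ℝ := excess P X.qr X.qc fun j => X.qc j ⬝ᵥ (T j - X.u j)

def ImplicitEq (v' wr' : V3) (wc' : Cables) : Prop :=
  P.mEff • (v' + P.g • e3) = T 0 + T 1 + (P.mQ * P.Lc) •
    ((wc' 0 ⨯₃ X.qc 0 + X.wc 0 ⨯₃ (X.wc 0 ⨯₃ X.qc 0))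
      + (wc' 1 ⨯₃ X.qc 1 + X.wc 1 ⨯₃ (X.wc 1 ⨯₃ X.qc 1))) ∧
  P.IEff • wr' = X.qr ⨯₃ (T 1 - T 0 + (P.mQ * P.Lc) •
    ((wc' 1 ⨯₃ X.qc 1 + X.wc 1 ⨯₃ (X.wc 1 ⨯₃ X.qc 1))
      - (wc' 0 ⨯₃ X.qc 0 + X.wc 0 ⨯₃ (X.wc 0 ⨯₃ X.qc 0)))) ∧
  ∀ j, (P.mQ * P.Lc) • wc' j = P.mQ • (X.qc j ⨯₃
    (v' + (sgn j * P.Lr) • (wr' ⨯₃ X.qr + X.wr ⨯₃ (X.wr ⨯₃ X.qr)) + P.g • e3)) - X.qc j ⨯₃ T j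

def ExplicitEq (v' wr' : V3) (wc' : Cables) : Prop :=
  v' = X.acc + excessV P X.qc (X.nu T) ∧
  wr' = X.accW + excessW P X.qr X.qc (X.nu T) ∧
  ∀ j, wc' j = (1 / P.Lc) • (X.qc j ⨯₃ (X.endAcc j + excessA P X.qr X.qc (X.nu T) j))
    - (1 / (P.mQ * P.Lc)) • (X.qc j ⨯₃ T j)

variable {X T} {v' wr' : V3} {wc' : Cables}

theorem wc'_iff {a : V3} (j : Fin 2) : (P.mQ * P.Lc) • wc' j =
    P.mQ • (X.qc j ⨯₃ a) - X.qc j ⨯₃ T j ↔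
    wc' j = (1 / P.Lc) • (X.qc j ⨯₃ a) - (1 / (P.mQ * P.Lc)) • (X.qc j ⨯₃ T j) := by
  have h1 := P.mQ_pos.ne'
  have h2 := P.Lc_pos.ne'
  constructor
  · intro h
    have h3 : wc' j = (1 / (P.mQ * P.Lc)) • (P.mQ * P.Lc) • wc' j := by
      rw [smul_smul, one_div, inv_mul_cancel₀ (mul_ne_zero h1 h2), one_smul]
    rw [h3, h, smul_sub, smul_smul]
    congr 2
    field_simp
  · intro h
    rw [h, smul_sub, smul_smul, smul_smul]
    congr 1
    · congr 1; field_simp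
    · rw [mul_one_div_cancel (mul_ne_zero h1 h2), one_smul]

/-- With the cable equations, the rod equations are those of a rod pulled by the tensions. -/
theorem rod_iff (hwr : X.qr ⬝ᵥ wr' = 0) {a : Cables} {lam : Fin 2 → ℝ}
    (ha : ∀ j, a j = v' + (sgn j * P.Lr) • (wr' ⨯₃ X.qr + X.wr ⨯₃ (X.wr ⨯₃ X.qr)) + P.g • e3)
    (hacc : ∀ j, (P.mQ * P.Lc) • (wc' j ⨯₃ X.qc j + X.wc j ⨯₃ (X.wc j ⨯₃ X.qc j)) =
      P.mQ • a j - T j + lam j • X.qc j) :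
    (P.mEff • (v' + P.g • e3) = T 0 + T 1 + (P.mQ * P.Lc) •
      ((wc' 0 ⨯₃ X.qc 0 + X.wc 0 ⨯₃ (X.wc 0 ⨯₃ X.qc 0))
        + (wc' 1 ⨯₃ X.qc 1 + X.wc 1 ⨯₃ (X.wc 1 ⨯₃ X.qc 1))) ↔
      P.mr • (v' + P.g • e3) = lam 0 • X.qc 0 + lam 1 • X.qc 1) ∧
    (P.IEff • wr' = X.qr ⨯₃ (T 1 - T 0 + (P.mQ * P.Lc) •
      ((wc' 1 ⨯₃ X.qc 1 + X.wc 1 ⨯₃ (X.wc 1 ⨯₃ X.qc 1))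
        - (wc' 0 ⨯₃ X.qc 0 + X.wc 0 ⨯₃ (X.wc 0 ⨯₃ X.qc 0)))) ↔
      (2 / 3 * P.mr * P.Lr) • wr' = X.qr ⨯₃ (lam 1 • X.qc 1 - lam 0 • X.qc 0)) := by
  constructor
  · rw [smul_add (P.mQ * P.Lc), hacc 0, hacc 1, ha 0, ha 1, sgn_zero, sgn_one, Params.mEff,
      ← sub_eq_zero, ← sub_eq_zero (a := P.mr • (v' + P.g • e3))]
    apply Eq.congr_left
    module
  · have hq : X.qr ⨯₃ (wr' ⨯₃ X.qr + X.wr ⨯₃ (X.wr ⨯₃ X.qr)) = wr' := by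
      rw [cross_add_right, cross_cross_right, X.qr_unit, hwr, cross_cross_right X.wr, X.wr_dot]
      simp
    have hs : T 1 - T 0 + (P.mQ * P.Lc) •
      ((wc' 1 ⨯₃ X.qc 1 + X.wc 1 ⨯₃ (X.wc 1 ⨯₃ X.qc 1))
        - (wc' 0 ⨯₃ X.qc 0 + X.wc 0 ⨯₃ (X.wc 0 ⨯₃ X.qc 0))) =
        (2 * P.mQ * P.Lr) • (wr' ⨯₃ X.qr + X.wr ⨯₃ (X.wr ⨯₃ X.qr))
          + (lam 1 • X.qc 1 - lam 0 • X.qc 0) := by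
      rw [smul_sub, hacc 0, hacc 1, ha 0, ha 1, sgn_zero, sgn_one]
      module
    rw [hs, cross_add_right, cross_smul_right, hq, Params.IEff,
      ← sub_eq_zero, ← sub_eq_zero (a := (2 / 3 * P.mr * P.Lr) • wr')]
    apply Eq.congr_left
    module

/-- The cable equations express the true tensions through the accelerations of the ends of the rod,
and the rod equations say that the rod is pulled by these tensions. The accelerations are affine in
the tensions, so comparison with the design leaves a closed linear system for the excesses. One
direction serves the estimate of given motions, the other the construction of motions. -/
theorem implicit_iff_explicit :
    X.ImplicitEq T v' wr' wc' ↔ X.ExplicitEq T v' wr' wc' := by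
  have hmr := P.mr_pos.ne'
  have hI : 2 / 3 * P.mr * P.Lr ≠ 0 := by
    have := P.Lr_pos; have := P.mr_pos; positivity
  constructor
  · rintro ⟨h1, h2, h3⟩
    -- The torque has no component along the rod. This is needed to recover the angular acceleration
    -- from the second derivative of the direction.
    have hwr : X.qr ⬝ᵥ wr' = 0 := by
      have hIE : P.IEff ≠ 0 := by
        have := P.Lr_pos; have := P.mr_pos; have := P.mQ_pos
        rw [Params.IEff]; positivity
      have := congrArg (fun v => X.qr ⬝ᵥ v) h2
      simp only [dotProduct_smul, dot_self_cross, smul_eq_mul] at this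
      exact (mul_eq_zero.1 this).resolve_left hIE
    set a : Cables := fun j => v' + (sgn j * P.Lr) •
      (wr' ⨯₃ X.qr + X.wr ⨯₃ (X.wr ⨯₃ X.qr)) + P.g • e3 with ha
    -- The true tension of cable `j`, read off from the component of the cable motion along the
    -- cable.
    set lam : Fin 2 → ℝ := fun j => X.qc j ⬝ᵥ T j - P.mQ * (X.qc j ⬝ᵥ a j)
      - P.mQ * P.Lc * (X.wc j ⬝ᵥ X.wc j) with hlam
    have hacc : ∀ j, (P.mQ * P.Lc) • (wc' j ⨯₃ X.qc j + X.wc j ⨯₃ (X.wc j ⨯₃ X.qc j)) =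
      P.mQ • a j - T j + lam j • X.qc j := fun j => cable_acc (X.qc_unit j) (X.wc_dot j) (h3 j)
    obtain ⟨r1, r2⟩ := rod_iff hwr (fun j => rfl) hacc
    have e1 := r1.1 h1
    have e2 := r2.1 h2
    set ν : Fin 2 → ℝ := fun j => lam j - X.lam j with hν
    have f1 : v' = X.acc + excessV P X.qc ν := by
      have h4 : v' = (1 / P.mr) • (P.mr • (v' + P.g • e3)) - P.g • e3 := by
        rw [smul_smul, one_div, inv_mul_cancel₀ hmr]; module
      rw [h4, e1, X.acc_eq, excessV, hν]
      module
    have f2 : wr' = X.accW + excessW P X.qr X.qc ν := by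
      have h4 : wr' = (1 / (2 / 3 * P.mr * P.Lr)) • ((2 / 3 * P.mr * P.Lr) • wr') := by
        rw [smul_smul, one_div, inv_mul_cancel₀ hI, one_smul]
      rw [h4, e2, X.accW_eq, excessW, ← smul_add, ← cross_add_right, hν]
      congr 2
      module
    have f3 : ∀ j, a j = X.endAcc j + excessA P X.qr X.qc ν j := fun j => by
      simp only [ha]
      rw [endAcc, excessA, f1, f2, cross_add_left]
      module
    -- The design relation `u_dot` removes the designed tension, gravity and centripetal terms, and
    -- leaves only the deviation of the force along the cable as right-hand side.
    have f4 : ν = X.nu T := by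
      rw [nu, excess_iff]
      intro j
      rw [← dot_excessA]
      have h5 := X.u_dot j
      have h6 : lam j = X.qc j ⬝ᵥ T j - P.mQ * (X.qc j ⬝ᵥ a j)
        - P.mQ * P.Lc * (X.wc j ⬝ᵥ X.wc j) := rfl
      rw [f3 j, dotProduct_add] at h6
      have h7 : X.qc j ⬝ᵥ X.endAcc j = X.qc j ⬝ᵥ
        (X.acc + (sgn j * P.Lr) • (X.accW ⨯₃ X.qr + X.wr ⨯₃ (X.wr ⨯₃ X.qr)) + P.g • e3) := rfl
      rw [dotProduct_sub]
      simp only [hν]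
      linear_combination h6 + h5 - P.mQ * h7
    rw [f4] at f1 f2 f3
    refine ⟨f1, f2, fun j => ?_⟩
    rw [← f3 j]
    exact (wc'_iff j).1 (h3 j)
  · rintro ⟨h1, h2, h3⟩
    have hspec := (excess_iff _ (X.nu T)).1 rfl
    have hwr : X.qr ⬝ᵥ wr' = 0 := by
      rw [h2, X.accW_eq, excessW]
      simp only [dotProduct_add, dotProduct_smul, dot_self_cross, smul_zero, add_zero]
    set a : Cables := fun j => v' + (sgn j * P.Lr) •
      (wr' ⨯₃ X.qr + X.wr ⨯₃ (X.wr ⨯₃ X.qr)) + P.g • e3 with ha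
    have f3 : ∀ j, a j = X.endAcc j + excessA P X.qr X.qc (X.nu T) j := fun j => by
      simp only [ha]
      rw [endAcc, excessA, h1, h2, cross_add_left]
      module
    have h3' : ∀ j, (P.mQ * P.Lc) • wc' j = P.mQ • (X.qc j ⨯₃ a j) - X.qc j ⨯₃ T j := fun j => by
      refine (wc'_iff j).2 ?_
      rw [f3 j]
      exact h3 j
    have hacc : ∀ j, (P.mQ * P.Lc) • (wc' j ⨯₃ X.qc j + X.wc j ⨯₃ (X.wc j ⨯₃ X.qc j)) =
        P.mQ • a j - T j + (X.lam j + X.nu T j) • X.qc j := fun j => by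
      rw [cable_acc (X.qc_unit j) (X.wc_dot j) (h3' j)]
      congr 2
      have h5 := X.u_dot j
      have h6 := hspec j
      rw [← dot_excessA, dotProduct_sub] at h6
      have h7 : X.qc j ⬝ᵥ X.endAcc j = X.qc j ⬝ᵥ
        (X.acc + (sgn j * P.Lr) • (X.accW ⨯₃ X.qr + X.wr ⨯₃ (X.wr ⨯₃ X.qr)) + P.g • e3) := rfl
      rw [f3 j, dotProduct_add]
      linear_combination h5 - h6 - P.mQ * h7
    obtain ⟨r1, r2⟩ := rod_iff (lam := fun j => X.lam j + X.nu T j) hwr (fun j => rfl) hacc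
    refine ⟨r1.2 ?_, r2.2 ?_, h3'⟩
    · rw [h1, X.acc_eq, excessV]
      have e : (1 / P.mr) • (X.lam 0 • X.qc 0 + X.lam 1 • X.qc 1) - P.g • e3
          + (1 / P.mr) • (X.nu T 0 • X.qc 0 + X.nu T 1 • X.qc 1) + P.g • e3 =
          (1 / P.mr) • ((X.lam 0 + X.nu T 0) • X.qc 0 + (X.lam 1 + X.nu T 1) • X.qc 1) := by
        module
      rw [e, smul_smul, mul_one_div_cancel hmr, one_smul]
    · rw [h2, X.accW_eq, excessW, ← smul_add, ← cross_add_right, smul_smul,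
        mul_one_div_cancel hI, one_smul]
      congr 1
      module

end DesignData

end Mechanics

/-! ### The closed loop in relative coordinates -/

/-- States of the closed loop: rod, cables, relative rotations and angular velocity errors of the
quadrotors. -/
abbrev CState := (Rod × Cables × Cables) × (Fin 2 → Fin 3 → V3) × Cables

/-- The relative rotation `R_dᵀ R`. -/
def CState.rot (z : CState) (j : Fin 2) : M3 := Matrix.of (z.2.1 j)

section Field

variable (P : Params) (K : Gains)

/-- The controller is smooth at the argument. -/
def Regular (x : TubeArg) : Prop :=
  ∀ j, jetMuTilde P K j x.1.1.1 x.2.1 ≠ 0 ∧ jetU P K j x.arg ⨯₃ x.1.2 j ≠ 0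

/-- The desired attitude of quadrotor `j`. -/
def rotDes (x : TubeArg) (j : Fin 2) : M3 := attitude (jetU P K j x.arg) (x.1.2 j)

/-- The forces of the quadrotors. -/
def forces (x : TubeArg) (E : Fin 2 → M3) : Cables := fun j =>
  projThrust (jetU P K j x.arg) (rotDes P K x j * E j)

/-- The deviations of the forces of the quadrotors along the cables. -/
def tensionDev (x : TubeArg) (E : Fin 2 → M3) : Fin 2 → ℝ := fun j =>
  x.2.2.1 j ⬝ᵥ (forces P K x E j - jetU P K j x.arg)

/-- The tension excesses. -/
def tensionExc (x : TubeArg) (E : Fin 2 → M3) : Fin 2 → ℝ :=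
  excess P (qR x.2.1) x.2.2.1 (tensionDev P K x E)

/-- Deviation of the rod field from the design field. -/
def rodExc (x : TubeArg) (E : Fin 2 → M3) : Rod :=
  (0, excessV P x.2.2.1 (tensionExc P K x E), 0,
    excessW P (qR x.2.1) x.2.2.1 (tensionExc P K x E))

def rodRate (x : TubeArg) (E : Fin 2 → M3) : Rod :=
  jetRodField P K x.1.1.1 x.2.1 x.2.2.1 + rodExc P K x E

def cableRate (x : TubeArg) : Cables := fun j => x.2.2.2 j ⨯₃ x.2.2.1 j

def cableAcc (x : TubeArg) (E : Fin 2 → M3) : Cables := fun j =>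
  (1 / P.Lc) • (x.2.2.1 j ⨯₃ (jetEndAcc P K j x.arg
      + excessA P (qR x.2.1) x.2.2.1 (tensionExc P K x E) j))
    - (1 / (P.mQ * P.Lc)) • (x.2.2.1 j ⨯₃ forces P K x E j)

/-- The closed loop; `k₁`, `k₂` are the gains of the moments. -/
def loopField (k₁ k₂ : ℝ) (y : Prm × CState) : CState :=
  ((rodRate P K (y.1, y.2.1) y.2.rot, cableRate (y.1, y.2.1),
    cableAcc P K (y.1, y.2.1) y.2.rot),
    fun j => Matrix.of.symm (y.2.rot j * hat (y.2.2.2 j)),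
    fun j => P.J⁻¹ *ᵥ (-(k₁ • rotErr (y.2.rot j)) - k₂ • y.2.2.2 j))

variable {P K}

/-- Cramer's formula with a determinant that is positive everywhere: solving for the accelerations
creates no singularity. -/
theorem contDiffAt_excess {F : Type*} [NormedAddCommGroup F] [NormedSpace ℝ F] {q : F → V3}
    {c : F → Cables} {δ : F → Fin 2 → ℝ} {x : F} (hq : ContDiffAt ℝ ∞ q x)
    (hc : ContDiffAt ℝ ∞ c x) (hδ : ContDiffAt ℝ ∞ δ x) :
    ContDiffAt ℝ ∞ (fun y => excess P (q y) (c y) (δ y)) x := by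
  have hM : ∀ i j, ContDiffAt ℝ ∞ (fun y => sysM P (q y) (c y) i j) x := fun i j => by
    unfold sysM gram; fun_prop
  have hD : ContDiffAt ℝ ∞ (fun y => sysDet P (q y) (c y)) x :=
    ((hM 0 0).mul (hM 1 1)).sub ((hM 0 1).mul (hM 0 1))
  have hI := hD.inv (sysDet_pos (P := P) (qr := q x) (qc := c x)).ne'
  have h0 : ContDiffAt ℝ ∞ (fun y => δ y 0) x := by fun_prop
  have h1 : ContDiffAt ℝ ∞ (fun y => δ y 1) x := by fun_prop
  refine contDiffAt_pi.2 fun j => ?_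
  fin_cases j
  · exact (((hM 1 1).mul h0).sub ((hM 0 1).mul h1)).mul hI
  · exact (((hM 0 0).mul h1).sub ((hM 0 1).mul h0)).mul hI

theorem Regular.contDiffAt_jetU {x : TubeArg} (h : Regular P K x) (j : Fin 2) :
    ContDiffAt ℝ ∞ (fun x : TubeArg => jetU P K j x.arg) x := by
  have h1 : ContDiffAt ℝ ∞ (fun x : TubeArg => x.arg) x := by unfold TubeArg.arg; fun_prop
  exact (RodTransport.contDiffAt_jetU (y := x.arg) j (h j).1).comp x h1

theorem Regular.contDiffAt_rotDes {x : TubeArg} (h : Regular P K x) (j : Fin 2) (a b : Fin 3) :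
    ContDiffAt ℝ ∞ (fun x : TubeArg => rotDes P K x j a b) x :=
  contDiffAt_attitude (h.contDiffAt_jetU j) (by fun_prop) (h j).2 a b

theorem contDiffAt_mul_mat {F : Type*} [NormedAddCommGroup F] [NormedSpace ℝ F] {A B : F → M3}
    {x : F} (hA : ∀ a b, ContDiffAt ℝ ∞ (fun y => A y a b) x)
    (hB : ∀ a b, ContDiffAt ℝ ∞ (fun y => B y a b) x) (a b : Fin 3) :
    ContDiffAt ℝ ∞ (fun y => (A y * B y) a b) x := by
  simp only [Matrix.mul_apply]
  exact ContDiffAt.sum fun i _ => (hA a i).mul (hB i b)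

theorem contDiffAt_mulVec {F : Type*} [NormedAddCommGroup F] [NormedSpace ℝ F] {A : F → M3}
    {v : F → V3} {x : F} (hA : ∀ a b, ContDiffAt ℝ ∞ (fun y => A y a b) x)
    (hv : ContDiffAt ℝ ∞ v x) : ContDiffAt ℝ ∞ (fun y => A y *ᵥ v y) x := by
  refine contDiffAt_pi.2 fun a => ?_
  simp only [Matrix.mulVec, dotProduct]
  exact ContDiffAt.sum fun i _ => (hA a i).mul (contDiffAt_pi.1 hv i)

theorem contDiffAt_rotErr {F : Type*} [NormedAddCommGroup F] [NormedSpace ℝ F] {A : F → M3}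
    {x : F} (hA : ∀ a b, ContDiffAt ℝ ∞ (fun y => A y a b) x) :
    ContDiffAt ℝ ∞ (fun y => rotErr (A y)) x := by
  refine contDiffAt_pi.2 fun i => ?_
  have h := fun a b => (contDiffAt_const (c := (1 / 2 : ℝ))).mul ((hA a b).sub (hA b a))
  fin_cases i
  · exact h 2 1
  · exact h 0 2
  · exact h 1 0

theorem contDiffAt_loopField {k₁ k₂ : ℝ} {y : Prm × CState} (h : Regular P K (y.1, y.2.1)) :
    ContDiffAt ℝ ∞ (loopField P K k₁ k₂) y := by
  have hx : ContDiffAt ℝ ∞ (fun y : Prm × CState => ((y.1, y.2.1) : TubeArg)) y := by fun_prop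
  have hE : ∀ j a b, ContDiffAt ℝ ∞ (fun y : Prm × CState => y.2.rot j a b) y := fun j a b => by
    change ContDiffAt ℝ ∞ (fun y : Prm × CState => y.2.2.1 j a b) y
    fun_prop
  have hU : ∀ j, ContDiffAt ℝ ∞ (fun y : Prm × CState =>
      jetU P K j (TubeArg.arg (y.1, y.2.1))) y := fun j =>
    (h.contDiffAt_jetU j).comp (f := fun y : Prm × CState => ((y.1, y.2.1) : TubeArg)) y hx
  have hR : ∀ j a b, ContDiffAt ℝ ∞ (fun y : Prm × CState =>
      rotDes P K (y.1, y.2.1) j a b) y := fun j a b =>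
    (h.contDiffAt_rotDes j a b).comp (f := fun y : Prm × CState => ((y.1, y.2.1) : TubeArg)) y hx
  have hF : ∀ j, ContDiffAt ℝ ∞ (fun y : Prm × CState =>
      forces P K (y.1, y.2.1) y.2.rot j) y := fun j => by
    have h1 := contDiffAt_mulVec (v := fun _ => e3) (contDiffAt_mul_mat (hR j) (hE j))
      contDiffAt_const
    have h2 := hU j
    unfold forces projThrust
    fun_prop
  have hdev : ContDiffAt ℝ ∞ (fun y : Prm × CState =>
      tensionDev P K (y.1, y.2.1) y.2.rot) y := contDiffAt_pi.2 fun j => by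
    have h1 := hF j
    have h2 := hU j
    unfold tensionDev
    fun_prop
  have hexc : ContDiffAt ℝ ∞ (fun y : Prm × CState =>
      tensionExc P K (y.1, y.2.1) y.2.rot) y :=
    contDiffAt_excess (by fun_prop) (by fun_prop) hdev
  have hV : ContDiffAt ℝ ∞ (fun y : Prm × CState =>
      excessV P y.2.1.2.1 (tensionExc P K (y.1, y.2.1) y.2.rot)) y := by
    unfold excessV; fun_prop
  have hW : ContDiffAt ℝ ∞ (fun y : Prm × CState =>
      excessW P (qR y.2.1.1) y.2.1.2.1 (tensionExc P K (y.1, y.2.1) y.2.rot)) y := by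
    unfold excessW; fun_prop
  have hA : ∀ j, ContDiffAt ℝ ∞ (fun y : Prm × CState =>
      excessA P (qR y.2.1.1) y.2.1.2.1 (tensionExc P K (y.1, y.2.1) y.2.rot) j) y := fun j => by
    unfold excessA; fun_prop
  have hend : ∀ j, ContDiffAt ℝ ∞ (fun y : Prm × CState =>
      jetEndAcc P K j (TubeArg.arg (y.1, y.2.1))) y := fun j =>
    (contDiffAt_jetEndAcc j _).comp
      (f := fun y : Prm × CState => TubeArg.arg (y.1, y.2.1)) y (by unfold TubeArg.arg; fun_prop)
  have hrod : ContDiffAt ℝ ∞ (fun y : Prm × CState =>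
      jetRodField P K y.1.1.1 y.2.1.1 y.2.1.2.1) y :=
    contDiffAt_jetRodField (by fun_prop) (by fun_prop) (by fun_prop)
  have hzero : ContDiffAt ℝ ∞ (fun _ : Prm × CState => (0 : V3)) y := contDiffAt_const
  refine ContDiffAt.prodMk (ContDiffAt.prodMk ?_ (ContDiffAt.prodMk ?_ ?_))
    (ContDiffAt.prodMk ?_ ?_)
  · exact hrod.add (hzero.prodMk (hV.prodMk (hzero.prodMk hW)))
  · unfold cableRate
    exact contDiffAt_pi.2 fun j => by fun_prop
  · refine contDiffAt_pi.2 fun j => ?_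
    have h1 := hF j
    have h2 := hA j
    have h3 := hend j
    have h4 : ContDiffAt ℝ ∞ (fun y : Prm × CState => y.2.1.2.1 j) y := by fun_prop
    exact ((h4.cross (h3.add h2)).const_smul (1 / P.Lc)).sub
      ((h4.cross h1).const_smul (1 / (P.mQ * P.Lc)))
  · refine contDiffAt_pi.2 fun j => contDiffAt_pi.2 fun a => contDiffAt_pi.2 fun b => ?_
    refine contDiffAt_mul_mat (B := fun y : Prm × CState => hat (y.2.2.2 j)) (hE j) ?_ a b
    intro a b
    fin_cases a <;> fin_cases b <;> simp [hat] <;> fun_prop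
  · refine contDiffAt_pi.2 fun j => contDiffAt_mulVec (fun _ _ => contDiffAt_const) ?_
    have h1 := contDiffAt_rotErr (hE j)
    fun_prop

/-- Regularity is an open condition. -/
theorem Regular.eventually {x : TubeArg} (h : Regular P K x) :
    ∀ᶠ y in nhds x, Regular P K y := by
  refine Filter.eventually_all.2 fun j => ?_
  have h1 : ContinuousAt (fun y : TubeArg => jetMuTilde P K j y.1.1.1 y.2.1) x :=
    (Continuous.jetMuTilde (by fun_prop) (by fun_prop) j).continuousAt
  have h2 : ContinuousAt (fun y : TubeArg => jetU P K j y.arg ⨯₃ y.1.2 j) x :=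
    ((h.contDiffAt_jetU j).cross (by fun_prop)).continuousAt
  exact (h1.eventually_ne (h j).1).and (h2.eventually_ne (h j).2)

end Field

/-! ### The equations of motion and the closed loop -/

section Design

variable {P : Params} {K : Gains}

/-- `I + hat q ^ 2` is the orthogonal projection on the line of the cable; its coefficient is the
designed tension. -/
theorem jetMu_eq_smul {qc : Cables} (j : Fin 2) (h : qc j ⬝ᵥ qc j = 1) (g : Jet) (z : Rod) :
    jetMu P K j g z qc = (qc j ⬝ᵥ jetMuTilde P K j g z) • qc j := by
  rw [jetMu, cross_cross_unit h]; abel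

/-- The constraints of the rod and the cables. -/
def Admissible (z : Rod × Cables × Cables) : Prop :=
  qR z.1 ⬝ᵥ qR z.1 = 1 ∧ wR z.1 ⬝ᵥ qR z.1 = 0 ∧
    ∀ j, z.2.1 j ⬝ᵥ z.2.1 j = 1 ∧ z.2.2 j ⬝ᵥ z.2.1 j = 0

/-- The designed accelerations, tensions and forces. -/
def designData (P : Params) (K : Gains) (x : TubeArg) (h : Admissible x.2) : DesignData P where
  qr := qR x.2.1
  wr := wR x.2.1
  qc := x.2.2.1
  wc := x.2.2.2
  acc := jetAccX P K x.1.1.1 x.2.1 x.2.2.1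
  accW := jetAccW P K x.1.1.1 x.2.1 x.2.2.1
  lam j := x.2.2.1 j ⬝ᵥ jetMuTilde P K j x.1.1.1 x.2.1
  u j := jetU P K j x.arg
  qr_unit := h.1
  wr_dot := h.2.1
  qc_unit j := (h.2.2 j).1
  wc_dot j := (h.2.2 j).2
  acc_eq := by rw [jetAccX, jetMu_eq_smul 0 (h.2.2 0).1, jetMu_eq_smul 1 (h.2.2 1).1]
  accW_eq := by rw [jetAccW, jetMu_eq_smul 0 (h.2.2 0).1, jetMu_eq_smul 1 (h.2.2 1).1]
  u_dot j := by
    rw [jetU]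
    change x.2.2.1 j ⬝ᵥ (jetMu P K j x.1.1.1 x.2.1 x.2.2.1 + _ + _) = _
    rw [jetMu_eq_smul j (h.2.2 j).1]
    simp only [dotProduct_add, dotProduct_sub, dotProduct_neg, dotProduct_smul, dot_self_cross,
      smul_eq_mul, TubeArg.arg, (h.2.2 j).1, jetEndAcc, jetAccQ, add_dotProduct, smul_dotProduct]
    simp only [dotProduct_comm _ (x.2.2.1 j)]
    ring

theorem designData_explicit {x : TubeArg} (h : Admissible x.2) {E : Fin 2 → M3} {v' wr' : V3}
    {wc' : Cables} : (designData P K x h).ExplicitEq (forces P K x E) v' wr' wc' ↔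
      v' = jetAccX P K x.1.1.1 x.2.1 x.2.2.1 + (rodExc P K x E).2.1 ∧
      wr' = jetAccW P K x.1.1.1 x.2.1 x.2.2.1 + (rodExc P K x E).2.2.2 ∧
      ∀ j, wc' j = cableAcc P K x E j := by
  have e : ∀ j, (designData P K x h).endAcc j = jetEndAcc P K j x.arg := fun j => rfl
  simp only [DesignData.ExplicitEq, e]
  rfl

end Design

/-! ### The closed loop as a perturbed tracking law -/

section Laws

variable {P : Params} {K : Gains}

theorem jetMuTilde_add (g : Jet) (z : Rod) : jetMuTilde P K 0 g z + jetMuTilde P K 1 g z =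
    P.mr • (g.1 + P.g • e3 - K.kv • vR z - K.kx • xR z) := by
  rw [jetMuTilde, jetMuTilde, sgn_zero, sgn_one]
  module

theorem jetMuTilde_sub (g : Jet) (z : Rod) : jetMuTilde P K 1 g z - jetMuTilde P K 0 g z =
    (2 / 3 * P.mr * P.Lr) •
      (-(qR z ⨯₃ jetWdot g)
        + (qR z ⬝ᵥ jetW g) • (qR z ⨯₃ (qR z ⨯₃ jetW g))
        - (qR z ⬝ᵥ jetW g) • jetEw g z
        + K.kw • (qR z ⨯₃ jetEw g z)
        + K.kq • (qR z ⨯₃ (g.2.1 ⨯₃ qR z))) := by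
  rw [jetMuTilde, jetMuTilde, sgn_zero, sgn_one]
  module

theorem cross_cross_perp {q v : V3} (hq : q ⬝ᵥ q = 1) (hv : q ⬝ᵥ v = 0) :
    q ⨯₃ (q ⨯₃ v) = -v := by
  rw [cross_cross_unit hq, hv, zero_smul, zero_sub]

/-- The part of the designed force on the rod lost by the misalignment of cable `j`. -/
def forceLoss (P : Params) (K : Gains) (x : TubeArg) (j : Fin 2) : V3 :=
  x.2.2.1 j ⨯₃ (x.2.2.1 j ⨯₃ jetMuTilde P K j x.1.1.1 x.2.1)

theorem jetMu_eq_add (x : TubeArg) (j : Fin 2) : jetMu P K j x.1.1.1 x.2.1 x.2.2.1 =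
    jetMuTilde P K j x.1.1.1 x.2.1 + forceLoss P K x j := rfl

/-- Perturbation of the linear tracking law of the rod. -/
def posPert (P : Params) (K : Gains) (x : TubeArg) (E : Fin 2 → M3) : V3 :=
  (1 / P.mr) • (forceLoss P K x 0 + forceLoss P K x 1) + (rodExc P K x E).2.1

/-- The sum of the assigned forces was chosen to produce the linear feedback law. What remains is
the force lost by misaligned cables and the effect of tension excesses. -/
theorem rodRate_vel (x : TubeArg) (E : Fin 2 → M3) : (rodRate P K x E).2.1 =
    -(K.kx • xR x.2.1) - K.kv • vR x.2.1 + posPert P K x E := by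
  have h : (rodRate P K x E).2.1 = (1 / P.mr) •
      ((jetMuTilde P K 0 x.1.1.1 x.2.1 + jetMuTilde P K 1 x.1.1.1 x.2.1)
        + (forceLoss P K x 0 + forceLoss P K x 1)) - P.g • e3 - x.1.1.1.1
        + (rodExc P K x E).2.1 := by
    rw [add_add_add_comm, ← jetMu_eq_add, ← jetMu_eq_add]
    rfl
  rw [h, jetMuTilde_add, smul_add, smul_smul, one_div, inv_mul_cancel₀ P.mr_pos.ne', posPert,
    one_div]
  module

/-- Perturbation of the tracking law of the attitude of the rod. -/
def rodPert (P : Params) (K : Gains) (x : TubeArg) (E : Fin 2 → M3) : V3 :=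
  (1 / (2 / 3 * P.mr * P.Lr)) • (qR x.2.1 ⨯₃ (forceLoss P K x 1 - forceLoss P K x 0))
    + (rodExc P K x E).2.2.2

/-- The gyroscopic term enters the controller with the sign opposite to that of the exact tracking
law, which leaves `-2 (q ⬝ ω̃) (q ⨯₃ ω)`. It vanishes on the desired attitude because `ω̃` is
orthogonal to `q̃`, and it is absorbed by large gains. -/
theorem rodRate_ang {x : TubeArg} (h : Admissible x.2) (E : Fin 2 → M3) :
    (rodRate P K x E).2.2.2 = -(qR x.2.1 ⨯₃ (qR x.2.1 ⨯₃ jetWdot x.1.1.1))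
      + (qR x.2.1 ⬝ᵥ jetW x.1.1.1) • (qR x.2.1 ⨯₃ wR x.2.1)
      - K.kq • (x.1.1.1.2.1 ⨯₃ qR x.2.1)
      - K.kw • sphereEw (qR x.2.1) (wR x.2.1) (jetW x.1.1.1)
      + (-((2 * (qR x.2.1 ⬝ᵥ jetW x.1.1.1)) • (qR x.2.1 ⨯₃ wR x.2.1)) + rodPert P K x E) := by
  have hI : 2 / 3 * P.mr * P.Lr ≠ 0 := by
    have := P.Lr_pos; have := P.mr_pos; positivity
  have h0 : (rodRate P K x E).2.2.2 = (1 / (2 / 3 * P.mr * P.Lr)) • (qR x.2.1 ⨯₃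
      ((jetMuTilde P K 1 x.1.1.1 x.2.1 - jetMuTilde P K 0 x.1.1.1 x.2.1)
        + (forceLoss P K x 1 - forceLoss P K x 0))) + (rodExc P K x E).2.2.2 := by
    rw [sub_add_sub_comm, ← jetMu_eq_add, ← jetMu_eq_add]
    rfl
  have hq := h.1
  have hew : qR x.2.1 ⬝ᵥ jetEw x.1.1.1 x.2.1 = 0 := by
    rw [dotProduct_comm]; exact sphereEw_dot h.2.1 _
  have h1 : qR x.2.1 ⨯₃ (qR x.2.1 ⨯₃ (qR x.2.1 ⨯₃ jetW x.1.1.1)) = -(qR x.2.1 ⨯₃ jetW x.1.1.1) :=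
    cross_cross_perp hq (dot_self_cross _ _)
  have h2 : qR x.2.1 ⨯₃ jetEw x.1.1.1 x.2.1 =
      qR x.2.1 ⨯₃ wR x.2.1 - qR x.2.1 ⨯₃ jetW x.1.1.1 := by
    rw [jetEw, cross_add_right, h1, sub_eq_add_neg]
  have h3 : jetEw x.1.1.1 x.2.1 = sphereEw (qR x.2.1) (wR x.2.1) (jetW x.1.1.1) := rfl
  rw [h0, jetMuTilde_sub, cross_add_right, cross_smul_right, smul_add, smul_smul, one_div,
    inv_mul_cancel₀ hI, one_smul, rodPert, one_div, ← h3]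
  simp only [cross_add_right, cross_sub_right, cross_smul_right, cross_neg_right]
  rw [h1, cross_cross_perp hq hew, cross_cross_perp hq (dot_cross_self _ _), h2]
  module

/-- Perturbation of the tracking law of cable `j`, apart from the change of the desired angular
acceleration. -/
def cablePert (P : Params) (K : Gains) (x : TubeArg) (E : Fin 2 → M3) (j : Fin 2) : V3 :=
  (1 / P.Lc) • (x.2.2.1 j ⨯₃ excessA P (qR x.2.1) x.2.2.1 (tensionExc P K x E) j)
    - (1 / (P.mQ * P.Lc)) • (x.2.2.1 j ⨯₃ (forces P K x E j - jetU P K j x.arg))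

theorem cross_jetU {x : TubeArg} (h : Admissible x.2) (j : Fin 2) :
    x.2.2.1 j ⨯₃ jetU P K j x.arg = P.mQ • (x.2.2.1 j ⨯₃ jetEndAcc P K j x.arg)
      + (P.mQ * P.Lc) • (x.2.2.1 j ⨯₃ (x.2.2.1 j ⨯₃ jetWTildeDot P K j x.arg)
        - (x.2.2.1 j ⬝ᵥ jetWc P K j x.arg) • (x.2.2.1 j ⨯₃ x.2.2.2 j)
        + K.kqc j • jetEqc P K j x.arg + K.kwc j • jetEwc P K j x.arg) := by
  have hq := (h.2.2 j).1
  have hw := (h.2.2 j).2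
  have h1 : x.2.2.1 j ⬝ᵥ jetEqc P K j x.arg = 0 := dot_cross_self _ _
  have h2 : x.2.2.1 j ⬝ᵥ jetEwc P K j x.arg = 0 := by
    rw [dotProduct_comm]; exact sphereEw_dot hw _
  have h3 : ∀ v, x.2.2.1 j ⨯₃ (x.2.2.1 j ⨯₃ (x.2.2.1 j ⨯₃ v)) = -(x.2.2.1 j ⨯₃ v) := fun v =>
    cross_cross_perp hq (dot_self_cross _ _)
  have h4 := cross_cross_perp hq h1
  have h5 := cross_cross_perp hq h2
  rw [jetU]
  change x.2.2.1 j ⨯₃ (jetMu P K j x.1.1.1 x.2.1 x.2.2.1 + P.mQ •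
    ((jetEndAcc P K j x.arg ⬝ᵥ x.2.2.1 j) • x.2.2.1 j
      + (P.Lc * (x.2.2.2 j ⬝ᵥ x.2.2.2 j)) • x.2.2.1 j)
    + (-(P.mQ • (x.2.2.1 j ⨯₃ (x.2.2.1 j ⨯₃
      (jetEndAcc P K j x.arg + P.Lc • (x.2.2.1 j ⨯₃ jetWTildeDot P K j x.arg)
        - (P.Lc * (x.2.2.1 j ⬝ᵥ jetWc P K j x.arg)) • x.2.2.2 j))))
  - (P.mQ * P.Lc) • (x.2.2.1 j ⨯₃ (K.kqc j • jetEqc P K j x.arg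
      + K.kwc j • jetEwc P K j x.arg)))) = _
  rw [jetMu_eq_smul j hq]
  simp only [cross_add_right, cross_sub_right, cross_smul_right, cross_neg_right, cross_self, h3,
    h4, h5]
  module

/-- The perpendicular part of `u` contains the designed acceleration of the end of the rod, so that
acceleration cancels. Only the tracking law and the consequences of the force deviation survive. -/
theorem cableAcc_eq {x : TubeArg} (h : Admissible x.2) (E : Fin 2 → M3) (j : Fin 2) :
    cableAcc P K x E j = -(x.2.2.1 j ⨯₃ (x.2.2.1 j ⨯₃ jetWTildeDot P K j x.arg))
      + (x.2.2.1 j ⬝ᵥ jetWc P K j x.arg) • (x.2.2.1 j ⨯₃ x.2.2.2 j)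
      - K.kqc j • jetEqc P K j x.arg - K.kwc j • jetEwc P K j x.arg + cablePert P K x E j := by
  have h1 := P.mQ_pos.ne'
  have h2 := P.Lc_pos.ne'
  have h3 : x.2.2.1 j ⨯₃ forces P K x E j = x.2.2.1 j ⨯₃ jetU P K j x.arg
      + x.2.2.1 j ⨯₃ (forces P K x E j - jetU P K j x.arg) := by
    rw [← cross_add_right, add_sub_cancel]
  have e1 : 1 / (P.mQ * P.Lc) * P.mQ = 1 / P.Lc := by field_simp
  have e2 : 1 / (P.mQ * P.Lc) * (P.mQ * P.Lc) = 1 := by field_simp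
  rw [cableAcc, h3, cross_jetU h, smul_add (1 / (P.mQ * P.Lc)), smul_add (1 / (P.mQ * P.Lc)),
    smul_smul, smul_smul, e1, e2, cross_add_right, cablePert]
  module

end Laws

/-! ### Bounds of the perturbations -/

section Bounds

variable {P : Params} {K : Gains}

/-- Uniform bounds of the controller. -/
def CtrlBound (P : Params) (K : Gains) (M : ℝ) (x : TubeArg) : Prop :=
  ∀ j, len (jetMuTilde P K j x.1.1.1 x.2.1) ≤ M ∧ len (jetU P K j x.arg) ≤ M ∧
    len (jetWc P K j x.arg) ≤ M ∧ ‖fderiv ℝ (jetQTilde P K j) (x.1.1.1, x.2.1)‖ ≤ M ∧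
    ‖fderiv ℝ (jetWTilde P K j) (x.1.1.1, x.1.1.2.1, x.2.1, x.2.2.1)‖ ≤ M

theorem exists_ctrlBound {S : Set TubeArg} (hS : IsCompact S)
    (h : ∀ x ∈ S, ∀ j, jetMuTilde P K j x.1.1.1 x.2.1 ≠ 0) :
    ∃ M, 0 ≤ M ∧ ∀ x ∈ S, CtrlBound P K M x := by
  have key : ∀ f : TubeArg → ℝ, ContinuousOn f S → ∃ M, ∀ x ∈ S, f x ≤ M := fun f hf => by
    obtain ⟨M, hM⟩ := (hS.image_of_continuousOn hf).bddAbove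
    exact ⟨M, fun x hx => hM ⟨x, hx, rfl⟩⟩
  have harg : Continuous fun x : TubeArg => x.arg := by unfold TubeArg.arg; fun_prop
  have hg1 : Continuous fun x : TubeArg => (x.1.1.1, x.2.1) := by fun_prop
  have hg2 : Continuous fun x : TubeArg => (x.1.1.1, x.1.1.2.1, x.2.1, x.2.2.1) := by fun_prop
  have c1 : ∀ j, ContinuousOn (fun x : TubeArg => len (jetMuTilde P K j x.1.1.1 x.2.1)) S :=
    fun j => (continuous_len.comp (Continuous.jetMuTilde (by fun_prop) (by fun_prop)
      j)).continuousOn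
  have c2 : ∀ j, ContinuousOn (fun x : TubeArg => len (jetU P K j x.arg)) S := fun j x hx =>
    (continuous_len.continuousAt.comp ((contDiffAt_jetU (y := x.arg) j
      (h x hx j)).continuousAt.comp harg.continuousAt)).continuousWithinAt
  have c3 : ∀ j, ContinuousOn (fun x : TubeArg => len (jetWc P K j x.arg)) S := fun j x hx =>
    (continuous_len.continuousAt.comp ((contDiffAt_jetWc (y := x.arg) j
      (h x hx j)).continuousAt.comp harg.continuousAt)).continuousWithinAt
  have c4 : ∀ j, ContinuousOn (fun x : TubeArg =>
      ‖fderiv ℝ (jetQTilde P K j) (x.1.1.1, x.2.1)‖) S := fun j x hx => by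
    have h1 : ContDiffAt ℝ ∞ (fderiv ℝ (jetQTilde P K j)) (x.1.1.1, x.2.1) :=
      (contDiffAt_jetQTilde (y := (x.1.1.1, x.2.1)) j (h x hx j)).fderiv_right (by simp)
    exact (h1.continuousAt.comp (f := fun x : TubeArg => (x.1.1.1, x.2.1))
      hg1.continuousAt).norm.continuousWithinAt
  have c5 : ∀ j, ContinuousOn (fun x : TubeArg =>
      ‖fderiv ℝ (jetWTilde P K j) (x.1.1.1, x.1.1.2.1, x.2.1, x.2.2.1)‖) S := fun j x hx => by
    have h1 : ContDiffAt ℝ ∞ (fderiv ℝ (jetWTilde P K j))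
        (x.1.1.1, x.1.1.2.1, x.2.1, x.2.2.1) :=
      (contDiffAt_jetWTilde (y := (x.1.1.1, x.1.1.2.1, x.2.1, x.2.2.1)) j
        (h x hx j)).fderiv_right (by simp)
    exact (h1.continuousAt.comp (f := fun x : TubeArg => (x.1.1.1, x.1.1.2.1, x.2.1, x.2.2.1))
      hg2.continuousAt).norm.continuousWithinAt
  obtain ⟨M, hM⟩ := key (fun x => ∑ j, (len (jetMuTilde P K j x.1.1.1 x.2.1)
    + len (jetU P K j x.arg) + len (jetWc P K j x.arg)
    + ‖fderiv ℝ (jetQTilde P K j) (x.1.1.1, x.2.1)‖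
    + ‖fderiv ℝ (jetWTilde P K j) (x.1.1.1, x.1.1.2.1, x.2.1, x.2.2.1)‖))
    (continuousOn_finsetSum _ fun j _ => ((((c1 j).add (c2 j)).add (c3 j)).add (c4 j)).add (c5 j))
  refine ⟨max M 0, le_max_right _ _, fun x hx j => ?_⟩
  have h0 := (hM x hx).trans (le_max_left M 0)
  have h1 := (Finset.single_le_sum (f := fun j => len (jetMuTilde P K j x.1.1.1 x.2.1)
    + len (jetU P K j x.arg) + len (jetWc P K j x.arg)
    + ‖fderiv ℝ (jetQTilde P K j) (x.1.1.1, x.2.1)‖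
    + ‖fderiv ℝ (jetWTilde P K j) (x.1.1.1, x.1.1.2.1, x.2.1, x.2.2.1)‖)
    (fun i _ => by
      have := len_nonneg (jetMuTilde P K i x.1.1.1 x.2.1)
      have := len_nonneg (jetU P K i x.arg)
      have := len_nonneg (jetWc P K i x.arg)
      positivity) (Finset.mem_univ j)).trans h0
  have a1 := len_nonneg (jetMuTilde P K j x.1.1.1 x.2.1)
  have a2 := len_nonneg (jetU P K j x.arg)
  have a3 := len_nonneg (jetWc P K j x.arg)
  have a4 := norm_nonneg (fderiv ℝ (jetQTilde P K j) (x.1.1.1, x.2.1))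
  have a5 := norm_nonneg (fderiv ℝ (jetWTilde P K j) (x.1.1.1, x.1.1.2.1, x.2.1, x.2.2.1))
  refine ⟨?_, ?_, ?_, ?_, ?_⟩ <;> linarith

/-- Sum of the attitude errors of the quadrotors. -/
def rotSum (E : Fin 2 → M3) : ℝ := len (rotErr (E 0)) + len (rotErr (E 1))

/-- The relative rotations are rotations by at most a right angle, say. -/
def RotNear (E : Fin 2 → M3) : Prop := ∀ j, E j ∈ SO3 ∧ rotConfig (E j) ≤ 1

theorem rotSum_nonneg (E : Fin 2 → M3) : 0 ≤ rotSum E := add_nonneg (len_nonneg _) (len_nonneg _)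

theorem le_rotSum (E : Fin 2 → M3) (j : Fin 2) : len (rotErr (E j)) ≤ rotSum E := by
  have h0 := len_nonneg (rotErr (E 0))
  have h1 := len_nonneg (rotErr (E 1))
  fin_cases j
  · exact le_add_of_nonneg_right h1
  · exact le_add_of_nonneg_left h0

variable {x : TubeArg} {E : Fin 2 → M3} {M : ℝ}

theorem len_forces_sub_le (hM : CtrlBound P K M x) (hreg : Regular P K x) (hE : RotNear E)
    (j : Fin 2) : len (forces P K x E j - jetU P K j x.arg) ≤ 2 * M * len (rotErr (E j)) := by
  have h1 := len_projThrust_sub (hE j).1 (attitude_mem (hreg j).2) (attitude_e3 (hreg j).2)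
    (hE j).2
  refine h1.trans (mul_le_mul_of_nonneg_right ?_ (len_nonneg _))
  linarith [(hM j).2.1]

theorem abs_tensionExc_le (hM : CtrlBound P K M x) (hreg : Regular P K x) (hE : RotNear E)
    (ha : Admissible x.2) (j : Fin 2) : |tensionExc P K x E j| ≤ 2 * M * rotSum E := by
  have h : ∀ i, |tensionDev P K x E i| ≤ 2 * M * len (rotErr (E i)) := fun i => by
    refine (abs_dot_le _ _).trans ?_
    rw [len_eq_one (ha.2.2 i).1, one_mul]
    exact len_forces_sub_le hM hreg hE i
  refine (abs_excess_le _ j).trans ?_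
  rw [rotSum]
  linarith [h 0, h 1]

theorem len_excessV_le {qc : Cables} {ν : Fin 2 → ℝ} {n : ℝ} (hq : ∀ j, qc j ⬝ᵥ qc j = 1)
    (hν : ∀ j, |ν j| ≤ n) : len (excessV P qc ν) ≤ 2 / P.mr * n := by
  have h := P.mr_pos
  have h1 := len_add_le (ν 0 • qc 0) (ν 1 • qc 1)
  rw [len_smul, len_smul, len_eq_one (hq 0), len_eq_one (hq 1)] at h1
  rw [excessV, len_smul, abs_of_pos (one_div_pos.2 h)]
  calc _ ≤ 1 / P.mr * (n + n) :=
        mul_le_mul_of_nonneg_left (by linarith [hν 0, hν 1]) (one_div_pos.2 h).le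
    _ = _ := by ring

theorem len_excessW_le {qr : V3} {qc : Cables} {ν : Fin 2 → ℝ} {n : ℝ} (hr : qr ⬝ᵥ qr = 1)
    (hq : ∀ j, qc j ⬝ᵥ qc j = 1) (hν : ∀ j, |ν j| ≤ n) :
    len (excessW P qr qc ν) ≤ 2 / (2 / 3 * P.mr * P.Lr) * n := by
  have hI : 0 < 2 / 3 * P.mr * P.Lr := by
    have := P.Lr_pos; have := P.mr_pos; positivity
  have h1 := len_sub_le (ν 1 • qc 1) (ν 0 • qc 0)
  rw [len_smul, len_smul, len_eq_one (hq 0), len_eq_one (hq 1)] at h1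
  have h2 := len_cross_le qr (ν 1 • qc 1 - ν 0 • qc 0)
  rw [len_eq_one hr, one_mul] at h2
  rw [excessW, len_smul, abs_of_pos (one_div_pos.2 hI)]
  calc _ ≤ 1 / (2 / 3 * P.mr * P.Lr) * (n + n) :=
        mul_le_mul_of_nonneg_left (by linarith [hν 0, hν 1]) (one_div_pos.2 hI).le
    _ = _ := by ring

theorem len_excessA_le {qr : V3} {qc : Cables} {ν : Fin 2 → ℝ} {n : ℝ} (hr : qr ⬝ᵥ qr = 1)
    (hq : ∀ j, qc j ⬝ᵥ qc j = 1) (hν : ∀ j, |ν j| ≤ n) (j : Fin 2) :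
    len (excessA P qr qc ν j) ≤ (2 / P.mr + P.Lr * (2 / (2 / 3 * P.mr * P.Lr))) * n := by
  have h1 := len_excessV_le (P := P) hq hν
  have h2 := len_excessW_le (P := P) hr hq hν
  have h3 := len_cross_le (excessW P qr qc ν) qr
  rw [len_eq_one hr, mul_one] at h3
  have h4 : |sgn j * P.Lr| = P.Lr := by
    rw [abs_mul, abs_of_pos P.Lr_pos]
    fin_cases j <;> simp [sgn]
  have h5 := len_add_le (excessV P qc ν) ((sgn j * P.Lr) • (excessW P qr qc ν ⨯₃ qr))
  rw [len_smul, h4] at h5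
  have h6 := mul_le_mul_of_nonneg_left (h3.trans h2) P.Lr_pos.le
  rw [excessA]
  linarith

/-- The lost force is the part of the assigned force orthogonal to the cable, and the assigned force
points along the desired cable direction. -/
theorem len_forceLoss_le (hM : CtrlBound P K M x) (hreg : Regular P K x) (ha : Admissible x.2)
    (j : Fin 2) : len (forceLoss P K x j) ≤ M * len (jetEqc P K j x.arg) := by
  have h1 := jetMuTilde_eq_smul (y := (x.1.1.1, x.2.1)) (hreg j).1
  simp only at h1
  rw [forceLoss, len_cross_cross (ha.2.2 j).1, h1, cross_smul_right, len_smul, abs_neg,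
    abs_of_nonneg (len_nonneg _), ← cross_anticomm, len_neg]
  exact mul_le_mul_of_nonneg_right (hM j).1 (len_nonneg _)

/-- Constants that depend on the parameters only. -/
theorem exists_pert_bound (P : Params) (K : Gains) {M : ℝ} (hM0 : 0 ≤ M) : ∃ C, 0 ≤ C ∧
    ∀ (x : TubeArg) (E : Fin 2 → M3), CtrlBound P K M x → Regular P K x → RotNear E →
      Admissible x.2 →
      len (posPert P K x E) ≤ C * (len (jetEqc P K 0 x.arg) + len (jetEqc P K 1 x.arg) + rotSum E) ∧
      len (rodPert P K x E) ≤ C * (len (jetEqc P K 0 x.arg) + len (jetEqc P K 1 x.arg) + rotSum E) ∧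
      ‖rodExc P K x E‖ ≤ C * rotSum E ∧
      ∀ j, len (cablePert P K x E j) ≤ C * rotSum E := by
  have hmr := P.mr_pos
  have hmQ := P.mQ_pos
  have hLc := P.Lc_pos
  have hLr := P.Lr_pos
  set I := 2 / 3 * P.mr * P.Lr with hI
  have hI0 : 0 < I := by positivity
  set C₁ := 2 / P.mr * (2 * M) with hC₁
  set C₂ := 2 / I * (2 * M) with hC₂
  set C₃ := (2 / P.mr + P.Lr * (2 / I)) * (2 * M) with hC₃
  set C₄ := 1 / P.Lc * C₃ + 1 / (P.mQ * P.Lc) * (2 * M) with hC₄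
  have p1 : 0 ≤ C₁ := by positivity
  have p2 : 0 ≤ C₂ := by positivity
  have p3 : 0 ≤ C₃ := by positivity
  have p4 : 0 ≤ C₄ := by positivity
  have p5 : 0 ≤ 1 / P.mr * M := by positivity
  have p6 : 0 ≤ 1 / I * M := by positivity
  refine ⟨C₁ + C₂ + C₄ + 1 / P.mr * M + 1 / I * M, by positivity, fun x E hM hreg hE ha => ?_⟩
  have hν := abs_tensionExc_le hM hreg hE ha
  have hq : ∀ j, x.2.2.1 j ⬝ᵥ x.2.2.1 j = 1 := fun j => (ha.2.2 j).1
  have hs := rotSum_nonneg E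
  have a1 : len (rodExc P K x E).2.1 ≤ C₁ * rotSum E := by
    refine (len_excessV_le hq hν).trans (le_of_eq ?_); rw [hC₁]; ring
  have a2 : len (rodExc P K x E).2.2.2 ≤ C₂ * rotSum E := by
    refine (len_excessW_le ha.1 hq hν).trans (le_of_eq ?_); rw [hC₂]; ring
  have l0 := len_forceLoss_le hM hreg ha 0
  have l1 := len_forceLoss_le hM hreg ha 1
  have e0 := len_nonneg (jetEqc P K 0 x.arg)
  have e1 := len_nonneg (jetEqc P K 1 x.arg)
  generalize len (jetEqc P K 0 x.arg) = Q₀ at *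
  generalize len (jetEqc P K 1 x.arg) = Q₁ at *
  have exp : ∀ c : ℝ, 0 ≤ c → 0 ≤ c * Q₀ ∧ 0 ≤ c * Q₁ ∧ 0 ≤ c * rotSum E := fun c hc =>
    ⟨mul_nonneg hc e0, mul_nonneg hc e1, mul_nonneg hc hs⟩
  have x1 := exp C₁ p1
  have x2 := exp C₂ p2
  have x4 := exp C₄ p4
  have x5 := exp _ p5
  have x6 := exp _ p6
  refine ⟨?_, ?_, ?_, fun j => ?_⟩
  · have h1 := len_add_le ((1 / P.mr) • (forceLoss P K x 0 + forceLoss P K x 1))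
      (rodExc P K x E).2.1
    rw [len_smul, abs_of_pos (one_div_pos.2 hmr)] at h1
    have h2 : 1 / P.mr * len (forceLoss P K x 0 + forceLoss P K x 1) ≤
        1 / P.mr * (M * Q₀ + M * Q₁) := mul_le_mul_of_nonneg_left
      ((len_add_le _ _).trans (add_le_add l0 l1)) (one_div_pos.2 hmr).le
    rw [posPert]
    linarith
  · have h1 := len_add_le ((1 / I) • (qR x.2.1 ⨯₃ (forceLoss P K x 1 - forceLoss P K x 0)))
      (rodExc P K x E).2.2.2
    rw [len_smul, abs_of_pos (one_div_pos.2 hI0)] at h1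
    have h3 := len_cross_le (qR x.2.1) (forceLoss P K x 1 - forceLoss P K x 0)
    rw [len_eq_one ha.1, one_mul] at h3
    have h2 : 1 / I * len (qR x.2.1 ⨯₃ (forceLoss P K x 1 - forceLoss P K x 0)) ≤
        1 / I * (M * Q₁ + M * Q₀) := mul_le_mul_of_nonneg_left
      (h3.trans ((len_sub_le _ _).trans (add_le_add l1 l0))) (one_div_pos.2 hI0).le
    rw [rodPert]
    linarith
  · have n1 := (norm_le_len (rodExc P K x E).2.1).trans a1
    have n2 := (norm_le_len (rodExc P K x E).2.2.2).trans a2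
    have n0 : 0 ≤ (C₁ + C₂ + C₄ + 1 / P.mr * M + 1 / I * M) * rotSum E := by positivity
    rw [Prod.norm_def, Prod.norm_def, Prod.norm_def]
    have z1 : ‖(rodExc P K x E).1‖ = 0 := norm_zero
    have z2 : ‖(rodExc P K x E).2.2.1‖ = 0 := norm_zero
    refine max_le (by rw [z1]; exact n0) (max_le ?_ (max_le (by rw [z2]; exact n0) ?_)) <;>
      linarith
  -- No cable misalignment enters: apart from the desired angular velocity, the cables are disturbed
  -- by the attitudes alone. This makes the system a cascade.
  · have hA := len_excessA_le (P := P) ha.1 hq hν j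
    have hT := (len_forces_sub_le hM hreg hE j).trans
      (mul_le_mul_of_nonneg_left (le_rotSum E j) (by positivity))
    have c1 := len_cross_le (x.2.2.1 j) (excessA P (qR x.2.1) x.2.2.1 (tensionExc P K x E) j)
    have c2 := len_cross_le (x.2.2.1 j) (forces P K x E j - jetU P K j x.arg)
    rw [len_eq_one (hq j), one_mul] at c1 c2
    have h1 := len_sub_le ((1 / P.Lc) • (x.2.2.1 j ⨯₃ excessA P (qR x.2.1) x.2.2.1
      (tensionExc P K x E) j)) ((1 / (P.mQ * P.Lc)) • (x.2.2.1 j ⨯₃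
        (forces P K x E j - jetU P K j x.arg)))
    rw [len_smul, len_smul, abs_of_pos (by positivity), abs_of_pos (by positivity)] at h1
    have h2 := mul_le_mul_of_nonneg_left (c1.trans hA) (one_div_pos.2 hLc).le
    have h3 := mul_le_mul_of_nonneg_left (c2.trans hT) (one_div_pos.2 (mul_pos hmQ hLc)).le
    have h4 : len (cablePert P K x E j) ≤ C₄ * rotSum E := by
      rw [cablePert, hC₄, hC₃]
      linarith
    linarith

end Bounds

/-! ### Decay of the Lyapunov functions along the closed loop -/

theorem _root_.HasDerivWithinAt.fst' {E F : Type*} [NormedAddCommGroup E] [NormedSpace ℝ E]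
    [NormedAddCommGroup F] [NormedSpace ℝ F] {f : ℝ → E × F} {f' : E × F} {s : Set ℝ} {t : ℝ}
    (h : HasDerivWithinAt f f' s t) : HasDerivWithinAt (fun τ => (f τ).1) f'.1 s t :=
  (ContinuousLinearMap.fst ℝ E F).hasFDerivAt.comp_hasDerivWithinAt t h

theorem _root_.HasDerivWithinAt.snd' {E F : Type*} [NormedAddCommGroup E] [NormedSpace ℝ E]
    [NormedAddCommGroup F] [NormedSpace ℝ F] {f : ℝ → E × F} {f' : E × F} {s : Set ℝ} {t : ℝ}
    (h : HasDerivWithinAt f f' s t) : HasDerivWithinAt (fun τ => (f τ).2) f'.2 s t :=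
  (ContinuousLinearMap.snd ℝ E F).hasFDerivAt.comp_hasDerivWithinAt t h

/-- The cross term has coefficient one; positivity and decay are ensured by the size of `k` instead.
-/
def rodV (k : ℝ) (x : TubeArg) : ℝ := posV (xR x.2.1) (vR x.2.1)
  + sphereV k 1 (qR x.2.1) (wR x.2.1) x.1.1.1.2.1 (jetW x.1.1.1)

/-- Here the gain is one and the coefficient `c` of the cross term is small, of the order of the
inverse squared bound of the desired angular velocity. -/
def cableV (P : Params) (K : Gains) (c : ℝ) (j : Fin 2) (x : TubeArg) : ℝ :=
  sphereV 1 c (x.2.2.1 j) (x.2.2.2 j) (jetQTilde P K j (x.1.1.1, x.2.1)) (jetWc P K j x.arg)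

/-- Sum of the squared errors of the rod. -/
def rodSq (x : TubeArg) : ℝ := len (xR x.2.1) ^ 2 + len (vR x.2.1) ^ 2
  + len (x.1.1.1.2.1 ⨯₃ qR x.2.1) ^ 2 + len (jetEw x.1.1.1 x.2.1) ^ 2

/-- Sum of the squared errors of cable `j`. -/
def cableSq (P : Params) (K : Gains) (j : Fin 2) (x : TubeArg) : ℝ :=
  len (jetEqc P K j x.arg) ^ 2 + len (jetEwc P K j x.arg) ^ 2

/-- Sum of the squared errors of quadrotor `j`. -/
def attSq (j : Fin 2) (z : CState) : ℝ := len (rotErr (z.rot j)) ^ 2 + len (z.2.2 j) ^ 2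

/-- `B` bounds the desired angular velocity, `β` is the coefficient of the gyroscopic term and `p`
bounds the disturbance. The hypothesis on `k` pays for all terms in `Q` and `W`; Young's inequality
costs `4 + 1 + 1 + 1 = 7` times `p²`. -/
theorem rod_young {X V Q W B β k p : ℝ} (hW1 : W ≤ 1) (hB : 0 ≤ B)
    (hβ : 0 ≤ β) (hk : 4 + 2 * B + 4 * β ≤ k) :
    (-(1 / 2) * (X ^ 2 + V ^ 2) + p * (2 * V + X))
      + (-k * W ^ 2 + (β * Q + p) * W + k * (0 * Q)
        + 1 * (W ^ 2 + B * Q ^ 2 * W + 0 * W - k * Q ^ 2 + k * (Q * W) + (β * Q + p) * Q)) ≤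
      -(1 / 4) * (X ^ 2 + V ^ 2 + Q ^ 2 + W ^ 2) + 7 * p ^ 2 := by
  have h1 : B * Q ^ 2 * W ≤ B * Q ^ 2 := mul_le_of_le_one_right (by positivity) hW1
  have h2 : k * (Q * W) ≤ k / 2 * (Q ^ 2 + W ^ 2) := by
    nlinarith [mul_nonneg (show 0 ≤ k by linarith) (sq_nonneg (Q - W))]
  have h3 : β * (Q * W) ≤ β / 2 * (Q ^ 2 + W ^ 2) := by
    nlinarith [mul_nonneg hβ (sq_nonneg (Q - W))]
  have h4 : 2 * (p * V) ≤ 1 / 4 * V ^ 2 + 4 * p ^ 2 := by nlinarith [sq_nonneg (V - 4 * p)]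
  have h5 : p * X ≤ 1 / 4 * X ^ 2 + p ^ 2 := by nlinarith [sq_nonneg (X - 2 * p)]
  have h6 : p * W ≤ 1 / 4 * W ^ 2 + p ^ 2 := by nlinarith [sq_nonneg (W - 2 * p)]
  have h7 : p * Q ≤ 1 / 4 * Q ^ 2 + p ^ 2 := by nlinarith [sq_nonneg (Q - 2 * p)]
  have h8 : (4 + 2 * B + 4 * β) * (Q ^ 2 + W ^ 2) ≤ k * (Q ^ 2 + W ^ 2) :=
    mul_le_mul_of_nonneg_right hk (by positivity)
  have h9 : 0 ≤ B * W ^ 2 := by positivity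
  have h10 : 0 ≤ β * W ^ 2 := by positivity
  have h11 : 0 ≤ β * Q ^ 2 := by positivity
  nlinarith

/-- The normalisation of `c` makes the cost of the cross term, including the mixed terms `Q W`,
exactly half of the damping `W²`. Since the decay in `Q` is only of order `c`, the disturbance is
paid for with a factor `1 / c`. -/
theorem cable_young {Q W Ω c p : ℝ} (hQ : 0 ≤ Q) (hQ1 : Q ≤ 1) (hW : 0 ≤ W) (hΩ : 0 ≤ Ω)
    (hc : 0 < c) (hc' : c * (2 + (Ω + 1) ^ 2) = 1) (hp : 0 ≤ p) :
    -1 * W ^ 2 + p * W + 1 * (p * Q)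
      + c * (W ^ 2 + Ω * Q ^ 2 * W + p * W - 1 * Q ^ 2 + 1 * (Q * W) + p * Q) ≤
      -(c / 4) * (Q ^ 2 + W ^ 2) + 9 / c * p ^ 2 := by
  have hc2 : c ≤ 1 / 2 := by nlinarith [mul_nonneg hc.le (sq_nonneg (Ω + 1))]
  have h1 : Ω * Q ^ 2 * W + Q * W ≤ (Ω + 1) * (Q * W) := by
    have : Ω * Q * W * Q ≤ Ω * Q * W := mul_le_of_le_one_right (by positivity) hQ1
    nlinarith
  have h2 : (Ω + 1) * (Q * W) ≤ 1 / 2 * Q ^ 2 + (Ω + 1) ^ 2 / 2 * W ^ 2 := by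
    nlinarith [sq_nonneg (Q - (Ω + 1) * W)]
  have h3 : c * (Ω * Q ^ 2 * W + Q * W) ≤ c * (1 / 2 * Q ^ 2 + (Ω + 1) ^ 2 / 2 * W ^ 2) :=
    mul_le_mul_of_nonneg_left (h1.trans h2) hc.le
  have h4 : c * (p * W + p * Q) ≤ 1 / 2 * (p * W + p * Q) :=
    mul_le_mul_of_nonneg_right hc2 (by positivity)
  have h5 : 3 / 2 * (p * Q) ≤ c / 4 * Q ^ 2 + 9 / (4 * c) * p ^ 2 := by
    have e : c / 4 * Q ^ 2 + 9 / (4 * c) * p ^ 2 - 3 / 2 * (p * Q) =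
        (c * Q - 3 * p) ^ 2 / (4 * c) := by field_simp; ring
    have : 0 ≤ (c * Q - 3 * p) ^ 2 / (4 * c) := by positivity
    linarith
  have h6 : 3 / 2 * (p * W) ≤ 1 / 4 * W ^ 2 + 9 / 4 * p ^ 2 := by nlinarith [sq_nonneg (W - 3 * p)]
  have h7 : 9 / 4 * p ^ 2 ≤ 9 / (4 * c) * p ^ 2 := by
    refine mul_le_mul_of_nonneg_right ?_ (sq_nonneg p)
    exact div_le_div_of_nonneg_left (by norm_num) (by positivity) (by linarith)
  have h8 : 9 / c * p ^ 2 = 4 * (9 / (4 * c) * p ^ 2) := by field_simp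
  have h9 : c * (W ^ 2 + (Ω + 1) ^ 2 / 2 * W ^ 2) = 1 / 2 * W ^ 2 := by
    linear_combination (1 / 2 * W ^ 2) * hc'
  have h10 : c * W ^ 2 ≤ 1 / 2 * W ^ 2 := mul_le_mul_of_nonneg_right hc2 (sq_nonneg W)
  have h11 : 0 ≤ 9 / (4 * c) * p ^ 2 := by positivity
  nlinarith

section Decay

variable {P : Params} {K : Gains} {D : Desired} {k₁ k₂ : ℝ} {I : Set ℝ} {z : ℝ → CState} {t : ℝ}

/-- The gyroscopic term of the rod controller is a perturbation of first order. -/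
theorem len_gyro_le {q w qt g1 p : V3} {B e : ℝ} (hq : q ⬝ᵥ q = 1) (hqt : qt ⬝ᵥ qt = 1)
    (hB : len (qt ⨯₃ g1) ≤ B) (hew : len (w + q ⨯₃ (q ⨯₃ (qt ⨯₃ g1))) ≤ 1) (hp : len p ≤ e) :
    len (-((2 * (q ⬝ᵥ (qt ⨯₃ g1))) • (q ⨯₃ w)) + p) ≤
      2 * B * (B + 1) * len (qt ⨯₃ q) + e := by
  have hB0 : 0 ≤ B := (len_nonneg _).trans hB
  refine (len_add_le _ _).trans (add_le_add ?_ hp)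
  rw [len_neg, len_smul, abs_mul, abs_two]
  have a1 : |q ⬝ᵥ (qt ⨯₃ g1)| ≤ B * len (qt ⨯₃ q) := by
    rw [dotProduct_comm]
    refine (abs_dot_le_cross hqt _ (cross_dot_left _ _)).trans ?_
    exact mul_le_mul_of_nonneg_right hB (len_nonneg _)
  have a2 : len (q ⨯₃ w) ≤ B + 1 := by
    have b1 := len_cross_le q w
    rw [len_eq_one hq, one_mul] at b1
    have b3 := len_sub_le (w + q ⨯₃ (q ⨯₃ (qt ⨯₃ g1))) (q ⨯₃ (q ⨯₃ (qt ⨯₃ g1)))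
    rw [add_sub_cancel_right, len_cross_cross hq] at b3
    have b4 := len_cross_le q (qt ⨯₃ g1)
    rw [len_eq_one hq, one_mul] at b4
    linarith
  calc 2 * |q ⬝ᵥ (qt ⨯₃ g1)| * len (q ⨯₃ w) ≤ 2 * (B * len (qt ⨯₃ q)) * (B + 1) :=
        mul_le_mul (by linarith) a2 (len_nonneg _)
          (mul_nonneg zero_le_two (mul_nonneg hB0 (len_nonneg _)))
    _ = _ := by ring

theorem posV_rod_deriv (hkx : K.kx = 1) (hkv : K.kv = 1)
    (hz : HasDerivWithinAt z (loopField P K k₁ k₂ (prm D t, z t)) I t) :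
    ∃ V', HasDerivWithinAt (fun τ => posV (xR (z τ).1.1) (vR (z τ).1.1)) V' I t ∧
      V' ≤ -(1 / 2) * (len (xR (z t).1.1) ^ 2 + len (vR (z t).1.1) ^ 2)
        + len (posPert P K (prm D t, (z t).1) (z t).rot)
          * (2 * len (vR (z t).1.1) + len (xR (z t).1.1)) := by
  have dr := hz.fst'.fst'
  have dx : HasDerivWithinAt (fun τ => xR (z τ).1.1) (vR (z t).1.1) I t :=
    dr.fst'.congr_deriv (add_zero _)
  have dv : HasDerivWithinAt (fun τ => vR (z τ).1.1) (-xR (z t).1.1 - vR (z t).1.1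
      + posPert P K (prm D t, (z t).1) (z t).rot) I t := by
    refine dr.snd'.fst'.congr_deriv ?_
    have := rodRate_vel (P := P) (K := K) (prm D t, (z t).1) (z t).rot
    rw [hkx, hkv, one_smul, one_smul] at this
    exact this
  exact hasDerivWithinAt_posV (x := fun τ => xR (z τ).1.1) (v := fun τ => vR (z τ).1.1) dx dv

/-- The desired direction of the rod moves exactly with its desired angular velocity, so the
disturbance `pq` of the direction is zero; the terms `0 * Q` and `0 * W` are its traces. -/
theorem sphereV_rod_deriv {k B p : ℝ} (hk0 : 0 ≤ k) (hkq : K.kq = k) (hkw : K.kw = k)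
    (hB : len (jetW (jet D t)) ≤ B)
    (ha : Admissible (z t).1) (hew : len (jetEw (jet D t) (z t).1.1) ≤ 1)
    (hp' : len (rodPert P K (prm D t, (z t).1) (z t).rot) ≤ p)
    (hz : HasDerivWithinAt z (loopField P K k₁ k₂ (prm D t, z t)) I t) :
    ∃ V', HasDerivWithinAt (fun τ => sphereV k 1 (qR (z τ).1.1) (wR (z τ).1.1) (D.q τ)
        (jetW (jet D τ))) V' I t ∧
      ∀ Q W, Q = len (D.q t ⨯₃ qR (z t).1.1) → W = len (jetEw (jet D t) (z t).1.1) →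
      V' ≤ -k * W ^ 2 + (2 * B * (B + 1) * Q + p) * W + k * (0 * Q)
        + 1 * (W ^ 2 + B * Q ^ 2 * W + 0 * W - k * Q ^ 2 + k * (Q * W)
          + (2 * B * (B + 1) * Q + p) * Q) := by
  have dr := hz.fst'.fst'
  have dq : HasDerivWithinAt (fun τ => qR (z τ).1.1) (wR (z t).1.1 ⨯₃ qR (z t).1.1) I t :=
    dr.snd'.snd'.fst'.congr_deriv (add_zero _)
  have dw : HasDerivWithinAt (fun τ => wR (z τ).1.1)
      (rodRate P K (prm D t, (z t).1) (z t).rot).2.2.2 I t := dr.snd'.snd'.snd'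
  have hu := D.q_unit t
  have dqt : HasDerivWithinAt D.q (jetW (jet D t) ⨯₃ D.q t + 0) I t := by
    refine (D.q_smooth.hasDerivAt_infty t).hasDerivWithinAt.congr_deriv ?_
    rw [add_zero]
    exact (cross_self_cross hu (D.q_dot_deriv t)).symm
  have dwt : HasDerivWithinAt (fun τ => jetW (jet D τ)) (jetWdot (jet D t)) I t :=
    (D.hasDerivAt_w t).hasDerivWithinAt
  have law := rodRate_ang (K := K) (P := P) (x := (prm D t, (z t).1)) ha (z t).rot
  rw [hkq, hkw] at law
  obtain ⟨V', hV', le'⟩ := hasDerivWithinAt_sphereV (q := fun τ => qR (z τ).1.1)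
    (w := fun τ => wR (z τ).1.1) (qt := D.q) (wt := fun τ => jetW (jet D τ))
    (c := 1) zero_le_one hk0 hk0 ha.1 ha.2.1 hu
    (cross_dot_left _ _) (zero_dotProduct _) dq dqt dw dwt law
  refine ⟨V', hV', fun Q W hQ hW => le'.trans ?_⟩
  have hpw := len_gyro_le (q := qR (z t).1.1) (w := wR (z t).1.1) (qt := D.q t)
    (g1 := deriv D.q t) ha.1 hu hB hew hp'
  have hEw : sphereEw (qR (z t).1.1) (wR (z t).1.1) (jetW (jet D t)) =
    jetEw (jet D t) (z t).1.1 := rfl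
  have n3 := len_nonneg (D.q t ⨯₃ qR (z t).1.1)
  have n4 := len_nonneg (jetEw (jet D t) (z t).1.1)
  simp only [hEw, len_zero]
  rw [← hQ] at n3 hpw ⊢
  rw [← hW] at n4 ⊢
  gcongr
  · exact hpw
  · exact hpw

theorem rodV_decay {k B p : ℝ} (hkx : K.kx = 1) (hkv : K.kv = 1) (hkq : K.kq = k) (hkw : K.kw = k)
    (hB : len (jetW (jet D t)) ≤ B) (hk : 4 + 2 * B + 4 * (2 * B * (B + 1)) ≤ k)
    (ha : Admissible (z t).1) (hew : len (jetEw (jet D t) (z t).1.1) ≤ 1)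
    (hp : len (posPert P K (prm D t, (z t).1) (z t).rot) ≤ p)
    (hp' : len (rodPert P K (prm D t, (z t).1) (z t).rot) ≤ p)
    (hz : HasDerivWithinAt z (loopField P K k₁ k₂ (prm D t, z t)) I t) :
    ∃ V', HasDerivWithinAt (fun τ => rodV k (prm D τ, (z τ).1)) V' I t ∧
      V' ≤ -(1 / 4) * rodSq (prm D t, (z t).1) + 7 * p ^ 2 := by
  have hB0 : 0 ≤ B := (len_nonneg _).trans hB
  have hβ : 0 ≤ 2 * B * (B + 1) := by positivity
  obtain ⟨V₁, hV₁, le₁⟩ := posV_rod_deriv hkx hkv hz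
  obtain ⟨V₂, hV₂, le₂⟩ := sphereV_rod_deriv (by linarith) hkq hkw hB ha hew hp' hz
  refine ⟨V₁ + V₂, hV₁.add hV₂, ?_⟩
  have y := rod_young (X := len (xR (z t).1.1)) (V := len (vR (z t).1.1)) (p := p)
    (Q := len (D.q t ⨯₃ qR (z t).1.1)) hew hB0 hβ hk
  have m1 := mul_le_mul_of_nonneg_right hp (add_nonneg
    (mul_nonneg zero_le_two (len_nonneg (vR (z t).1.1))) (len_nonneg (xR (z t).1.1)))
  have hsq : rodSq (prm D t, (z t).1) = len (xR (z t).1.1) ^ 2 + len (vR (z t).1.1) ^ 2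
    + len (D.q t ⨯₃ qR (z t).1.1) ^ 2 + len (jetEw (jet D t) (z t).1.1) ^ 2 := rfl
  rw [hsq]
  exact (add_le_add (le₁.trans (by gcongr)) (le₂ _ _ rfl rfl)).trans y

/-- Change of the derivative of the desired direction of a cable due to tension excesses. -/
def dirPert (P : Params) (K : Gains) (j : Fin 2) (x : TubeArg) (E : Fin 2 → M3) : V3 :=
  fderiv ℝ (jetQTilde P K j) (x.1.1.1, x.2.1) (0, rodExc P K x E)

/-- Change of the derivative of the desired angular velocity of a cable due to tension
excesses. -/
def angPert (P : Params) (K : Gains) (j : Fin 2) (x : TubeArg) (E : Fin 2 → M3) : V3 :=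
  fderiv ℝ (jetWTilde P K j) (x.1.1.1, x.1.1.2.1, x.2.1, x.2.2.1) (0, 0, rodExc P K x E, 0)

/-- The true rod rate is the design field plus `rodExc`. The derivative is linear in the direction,
so the design part gives `ω̃ ⨯₃ q̃` and the rest is a disturbance proportional to the tension
excesses. -/
theorem hasDerivWithinAt_jetQTilde {j : Fin 2} (hreg : Regular P K (prm D t, (z t).1))
    (hz : HasDerivWithinAt z (loopField P K k₁ k₂ (prm D t, z t)) I t) :
    HasDerivWithinAt (fun τ => jetQTilde P K j (jet D τ, (z τ).1.1))
      (jetWc P K j (TubeArg.arg (prm D t, (z t).1)) ⨯₃ jetQTilde P K j (jet D t, (z t).1.1)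
        + dirPert P K j (prm D t, (z t).1) (z t).rot) I t := by
  have djet := (D.contDiff_jet.hasDerivAt_infty t).hasDerivWithinAt (s := I)
  have fq := (contDiffAt_jetQTilde (P := P) (K := K) (y := (jet D t, (z t).1.1)) j
    (hreg j).1).hasFDerivAt_infty
  refine (fq.comp_hasDerivWithinAt t (djet.prodMk hz.fst'.fst')).congr_deriv ?_
  have e1 : ((deriv (jet D) t, (loopField P K k₁ k₂ (prm D t, z t)).1.1) : Jet × Rod) =
      (deriv (jet D) t, jetRodField P K (jet D t) (z t).1.1 (z t).1.2.1)
        + (0, rodExc P K (prm D t, (z t).1) (z t).rot) :=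
    Prod.ext (add_zero _).symm rfl
  rw [e1, map_add]
  congr 1
  exact (jetWTilde_cross (y := (jet D t, deriv (jet D) t, (z t).1.1, (z t).1.2.1))
    (hreg j).1).symm

theorem hasDerivWithinAt_jetWc {j : Fin 2} (hreg : Regular P K (prm D t, (z t).1))
    (hz : HasDerivWithinAt z (loopField P K k₁ k₂ (prm D t, z t)) I t) :
    HasDerivWithinAt (fun τ => jetWc P K j (TubeArg.arg (prm D τ, (z τ).1)))
      (jetWTildeDot P K j (TubeArg.arg (prm D t, (z t).1))
        + angPert P K j (prm D t, (z t).1) (z t).rot) I t := by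
  have djet := (D.contDiff_jet.hasDerivAt_infty t).hasDerivWithinAt (s := I)
  have djet' := ((contDiff_deriv D.contDiff_jet).hasDerivAt_infty t).hasDerivWithinAt (s := I)
  have fw := (contDiffAt_jetWTilde (P := P) (K := K) (y := (jet D t, deriv (jet D) t, (z t).1.1,
    (z t).1.2.1)) j (hreg j).1).hasFDerivAt_infty
  refine (fw.comp_hasDerivWithinAt t
    (djet.prodMk (djet'.prodMk (hz.fst'.fst'.prodMk hz.fst'.snd'.fst')))).congr_deriv ?_
  have e1 : ((deriv (jet D) t, deriv (deriv (jet D)) t,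
      (loopField P K k₁ k₂ (prm D t, z t)).1.1,
      (loopField P K k₁ k₂ (prm D t, z t)).1.2.1) : Jet × Jet × Rod × Cables) =
      (deriv (jet D) t, deriv (deriv (jet D)) t,
        jetRodField P K (jet D t) (z t).1.1 (z t).1.2.1, cableRate (prm D t, (z t).1))
        + (0, 0, rodExc P K (prm D t, (z t).1) (z t).rot, 0) :=
    Prod.ext (add_zero _).symm (Prod.ext (add_zero _).symm (Prod.ext rfl (add_zero _).symm))
  rw [e1, map_add]
  congr 1
  rw [jetWTildeDot]
  rfl

/-- The tracking law must contain the true derivative of the desired angular velocity, whereas the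
controller uses the one of the design model. The difference `pA` is added to the law and compensated
in the disturbance. -/
theorem cableAcc_law {x : TubeArg} {E : Fin 2 → M3} {j : Fin 2} (hkq : K.kqc j = 1)
    (hkw : K.kwc j = 1) (ha : Admissible x.2) (pA : V3) :
    cableAcc P K x E j = -(x.2.2.1 j ⨯₃ (x.2.2.1 j ⨯₃ (jetWTildeDot P K j x.arg + pA)))
      + (x.2.2.1 j ⬝ᵥ jetWc P K j x.arg) • (x.2.2.1 j ⨯₃ x.2.2.2 j)
      - (1 : ℝ) • (jetQTilde P K j (x.1.1.1, x.2.1) ⨯₃ x.2.2.1 j)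
      - (1 : ℝ) • sphereEw (x.2.2.1 j) (x.2.2.2 j) (jetWc P K j x.arg)
      + (cablePert P K x E j + x.2.2.1 j ⨯₃ (x.2.2.1 j ⨯₃ pA)) := by
  have h0 := cableAcc_eq (P := P) (K := K) (x := x) ha E j
  rw [hkq, hkw] at h0
  have h1 : jetEqc P K j x.arg = jetQTilde P K j (x.1.1.1, x.2.1) ⨯₃ x.2.2.1 j := rfl
  have h2 : jetEwc P K j x.arg = sphereEw (x.2.2.1 j) (x.2.2.2 j) (jetWc P K j x.arg) := rfl
  rw [h0, cross_add_right, cross_add_right, h1, h2]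
  module

theorem norm_third {A B C F : Type*} [NormedAddCommGroup A] [NormedAddCommGroup B]
    [NormedAddCommGroup C] [NormedAddCommGroup F] (v : C) :
    ‖((0, 0, v, 0) : A × B × C × F)‖ = ‖v‖ := by
  simp [Prod.norm_mk]

theorem len_dirPert_le {M e : ℝ} {x : TubeArg} {E : Fin 2 → M3} (j : Fin 2)
    (hM0 : 0 ≤ M) (hM : CtrlBound P K M x) (hx : ‖rodExc P K x E‖ ≤ e) :
    len (dirPert P K j x E) ≤ 2 * M * e := by
  have h1 := (fderiv ℝ (jetQTilde P K j) (x.1.1.1, x.2.1)).le_of_opNorm_le (hM j).2.2.2.1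
    (0, rodExc P K x E)
  rw [Prod.norm_mk, norm_zero, max_eq_right (norm_nonneg _)] at h1
  have h2 := len_le_norm (dirPert P K j x E)
  have h3 := mul_le_mul_of_nonneg_left hx hM0
  have h4 : ‖dirPert P K j x E‖ ≤ M * ‖rodExc P K x E‖ := h1
  linarith

theorem len_angPert_le {M e : ℝ} {x : TubeArg} {E : Fin 2 → M3} (j : Fin 2)
    (hM0 : 0 ≤ M) (hM : CtrlBound P K M x) (hx : ‖rodExc P K x E‖ ≤ e) :
    len (angPert P K j x E) ≤ 2 * M * e := by
  have h1 := (fderiv ℝ (jetWTilde P K j) (x.1.1.1, x.1.1.2.1, x.2.1,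
    x.2.2.1)).le_of_opNorm_le (hM j).2.2.2.2 (0, 0, rodExc P K x E, 0)
  rw [norm_third] at h1
  have h2 := len_le_norm (angPert P K j x E)
  have h3 := mul_le_mul_of_nonneg_left hx hM0
  have h4 : ‖angPert P K j x E‖ ≤ M * ‖rodExc P K x E‖ := h1
  linarith

theorem cableV_decay {M c e : ℝ} {j : Fin 2} (hkq : K.kqc j = 1) (hkw : K.kwc j = 1)
    (hM0 : 0 ≤ M) (hc : 0 < c) (hc' : c * (2 + (M + 1) ^ 2) = 1)
    (ha : Admissible (z t).1) (hM : CtrlBound P K M (prm D t, (z t).1))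
    (hreg : Regular P K (prm D t, (z t).1))
    (hx : ‖rodExc P K (prm D t, (z t).1) (z t).rot‖ ≤ e)
    (hp : len (cablePert P K (prm D t, (z t).1) (z t).rot j) ≤ e)
    (hz : HasDerivWithinAt z (loopField P K k₁ k₂ (prm D t, z t)) I t) :
    ∃ V', HasDerivWithinAt (fun τ => cableV P K c j (prm D τ, (z τ).1)) V' I t ∧
      V' ≤ -(c / 4) * cableSq P K j (prm D t, (z t).1) + 9 / c * ((1 + 2 * M) * e) ^ 2 := by
  have he : 0 ≤ e := (norm_nonneg _).trans hx
  have hq := (ha.2.2 j).1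
  have hw := (ha.2.2 j).2
  have dq : HasDerivWithinAt (fun τ => (z τ).1.2.1 j) ((z t).1.2.2 j ⨯₃ (z t).1.2.1 j) I t :=
    hasDerivWithinAt_pi.1 hz.fst'.snd'.fst' j
  have dw : HasDerivWithinAt (fun τ => (z τ).1.2.2 j)
      (cableAcc P K (prm D t, (z t).1) (z t).rot j) I t :=
    hasDerivWithinAt_pi.1 hz.fst'.snd'.snd' j
  have hqt : jetQTilde P K j (jet D t, (z t).1.1) ⬝ᵥ jetQTilde P K j (jet D t, (z t).1.1) = 1 :=
    jetQTilde_unit (y := (jet D t, (z t).1.1)) (hreg j).1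
  have hperp : dirPert P K j (prm D t, (z t).1) (z t).rot ⬝ᵥ
      jetQTilde P K j (jet D t, (z t).1.1) = 0 := by
    rw [dotProduct_comm]
    exact jetQTilde_dot_fderiv (y := (jet D t, (z t).1.1)) (hreg j).1 _
  obtain ⟨V', hV', le'⟩ := hasDerivWithinAt_sphereV
    (q := fun τ => (z τ).1.2.1 j) (w := fun τ => (z τ).1.2.2 j)
    (qt := fun τ => jetQTilde P K j (jet D τ, (z τ).1.1))
    (wt := fun τ => jetWc P K j (TubeArg.arg (prm D τ, (z τ).1)))
    hc.le zero_le_one zero_le_one hq hw hqt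
    (jetWTilde_dot (j := j) (jet D t, deriv (jet D) t, (z t).1.1, (z t).1.2.1))
    hperp dq (hasDerivWithinAt_jetQTilde hreg hz) dw (hasDerivWithinAt_jetWc hreg hz)
    (cableAcc_law hkq hkw ha _)
  refine ⟨V', hV', le'.trans ?_⟩
  have b1 : len (dirPert P K j (prm D t, (z t).1) (z t).rot) ≤ (1 + 2 * M) * e := by
    linarith [len_dirPert_le j hM0 hM hx]
  have b2 : len (cablePert P K (prm D t, (z t).1) (z t).rot j + (z t).1.2.1 j ⨯₃
      ((z t).1.2.1 j ⨯₃ angPert P K j (prm D t, (z t).1) (z t).rot)) ≤ (1 + 2 * M) * e := by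
    have h2 := len_angPert_le j hM0 hM hx
    generalize angPert P K j (prm D t, (z t).1) (z t).rot = pA at *
    have h4 := len_add_le (cablePert P K (prm D t, (z t).1) (z t).rot j)
      ((z t).1.2.1 j ⨯₃ ((z t).1.2.1 j ⨯₃ pA))
    rw [len_cross_cross hq] at h4
    have h5 := len_cross_le ((z t).1.2.1 j) pA
    rw [len_eq_one hq, one_mul] at h5
    linarith
  have hp0 : 0 ≤ (1 + 2 * M) * e := by positivity
  have hQ1 := len_cross_unit_le_one hqt hq
  have hQ0 := len_nonneg (jetQTilde P K j (jet D t, (z t).1.1) ⨯₃ (z t).1.2.1 j)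
  have hW0 := len_nonneg (jetEwc P K j (TubeArg.arg (prm D t, (z t).1)))
  have hΩ : len (jetWc P K j (TubeArg.arg (prm D t, (z t).1))) ≤ M := (hM j).2.2.1
  have hΩ0 := len_nonneg (jetWc P K j (TubeArg.arg (prm D t, (z t).1)))
  have hsq : cableSq P K j (prm D t, (z t).1) =
    len (jetQTilde P K j (jet D t, (z t).1.1) ⨯₃ (z t).1.2.1 j) ^ 2
      + len (jetEwc P K j (TubeArg.arg (prm D t, (z t).1))) ^ 2 := rfl
  have hew : sphereEw ((z t).1.2.1 j) ((z t).1.2.2 j)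
    (jetWc P K j (TubeArg.arg (prm D t, (z t).1))) =
      jetEwc P K j (TubeArg.arg (prm D t, (z t).1)) := rfl
  rw [hsq]
  simp only [hew]
  refine le_trans ?_ (cable_young hQ0 hQ1 hW0 hM0 hc hc' hp0)
  gcongr

end Decay

/-! ### The Lyapunov function of the closed loop -/

/-- Sum of the squares of all tracking errors. -/
def totalSq (P : Params) (K : Gains) (y : Prm × CState) : ℝ :=
  rodSq (y.1, y.2.1) + (cableSq P K 0 (y.1, y.2.1) + cableSq P K 1 (y.1, y.2.1))
    + (attSq 0 y.2 + attSq 1 y.2)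

/-- All tracking errors are at most `r`, on the side of the desired attitudes. -/
def InTube (P : Params) (K : Gains) (r : ℝ) (y : Prm × CState) : Prop :=
  Small P K r (y.1.1, y.2.1) ∧ Admissible y.2.1 ∧ RotNear y.2.rot ∧ ∀ j, len (y.2.2.2 j) ≤ r

/-- `z` is a motion of the closed loop on `I`, as long as it stays in the tube. -/
structure IsLoop (P : Params) (K : Gains) (D : Desired) (k₁ k₂ r : ℝ) (I : Set ℝ)
    (z : ℝ → CState) : Prop where
  cont : ContinuousOn z I
  adm : ∀ t ∈ I, Admissible (z t).1
  rot : ∀ t ∈ I, Regular P K (prm D t, (z t).1) → ∀ j, (z t).rot j ∈ SO3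
  dyn : ∀ t ∈ I, Regular P K (prm D t, (z t).1) → InTube P K r (prm D t, z t) →
    HasDerivWithinAt z (loopField P K k₁ k₂ (prm D t, z t)) I t

/-- A Lyapunov function of the closed loop in a tube. -/
structure IsLyapunov (P : Params) (K : Gains) (D : Desired) (k₁ k₂ r : ℝ) (V : Prm × CState → ℝ)
    (a b lam : ℝ) : Prop where
  a_pos : 0 < a
  b_pos : 0 < b
  lam_pos : 0 < lam
  bounds : ∀ p ∈ prmSet D, ∀ z, InTube P K r (p, z) →
    a * totalSq P K (p, z) ≤ V (p, z) ∧ V (p, z) ≤ b * totalSq P K (p, z)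
  decay : ∀ (z : ℝ → CState) (I : Set ℝ) (t : ℝ), 0 ≤ t → InTube P K r (prm D t, z t) →
    HasDerivWithinAt z (loopField P K k₁ k₂ (prm D t, z t)) I t →
    ∃ V', HasDerivWithinAt (fun τ => V (prm D τ, z τ)) V' I t ∧ V' ≤ -lam * V (prm D t, z t)

/-- A tube around the desired motion in which the controller is smooth. -/
structure IsTube (P : Params) (K : Gains) (D : Desired) (r : ℝ) (S : Set TubeArg) : Prop where
  pos : 0 < r
  le_one : r ≤ 1
  compact : IsCompact S
  regular : ∀ x ∈ S, Regular P K x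
  rod : ∀ p ∈ prmSet D, ∀ z, RodSmall r p.1.1 z → ∀ j, jetMuTilde P K j p.1.1 z ≠ 0
  mem : ∀ p ∈ prmSet D, ∀ z, Small P K r (p.1, z) → (p, z) ∈ S

section Lyapunov

variable {P : Params} {K : Gains} {D : Desired}

theorem rodV_bounds {k : ℝ} (hk : 4 ≤ k) {x : TubeArg} (hu : x.1.1.1.2.1 ⬝ᵥ x.1.1.1.2.1 = 1)
    (hq : qR x.2.1 ⬝ᵥ qR x.2.1 = 1) (h0 : 0 ≤ x.1.1.1.2.1 ⬝ᵥ qR x.2.1) :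
    1 / 4 * rodSq x ≤ rodV k x ∧ rodV k x ≤ (k + 2) * rodSq x := by
  have h1 := posV_le (xR x.2.1) (vR x.2.1)
  have h2 := le_posV (xR x.2.1) (vR x.2.1)
  have h3 := sphereV_le (kq := k) (c := 1) (w := wR x.2.1) (wt := jetW x.1.1.1) (by linarith)
    zero_le_one hq hu h0
  have h4 := le_sphereV (kq := k) (c := 1) (w := wR x.2.1) (wt := jetW x.1.1.1) (by linarith)
    zero_le_one hq hu
  have e : sphereEw (qR x.2.1) (wR x.2.1) (jetW x.1.1.1) = jetEw x.1.1.1 x.2.1 := rfl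
  rw [e] at h3 h4
  have n1 := sq_nonneg (len (xR x.2.1))
  have n2 := sq_nonneg (len (vR x.2.1))
  have n3 := sq_nonneg (len (x.1.1.1.2.1 ⨯₃ qR x.2.1))
  have n4 := sq_nonneg (len (jetEw x.1.1.1 x.2.1))
  rw [rodV, rodSq]
  constructor
  · have h5 := mul_le_mul_of_nonneg_right hk n3
    nlinarith [sq_nonneg (len (jetEw x.1.1.1 x.2.1) - 2 * len (x.1.1.1.2.1 ⨯₃ qR x.2.1))]
  · have h5 := mul_le_mul_of_nonneg_right hk n1
    have h6 := mul_le_mul_of_nonneg_right hk n2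
    linarith

theorem cableV_bounds {c : ℝ} (hc : 0 ≤ c) (hc' : c ≤ 1 / 2) {x : TubeArg} {j : Fin 2}
    (hu : jetQTilde P K j (x.1.1.1, x.2.1) ⬝ᵥ jetQTilde P K j (x.1.1.1, x.2.1) = 1)
    (hq : x.2.2.1 j ⬝ᵥ x.2.2.1 j = 1) (h0 : 0 ≤ jetQTilde P K j (x.1.1.1, x.2.1) ⬝ᵥ x.2.2.1 j) :
    1 / 4 * cableSq P K j x ≤ cableV P K c j x ∧ cableV P K c j x ≤ 2 * cableSq P K j x := by
  have h3 := sphereV_le (kq := 1) (c := c) (w := x.2.2.2 j) (wt := jetWc P K j x.arg) zero_le_one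
    hc hq hu h0
  have h4 := le_sphereV (kq := 1) (c := c) (w := x.2.2.2 j) (wt := jetWc P K j x.arg) zero_le_one
    hc hq hu
  have e : sphereEw (x.2.2.1 j) (x.2.2.2 j) (jetWc P K j x.arg) = jetEwc P K j x.arg := rfl
  have e' : jetQTilde P K j (x.1.1.1, x.2.1) ⨯₃ x.2.2.1 j = jetEqc P K j x.arg := rfl
  rw [e, e'] at h3 h4
  rw [cableV, cableSq]
  generalize sphereV 1 c _ _ _ _ = V at *
  have n1 := len_nonneg (jetEqc P K j x.arg)
  have n2 := len_nonneg (jetEwc P K j x.arg)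
  generalize len (jetEqc P K j x.arg) = Q at *
  generalize len (jetEwc P K j x.arg) = W at *
  constructor
  · have h5 := mul_le_mul_of_nonneg_right hc' (mul_nonneg n1 n2)
    nlinarith [sq_nonneg (Q - W)]
  · have h5 := mul_le_mul_of_nonneg_right hc' (add_nonneg (sq_nonneg Q) (sq_nonneg W))
    linarith

theorem sum_four_sq_le (a b c d : ℝ) : (a + b + (c + d)) ^ 2 ≤ 4 * (a ^ 2 + b ^ 2 + c ^ 2 + d ^ 2) := by
  nlinarith [sq_nonneg (a - b), sq_nonneg (a - c), sq_nonneg (a - d), sq_nonneg (b - c),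
    sq_nonneg (b - d), sq_nonneg (c - d)]

theorem weighted_bounds {k κ₂ κ₃ al be s₁ s₂ s₂' s₃ s₃' v₁ v₂ v₂' v₃ v₃' : ℝ}
    (hk : 0 ≤ k) (hκ₂ : 0 ≤ κ₂) (hκ₃ : 0 ≤ κ₃) (hbe : 0 ≤ be) (n₁ : 0 ≤ s₁)
    (n₂ : 0 ≤ s₂) (n₂' : 0 ≤ s₂') (n₃ : 0 ≤ s₃) (n₃' : 0 ≤ s₃')
    (h₁ : 1 / 4 * s₁ ≤ v₁ ∧ v₁ ≤ (k + 2) * s₁) (h₂ : 1 / 4 * s₂ ≤ v₂ ∧ v₂ ≤ 2 * s₂)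
    (h₂' : 1 / 4 * s₂' ≤ v₂' ∧ v₂' ≤ 2 * s₂') (h₃ : al * s₃ ≤ v₃ ∧ v₃ ≤ be * s₃)
    (h₃' : al * s₃' ≤ v₃' ∧ v₃' ≤ be * s₃') :
    min (1 / 4) (min (κ₂ / 4) (κ₃ * al)) * (s₁ + (s₂ + s₂') + (s₃ + s₃')) ≤
      v₁ + κ₂ * (v₂ + v₂') + κ₃ * (v₃ + v₃') ∧
    v₁ + κ₂ * (v₂ + v₂') + κ₃ * (v₃ + v₃') ≤
      (k + 2 + 2 * κ₂ + κ₃ * be) * (s₁ + (s₂ + s₂') + (s₃ + s₃')) := by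
  have n22 := add_nonneg n₂ n₂'
  have n33 := add_nonneg n₃ n₃'
  constructor
  · set a := min (1 / 4) (min (κ₂ / 4) (κ₃ * al))
    have a1 : a ≤ 1 / 4 := min_le_left _ _
    have a2 : a ≤ κ₂ / 4 := (min_le_right _ _).trans (min_le_left _ _)
    have a3 : a ≤ κ₃ * al := (min_le_right _ _).trans (min_le_right _ _)
    have t1 := mul_le_mul_of_nonneg_right a1 n₁
    have t2 := mul_le_mul_of_nonneg_right a2 n22
    have t3 := mul_le_mul_of_nonneg_right a3 n33
    have t4 := mul_le_mul_of_nonneg_left (add_le_add h₂.1 h₂'.1) hκ₂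
    have t5 := mul_le_mul_of_nonneg_left (add_le_add h₃.1 h₃'.1) hκ₃
    linarith
  · have t4 := mul_le_mul_of_nonneg_left (add_le_add h₂.2 h₂'.2) hκ₂
    have t5 := mul_le_mul_of_nonneg_left (add_le_add h₃.2 h₃'.2) hκ₃
    have p1 := mul_nonneg (add_nonneg hk zero_le_two) (add_nonneg n22 n33)
    have p2 := mul_nonneg hκ₂ (add_nonneg n₁ n33)
    have p3 := mul_nonneg (mul_nonneg hκ₃ hbe) (add_nonneg n₁ n22)
    linarith [h₁.2]

/-- The two equations fix the weights down the cascade: the decay of the cables exceeds their effect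
on the rod by one, and the decay of the attitudes exceeds their effects on rod and on both weighted
cables by one. -/
theorem weighted_decay {C N c d κ₂ κ₃ s₁ s₂ s₂' s₃ s₃' p e V₁ V₂ V₂' V₃ V₃' : ℝ} (hκ₂ : 0 ≤ κ₂)
    (hκ₃ : 0 ≤ κ₃) (eκ₂ : κ₂ * (c / 4) = 28 * C ^ 2 + 1)
    (eκ₃ : κ₃ * d = 28 * C ^ 2 + 4 * N * κ₂ + 1)
    (n₂ : 0 ≤ s₂ + s₂') (n₃ : 0 ≤ s₃ + s₃')
    (hp : p ≤ 28 * C ^ 2 * (s₂ + s₂' + (s₃ + s₃'))) (he : e ≤ N * (2 * (s₃ + s₃')))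
    (d₁ : V₁ ≤ -(1 / 4) * s₁ + p) (d₂ : V₂ ≤ -(c / 4) * s₂ + e) (d₂' : V₂' ≤ -(c / 4) * s₂' + e)
    (d₃ : V₃ ≤ -d * s₃) (d₃' : V₃' ≤ -d * s₃') :
    V₁ + κ₂ * (V₂ + V₂') + κ₃ * (V₃ + V₃') ≤ -(1 / 4) * (s₁ + (s₂ + s₂') + (s₃ + s₃')) := by
  have g3 : κ₂ * (V₂ + V₂') ≤ -(28 * C ^ 2 + 1) * (s₂ + s₂') + 4 * N * κ₂ * (s₃ + s₃') := by
    calc κ₂ * (V₂ + V₂') ≤ κ₂ * (-(c / 4) * (s₂ + s₂') + 4 * N * (s₃ + s₃')) :=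
          mul_le_mul_of_nonneg_left (by linarith) hκ₂
      _ = -(κ₂ * (c / 4)) * (s₂ + s₂') + 4 * N * κ₂ * (s₃ + s₃') := by ring
      _ = _ := by rw [eκ₂]
  have g4 : κ₃ * (V₃ + V₃') ≤ -(28 * C ^ 2 + 4 * N * κ₂ + 1) * (s₃ + s₃') := by
    calc κ₃ * (V₃ + V₃') ≤ κ₃ * (-d * (s₃ + s₃')) :=
          mul_le_mul_of_nonneg_left (by linarith) hκ₃
      _ = -(κ₃ * d) * (s₃ + s₃') := by ring
      _ = _ := by rw [eκ₃]
  linarith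

/-- The Lyapunov function. -/
def loopV (P : Params) (K : Gains) (k k₁ c cr κ₂ κ₃ : ℝ) (y : Prm × CState) : ℝ :=
  rodV k (y.1, y.2.1) + κ₂ * (cableV P K c 0 (y.1, y.2.1) + cableV P K c 1 (y.1, y.2.1))
    + κ₃ * (rotV P.J k₁ cr (y.2.rot 0) (y.2.2.2 0) + rotV P.J k₁ cr (y.2.rot 1) (y.2.2.2 1))

theorem rodSq_nonneg (x : TubeArg) : 0 ≤ rodSq x := by rw [rodSq]; positivity

theorem cableSq_nonneg (j : Fin 2) (x : TubeArg) : 0 ≤ cableSq P K j x := by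
  rw [cableSq]; positivity

theorem attSq_nonneg (j : Fin 2) (z : CState) : 0 ≤ attSq j z := by rw [attSq]; positivity

set_option maxHeartbeats 800000 in
-- The constants of the attitude part depend on `k₁` and `k₂`, but any positive values are allowed
-- because the attitudes are autonomous and their weight is chosen last.
theorem exists_isLyapunov {k B : ℝ} (hkx : K.kx = 1) (hkv : K.kv = 1) (hkq : K.kq = k)
    (hkw : K.kw = k) (hkqc : ∀ j, K.kqc j = 1) (hkwc : ∀ j, K.kwc j = 1)
    (hB : ∀ p ∈ prmSet D, len (jetW p.1.1) ≤ B) (hk : 4 + 2 * B + 4 * (2 * B * (B + 1)) ≤ k)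
    {r : ℝ} {S : Set TubeArg} (hS : IsTube P K D r S) {k₁ k₂ : ℝ} (hk₁ : 0 < k₁) (hk₂ : 0 < k₂) :
    ∃ V a b lam, IsLyapunov P K D k₁ k₂ r V a b lam := by
  have hB0 : 0 ≤ B := (len_nonneg _).trans (hB _ (prm_mem D le_rfl))
  have hk4 : 4 ≤ k := by
    have : 0 ≤ 2 * B * (B + 1) := by positivity
    linarith
  obtain ⟨M, hM0, hM⟩ := exists_ctrlBound hS.compact (fun x hx j => (hS.regular x hx j).1)
  obtain ⟨C, hC0, hC⟩ := exists_pert_bound P K hM0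
  obtain ⟨cr, ar, br, dr, -, har, hbr, hdr, hrot, hrot'⟩ := exists_rotV_const P.J_posDef hk₁ hk₂
  set c : ℝ := 1 / (2 + (M + 1) ^ 2) with hc
  have hc0 : 0 < c := by positivity
  have hc1 : c * (2 + (M + 1) ^ 2) = 1 := by
    rw [hc]; exact one_div_mul_cancel (by positivity)
  have hc2 : c ≤ 1 / 2 := by nlinarith [mul_nonneg hc0.le (sq_nonneg (M + 1))]
  -- The disturbance of a cable is at most `(1 + 2 * M) * C` times the attitude errors: directly,
  -- and through the derivatives of its desired direction and angular velocity, with `2` from the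
  -- comparison of norms. The factor `9 / c` is that of `cable_young`.
  set N : ℝ := 9 / c * ((1 + 2 * M) * C) ^ 2 with hN
  have hN0 : 0 ≤ N := by positivity
  -- The number `28` is `7`, from the rod estimate, times `4`, from squaring the sum of four errors.
  set κ₂ : ℝ := (28 * C ^ 2 + 1) * (4 / c) with hκ₂
  set κ₃ : ℝ := (28 * C ^ 2 + 4 * N * κ₂ + 1) / dr with hκ₃
  have hκ₂0 : 0 < κ₂ := by positivity
  have hκ₃0 : 0 < κ₃ := by positivity
  have eκ₂ : κ₂ * (c / 4) = 28 * C ^ 2 + 1 := by rw [hκ₂]; field_simp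
  have eκ₃ : κ₃ * dr = 28 * C ^ 2 + 4 * N * κ₂ + 1 := by rw [hκ₃]; field_simp
  have upper : ∀ p ∈ prmSet D, ∀ z, InTube P K r (p, z) →
      min (1 / 4) (min (κ₂ / 4) (κ₃ * ar)) * totalSq P K (p, z) ≤
        loopV P K k k₁ c cr κ₂ κ₃ (p, z) ∧
      loopV P K k k₁ c cr κ₂ κ₃ (p, z) ≤ (k + 2 + 2 * κ₂ + κ₃ * br) * totalSq P K (p, z) := by
    rintro p hp z ⟨hs, hadm, hE, -⟩
    have hreg := hS.regular _ (hS.mem p hp z.1 hs)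
    have h1 := rodV_bounds (x := (p, z.1)) hk4 (prmSet_unit hp) hadm.1 hs.1.2.1
    have hc := fun j => cableV_bounds (P := P) (K := K) (x := (p, z.1)) (j := j) hc0.le hc2
      (jetQTilde_unit (y := (p.1.1, z.1.1)) (hreg j).1) (hadm.2.2 j).1 (hs.2 j).2.1
    have hr := fun j => hrot (z.rot j) (z.2.2 j) (hE j).1 (hE j).2
    exact weighted_bounds (by linarith) hκ₂0.le hκ₃0.le hbr.le (rodSq_nonneg _)
      (cableSq_nonneg 0 _) (cableSq_nonneg 1 _) (attSq_nonneg 0 z) (attSq_nonneg 1 z) h1 (hc 0)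
      (hc 1) (hr 0) (hr 1)
  have hb0 : 0 < k + 2 + 2 * κ₂ + κ₃ * br := by positivity
  refine ⟨loopV P K k k₁ c cr κ₂ κ₃, _, _, 1 / (4 * (k + 2 + 2 * κ₂ + κ₃ * br)),
    lt_min (by norm_num) (lt_min (by positivity) (by positivity)), hb0, by positivity, upper, ?_⟩
  intro z I t ht htube hz
  have hp := prm_mem D ht
  have hup := (upper _ hp _ htube).2
  obtain ⟨hs, hadm, hE, -⟩ := htube
  have hmem := hS.mem _ hp (z t).1 hs
  have hreg := hS.regular _ hmem
  have hMx := hM _ hmem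
  obtain ⟨p1, p2, p3, p4⟩ := hC _ (z t).rot hMx hreg hE hadm
  obtain ⟨V₁, hV₁, d₁⟩ := rodV_decay hkx hkv hkq hkw (hB _ hp) hk hadm
    (hs.1.2.2.2.2.2.trans hS.le_one) p1 p2 hz
  have hcab := fun j => cableV_decay (hkqc j) (hkwc j) hM0 hc0 hc1 hadm hMx hreg p3 (p4 j) hz
  obtain ⟨V₂, hV₂, d₂⟩ := hcab 0
  obtain ⟨V₃, hV₃, d₃⟩ := hcab 1
  have hJ : P.J * P.J⁻¹ = 1 := Matrix.mul_nonsing_inv _ P.J_posDef.det_pos.ne'.isUnit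
  have hatt := fun j => hrot' (fun τ => (z τ).rot j) (fun τ => (z τ).2.2 j)
    (P.J⁻¹ *ᵥ (-(k₁ • rotErr ((z t).rot j)) - k₂ • (z t).2.2 j)) I t (hE j).1
    (fun a b => hasDerivWithinAt_pi.1 (hasDerivWithinAt_pi.1 (hasDerivWithinAt_pi.1
      hz.snd'.fst' j) a) b)
    (hasDerivWithinAt_pi.1 hz.snd'.snd' j)
    (by rw [Matrix.mulVec_mulVec, hJ, Matrix.one_mulVec])
  obtain ⟨V₄, hV₄, d₄⟩ := hatt 0
  obtain ⟨V₅, hV₅, d₅⟩ := hatt 1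
  refine ⟨V₁ + κ₂ * (V₂ + V₃) + κ₃ * (V₄ + V₅),
    (hV₁.add ((hV₂.add hV₃).const_mul κ₂)).add ((hV₄.add hV₅).const_mul κ₃), ?_⟩
  have hmain : V₁ + κ₂ * (V₂ + V₃) + κ₃ * (V₄ + V₅) ≤ -(1 / 4) * totalSq P K (prm D t, z t) := by
    have q0 : len (jetEqc P K 0 (TubeArg.arg (prm D t, (z t).1))) ^ 2 ≤
        cableSq P K 0 (prm D t, (z t).1) := le_add_of_nonneg_right (sq_nonneg _)
    have q1 : len (jetEqc P K 1 (TubeArg.arg (prm D t, (z t).1))) ^ 2 ≤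
        cableSq P K 1 (prm D t, (z t).1) := le_add_of_nonneg_right (sq_nonneg _)
    have r0 : len (rotErr ((z t).rot 0)) ^ 2 ≤ attSq 0 (z t) :=
      le_add_of_nonneg_right (sq_nonneg _)
    have r1 : len (rotErr ((z t).rot 1)) ^ 2 ≤ attSq 1 (z t) :=
      le_add_of_nonneg_right (sq_nonneg _)
    refine weighted_decay hκ₂0.le hκ₃0.le eκ₂ eκ₃
      (add_nonneg (cableSq_nonneg 0 _) (cableSq_nonneg 1 _))
      (add_nonneg (attSq_nonneg 0 _) (attSq_nonneg 1 _)) ?_ ?_ d₁ d₂ d₃ d₄ d₅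
    · have f4 := sum_four_sq_le (len (jetEqc P K 0 (TubeArg.arg (prm D t, (z t).1))))
        (len (jetEqc P K 1 (TubeArg.arg (prm D t, (z t).1)))) (len (rotErr ((z t).rot 0)))
        (len (rotErr ((z t).rot 1)))
      rw [← rotSum] at f4
      have h5 := mul_le_mul_of_nonneg_left (f4.trans (mul_le_mul_of_nonneg_left
        (add_le_add (add_le_add (add_le_add q0 q1) r0) r1) (by norm_num))) (sq_nonneg C)
      rw [mul_pow]
      linarith
    · have f2 : rotSum (z t).rot ^ 2 ≤ 2 * (attSq 0 (z t) + attSq 1 (z t)) := by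
        rw [rotSum]
        have := sq_nonneg (len (rotErr ((z t).rot 0)) - len (rotErr ((z t).rot 1)))
        linarith
      have e : 9 / c * ((1 + 2 * M) * (C * rotSum (z t).rot)) ^ 2 = N * rotSum (z t).rot ^ 2 := by
        rw [hN]; ring
      rw [e]
      exact mul_le_mul_of_nonneg_left f2 hN0
  refine hmain.trans ?_
  have hlam' := mul_le_mul_of_nonneg_left hup
    (by positivity : 0 ≤ 1 / (4 * (k + 2 + 2 * κ₂ + κ₃ * br)))
  have hlam : 1 / (4 * (k + 2 + 2 * κ₂ + κ₃ * br)) * ((k + 2 + 2 * κ₂ + κ₃ * br)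
      * totalSq P K (prm D t, z t)) = 1 / 4 * totalSq P K (prm D t, z t) := by
    field_simp
  rw [hlam] at hlam'
  linarith

/-- A tube and gains. -/
theorem exists_gains (hD : D.Bounded) : ∃ (K : Gains) (k B : ℝ), K.kx = 1 ∧ K.kv = 1 ∧
    K.kq = k ∧ K.kw = k ∧ (∀ j, K.kqc j = 1) ∧ (∀ j, K.kwc j = 1) ∧
    (∀ p ∈ prmSet D, len (jetW p.1.1) ≤ B) ∧ 4 + 2 * B + 4 * (2 * B * (B + 1)) ≤ k := by
  have hcont : Continuous fun p : Prm => len (jetW p.1.1) := by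
    have := continuous_len
    unfold jetW
    fun_prop
  obtain ⟨B, hB⟩ := ((isCompact_prmSet hD).image hcont).bddAbove
  have hB' : ∀ p ∈ prmSet D, len (jetW p.1.1) ≤ B := fun p hp => hB ⟨p, hp, rfl⟩
  have hB0 : 0 ≤ B := (len_nonneg _).trans (hB' _ (prm_mem D le_rfl))
  -- The threshold is itself taken as the gain of the rod attitude. The bound `B` of the desired
  -- angular velocity is uniform in time and independent of the gains.
  have hk : 0 < 4 + 2 * B + 4 * (2 * B * (B + 1)) := by positivity
  exact ⟨⟨1, 1, _, _, fun _ => 1, fun _ => 1, one_pos, one_pos, hk, hk, fun _ => one_pos,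
    fun _ => one_pos⟩, _, B, rfl, rfl, rfl, rfl, fun _ => rfl, fun _ => rfl, hB', le_rfl⟩

theorem exists_isTube (K : Gains) (hD : D.Bounded) (hnd : D.Nondegenerate P) :
    ∃ r S, IsTube P K D r S := by
  obtain ⟨r, h0, h1, S, hS, h2, h3, h4⟩ := exists_tube K hD hnd
  exact ⟨r, S, h0, h1, hS, fun x hx j => ⟨(h2 x hx).1 j, (h2 x hx).2 j⟩, h3, h4⟩

end Lyapunov

/-! ### Invariance of the tube and exponential decay -/

/-- Exponential decay from a differential inequality. -/
theorem le_exp_of_deriv_le {f : ℝ → ℝ} {I : Set ℝ} {lam a b : ℝ} (hab : a ≤ b)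
    (hI : Set.Icc a b ⊆ I)
    (h : ∀ t ∈ Set.Icc a b, ∃ f', HasDerivWithinAt f f' I t ∧ f' ≤ -lam * f t) :
    f b ≤ f a * Real.exp (-lam * (b - a)) := by
  -- The integrating factor `exp (lam * s)` turns the inequality into monotonicity; no sign of `f`
  -- is needed.
  have hd : ∀ t ∈ Set.Icc a b, ∃ g', HasDerivWithinAt (fun s => f s * Real.exp (lam * s)) g' I t ∧
      g' ≤ 0 := fun t ht => by
    obtain ⟨f', hf', hle⟩ := h t ht
    have he : HasDerivAt (fun s => Real.exp (lam * s)) (Real.exp (lam * t) * lam) t := by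
      simpa using ((hasDerivAt_id t).const_mul lam).exp
    refine ⟨_, hf'.mul he.hasDerivWithinAt, ?_⟩
    have := mul_le_mul_of_nonneg_right hle (Real.exp_pos (lam * t)).le
    linarith
  have hanti : AntitoneOn (fun s => f s * Real.exp (lam * s)) (Set.Icc a b) := by
    refine antitoneOn_of_deriv_nonpos (convex_Icc a b) (fun t ht => ?_) (fun t ht => ?_)
      fun t ht => ?_
    · obtain ⟨g', hg', -⟩ := hd t ht
      exact (hg'.mono hI).continuousWithinAt
    · obtain ⟨g', hg', -⟩ := hd t (interior_subset ht)
      exact (hg'.mono (interior_subset.trans hI)).differentiableWithinAt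
    · obtain ⟨g', hg', hle⟩ := hd t (interior_subset ht)
      have hn : I ∈ 𝓝 t := Filter.mem_of_superset (mem_interior_iff_mem_nhds.1 ht) hI
      rw [(hg'.hasDerivAt hn).deriv]
      exact hle
  have h1 := hanti (Set.left_mem_Icc.2 hab) (Set.right_mem_Icc.2 hab) hab
  simp only at h1
  have h2 := mul_le_mul_of_nonneg_right h1 (Real.exp_pos (-lam * b)).le
  rw [mul_assoc, mul_assoc, ← Real.exp_add, ← Real.exp_add] at h2
  have e1 : lam * b + -lam * b = 0 := by ring
  have e2 : lam * a + -lam * b = -lam * (b - a) := by ring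
  rw [e1, e2, Real.exp_zero, mul_one] at h2
  exact h2

/-- Induction along an interval. -/
theorem forall_Icc_of_step_of_limit {O : ℝ → Prop} {a b : ℝ} (ha : O a)
    (step : ∀ t ∈ Set.Ico a b, (∀ s ∈ Set.Icc a t, O s) → ∀ᶠ s in 𝓝[>] t, O s)
    (limit : ∀ t ∈ Set.Ioc a b, (∀ s ∈ Set.Ico a t, O s) → O t) : ∀ t ∈ Set.Icc a b, O t := by
  by_contra hcon
  push Not at hcon
  obtain ⟨t₁, ht₁, hO₁⟩ := hcon
  set A := {t | t ∈ Set.Icc a b ∧ ¬O t} with hA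
  have hbdd : BddBelow A := ⟨a, fun t ht => ht.1.1⟩
  set m := sInf A with hm
  have hAne : A.Nonempty := ⟨t₁, ht₁, hO₁⟩
  have hm1 : m ≤ t₁ := csInf_le hbdd ⟨ht₁, hO₁⟩
  have hm0 : a ≤ m := le_csInf hAne fun t ht => ht.1.1
  have hbelow : ∀ s ∈ Set.Ico a m, O s := fun s hs => by
    by_contra h
    exact absurd (csInf_le hbdd ⟨⟨hs.1, hs.2.le.trans (hm1.trans ht₁.2)⟩, h⟩) (not_le.2 hs.2)
  have hOm : O m := by
    rcases hm0.eq_or_lt with h | h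
    · rw [← h]; exact ha
    · exact limit m ⟨h, hm1.trans ht₁.2⟩ hbelow
  have hmb : m < b := lt_of_le_of_ne (hm1.trans ht₁.2) fun h => hO₁ (by
    have : t₁ = m := le_antisymm (h ▸ ht₁.2) hm1
    rw [this]; exact hOm)
  have hst := step m ⟨hm0, hmb⟩ fun s hs => by
    rcases hs.2.eq_or_lt with h | h
    · rw [h]; exact hOm
    · exact hbelow s ⟨hs.1, h⟩
  obtain ⟨u, hu, hIoo⟩ := (mem_nhdsGT_iff_exists_Ioo_subset).1 hst
  have : u ≤ m := le_csInf hAne fun t ht => by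
    by_contra hlt
    rcases (csInf_le hbdd ht : m ≤ t).eq_or_lt with h | h
    · exact ht.2 (h ▸ hOm)
    · exact ht.2 (hIoo ⟨h, not_le.1 hlt⟩)
  exact absurd this (not_le.2 hu)

/-! ### Continuity of the error functions where the controller is defined. -/

section Continuity

variable {P : Params} {K : Gains}

theorem continuous_rot (j : Fin 2) (a b : Fin 3) :
    Continuous fun y : Prm × CState => y.2.rot j a b := by
  change Continuous fun y : Prm × CState => y.2.2.1 j a b
  fun_prop

theorem continuous_rotErr_rot (j : Fin 2) :
    Continuous fun y : Prm × CState => rotErr (y.2.rot j) := by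
  refine continuous_pi fun i => ?_
  have h := fun a b => (continuous_const (y := (1 / 2 : ℝ))).mul
    ((continuous_rot j a b).sub (continuous_rot j b a))
  fin_cases i
  · exact h 2 1
  · exact h 0 2
  · exact h 1 0

theorem continuous_rotConfig_rot (j : Fin 2) :
    Continuous fun y : Prm × CState => rotConfig (y.2.rot j) := by
  simp only [rotConfig_eq]
  exact continuous_const.mul (continuous_const.sub (((continuous_rot j 0 0).add
    (continuous_rot j 1 1)).add (continuous_rot j 2 2)))

theorem continuous_attSq (j : Fin 2) : Continuous fun y : Prm × CState => attSq j y.2 :=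
  ((continuous_len.comp (continuous_rotErr_rot j)).pow 2).add
    ((continuous_len.comp (by fun_prop)).pow 2)

theorem continuous_rodSq : Continuous fun y : Prm × CState => rodSq (y.1, y.2.1) := by
  have := continuous_len
  unfold rodSq jetEw jetW
  fun_prop

theorem continuousAt_arg (y : Prm × CState) :
    ContinuousAt (fun y : Prm × CState => TubeArg.arg (y.1, y.2.1)) y := by
  unfold TubeArg.arg; fun_prop

theorem continuousAt_cableSq {y : Prm × CState} {j : Fin 2}
    (h : jetMuTilde P K j y.1.1.1 y.2.1.1 ≠ 0) :
    ContinuousAt (fun y : Prm × CState => cableSq P K j (y.1, y.2.1)) y := by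
  have h1 := (contDiffAt_jetEqc (y := TubeArg.arg (y.1, y.2.1)) j h).continuousAt.comp
    (f := fun y : Prm × CState => TubeArg.arg (y.1, y.2.1)) (continuousAt_arg y)
  have h2 := (contDiffAt_jetEwc (y := TubeArg.arg (y.1, y.2.1)) j h).continuousAt.comp
    (f := fun y : Prm × CState => TubeArg.arg (y.1, y.2.1)) (continuousAt_arg y)
  exact ((continuous_len.continuousAt.comp h1).pow 2).add
    ((continuous_len.continuousAt.comp h2).pow 2)

theorem continuousAt_jetQTilde_dot {y : Prm × CState} {j : Fin 2}
    (h : jetMuTilde P K j y.1.1.1 y.2.1.1 ≠ 0) :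
    ContinuousAt (fun y : Prm × CState =>
      jetQTilde P K j (y.1.1.1, y.2.1.1) ⬝ᵥ y.2.1.2.1 j) y := by
  have h1 := (contDiffAt_jetQTilde (y := (y.1.1.1, y.2.1.1)) j h).continuousAt.comp
    (f := fun y : Prm × CState => (y.1.1.1, y.2.1.1)) (x := y) (by fun_prop)
  have h2 : ContinuousAt (fun y : Prm × CState => y.2.1.2.1 j) y := by fun_prop
  have h3 := ContinuousWithinAt.dot (s := Set.univ) h1.continuousWithinAt h2.continuousWithinAt
  exact continuousWithinAt_univ _ _ |>.1 h3

theorem continuousAt_totalSq {y : Prm × CState} (h : ∀ j, jetMuTilde P K j y.1.1.1 y.2.1.1 ≠ 0) :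
    ContinuousAt (totalSq P K) y :=
  (continuous_rodSq.continuousAt.add ((continuousAt_cableSq (h 0)).add
    (continuousAt_cableSq (h 1)))).add
      ((continuous_attSq 0).continuousAt.add (continuous_attSq 1).continuousAt)

end Continuity

/-- The configuration errors are less than one. -/
def NearZ (P : Params) (K : Gains) (y : Prm × CState) : Prop :=
  0 < y.1.1.1.2.1 ⬝ᵥ qR y.2.1.1 ∧
  (∀ j, 0 < jetQTilde P K j (y.1.1.1, y.2.1.1) ⬝ᵥ y.2.1.2.1 j) ∧ ∀ j, rotConfig (y.2.rot j) < 1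

/-! ### Openness and closedness of the tube conditions. -/

section Tube

variable {P : Params} {K : Gains} {D : Desired} {r : ℝ} {S : Set TubeArg}

theorem len_le_of_sq_le {v : V3} {s : ℝ} (hs : 0 ≤ s) (h : len v ^ 2 ≤ s ^ 2) : len v ≤ s :=
  (sq_le_sq₀ (len_nonneg v) hs).1 h

theorem rodSmall_of_sq {s : ℝ} {x : TubeArg} (hs : 0 ≤ s) (ha : qR x.2.1 ⬝ᵥ qR x.2.1 = 1)
    (h0 : 0 ≤ x.1.1.1.2.1 ⬝ᵥ qR x.2.1) (h : rodSq x ≤ s ^ 2) : RodSmall s x.1.1.1 x.2.1 := by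
  rw [rodSq] at h
  have n1 := sq_nonneg (len (xR x.2.1))
  have n2 := sq_nonneg (len (vR x.2.1))
  have n3 := sq_nonneg (len (x.1.1.1.2.1 ⨯₃ qR x.2.1))
  have n4 := sq_nonneg (len (jetEw x.1.1.1 x.2.1))
  exact ⟨ha, h0, len_le_of_sq_le hs (by linarith), len_le_of_sq_le hs (by linarith),
    len_le_of_sq_le hs (by linarith), len_le_of_sq_le hs (by linarith)⟩

theorem rodSq_le_totalSq (y : Prm × CState) : rodSq (y.1, y.2.1) ≤ totalSq P K y := by
  rw [totalSq]
  linarith [cableSq_nonneg (P := P) (K := K) 0 (y.1, y.2.1),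
    cableSq_nonneg (P := P) (K := K) 1 (y.1, y.2.1), attSq_nonneg 0 y.2, attSq_nonneg 1 y.2]

theorem cableSq_le_totalSq (j : Fin 2) (y : Prm × CState) :
    cableSq P K j (y.1, y.2.1) ≤ totalSq P K y := by
  have h := rodSq_nonneg (y.1, y.2.1)
  have h0 := cableSq_nonneg (P := P) (K := K) 0 (y.1, y.2.1)
  have h1 := cableSq_nonneg (P := P) (K := K) 1 (y.1, y.2.1)
  have h2 := attSq_nonneg 0 y.2
  have h3 := attSq_nonneg 1 y.2
  rw [totalSq]
  fin_cases j
  · change cableSq P K 0 (y.1, y.2.1) ≤ _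
    linarith
  · change cableSq P K 1 (y.1, y.2.1) ≤ _
    linarith

theorem attSq_le_totalSq (j : Fin 2) (y : Prm × CState) : attSq j y.2 ≤ totalSq P K y := by
  have h := rodSq_nonneg (y.1, y.2.1)
  have h0 := cableSq_nonneg (P := P) (K := K) 0 (y.1, y.2.1)
  have h1 := cableSq_nonneg (P := P) (K := K) 1 (y.1, y.2.1)
  have h2 := attSq_nonneg 0 y.2
  have h3 := attSq_nonneg 1 y.2
  rw [totalSq]
  fin_cases j
  · change attSq 0 y.2 ≤ _
    linarith
  · change attSq 1 y.2 ≤ _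
    linarith

theorem totalSq_nonneg (y : Prm × CState) : 0 ≤ totalSq P K y :=
  (rodSq_nonneg _).trans (rodSq_le_totalSq y)

theorem small_of_sq {s : ℝ} {y : Prm × CState} (hs : 0 ≤ s) (ha : Admissible y.2.1)
    (h0 : 0 ≤ y.1.1.1.2.1 ⬝ᵥ qR y.2.1.1)
    (h1 : ∀ j, 0 ≤ jetQTilde P K j (y.1.1.1, y.2.1.1) ⬝ᵥ y.2.1.2.1 j)
    (h : totalSq P K y ≤ s ^ 2) : Small P K s (y.1.1, y.2.1) := by
  refine ⟨rodSmall_of_sq (x := (y.1, y.2.1)) hs ha.1 h0 ((rodSq_le_totalSq y).trans h), fun j => ?_⟩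
  have hc := (cableSq_le_totalSq j y).trans h
  rw [cableSq] at hc
  exact ⟨(ha.2.2 j).1, h1 j,
    len_le_of_sq_le hs (le_trans (le_add_of_nonneg_right (sq_nonneg _)) hc),
    len_le_of_sq_le hs (le_trans (le_add_of_nonneg_left (sq_nonneg _)) hc)⟩

theorem dot_ne_zero_of_cross_lt {p q : V3} (hp : p ⬝ᵥ p = 1) (hq : q ⬝ᵥ q = 1) {s : ℝ}
    (h : len (p ⨯₃ q) ≤ s) (hs : s < 1) : p ⬝ᵥ q ≠ 0 := fun h0 => by
  have := len_cross_unit_sq hp hq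
  rw [h0] at this
  nlinarith [len_nonneg (p ⨯₃ q)]

/-- Weak inequalities for the configuration errors are strict in the tube. -/
theorem nearZ_of_le (hS : IsTube P K D r S) {s : ℝ} (hs : 0 ≤ s) (hsr : s ≤ r) (hs1 : s < 1)
    {p : Prm} (hp : p ∈ prmSet D) {z : CState} (ha : Admissible z.1)
    (h0 : 0 ≤ p.1.1.2.1 ⬝ᵥ qR z.1.1)
    (h1 : ∀ j, 0 ≤ jetQTilde P K j (p.1.1, z.1.1) ⬝ᵥ z.1.2.1 j)
    (h2 : ∀ j, rotConfig (z.rot j) ≤ 1) (hE : Regular P K (p, z.1) → ∀ j, z.rot j ∈ SO3)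
    (h : totalSq P K (p, z) ≤ s ^ 2) : NearZ P K (p, z) := by
  have hsm := small_of_sq (P := P) (K := K) (y := (p, z)) hs ha h0 h1 h
  have hreg := hS.regular _ (hS.mem p hp z.1 (hsm.mono hsr))
  refine ⟨lt_of_le_of_ne h0 (dot_ne_zero_of_cross_lt (prmSet_unit hp) ha.1
    hsm.1.2.2.2.2.1 hs1).symm, fun j => lt_of_le_of_ne (h1 j) (dot_ne_zero_of_cross_lt
    (jetQTilde_unit (y := (p.1.1, z.1.1)) (hreg j).1) (ha.2.2 j).1 (hsm.2 j).2.2.1 hs1).symm,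
    fun j => lt_of_le_of_ne (h2 j) fun h3 => ?_⟩
  have h4 := SO3.len_rotErr_sq (hE hreg j)
  change rotConfig (z.rot j) = 1 at h3
  rw [h3] at h4
  have h5 := (attSq_le_totalSq (P := P) (K := K) j (p, z)).trans h
  rw [attSq] at h5
  change len (rotErr (z.rot j)) ^ 2 + len (z.2.2 j) ^ 2 ≤ s ^ 2 at h5
  nlinarith [sq_nonneg (len (z.2.2 j))]

/-- The order matters: small rod and cable errors give regularity, and only then is the desired
attitude known to be a rotation, so that the relative rotation lies in `SO3`. -/
theorem inTube_of_nearZ (hS : IsTube P K D r S) {p : Prm} (hp : p ∈ prmSet D) {z : CState}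
    (ha : Admissible z.1) (hE : Regular P K (p, z.1) → ∀ j, z.rot j ∈ SO3)
    (hn : NearZ P K (p, z)) (h : totalSq P K (p, z) ≤ r ^ 2) :
    Regular P K (p, z.1) ∧ InTube P K r (p, z) := by
  have hsm := small_of_sq (P := P) (K := K) (y := (p, z)) hS.pos.le ha hn.1.le
    (fun j => (hn.2.1 j).le) h
  have hreg := hS.regular _ (hS.mem p hp z.1 hsm)
  refine ⟨hreg, hsm, ha, fun j => ⟨hE hreg j, (hn.2.2 j).le⟩, fun j => ?_⟩
  have h5 := (attSq_le_totalSq (P := P) (K := K) j (p, z)).trans h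
  exact len_le_of_sq_le hS.pos.le (le_trans (le_add_of_nonneg_left (sq_nonneg _)) h5)

theorem nearZ_eventually {y : ℝ → Prm × CState} {l : Filter ℝ} {s : ℝ}
    (hc : Filter.Tendsto y l (𝓝 (y s)))
    (hmu : ∀ j, jetMuTilde P K j (y s).1.1.1 (y s).2.1.1 ≠ 0) (hn : NearZ P K (y s))
    (hr : totalSq P K (y s) < r ^ 2) :
    ∀ᶠ τ in l, NearZ P K (y τ) ∧ totalSq P K (y τ) < r ^ 2 := by
  have c1 := (continuousAt_totalSq hmu).tendsto.comp hc
  have c2 := (Continuous.continuousAt (f := fun y : Prm × CState => y.1.1.1.2.1 ⬝ᵥ qR y.2.1.1)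
    (x := y s) (by fun_prop)).tendsto.comp hc
  have c3 := fun j => (continuousAt_jetQTilde_dot (hmu j)).tendsto.comp hc
  have c4 := fun j => (continuous_rotConfig_rot j).continuousAt.tendsto.comp hc
  have d1 := c1.eventually (gt_mem_nhds hr)
  have d2 := c2.eventually (lt_mem_nhds hn.1)
  have d3 := Filter.eventually_all.2 fun j => (c3 j).eventually (lt_mem_nhds (hn.2.1 j))
  have d4 := Filter.eventually_all.2 fun j => (c4 j).eventually (gt_mem_nhds (hn.2.2 j))
  filter_upwards [d1, d2, d3, d4] with τ h1 h2 h3 h4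
  exact ⟨⟨h2, h3, h4⟩, h1⟩

/-- In the limit the sign conditions hold only weakly; being inside half the tube, where the sines
are less than one, makes them strict again. -/
theorem nearZ_of_tendsto (hS : IsTube P K D r S) {y : ℝ → Prm × CState} {l : Filter ℝ} [l.NeBot]
    {s : ℝ} (hc : Filter.Tendsto y l (𝓝 (y s))) (hp : (y s).1 ∈ prmSet D)
    (ha : Admissible (y s).2.1)
    (hE : Regular P K ((y s).1, (y s).2.1) → ∀ j, (y s).2.rot j ∈ SO3)
    (hn : ∀ᶠ τ in l, NearZ P K (y τ)) (hsq : ∀ᶠ τ in l, totalSq P K (y τ) ≤ (r / 2) ^ 2) :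
    NearZ P K (y s) ∧ totalSq P K (y s) ≤ (r / 2) ^ 2 := by
  have hr0 := hS.pos
  have hr1 := hS.le_one
  -- The rod errors are continuous everywhere, so they are treated first: they show that the forces
  -- do not vanish at the limit, where the cable errors then become continuous too.
  have r1 : rodSq ((y s).1, (y s).2.1) ≤ (r / 2) ^ 2 :=
    le_of_tendsto (continuous_rodSq.continuousAt.tendsto.comp hc)
      (hsq.mono fun τ hτ => (rodSq_le_totalSq (y τ)).trans hτ)
  have r2 : 0 ≤ (y s).1.1.1.2.1 ⬝ᵥ qR (y s).2.1.1 :=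
    ge_of_tendsto ((Continuous.continuousAt (f := fun y : Prm × CState =>
      y.1.1.1.2.1 ⬝ᵥ qR y.2.1.1) (x := y s) (by fun_prop)).tendsto.comp hc)
      (hn.mono fun τ hτ => hτ.1.le)
  have hmu := hS.rod (y s).1 hp (y s).2.1.1
    ((rodSmall_of_sq (x := ((y s).1, (y s).2.1)) (by linarith) ha.1 r2 r1).mono (by linarith))
  have r3 : totalSq P K (y s) ≤ (r / 2) ^ 2 :=
    le_of_tendsto ((continuousAt_totalSq hmu).tendsto.comp hc) hsq
  have r4 : ∀ j, 0 ≤ jetQTilde P K j ((y s).1.1.1, (y s).2.1.1) ⬝ᵥ (y s).2.1.2.1 j := fun j =>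
    ge_of_tendsto ((continuousAt_jetQTilde_dot (hmu j)).tendsto.comp hc)
      (hn.mono fun τ hτ => (hτ.2.1 j).le)
  have r5 : ∀ j, rotConfig ((y s).2.rot j) ≤ 1 := fun j =>
    le_of_tendsto ((continuous_rotConfig_rot j).continuousAt.tendsto.comp hc)
      (hn.mono fun τ hτ => (hτ.2.2 j).le)
  exact ⟨nearZ_of_le hS (by linarith) (by linarith) (by linarith) hp ha r2 r4 r5 hE r3, r3⟩

end Tube

/-! ### Continuation in the tube and decay of the errors. -/

section Core

variable {P : Params} {K : Gains} {D : Desired} {r : ℝ} {S : Set TubeArg} {k₁ k₂ a b lam : ℝ}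
  {V : Prm × CState → ℝ}

/-- Motions of the closed loop with small initial errors stay in the tube, and their errors
decay. -/
theorem IsLyapunov.loop_decay (hV : IsLyapunov P K D k₁ k₂ r V a b lam) (hS : IsTube P K D r S)
    {t₀ : ℝ} (ht₀ : 0 ≤ t₀) {I : Set ℝ} (hI : ∀ t ∈ I, Set.Icc t₀ t ⊆ I)
    (hI' : ∀ t ∈ I, t₀ ≤ t) {z : ℝ → CState} (hz : IsLoop P K D k₁ k₂ r I z)
    (hn : NearZ P K (prm D t₀, z t₀)) (h0 : b / a * totalSq P K (prm D t₀, z t₀) ≤ (r / 2) ^ 2)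
    (hr : totalSq P K (prm D t₀, z t₀) < r ^ 2) :
    ∀ t ∈ I, NearZ P K (prm D t, z t) ∧ totalSq P K (prm D t, z t) < r ^ 2 ∧
      totalSq P K (prm D t, z t) ≤
        b / a * totalSq P K (prm D t₀, z t₀) * Real.exp (-lam * (t - t₀)) := by
  have ha := hV.a_pos
  have hb := hV.b_pos
  have hr0 := hS.pos
  have hr1 := hS.le_one
  set O : ℝ → Prop := fun t => NearZ P K (prm D t, z t) ∧ totalSq P K (prm D t, z t) < r ^ 2
    with hO
  have hcont : ∀ t ∈ I, ContinuousWithinAt (fun τ => (prm D τ, z τ)) I t := fun t ht =>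
    (contDiff_prm D).continuous.continuousWithinAt.prodMk (hz.cont t ht)
  have hpm : ∀ t ∈ I, prm D t ∈ prmSet D := fun t ht => prm_mem D (ht₀.trans (hI' t ht))
  have tube : ∀ t ∈ I, O t → Regular P K (prm D t, (z t).1) ∧ InTube P K r (prm D t, z t) :=
    fun t ht h => inTube_of_nearZ hS (hpm t ht) (hz.adm t ht) (hz.rot t ht) h.1 h.2.le
  have est : ∀ t ∈ I, (∀ s ∈ Set.Icc t₀ t, O s) → totalSq P K (prm D t, z t) ≤
      b / a * totalSq P K (prm D t₀, z t₀) * Real.exp (-lam * (t - t₀)) := fun t ht h => by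
    have ht0 := hI' t ht
    have h1 := le_exp_of_deriv_le (f := fun τ => V (prm D τ, z τ)) (lam := lam) ht0 (hI t ht)
      fun s hs => by
        obtain ⟨hreg, htu⟩ := tube s (hI t ht hs) (h s hs)
        exact hV.decay z I s (ht₀.trans hs.1) htu (hz.dyn s (hI t ht hs) hreg htu)
    have h2 := (hV.bounds _ (hpm t ht) _ (tube t ht (h t ⟨ht0, le_rfl⟩)).2).1
    have ht₀I : t₀ ∈ I := hI t ht ⟨le_rfl, ht0⟩
    have h3 := (hV.bounds _ (hpm t₀ ht₀I) _ (tube t₀ ht₀I (h t₀ ⟨le_rfl, ht0⟩)).2).2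
    have h4 := h2.trans (h1.trans (mul_le_mul_of_nonneg_right h3 (Real.exp_pos _).le))
    rw [div_mul_eq_mul_div, div_mul_eq_mul_div, le_div_iff₀ ha]
    linarith
  have main : ∀ t ∈ I, ∀ s ∈ Set.Icc t₀ t, O s := fun t ht => by
    refine forall_Icc_of_step_of_limit ⟨hn, hr⟩ ?_ ?_
    · intro s hs hall
      have hsI : s ∈ I := hI t ht ⟨hs.1, hs.2.le⟩
      obtain ⟨hreg, -⟩ := tube s hsI (hall s ⟨hs.1, le_rfl⟩)
      have hOs := hall s ⟨hs.1, le_rfl⟩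
      have hmu : ∀ j, jetMuTilde P K j (prm D s).1.1 (z s).1.1 ≠ 0 := fun j => (hreg j).1
      have e1 : ∀ᶠ τ in 𝓝[I] s, O τ :=
        nearZ_eventually (y := fun τ => (prm D τ, z τ)) (hcont s hsI) hmu hOs.1 hOs.2
      have hsub : Set.Ioc s t ⊆ I := fun τ hτ => hI t ht ⟨hs.1.trans hτ.1.le, hτ.2⟩
      have e2 := nhdsWithin_mono s hsub e1
      rwa [nhdsWithin_Ioc_eq_nhdsGT hs.2] at e2
    · intro s hs hall
      have hsI : s ∈ I := hI t ht ⟨hs.1.le, hs.2⟩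
      have hsub : Set.Ico t₀ s ⊆ I := fun τ hτ => hI t ht ⟨hτ.1, hτ.2.le.trans hs.2⟩
      have hne : (𝓝[Set.Ico t₀ s] s).NeBot := by
        rw [nhdsWithin_Ico_eq_nhdsLT hs.1]; infer_instance
      have hc : ContinuousWithinAt (fun τ => (prm D τ, z τ)) (Set.Ico t₀ s) s :=
        (hcont s hsI).mono hsub
      -- As long as the motion is in the tube, the Lyapunov estimate confines it to half the radius.
      -- This closes the continuation argument.
      have hsq : ∀ τ ∈ Set.Ico t₀ s, totalSq P K (prm D τ, z τ) ≤ (r / 2) ^ 2 := fun τ hτ => by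
        have h1 := est τ (hsub hτ) fun σ hσ => hall σ ⟨hσ.1, hσ.2.trans_lt hτ.2⟩
        refine h1.trans ((mul_le_of_le_one_right ?_ ?_).trans h0)
        · exact mul_nonneg (div_pos hb ha).le (totalSq_nonneg _)
        · rw [Real.exp_le_one_iff]
          have := mul_nonneg hV.lam_pos.le (sub_nonneg.2 hτ.1)
          linarith
      have hev : ∀ {q : ℝ → Prop}, (∀ τ ∈ Set.Ico t₀ s, q τ) → ∀ᶠ τ in 𝓝[Set.Ico t₀ s] s, q τ :=
        fun h => Filter.eventually_of_mem self_mem_nhdsWithin h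
      obtain ⟨h1, h2⟩ := nearZ_of_tendsto hS (y := fun τ => (prm D τ, z τ)) hc (hpm s hsI)
        (hz.adm s hsI) (hz.rot s hsI) (hev fun τ hτ => (hall τ hτ).1) (hev hsq)
      exact ⟨h1, h2.trans_lt (by nlinarith)⟩
  intro t ht
  have h1 := main t ht t ⟨hI' t ht, le_rfl⟩
  exact ⟨h1.1, h1.2, est t ht (main t ht)⟩

end Core

/-! ### Global solutions of differential equations with bounded Lipschitz right-hand side -/

/-- A function that is smooth near a compact set agrees there with a bounded Lipschitz function. -/
theorem exists_cutoff {E F : Type*} [NormedAddCommGroup E] [NormedSpace ℝ E]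
    [FiniteDimensional ℝ E] [NormedAddCommGroup F] [NormedSpace ℝ F] {T : Set E}
    (hT : IsCompact T) {f : E → F} (hf : ∀ x ∈ T, ContDiffAt ℝ 1 f x) :
    ∃ (χ : E → ℝ) (L : NNReal) (M : ℝ), (∀ x ∈ T, χ x = 1) ∧ LipschitzWith L (fun x => χ x • f x) ∧
      ∀ x, ‖χ x • f x‖ ≤ M := by
  have hU : IsOpen {x | ContDiffAt ℝ 1 f x} :=
    isOpen_iff_mem_nhds.2 fun x hx =>
      ContDiffAt.eventually (show ContDiffAt ℝ 1 f x from hx) (by simp)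
  -- Points of finite smoothness order form an open set. A bump function equal to one near `T` and
  -- supported in a compact part of this set extends the field by zero, and compact support makes it
  -- Lipschitz and bounded.
  obtain ⟨C, hC, hTC, hCU⟩ := exists_compact_between hT hU hf
  obtain ⟨χ, h1, h0, -⟩ := exists_contMDiffMap_one_nhds_of_subset_interior
    (modelWithCornersSelf ℝ E) (n := 1) hT.isClosed hTC
  have hχ : ContDiff ℝ 1 χ := contMDiff_iff_contDiff.1 χ.contMDiff
  have hsupp : HasCompactSupport fun x => χ x • f x :=
    HasCompactSupport.intro hC fun x hx => by rw [h0 x hx, zero_smul]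
  have hg : ContDiff ℝ 1 fun x => χ x • f x := contDiff_iff_contDiffAt.2 fun x => by
    by_cases hx : x ∈ C
    · exact hχ.contDiffAt.smul (hCU hx)
    · have : (fun x => χ x • f x) =ᶠ[𝓝 x] fun _ => 0 := by
        filter_upwards [hC.isClosed.isOpen_compl.mem_nhds hx] with y hy
        rw [h0 y hy, zero_smul]
      exact contDiffAt_const.congr_of_eventuallyEq this
  obtain ⟨L, hL⟩ := hg.lipschitzWith_of_hasCompactSupport hsupp one_ne_zero
  obtain ⟨M, hM⟩ := hsupp.exists_bound_of_continuous hg.continuous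
  exact ⟨χ, L, M, fun x hx => h1.self_of_nhdsSet x hx, hL, hM⟩

section Global

variable {E : Type*} [NormedAddCommGroup E] [NormedSpace ℝ E] [CompleteSpace E]

/-- A field bounded by `M` cannot leave the ball of radius `M * (T - t₀)` before time `T`, so a
single application of the Picard–Lindelöf theorem covers the interval. -/
theorem exists_solution_Icc {v : ℝ → E → E} {L : NNReal} {M : ℝ} (hL : ∀ t, LipschitzWith L (v t))
    (hc : ∀ x, Continuous fun t => v t x) (hM : ∀ t x, ‖v t x‖ ≤ M) (t₀ : ℝ) (x₀ : E) {T : ℝ}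
    (hT : t₀ ≤ T) : ∃ z : ℝ → E, z t₀ = x₀ ∧
      ∀ t ∈ Set.Icc t₀ T, HasDerivWithinAt z (v t (z t)) (Set.Icc t₀ T) t := by
  have hM0 : 0 ≤ M := (norm_nonneg _).trans (hM t₀ x₀)
  have h : IsPicardLindelof v (tmin := t₀) (tmax := T) ⟨t₀, le_rfl, hT⟩ x₀
      ⟨M * (T - t₀), mul_nonneg hM0 (sub_nonneg.2 hT)⟩ 0 ⟨M, hM0⟩ L :=
    { lipschitzOnWith := fun t _ => (hL t).lipschitzOnWith
      continuousOn := fun x _ => (hc x).continuousOn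
      norm_le := fun t _ x _ => hM t x
      mul_max_le := by
        simp [sub_nonneg.2 hT]
        exact le_rfl }
  exact h.exists_eq_forall_mem_Icc_hasDerivWithinAt₀

theorem exists_solution_Ici {v : ℝ → E → E} {L : NNReal} {M : ℝ} (hL : ∀ t, LipschitzWith L (v t))
    (hc : ∀ x, Continuous fun t => v t x) (hM : ∀ t x, ‖v t x‖ ≤ M) (t₀ : ℝ) (x₀ : E) :
    ∃ z : ℝ → E, z t₀ = x₀ ∧
      ∀ t ∈ Set.Ici t₀, HasDerivWithinAt z (v t (z t)) (Set.Ici t₀) t := by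
  choose α h0 hα using fun n : ℕ => exists_solution_Icc hL hc hM t₀ x₀
    (le_add_of_nonneg_right n.cast_nonneg : t₀ ≤ t₀ + n)
  have heq : ∀ {m n : ℕ}, m ≤ n → Set.EqOn (α m) (α n) (Set.Icc t₀ (t₀ + m)) := fun {m n} hmn => by
    have hsub : Set.Icc t₀ (t₀ + m) ⊆ Set.Icc t₀ (t₀ + n) :=
      Set.Icc_subset_Icc_right (by gcongr)
    have key : ∀ k : ℕ, m ≤ k → ContinuousOn (α k) (Set.Icc t₀ (t₀ + m)) ∧
        ∀ t ∈ Set.Ico t₀ (t₀ + m), HasDerivWithinAt (α k) (v t (α k t)) (Set.Ici t) t :=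
      fun k hk => by
        have hk' : (m : ℝ) ≤ k := by exact_mod_cast hk
        refine ⟨fun t ht => ((hα k t ⟨ht.1, by linarith [ht.2]⟩).continuousWithinAt).mono
          (Set.Icc_subset_Icc_right (by gcongr)), fun t ht => ?_⟩
        refine (hα k t ⟨ht.1, by linarith [ht.2]⟩).mono_of_mem_nhdsWithin ?_
        exact Filter.mem_of_superset (Icc_mem_nhdsGE (show t < t₀ + k by linarith [ht.2]))
          (Set.Icc_subset_Icc_left ht.1)
    exact ODE_solution_unique hL (key m le_rfl).1 (key m le_rfl).2 (key n hmn).1 (key n hmn).2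
      ((h0 m).trans (h0 n).symm)
  refine ⟨fun t => α ⌈t - t₀⌉₊ t, by simp [h0], fun t ht => ?_⟩
  have ht' : t₀ ≤ t := ht
  -- One more than the ceiling puts `t` strictly before the end of the interval, so the glued
  -- function is a single solution on a neighbourhood of `t` in the half-line.
  set n := ⌈t - t₀⌉₊ + 1 with hn
  have htn : t < t₀ + n := by
    have := Nat.le_ceil (t - t₀)
    rw [hn]; push_cast; linarith
  have hz : ∀ s ∈ Set.Icc t₀ (t₀ + n), α ⌈s - t₀⌉₊ s = α n s := fun s hs =>
    heq (Nat.ceil_le.2 (by linarith [hs.2])) ⟨hs.1, by linarith [Nat.le_ceil (s - t₀)]⟩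
  have hd := (hα n t ⟨ht', htn.le⟩).congr hz (hz t ⟨ht', htn.le⟩)
  simp only [hz t ⟨ht', htn.le⟩] at hd ⊢
  refine hd.mono_of_mem_nhdsWithin ?_
  rw [← Set.Ici_inter_Iic]
  exact inter_mem_nhdsWithin _ (Iic_mem_nhds htn)

end Global

/-- Solutions of a cut-off differential equation with smooth coefficients. -/
theorem exists_cutoff_solution {Q E : Type*} [NormedAddCommGroup Q] [NormedSpace ℝ Q]
    [FiniteDimensional ℝ Q] [NormedAddCommGroup E] [NormedSpace ℝ E] [FiniteDimensional ℝ E]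
    {T : Set (Q × E)} (hT : IsCompact T) {f : Q × E → E} (hf : ∀ x ∈ T, ContDiffAt ℝ 1 f x)
    {p : ℝ → Q} (hp : Continuous p) (t₀ : ℝ) (z₀ : E) :
    ∃ (z : ℝ → E) (c : ℝ → ℝ), z t₀ = z₀ ∧
      (∀ t ∈ Set.Ici t₀, HasDerivWithinAt z (c t • f (p t, z t)) (Set.Ici t₀) t) ∧
      ∀ t, (p t, z t) ∈ T → c t = 1 := by
  have : CompleteSpace E := FiniteDimensional.complete ℝ E
  obtain ⟨χ, L, M, h1, hL, hM⟩ := exists_cutoff hT hf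
  obtain ⟨z, hz0, hz⟩ := exists_solution_Ici
    (v := fun t z => χ (p t, z) • f (p t, z)) (L := L * 1) (M := M)
    (fun t => hL.comp (LipschitzWith.prodMk_left (p t)))
    (fun x => hL.continuous.comp (hp.prodMk continuous_const)) (fun t x => hM _) t₀ z₀
  exact ⟨z, fun t => χ (p t, z t), hz0, hz, fun t ht => h1 _ ht⟩

/-! ### Existence of motions of the closed loop -/

theorem hasDerivWithinAt_mul_mat {A B : ℝ → M3} {A' B' : M3} {I : Set ℝ} {t : ℝ}
    (hA : ∀ a b, HasDerivWithinAt (fun s => A s a b) (A' a b) I t)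
    (hB : ∀ a b, HasDerivWithinAt (fun s => B s a b) (B' a b) I t) (a b : Fin 3) :
    HasDerivWithinAt (fun s => (A s * B s) a b) ((A' * B t + A t * B') a b) I t := by
  simp only [Matrix.mul_apply, Matrix.add_apply, ← Finset.sum_add_distrib]
  exact HasDerivWithinAt.fun_sum fun i _ => (hA a i).mul (hB i b)

theorem hat_transpose (v : V3) : (hat v)ᵀ = -hat v := by
  ext i j; fin_cases i <;> fin_cases j <;> simp [hat]

theorem hat_smul (c : ℝ) (v : V3) : hat (c • v) = c • hat v := by
  ext i j; fin_cases i <;> fin_cases j <;> simp [hat]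

theorem eq_of_hasDerivWithinAt_zero {E : Type*} [NormedAddCommGroup E] [NormedSpace ℝ E]
    {f : ℝ → E} {t₀ : ℝ} (h : ∀ t ∈ Set.Ici t₀, HasDerivWithinAt f 0 (Set.Ici t₀) t) {t : ℝ}
    (ht : t₀ ≤ t) : f t = f t₀ :=
  (convex_Ici t₀).is_const_of_fderivWithin_eq_zero (𝕜 := ℝ) (fun s hs => (h s hs).differentiableWithinAt)
    (fun s hs => by
      ext
      rw [(h s hs).hasFDerivWithinAt.fderivWithin (uniqueDiffOn_Ici t₀ s hs)]
      simp) ht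
    (Set.mem_Ici.2 le_rfl)

/-- The factor `c` is admitted because the cut-off field is a multiple of the true one; a multiple
of a tangential rate preserves the constraint as well. -/
theorem dot_self_eq_of_rate {q w : ℝ → V3} {c : ℝ → ℝ} {t₀ : ℝ}
    (hq : ∀ t ∈ Set.Ici t₀, HasDerivWithinAt q (c t • (w t ⨯₃ q t)) (Set.Ici t₀) t) {t : ℝ}
    (ht : t₀ ≤ t) : q t ⬝ᵥ q t = q t₀ ⬝ᵥ q t₀ := by
  refine eq_of_hasDerivWithinAt_zero (f := fun t => q t ⬝ᵥ q t) (fun s hs => ?_) ht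
  refine ((hq s hs).dot (hq s hs)).congr_deriv ?_
  rw [smul_dotProduct, dotProduct_smul, dot_cross_self, dotProduct_comm, dot_cross_self]
  simp

theorem dot_eq_of_rate {q w a : ℝ → V3} {c : ℝ → ℝ} {t₀ : ℝ}
    (hq : ∀ t ∈ Set.Ici t₀, HasDerivWithinAt q (c t • (w t ⨯₃ q t)) (Set.Ici t₀) t)
    (hw : ∀ t ∈ Set.Ici t₀, HasDerivWithinAt w (c t • (q t ⨯₃ a t)) (Set.Ici t₀) t) {t : ℝ}
    (ht : t₀ ≤ t) : w t ⬝ᵥ q t = w t₀ ⬝ᵥ q t₀ := by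
  refine eq_of_hasDerivWithinAt_zero (f := fun t => w t ⬝ᵥ q t) (fun s hs => ?_) ht
  refine ((hw s hs).dot (hq s hs)).congr_deriv ?_
  rw [smul_dotProduct, dotProduct_smul, dot_self_cross, dotProduct_comm, dot_self_cross]
  simp

/-- Rotations are preserved by `E' = E hat v`. -/
theorem mem_SO3_of_rate {E : ℝ → M3} {v : ℝ → V3} {t₀ : ℝ}
    (hE : ∀ t ∈ Set.Ici t₀, ∀ a b, HasDerivWithinAt (fun s => E s a b) ((E t * hat (v t)) a b)
      (Set.Ici t₀) t) (h0 : E t₀ ∈ SO3) {t : ℝ} (ht : t₀ ≤ t) : E t ∈ SO3 := by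
  have horth : ∀ s, t₀ ≤ s → E s * (E s)ᵀ = 1 := fun s hs => by
    rw [← SO3.mul_transpose h0]
    ext a b
    refine eq_of_hasDerivWithinAt_zero (f := fun s => (E s * (E s)ᵀ) a b) (fun σ hσ => ?_) hs
    refine (hasDerivWithinAt_mul_mat (hE σ hσ) (B := fun s => (E s)ᵀ)
      (B' := (E σ * hat (v σ))ᵀ) (fun a b => hE σ hσ b a) a b).congr_deriv ?_
    rw [Matrix.transpose_mul, hat_transpose]
    simp [Matrix.mul_assoc]
  refine SO3.of_mul_transpose (horth t ht) ?_
  have hsq : ∀ s, t₀ ≤ s → (E s).det ^ 2 = 1 := fun s hs => by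
    have := congrArg Matrix.det (horth s hs)
    rwa [Matrix.det_mul, Matrix.det_transpose, Matrix.det_one, ← sq] at this
  have hc : ContinuousOn (fun s => (E s).det) (Set.Ici t₀) := by
    have h : ∀ a b, ContinuousOn (fun s => E s a b) (Set.Ici t₀) := fun a b s hs =>
      (hE s hs a b).continuousWithinAt
    have : ContinuousOn E (Set.Ici t₀) :=
      continuousOn_pi.2 fun a => continuousOn_pi.2 fun b => h a b
    exact Continuous.comp_continuousOn (Continuous.matrix_det continuous_id) this
  by_contra hne
  have h1 : (E t).det = -1 := (mul_self_eq_one_iff.1 ((sq _).symm.trans (hsq t ht))).resolve_left hne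
  have h2 : (E t₀).det = 1 := (Matrix.mem_specialOrthogonalGroup_iff.1 h0).2
  -- The determinant takes only the values `±1` and is continuous, so it cannot change its sign.
  obtain ⟨s, hs, h3⟩ := isPreconnected_Ici.intermediate_value ht (Set.mem_Ici.2 le_rfl) hc
    (show (0 : ℝ) ∈ Set.Icc (E t).det (E t₀).det by rw [h1, h2]; norm_num)
  have h4 := hsq s hs
  simp only at h3
  rw [h3] at h4
  norm_num at h4

section Loop

variable {P : Params} {K : Gains} {D : Desired} {r k₁ k₂ : ℝ} {S : Set TubeArg}

theorem excessW_eq (qr : V3) (qc : Cables) (ν : Fin 2 → ℝ) : excessW P qr qc ν =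
    qr ⨯₃ ((1 / (2 / 3 * P.mr * P.Lr)) • (ν 1 • qc 1 - ν 0 • qc 0)) := by
  rw [excessW, cross_smul_right]

theorem jetAccW_eq (g : Jet) (z : Rod) (qc : Cables) : jetAccW P K g z qc =
    qR z ⨯₃ ((1 / (2 / 3 * P.mr * P.Lr)) • (jetMu P K 1 g z qc - jetMu P K 0 g z qc)) := by
  rw [jetAccW, cross_smul_right]

theorem cableAcc_eq_cross (x : TubeArg) (E : Fin 2 → M3) (j : Fin 2) : cableAcc P K x E j =
    x.2.2.1 j ⨯₃ ((1 / P.Lc) • (jetEndAcc P K j x.arg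
      + excessA P (qR x.2.1) x.2.2.1 (tensionExc P K x E) j)
        - (1 / (P.mQ * P.Lc)) • forces P K x E j) := by
  rw [cableAcc, cross_sub_right, cross_smul_right, cross_smul_right]

/-- The constraints are preserved by multiples of the closed loop field. -/
theorem constraints_of_rate {z : ℝ → CState} {c : ℝ → ℝ} {p : ℝ → Prm} {t₀ : ℝ}
    (hz : ∀ t ∈ Set.Ici t₀, HasDerivWithinAt z (c t • loopField P K k₁ k₂ (p t, z t))
      (Set.Ici t₀) t) (ha : Admissible (z t₀).1) (hE : ∀ j, (z t₀).rot j ∈ SO3) {t : ℝ}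
    (ht : t₀ ≤ t) : Admissible (z t).1 ∧ ∀ j, (z t).rot j ∈ SO3 := by
  have hq : ∀ t ∈ Set.Ici t₀, HasDerivWithinAt (fun t => qR (z t).1.1)
      (c t • (wR (z t).1.1 ⨯₃ qR (z t).1.1)) (Set.Ici t₀) t := fun t ht => by
    refine (hz t ht).fst'.fst'.snd'.snd'.fst'.congr_deriv ?_
    change c t • (wR (z t).1.1 ⨯₃ qR (z t).1.1 + 0) = _
    rw [add_zero]
  have hw : ∀ t ∈ Set.Ici t₀, HasDerivWithinAt (fun t => wR (z t).1.1) (c t • (qR (z t).1.1 ⨯₃ _))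
      (Set.Ici t₀) t := fun t ht => by
    have h := (hz t ht).fst'.fst'.snd'.snd'.snd'
    change HasDerivWithinAt (fun t => wR (z t).1.1) (c t • (jetAccW P K (p t).1.1 (z t).1.1
      (z t).1.2.1 + excessW P (qR (z t).1.1) (z t).1.2.1
        (tensionExc P K (p t, (z t).1) (z t).rot))) _ _ at h
    rw [jetAccW_eq, excessW_eq, ← cross_add_right] at h
    exact h
  have hqc : ∀ j, ∀ t ∈ Set.Ici t₀, HasDerivWithinAt (fun t => (z t).1.2.1 j)
      (c t • ((z t).1.2.2 j ⨯₃ (z t).1.2.1 j)) (Set.Ici t₀) t := fun j t ht =>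
    hasDerivWithinAt_pi.1 (hz t ht).fst'.snd'.fst' j
  have hwc : ∀ j, ∀ t ∈ Set.Ici t₀, HasDerivWithinAt (fun t => (z t).1.2.2 j)
      (c t • ((z t).1.2.1 j ⨯₃ _)) (Set.Ici t₀) t := fun j t ht => by
    have h := hasDerivWithinAt_pi.1 (hz t ht).fst'.snd'.snd' j
    change HasDerivWithinAt _ (c t • cableAcc P K (p t, (z t).1) (z t).rot j) _ _ at h
    rw [cableAcc_eq_cross] at h
    exact h
  refine ⟨⟨?_, ?_, fun j => ⟨?_, ?_⟩⟩, fun j => ?_⟩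
  · rw [← ha.1]; exact dot_self_eq_of_rate hq ht
  · rw [← ha.2.1]; exact dot_eq_of_rate hq hw ht
  · rw [← (ha.2.2 j).1]; exact dot_self_eq_of_rate (hqc j) ht
  · rw [← (ha.2.2 j).2]; exact dot_eq_of_rate (hqc j) (hwc j) ht
  · refine mem_SO3_of_rate (E := fun t => (z t).rot j) (v := fun t => c t • (z t).2.2 j)
      (fun t ht a b => ?_) (hE j) ht
    have h := hasDerivWithinAt_pi.1 (hasDerivWithinAt_pi.1 (hasDerivWithinAt_pi.1
      (hz t ht).snd'.fst' j) a) b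
    refine h.congr_deriv ?_
    rw [hat_smul, Matrix.mul_smul]
    rfl

/-- The field is cut off outside a compact set containing the tube, which gives a solution for all
times. The constraints hold along it in any case, and the true equation holds whenever the solution
is in the tube; that it never leaves is shown afterwards. -/
theorem exists_isLoop (hS : IsTube P K D r S) {t₀ : ℝ} (ht₀ : 0 ≤ t₀) {z₀ : CState}
    (ha : Admissible z₀.1) (hE : ∀ j, z₀.rot j ∈ SO3) :
    ∃ z : ℝ → CState, z t₀ = z₀ ∧ IsLoop P K D k₁ k₂ r (Set.Ici t₀) z := by
  -- The unit ball suffices for the quadrotors: entries of rotations are at most one, and so is the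
  -- radius of the tube.
  set T : Set (Prm × CState) := (fun q : TubeArg × (Fin 2 → Fin 3 → V3) × Cables =>
    (q.1.1, (q.1.2, q.2))) '' (S ×ˢ Metric.closedBall 0 1) with hT
  have hTc : IsCompact T := (hS.compact.prod (isCompact_closedBall _ _)).image (by fun_prop)
  have hTm : ∀ p ∈ prmSet D, ∀ z, InTube P K r (p, z) → (p, z) ∈ T := by
    rintro p hp z ⟨h1, h2, h3, h4⟩
    refine ⟨((p, z.1), z.2), ⟨hS.mem p hp z.1 h1, ?_⟩, rfl⟩
    rw [mem_closedBall_zero_iff]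
    refine norm_prod_le_iff.2 ⟨?_, ?_⟩
    · refine (pi_norm_le_iff_of_nonneg zero_le_one).2 fun j =>
        (pi_norm_le_iff_of_nonneg zero_le_one).2 fun a =>
        (pi_norm_le_iff_of_nonneg zero_le_one).2 fun b => SO3.abs_le_one (h3 j).1 a b
    · exact (pi_norm_le_iff_of_nonneg zero_le_one).2 fun j =>
        (norm_le_len _).trans ((h4 j).trans hS.le_one)
  have : FiniteDimensional ℝ Prm := inferInstance
  have : FiniteDimensional ℝ CState := inferInstance
  have hf : ∀ x ∈ T, ContDiffAt ℝ 1 (loopField P K k₁ k₂) x := by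
    rintro _ ⟨q, hq, rfl⟩
    exact (contDiffAt_loopField (hS.regular _ hq.1)).of_le (by simp)
  obtain ⟨z, c, hz0, hz, h1⟩ := exists_cutoff_solution hTc hf (contDiff_prm D).continuous t₀ z₀
  have hcon := fun t ht => constraints_of_rate (t := t) hz (by rwa [hz0]) (by rwa [hz0]) ht
  refine ⟨z, hz0, ⟨fun t ht => (hz t ht).continuousWithinAt, fun t ht => (hcon t ht).1,
    fun t ht _ => (hcon t ht).2, fun t ht _ htu => ?_⟩⟩
  have h2 := hz t ht
  rwa [h1 t (hTm _ (prm_mem D (ht₀.trans ht)) _ htu), one_smul] at h2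

end Loop

/-! ### Kinematics of rotations -/

theorem hat_mulVec (v w : V3) : hat v *ᵥ w = v ⨯₃ w := by
  ext i; fin_cases i <;> simp [hat, Matrix.mulVec, dotProduct, Fin.sum_univ_three, cross_apply] <;>
    ring

theorem hat_add (v w : V3) : hat (v + w) = hat v + hat w := by
  ext i j; fin_cases i <;> fin_cases j <;> simp [hat] <;> ring

theorem hat_sub (v w : V3) : hat (v - w) = hat v - hat w := by
  ext i j; fin_cases i <;> fin_cases j <;> simp [hat] <;> ring

theorem hat_vee {A : M3} (h : Aᵀ = -A) : hat (vee A) = A := by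
  have h' : ∀ i j, A i j = -A j i := fun i j => congrFun (congrFun h j) i
  have h0 := h' 0 0
  have h1 := h' 1 1
  have h2 := h' 2 2
  have h01 := h' 0 1
  have h02 := h' 0 2
  have h12 := h' 1 2
  ext i j
  fin_cases i <;> fin_cases j <;> simp [hat, vee] <;> linarith

/-- The body angular velocity of a curve of rotations. -/
theorem hasDerivWithinAt_rotation {A : ℝ → M3} {A' : M3} {I : Set ℝ} {t : ℝ}
    (hI : UniqueDiffWithinAt ℝ I t) (ht : t ∈ I)
    (hA : ∀ a b, HasDerivWithinAt (fun s => A s a b) (A' a b) I t)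
    (h : ∀ᶠ s in 𝓝[I] t, A s ∈ SO3) : A t * hat (vee ((A t)ᵀ * A')) = A' := by
  have hA1 : A t ∈ SO3 := h.self_of_nhdsWithin ht
  have h0 : A'ᵀ * A t + (A t)ᵀ * A' = 0 := by
    ext a b
    have h1 := hasDerivWithinAt_mul_mat (A := fun s => (A s)ᵀ) (A' := A'ᵀ) (fun a b => hA b a) hA a b
    have h2 : HasDerivWithinAt (fun s => ((A s)ᵀ * A s) a b) 0 I t := by
      refine (hasDerivWithinAt_const t I ((1 : M3) a b)).congr_of_eventuallyEq ?_ ?_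
      · filter_upwards [h] with s hs
        rw [SO3.transpose_mul hs]
      · rw [SO3.transpose_mul hA1]
    exact hI.eq_deriv _ h1 h2
  rw [hat_vee, ← mul_assoc, SO3.mul_transpose hA1, one_mul]
  rw [Matrix.transpose_mul, Matrix.transpose_transpose]
  exact eq_neg_of_add_eq_zero_left h0

theorem _root_.HasDerivWithinAt.mulVec_entry {A : ℝ → M3} {A' : M3} {v : ℝ → V3} {v' : V3}
    {I : Set ℝ} {t : ℝ} (hA : ∀ a b, HasDerivWithinAt (fun s => A s a b) (A' a b) I t)
    (hv : HasDerivWithinAt v v' I t) :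
    HasDerivWithinAt (fun s => A s *ᵥ v s) (A' *ᵥ v t + A t *ᵥ v') I t := by
  refine hasDerivWithinAt_pi.2 fun i => ?_
  simp only [Matrix.mulVec, dotProduct, Pi.add_apply, ← Finset.sum_add_distrib]
  exact HasDerivWithinAt.fun_sum fun k _ => (hA i k).mul (hasDerivWithinAt_pi.1 hv k)

/-- Rate of the transported desired angular velocity `Eᵀ w`. -/
theorem hasDerivWithinAt_transported {E : ℝ → M3} {η : V3} {w : ℝ → V3} {w' : V3} {I : Set ℝ}
    {t : ℝ} (hE : ∀ a b, HasDerivWithinAt (fun s => E s a b) ((E t * hat η) a b) I t)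
    (hw : HasDerivWithinAt w w' I t) :
    HasDerivWithinAt (fun s => (E s)ᵀ *ᵥ w s)
      (-(η ⨯₃ ((E t)ᵀ *ᵥ w t)) + (E t)ᵀ *ᵥ w') I t := by
  refine (HasDerivWithinAt.mulVec_entry (A := fun s => (E s)ᵀ) (A' := (E t * hat η)ᵀ)
    (fun a b => hE b a) hw).congr_deriv ?_
  rw [Matrix.transpose_mul, hat_transpose, Matrix.neg_mul, Matrix.neg_mulVec, ← Matrix.mulVec_mulVec,
    hat_mulVec]

/-- The moments make the attitude errors autonomous. -/
theorem moment_iff {J : M3} {Ω η η' c d s : V3} (h : Ω = η + c) :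
    J *ᵥ (η' + (-(η ⨯₃ c) + d)) = (J *ᵥ Ω) ⨯₃ Ω + (s + Ω ⨯₃ (J *ᵥ Ω)
      - J *ᵥ (hat Ω *ᵥ c - d)) ↔ J *ᵥ η' = s := by
  have h1 : hat Ω *ᵥ c = η ⨯₃ c := by rw [hat_mulVec, h, cross_add_left, cross_self, add_zero]
  rw [h1, ← cross_anticomm Ω (J *ᵥ Ω), Matrix.mulVec_add, Matrix.mulVec_add, Matrix.mulVec_neg,
    Matrix.mulVec_sub, ← sub_eq_zero, ← sub_eq_zero (a := J *ᵥ η')]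
  apply Eq.congr_left
  abel

theorem ddot_of_rate {q w : ℝ → V3} {w' : V3} {I : Set ℝ} {t : ℝ} (hI : UniqueDiffOn ℝ I)
    (ht : t ∈ I) (hq : ∀ s ∈ I, HasDerivWithinAt q (w s ⨯₃ q s) I s)
    (hw : HasDerivWithinAt w w' I t) :
    ddot I q t = w' ⨯₃ q t + w t ⨯₃ (w t ⨯₃ q t) := by
  have h1 : ∀ s ∈ I, derivWithin q I s = w s ⨯₃ q s := fun s hs => (hq s hs).derivWithin (hI s hs)
  rw [ddot, derivWithin_congr h1 (h1 t ht)]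
  exact (hw.cross (hq t ht)).derivWithin (hI t ht)

namespace Motion

variable (y : Motion) (P : Params) (K : Gains) (D : Desired)

/-- The arguments of the controller along a motion. -/
def tubeArg (t : ℝ) : TubeArg := (prm D t, shift D t (y.rod t), y.qcs t, y.wcs t)

/-- The relative rotations along a motion. -/
def relRot (j : Fin 2) (t : ℝ) : M3 := (y.Rd P K D j t)ᵀ * y.R j t

/-- The motion in relative coordinates. -/
def toLoop (I : Set ℝ) (t : ℝ) : CState :=
  ((y.tubeArg D t).2, fun j => Matrix.of.symm (y.relRot P K D j t), fun j => y.eOm P K D I j t)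

variable {y P K D}

theorem u_eq {t : ℝ} (h : Regular P K (y.tubeArg D t)) (j : Fin 2) :
    y.u P K D j t = jetU P K j (y.tubeArg D t).arg :=
  uCtrl_eq P K D j t _ _ _ (h j).1

theorem Rd_eq {t : ℝ} (h : Regular P K (y.tubeArg D t)) (j : Fin 2) :
    y.Rd P K D j t = rotDes P K (y.tubeArg D t) j := by
  have := u_eq h j
  rw [u] at this
  rw [Rd, RDes, this]; rfl

theorem Rd_mem {t : ℝ} (h : Regular P K (y.tubeArg D t)) (j : Fin 2) :
    y.Rd P K D j t ∈ SO3 := by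
  rw [Rd_eq h]; exact attitude_mem (h j).2

theorem R_eq {t : ℝ} (h : Regular P K (y.tubeArg D t)) (j : Fin 2) :
    y.R j t = y.Rd P K D j t * y.relRot P K D j t := by
  rw [relRot, ← mul_assoc, SO3.mul_transpose (Rd_mem h j), one_mul]

theorem thrust_eq {t : ℝ} (h : Regular P K (y.tubeArg D t)) (j : Fin 2) :
    y.thrust P K D j t = forces P K (y.tubeArg D t) (fun j => y.relRot P K D j t) j := by
  simp only [forces]
  rw [← Rd_eq h, ← R_eq h, ← u_eq h]
  rfl

theorem eR_eq (j : Fin 2) (t : ℝ) : y.eR P K D j t = rotErr (y.relRot P K D j t) := by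
  rw [eR, eRot, rotErr, relRot, Matrix.transpose_mul, Matrix.transpose_transpose]
  rfl

theorem relRot_transpose (j : Fin 2) (t : ℝ) :
    (y.R j t)ᵀ * y.Rd P K D j t = (y.relRot P K D j t)ᵀ := by
  rw [relRot, Matrix.transpose_mul, Matrix.transpose_transpose]

theorem admissible_of_mem {t : ℝ} (h : StateMem (y.rod t) (y.qcs t) (y.wcs t) (y.Rs t)) :
    Admissible (y.tubeArg D t).2 := ⟨h.1, h.2.1, h.2.2.1⟩

theorem Rd_rate {I : Set ℝ} {t : ℝ} {j : Fin 2} (hI : UniqueDiffWithinAt ℝ I t) (ht : t ∈ I)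
    (hd : ∀ a b, DifferentiableWithinAt ℝ (fun s => y.Rd P K D j s a b) I t)
    (h : ∀ᶠ s in 𝓝[I] t, Regular P K (y.tubeArg D s)) (a b : Fin 3) :
    HasDerivWithinAt (fun s => y.Rd P K D j s a b)
      ((y.Rd P K D j t * hat (y.Omd P K D I j t)) a b) I t := by
  have h1 := hasDerivWithinAt_rotation (A := y.Rd P K D j)
    (A' := Matrix.of fun a b => derivWithin (fun s => y.Rd P K D j s a b) I t) hI ht
    (fun a b => (hd a b).hasDerivWithinAt) (h.mono fun s hs => Rd_mem hs j)
  rw [Omd, h1]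
  exact (hd a b).hasDerivWithinAt

theorem implicitEq_iff {t : ℝ} (h : Regular P K (y.tubeArg D t))
    (ha : Admissible (y.tubeArg D t).2) {I : Set ℝ} (hI : UniqueDiffOn ℝ I) (ht : t ∈ I)
    (hq : ∀ s ∈ I, HasDerivWithinAt y.q (y.w s ⨯₃ y.q s) I s)
    (hqc : ∀ s ∈ I, ∀ j, HasDerivWithinAt (y.qc j) (y.wc j s ⨯₃ y.qc j s) I s)
    {v' w' : V3} {wc' : Cables} (hw : HasDerivWithinAt y.w w' I t)
    (hwc : ∀ j, HasDerivWithinAt (y.wc j) (wc' j) I t) :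
    (P.mEff • (v' + P.g • e3) = y.thrust P K D 0 t + y.thrust P K D 1 t
        + (P.mQ * P.Lc) • (ddot I (y.qc 0) t + ddot I (y.qc 1) t) ∧
      P.IEff • w' = y.q t ⨯₃ (y.thrust P K D 1 t - y.thrust P K D 0 t
        + (P.mQ * P.Lc) • (ddot I (y.qc 1) t - ddot I (y.qc 0) t)) ∧
      ∀ j, (P.mQ * P.Lc) • wc' j = P.mQ • (y.qc j t ⨯₃
        (v' + (sgn j * P.Lr) • ddot I y.q t + P.g • e3)) - y.qc j t ⨯₃ y.thrust P K D j t) ↔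
    v' = jetAccX P K (prm D t).1.1 (y.tubeArg D t).2.1 (y.qcs t)
        + (rodExc P K (y.tubeArg D t) fun j => y.relRot P K D j t).2.1 ∧
      w' = jetAccW P K (prm D t).1.1 (y.tubeArg D t).2.1 (y.qcs t)
        + (rodExc P K (y.tubeArg D t) fun j => y.relRot P K D j t).2.2.2 ∧
      ∀ j, wc' j = cableAcc P K (y.tubeArg D t) (fun j => y.relRot P K D j t) j := by
  have h1 := designData_explicit (P := P) (K := K) (x := y.tubeArg D t) ha
    (E := fun j => y.relRot P K D j t) (v' := v') (wr' := w') (wc' := wc')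
  rw [← DesignData.implicit_iff_explicit] at h1
  refine Iff.trans ?_ h1
  rw [ddot_of_rate hI ht (fun s hs => hqc s hs 0) (hwc 0),
    ddot_of_rate hI ht (fun s hs => hqc s hs 1) (hwc 1), ddot_of_rate hI ht hq hw]
  simp only [thrust_eq h]
  rfl

end Motion

/-! ### Motions of the model are motions of the closed loop -/

namespace Motion

variable {y : Motion} {P : Params} {K : Gains} {D : Desired} {kR kOm ε : ℝ} {I : Set ℝ}

theorem continuousOn_tubeArg (hx : ContinuousOn y.x I) (hv : ContinuousOn y.v I)
    (hq : ContinuousOn y.q I) (hw : ContinuousOn y.w I) (hqc : ∀ j, ContinuousOn (y.qc j) I)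
    (hwc : ∀ j, ContinuousOn (y.wc j) I) : ContinuousOn (y.tubeArg D) I :=
  (contDiff_prm D).continuous.continuousOn.prodMk
    (((hx.sub D.x_smooth.continuous.continuousOn).prodMk
      ((hv.sub D.contDiff_v.continuous.continuousOn).prodMk (hq.prodMk hw))).prodMk
      ((continuousOn_pi.2 hqc).prodMk (continuousOn_pi.2 hwc)))

namespace IsSolution

theorem continuousOn_tubeArg (h : y.IsSolution P K D kR kOm ε I) :
    ContinuousOn (y.tubeArg D) I :=
  Motion.continuousOn_tubeArg (fun t ht => (h.x_kin t ht).continuousWithinAt)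
    h.v_diff.continuousOn (fun t ht => (h.q_kin t ht).continuousWithinAt) h.w_diff.continuousOn
    (fun j t ht => (h.qc_kin t ht j).continuousWithinAt) (fun j => (h.wc_diff j).continuousOn)

theorem continuousOn_toLoop (h : y.IsSolution P K D kR kOm ε I) :
    ContinuousOn (y.toLoop P K D I) I := by
  have hRd : ∀ j a b, ContinuousOn (fun s => y.Rd P K D j s a b) I := fun j a b =>
    (h.Rd_diff j a b).continuousOn
  have hR : ∀ j a b, ContinuousOn (fun s => y.R j s a b) I := fun j a b t ht =>
    (h.R_kin t ht j a b).continuousWithinAt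
  have hE : ∀ j a b, ContinuousOn (fun s => y.relRot P K D j s a b) I := fun j a b => by
    simp only [relRot, Matrix.mul_apply, Matrix.transpose_apply]
    exact continuousOn_finsetSum _ fun i _ => (hRd j i a).mul (hR j i b)
  have hη : ∀ j, ContinuousOn (fun s => y.eOm P K D I j s) I := fun j => by
    simp only [eOm, relRot_transpose]
    refine (h.Om_diff j).continuousOn.sub (continuousOn_pi.2 fun a => ?_)
    simp only [Matrix.mulVec, dotProduct, Matrix.transpose_apply]
    exact continuousOn_finsetSum _ fun i _ =>
      (hE j i a).mul (continuousOn_pi.1 (h.Omd_diff j).continuousOn i)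
  exact (continuous_snd.comp_continuousOn h.continuousOn_tubeArg).prodMk
    ((continuousOn_pi.2 fun j => continuousOn_pi.2 fun a => continuousOn_pi.2 fun b =>
      hE j a b).prodMk (continuousOn_pi.2 hη))

theorem regular_eventually (h : y.IsSolution P K D kR kOm ε I) {t : ℝ} (ht : t ∈ I)
    (hreg : Regular P K (y.tubeArg D t)) : ∀ᶠ s in 𝓝[I] t, Regular P K (y.tubeArg D s) :=
  (h.continuousOn_tubeArg t ht).eventually hreg.eventually

theorem relRot_mem (h : y.IsSolution P K D kR kOm ε I) {t : ℝ} (ht : t ∈ I)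
    (hreg : Regular P K (y.tubeArg D t)) (j : Fin 2) : y.relRot P K D j t ∈ SO3 :=
  mul_mem (SO3.transpose_mem (Rd_mem hreg j)) ((h.mem t ht).2.2.2 j)

/-- The desired attitude contributes `-hat Ω_d E`, which equals `-E hat (Eᵀ Ω_d)`; together with `E
hat Ω` this is `E hat e_Ω`, by the definition of the angular velocity error. -/
theorem relRot_rate (h : y.IsSolution P K D kR kOm ε I) (hI : UniqueDiffOn ℝ I) {t : ℝ}
    (ht : t ∈ I) (hreg : Regular P K (y.tubeArg D t)) (j : Fin 2) (a b : Fin 3) :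
    HasDerivWithinAt (fun s => y.relRot P K D j s a b)
      ((y.relRot P K D j t * hat (y.eOm P K D I j t)) a b) I t := by
  have h1 := Rd_rate (hI t ht) ht (fun a b => h.Rd_diff j a b t ht) (h.regular_eventually ht hreg)
  refine (hasDerivWithinAt_mul_mat (A := fun s => (y.Rd P K D j s)ᵀ)
    (A' := (y.Rd P K D j t * hat (y.Omd P K D I j t))ᵀ) (fun a b => h1 b a)
    (fun a b => h.R_kin t ht j a b) a b).congr_deriv ?_
  have key : (y.Rd P K D j t * hat (y.Omd P K D I j t))ᵀ * y.R j t
      + (y.Rd P K D j t)ᵀ * (y.R j t * hat (y.Om j t)) =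
      y.relRot P K D j t * hat (y.eOm P K D I j t) := by
    rw [eOm, relRot_transpose, hat_sub, Matrix.mul_sub, SO3.mul_hat (h.relRot_mem ht hreg j),
      Matrix.transpose_mul, hat_transpose, Matrix.mul_assoc, ← Matrix.mul_assoc _ (y.R j t),
      ← relRot, Matrix.neg_mul, neg_add_eq_sub]
  rw [← key]

/-- The feedforward part of the moment compensates the rate of the transported desired angular
velocity `Eᵀ Ω_d`, and the gyroscopic part the Euler term. -/
theorem eOm_rate (h : y.IsSolution P K D kR kOm ε I) (hI : UniqueDiffOn ℝ I) {t : ℝ}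
    (ht : t ∈ I) (hreg : Regular P K (y.tubeArg D t)) (j : Fin 2) :
    HasDerivWithinAt (fun s => y.eOm P K D I j s)
      (P.J⁻¹ *ᵥ (-((kR / ε ^ 2) • rotErr (y.relRot P K D j t))
        - (kOm / ε) • y.eOm P K D I j t)) I t := by
  have hJ : P.J⁻¹ * P.J = 1 := Matrix.nonsing_inv_mul _ P.J_posDef.det_pos.ne'.isUnit
  have h1 := hasDerivWithinAt_transported (fun a b => h.relRot_rate hI ht hreg j a b)
    (h.Omd_diff j t ht).hasDerivWithinAt
  have h2 := (h.Om_diff j t ht).hasDerivWithinAt.sub h1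
  have h3 : (fun s => y.eOm P K D I j s) =
      fun s => y.Om j s - (y.relRot P K D j s)ᵀ *ᵥ y.Omd P K D I j s := by
    funext s; rw [eOm, relRot_transpose]
  rw [h3]
  refine h2.congr_deriv ?_
  have h4 := h.Om_dyn t ht j
  rw [moment, eR_eq, relRot_transpose] at h4
  have h5 : y.Om j t = y.eOm P K D I j t + (y.relRot P K D j t)ᵀ *ᵥ y.Omd P K D I j t := by
    rw [eOm, relRot_transpose, sub_add_cancel]
  have h6 := (moment_iff (J := P.J) (η' := derivWithin (y.Om j) I t
    - (-(y.eOm P K D I j t ⨯₃ ((y.relRot P K D j t)ᵀ *ᵥ y.Omd P K D I j t))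
      + (y.relRot P K D j t)ᵀ *ᵥ derivWithin (y.Omd P K D I j) I t)) h5).1 (by
        rw [sub_add_cancel]; exact h4)
  rw [← h6, Matrix.mulVec_mulVec, hJ, Matrix.one_mulVec]

theorem toLoop_rate (h : y.IsSolution P K D kR kOm ε I) (hI : UniqueDiffOn ℝ I) {t : ℝ}
    (ht : t ∈ I) (hreg : Regular P K (y.tubeArg D t)) :
    HasDerivWithinAt (y.toLoop P K D I)
      (loopField P K (kR / ε ^ 2) (kOm / ε) (prm D t, y.toLoop P K D I t)) I t := by
  have hv := (h.v_diff t ht).hasDerivWithinAt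
  have hw := (h.w_diff t ht).hasDerivWithinAt
  have hwc := fun j => (h.wc_diff j t ht).hasDerivWithinAt
  obtain ⟨e1, e2, e3⟩ := (implicitEq_iff hreg (admissible_of_mem (h.mem t ht)) hI ht h.q_kin
    h.qc_kin (v' := derivWithin y.v I t) hw hwc).1
    ⟨h.v_dyn t ht, h.w_dyn t ht, fun j => h.wc_dyn t ht j⟩
  have dx := (h.x_kin t ht).sub (D.x_smooth.hasDerivAt_infty t).hasDerivWithinAt
  have dv := hv.sub (D.contDiff_v.hasDerivAt_infty t).hasDerivWithinAt
  have dE : HasDerivWithinAt (fun s j => Matrix.of.symm (y.relRot P K D j s))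
      (fun j => Matrix.of.symm (y.relRot P K D j t * hat (y.eOm P K D I j t))) I t :=
    hasDerivWithinAt_pi.2 fun j => hasDerivWithinAt_pi.2 fun a => hasDerivWithinAt_pi.2 fun b =>
      h.relRot_rate hI ht hreg j a b
  have main := ((dx.prodMk (dv.prodMk ((h.q_kin t ht).prodMk hw))).prodMk
    ((hasDerivWithinAt_pi.2 fun j => h.qc_kin t ht j).prodMk (hasDerivWithinAt_pi.2 hwc))).prodMk
      (dE.prodMk (hasDerivWithinAt_pi.2 fun j => h.eOm_rate hI ht hreg j))
  refine main.congr_deriv ?_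
  refine Prod.ext (Prod.ext (Prod.ext ?_ (Prod.ext ?_ (Prod.ext ?_ ?_))) (Prod.ext rfl ?_)) rfl
  · exact (add_zero _).symm
  · change derivWithin y.v I t - D.a t = (_ - D.a t) + _
    rw [e1, add_sub_right_comm]
    rfl
  · exact (add_zero _).symm
  · exact e2
  · exact funext e3

theorem isLoop (h : y.IsSolution P K D kR kOm ε I) (hI : UniqueDiffOn ℝ I) (r : ℝ) :
    IsLoop P K D (kR / ε ^ 2) (kOm / ε) r I (y.toLoop P K D I) where
  cont := h.continuousOn_toLoop
  adm _ ht := admissible_of_mem (D := D) (h.mem _ ht)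
  rot _ ht hreg j := h.relRot_mem ht hreg j
  dyn _ ht hreg _ := h.toLoop_rate hI ht hreg

end IsSolution

end Motion

/-! ### Motions of the closed loop are motions of the model -/

/-- Smooth functions are twice differentiable along solutions of smooth differential equations. -/
theorem differentiableOn_derivWithin_comp {Q E F : Type*} [NormedAddCommGroup Q] [NormedSpace ℝ Q]
    [NormedAddCommGroup E] [NormedSpace ℝ E] [NormedAddCommGroup F] [NormedSpace ℝ F] {I : Set ℝ}
    (hI : UniqueDiffOn ℝ I) {p : ℝ → Q} (hp : ContDiff ℝ ∞ p) {z : ℝ → E} {f : Q × E → E}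
    (hf : ∀ t ∈ I, ContDiffAt ℝ ∞ f (p t, z t))
    (hz : ∀ t ∈ I, HasDerivWithinAt z (f (p t, z t)) I t) {ρ : Q × E → F}
    (hρ : ∀ t ∈ I, ContDiffAt ℝ ∞ ρ (p t, z t)) :
    DifferentiableOn ℝ (fun t => ρ (p t, z t)) I ∧
      DifferentiableOn ℝ (derivWithin (fun t => ρ (p t, z t)) I) I := by
  have hX : ∀ t ∈ I, HasDerivWithinAt (fun t => (p t, z t)) (deriv p t, f (p t, z t)) I t :=
    fun t ht => (hp.hasDerivAt_infty t).hasDerivWithinAt.prodMk (hz t ht)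
  have h1 : ∀ t ∈ I, HasDerivWithinAt (fun t => ρ (p t, z t))
      (fderiv ℝ ρ (p t, z t) (deriv p t, f (p t, z t))) I t := fun t ht =>
    (hρ t ht).hasFDerivAt_infty.comp_hasDerivWithinAt t (hX t ht)
  refine ⟨fun t ht => (h1 t ht).differentiableWithinAt, fun t ht => ?_⟩
  refine DifferentiableWithinAt.congr (f := fun t =>
    fderiv ℝ ρ (p t, z t) (deriv p t, f (p t, z t))) ?_
    (fun s hs => (h1 s hs).derivWithin (hI s hs)) ((h1 t ht).derivWithin (hI t ht))
  have hX' := (hX t ht).differentiableWithinAt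
  have h2 : DifferentiableAt ℝ (fderiv ℝ ρ) (p t, z t) :=
    ((hρ t ht).fderiv_right (m := ∞) (by simp)).differentiableAt (by simp)
  have h3 : DifferentiableAt ℝ f (p t, z t) := (hf t ht).differentiableAt (by simp)
  have h4 : DifferentiableAt ℝ (deriv p) t :=
    ((contDiff_deriv hp).hasDerivAt_infty t).differentiableAt
  exact (h2.comp_differentiableWithinAt t hX').clm_apply
    (h4.differentiableWithinAt.prodMk (h3.comp_differentiableWithinAt t hX'))

theorem differentiableOn_vee_transpose_mul {A B : ℝ → M3} {I : Set ℝ}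
    (hA : ∀ a b, DifferentiableOn ℝ (fun s => A s a b) I)
    (hB : ∀ a b, DifferentiableOn ℝ (fun s => B s a b) I) :
    DifferentiableOn ℝ (fun s => vee ((A s)ᵀ * B s)) I := by
  have h : ∀ a b, DifferentiableOn ℝ (fun s => ((A s)ᵀ * B s) a b) I := fun a b => by
    simp only [Matrix.mul_apply, Matrix.transpose_apply]
    exact DifferentiableOn.fun_sum fun i _ => (hA i a).mul (hB i b)
  refine differentiableOn_pi.2 fun i => ?_
  fin_cases i
  · exact h 2 1
  · exact h 0 2
  · exact h 1 0

namespace Motion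

/-- The motion of the rod and the cables with given relative coordinates. -/
def carrier (D : Desired) (z : ℝ → CState) : Motion where
  x t := xR (z t).1.1 + D.x t
  v t := vR (z t).1.1 + D.v t
  q t := qR (z t).1.1
  w t := wR (z t).1.1
  qc j t := (z t).1.2.1 j
  wc j t := (z t).1.2.2 j
  -- Placeholders: the desired attitude and its angular velocity depend only on the rod and the
  -- cables, so they can be computed before the true attitudes exist.
  R _ _ := 1
  Om _ _ := 0

/-- The motion with given relative coordinates. -/
def ofLoop (P : Params) (K : Gains) (D : Desired) (I : Set ℝ) (z : ℝ → CState) : Motion :=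
  { carrier D z with
    R := fun j t => (carrier D z).Rd P K D j t * (z t).rot j
    Om := fun j t => (z t).2.2 j + ((z t).rot j)ᵀ *ᵥ (carrier D z).Omd P K D I j t }

variable {P : Params} {K : Gains} {D : Desired} {kR kOm ε : ℝ} {I : Set ℝ} {z : ℝ → CState}

theorem tubeArg_ofLoop (t : ℝ) : (ofLoop P K D I z).tubeArg D t = (prm D t, (z t).1) := by
  have e : shift D t ((ofLoop P K D I z).rod t) = (z t).1.1 :=
    Prod.ext (add_sub_cancel_right _ _) (Prod.ext (add_sub_cancel_right _ _) rfl)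
  rw [tubeArg, e]; rfl

theorem R_ofLoop (j : Fin 2) (t : ℝ) : (ofLoop P K D I z).R j t =
    (ofLoop P K D I z).Rd P K D j t * (z t).rot j := rfl

theorem Om_ofLoop (j : Fin 2) (t : ℝ) : (ofLoop P K D I z).Om j t =
    (z t).2.2 j + ((z t).rot j)ᵀ *ᵥ (ofLoop P K D I z).Omd P K D I j t := rfl

theorem relRot_ofLoop {t : ℝ} (h : Regular P K (prm D t, (z t).1)) (j : Fin 2) :
    (ofLoop P K D I z).relRot P K D j t = (z t).rot j := by
  rw [← tubeArg_ofLoop (P := P) (K := K) (I := I)] at h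
  rw [relRot, R_ofLoop, ← mul_assoc, SO3.transpose_mul (Rd_mem h j), one_mul]

theorem eOm_ofLoop {t : ℝ} (h : Regular P K (prm D t, (z t).1)) (j : Fin 2) :
    (ofLoop P K D I z).eOm P K D I j t = (z t).2.2 j := by
  rw [eOm, relRot_transpose, relRot_ofLoop h, Om_ofLoop, add_sub_cancel_right]

theorem isSolution_ofLoop (hI : UniqueDiffOn ℝ I)
    (hreg : ∀ t ∈ I, Regular P K (prm D t, (z t).1)) (hadm : ∀ t ∈ I, Admissible (z t).1)
    (hrot : ∀ t ∈ I, ∀ j, (z t).rot j ∈ SO3)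
    (hz : ∀ t ∈ I, HasDerivWithinAt z
      (loopField P K (kR / ε ^ 2) (kOm / ε) (prm D t, z t)) I t) :
    (ofLoop P K D I z).IsSolution P K D kR kOm ε I := by
  set y := ofLoop P K D I z with hy
  have hreg' : ∀ t ∈ I, Regular P K (y.tubeArg D t) := fun t ht => by
    rw [hy, tubeArg_ofLoop]; exact hreg t ht
  have hadm' : ∀ t ∈ I, Admissible (y.tubeArg D t).2 := fun t ht => by
    rw [hy, tubeArg_ofLoop]; exact hadm t ht
  have hrel : ∀ t ∈ I, (fun j => y.relRot P K D j t) = (z t).rot := fun t ht =>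
    funext fun j => relRot_ofLoop (hreg t ht) j
  have dx : ∀ t ∈ I, HasDerivWithinAt y.x (y.v t) I t := fun t ht => by
    refine ((hz t ht).fst'.fst'.fst'.add
      (D.x_smooth.hasDerivAt_infty t).hasDerivWithinAt).congr_deriv ?_
    change vR (z t).1.1 + 0 + D.v t = vR (z t).1.1 + D.v t
    rw [add_zero]
  have dv : ∀ t ∈ I, HasDerivWithinAt y.v (jetAccX P K (prm D t).1.1 (z t).1.1 (z t).1.2.1
      + (rodExc P K (prm D t, (z t).1) (z t).rot).2.1) I t := fun t ht => by
    refine ((hz t ht).fst'.fst'.snd'.fst'.add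
      (D.contDiff_v.hasDerivAt_infty t).hasDerivWithinAt).congr_deriv ?_
    change jetAccX P K (prm D t).1.1 (z t).1.1 (z t).1.2.1 - D.a t
      + (rodExc P K (prm D t, (z t).1) (z t).rot).2.1 + D.a t = _
    abel
  have dq : ∀ t ∈ I, HasDerivWithinAt y.q (y.w t ⨯₃ y.q t) I t := fun t ht => by
    refine (hz t ht).fst'.fst'.snd'.snd'.fst'.congr_deriv ?_
    change wR (z t).1.1 ⨯₃ qR (z t).1.1 + 0 = _
    rw [add_zero]; rfl
  have dw : ∀ t ∈ I, HasDerivWithinAt y.w (jetAccW P K (prm D t).1.1 (z t).1.1 (z t).1.2.1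
      + (rodExc P K (prm D t, (z t).1) (z t).rot).2.2.2) I t := fun t ht =>
    (hz t ht).fst'.fst'.snd'.snd'.snd'
  have dqc : ∀ t ∈ I, ∀ j, HasDerivWithinAt (y.qc j) (y.wc j t ⨯₃ y.qc j t) I t := fun t ht j =>
    hasDerivWithinAt_pi.1 (hz t ht).fst'.snd'.fst' j
  have dwc : ∀ t ∈ I, ∀ j, HasDerivWithinAt (y.wc j)
      (cableAcc P K (prm D t, (z t).1) (z t).rot j) I t := fun t ht j =>
    hasDerivWithinAt_pi.1 (hz t ht).fst'.snd'.snd' j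
  have dE : ∀ t ∈ I, ∀ j a b, HasDerivWithinAt (fun s => (z s).rot j a b)
      (((z t).rot j * hat ((z t).2.2 j)) a b) I t := fun t ht j a b =>
    hasDerivWithinAt_pi.1 (hasDerivWithinAt_pi.1 (hasDerivWithinAt_pi.1
      (hz t ht).snd'.fst' j) a) b
  have dη : ∀ t ∈ I, ∀ j, HasDerivWithinAt (fun s => (z s).2.2 j)
      (P.J⁻¹ *ᵥ (-((kR / ε ^ 2) • rotErr ((z t).rot j)) - (kOm / ε) • (z t).2.2 j)) I t :=
    fun t ht j => hasDerivWithinAt_pi.1 (hz t ht).snd'.snd' j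
  have eqs := fun t ht => (implicitEq_iff (hreg' t ht) (hadm' t ht) hI ht dq dqc
    (v' := jetAccX P K (prm D t).1.1 (z t).1.1 (z t).1.2.1
      + (rodExc P K (prm D t, (z t).1) (z t).rot).2.1) (dw t ht) (dwc t ht)).2 (by
      rw [hrel t ht, hy, tubeArg_ofLoop]; exact ⟨rfl, rfl, fun j => rfl⟩)
  -- The moments contain the derivative of `Ω_d`, hence a second derivative of the desired attitude.
  -- It exists because the attitude is a smooth function of parameters and state, and the state
  -- solves a smooth equation.
  have hRd : ∀ j a b, DifferentiableOn ℝ (fun s => y.Rd P K D j s a b) I ∧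
      DifferentiableOn ℝ (derivWithin (fun s => y.Rd P K D j s a b) I) I := fun j a b => by
    have h1 := differentiableOn_derivWithin_comp hI (contDiff_prm D)
      (fun t ht => contDiffAt_loopField (k₁ := kR / ε ^ 2) (k₂ := kOm / ε) (y := (prm D t, z t))
        (hreg t ht)) hz
      (ρ := fun y : Prm × CState => rotDes P K (y.1, y.2.1) j a b) (fun t ht =>
        ((hreg t ht).contDiffAt_rotDes j a b).comp
          (f := fun y : Prm × CState => ((y.1, y.2.1) : TubeArg)) (prm D t, z t) (by fun_prop))
    have h2 : ∀ t ∈ I, y.Rd P K D j t a b = rotDes P K (prm D t, (z t).1) j a b := fun t ht => by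
      rw [Rd_eq (hreg' t ht), hy, tubeArg_ofLoop]
    exact ⟨h1.1.congr h2, h1.2.congr fun t ht => derivWithin_congr h2 (h2 t ht)⟩
  have hOmd : ∀ j, DifferentiableOn ℝ (y.Omd P K D I j) I := fun j =>
    differentiableOn_vee_transpose_mul (fun a b => (hRd j a b).1) (fun a b => (hRd j a b).2)
  have dOm : ∀ t ∈ I, ∀ j, HasDerivWithinAt (y.Om j) _ I t := fun t ht j =>
    (dη t ht j).add (hasDerivWithinAt_transported (dE t ht j) (hOmd j t ht).hasDerivWithinAt)
  have hcont := Motion.continuousOn_tubeArg (D := D) (y := y)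
    (fun t ht => (dx t ht).continuousWithinAt)
    (fun t ht => (dv t ht).continuousWithinAt) (fun t ht => (dq t ht).continuousWithinAt)
    (fun t ht => (dw t ht).continuousWithinAt) (fun j t ht => (dqc t ht j).continuousWithinAt)
    (fun j t ht => (dwc t ht j).continuousWithinAt)
  have dR : ∀ t ∈ I, ∀ j a b, HasDerivWithinAt (fun s => y.R j s a b)
      ((y.R j t * hat (y.Om j t)) a b) I t := fun t ht j a b => by
    have h1 := Rd_rate (hI t ht) ht (fun a b => (hRd j a b).1 t ht)
      ((hcont t ht).eventually (hreg' t ht).eventually)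
    refine (hasDerivWithinAt_mul_mat h1 (dE t ht j) a b).congr_deriv ?_
    have key : y.Rd P K D j t * hat (y.Omd P K D I j t) * (z t).rot j
        + y.Rd P K D j t * ((z t).rot j * hat ((z t).2.2 j)) = y.R j t * hat (y.Om j t) := by
      rw [hy, R_ofLoop, Om_ofLoop, hat_add, Matrix.mul_add, Matrix.mul_assoc _ _ (hat (_ *ᵥ _)),
        SO3.mul_hat (hrot t ht j), add_comm, Matrix.mul_assoc, Matrix.mul_assoc]
    rw [← key]
  have hJ : P.J * P.J⁻¹ = 1 := Matrix.mul_nonsing_inv _ P.J_posDef.det_pos.ne'.isUnit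
  refine
    { mem := fun t ht => ⟨(hadm t ht).1, (hadm t ht).2.1, (hadm t ht).2.2, fun j =>
        mul_mem (Rd_mem (hreg' t ht) j) (hrot t ht j)⟩
      x_kin := dx
      v_diff := fun t ht => (dv t ht).differentiableWithinAt
      v_dyn := fun t ht => ?_
      q_kin := dq
      w_diff := fun t ht => (dw t ht).differentiableWithinAt
      w_dyn := fun t ht => ?_
      qc_kin := dqc
      wc_diff := fun j t ht => (dwc t ht j).differentiableWithinAt
      wc_dyn := fun t ht j => ?_
      R_kin := dR
      Om_diff := fun j t ht => (dOm t ht j).differentiableWithinAt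
      Om_dyn := fun t ht j => ?_
      Rd_diff := fun j a b => (hRd j a b).1
      Omd_diff := hOmd }
  · rw [(dv t ht).derivWithin (hI t ht)]; exact (eqs t ht).1
  · rw [(dw t ht).derivWithin (hI t ht)]; exact (eqs t ht).2.1
  · rw [(dwc t ht j).derivWithin (hI t ht), (dv t ht).derivWithin (hI t ht)]
    exact (eqs t ht).2.2 j
  · rw [(dOm t ht j).derivWithin (hI t ht), moment, eR_eq, relRot_transpose,
      relRot_ofLoop (hreg t ht), eOm_ofLoop (hreg t ht)]
    refine (moment_iff (Om_ofLoop j t)).2 ?_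
    rw [Matrix.mulVec_mulVec, hJ, Matrix.one_mulVec]

end Motion

/-! ### Exponential stability -/

section Stability

variable {P : Params} {K : Gains} {D : Desired}

/-- Relative coordinates of a state. -/
def relState (P : Params) (K : Gains) (D : Desired) (t : ℝ) (r : Rod) (qc wc : Cables)
    (R : Fin 2 → M3) (η : Cables) : CState :=
  ((shift D t r, qc, wc), fun j => Matrix.of.symm ((RDes P K D j t r qc wc)ᵀ * R j), η)

theorem nearState_iff {t : ℝ} {r : Rod} {qc wc : Cables} {R : Fin 2 → M3} {η : Cables} :
    NearState P K D t r qc wc R ↔ NearZ P K (prm D t, relState P K D t r qc wc R η) := by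
  rw [NearState, NearZ]
  refine and_congr (by rw [sub_lt_self_iff]; rfl) (and_congr (forall_congr' fun j => ?_) Iff.rfl)
  rw [qTilde_eq, sub_lt_self_iff]
  rfl

theorem eRot_eq (j : Fin 2) (t : ℝ) (r : Rod) (qc wc : Cables) (R : Fin 2 → M3) (η : Cables) :
    eRot P K D j t r qc wc (R j) = rotErr ((relState P K D t r qc wc R η).rot j) := by
  change _ = rotErr ((RDes P K D j t r qc wc)ᵀ * R j)
  rw [eRot, rotErr, Matrix.transpose_mul, Matrix.transpose_transpose]

theorem errNorm_nonneg (t : ℝ) (r : Rod) (qc wc : Cables) (R : Fin 2 → M3) (η : Cables) :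
    0 ≤ errNorm P K D t r qc wc R η := Real.sqrt_nonneg _

theorem rodSq_le_errNorm_sq (t : ℝ) (r : Rod) (qc wc : Cables) (R : Fin 2 → M3) (η : Cables) :
    rodSq (prm D t, (shift D t r, qc, wc)) ≤ errNorm P K D t r qc wc R η ^ 2 := by
  rw [errNorm, Real.sq_sqrt (by positivity)]
  exact le_add_of_nonneg_right (by positivity)

/-- The condition is needed since the cable angular velocity error involves a derivative that is
computed by the chain rule only where the assigned forces do not vanish. -/
theorem errNorm_sq {t : ℝ} {r : Rod} (h : ∀ j, jetMuTilde P K j (jet D t) (shift D t r) ≠ 0)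
    (qc wc : Cables) (R : Fin 2 → M3) (η : Cables) :
    errNorm P K D t r qc wc R η ^ 2 = totalSq P K (prm D t, relState P K D t r qc wc R η) := by
  rw [errNorm, Real.sq_sqrt (by positivity), Fin.sum_univ_two]
  simp only [eRot_eq _ t r qc wc R η, eqc_eq P K D _ t r qc wc,
    ewc_eq P K D _ t r qc wc (h _)]
  rw [totalSq, cableSq, cableSq, attSq, attSq]
  change rodSq (prm D t, (shift D t r, qc, wc)) + _ = _
  simp only [TubeArg.arg, ctrlArg, relState, prm]
  ring

/-- Only the rod errors are used, and they are the same in both descriptions. This avoids a circle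
with `errNorm_sq`, which presupposes the conclusion. -/
theorem muTilde_ne_zero {ρ : ℝ} {S : Set TubeArg} (hS : IsTube P K D ρ S) {t : ℝ} (ht : 0 ≤ t)
    {r : Rod} {qc wc : Cables} {R : Fin 2 → M3} {η : Cables} (hm : StateMem r qc wc R)
    (hn : NearState P K D t r qc wc R) (h : errNorm P K D t r qc wc R η < ρ) (j : Fin 2) :
    jetMuTilde P K j (jet D t) (shift D t r) ≠ 0 := by
  refine hS.rod (prm D t) (prm_mem D ht) (shift D t r) ?_ j
  refine rodSmall_of_sq (x := (prm D t, (shift D t r, qc, wc))) hS.pos.le hm.1 ?_ ?_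
  · have := hn.1
    rw [sub_lt_self_iff] at this
    exact this.le
  · exact (rodSq_le_errNorm_sq t r qc wc R η).trans
      (pow_le_pow_left₀ (errNorm_nonneg t r qc wc R η) h.le 2)

theorem RDes_eq {t : ℝ} {r : Rod} {qc wc : Cables}
    (h : Regular P K (prm D t, (shift D t r, qc, wc))) (j : Fin 2) :
    RDes P K D j t r qc wc = rotDes P K (prm D t, (shift D t r, qc, wc)) j := by
  rw [RDes, uCtrl_eq P K D j t r qc wc (h j).1]; rfl

theorem RDes_mem {t : ℝ} {r : Rod} {qc wc : Cables}
    (h : Regular P K (prm D t, (shift D t r, qc, wc))) (j : Fin 2) :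
    RDes P K D j t r qc wc ∈ SO3 := by
  rw [RDes_eq h]; exact attitude_mem (h j).2

theorem le_of_sq_decay {x x₀ C lam τ : ℝ} (hx : 0 ≤ x) (hx₀ : 0 ≤ x₀) (hC : 0 ≤ C)
    (h : x ^ 2 ≤ C ^ 2 * x₀ ^ 2 * Real.exp (-lam * τ)) :
    x ≤ C * x₀ * Real.exp (-(lam / 2) * τ) := by
  have h1 := Real.exp_pos (-(lam / 2) * τ)
  refine (sq_le_sq₀ hx (by positivity)).1 (h.trans_eq ?_)
  rw [mul_pow, mul_pow, ← Real.exp_nat_mul]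
  congr 2
  push_cast
  ring

theorem exponentiallyStable {kR kOm ε ρ a b lam : ℝ} {S : Set TubeArg} {V : Prm × CState → ℝ}
    (hS : IsTube P K D ρ S) (hV : IsLyapunov P K D (kR / ε ^ 2) (kOm / ε) ρ V a b lam) :
    ExponentiallyStable P K D kR kOm ε := by
  have hba : 0 < b / a := div_pos hV.b_pos hV.a_pos
  -- The Lyapunov function compares squared errors, so the constant is a square root and the decay
  -- rate of the errors is half that of the function.
  set C : ℝ := Real.sqrt (b / a) with hCdef
  have hC : 0 < C := Real.sqrt_pos.2 hba
  have hC2 : C ^ 2 = b / a := Real.sq_sqrt hba.le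
  have hρ := hS.pos
  -- The second bound makes the overshoot factor `C` harmless: errors starting below it stay within
  -- half the tube.
  set ρ' : ℝ := min ρ (ρ / (2 * C)) with hρ'
  have hρ'0 : 0 < ρ' := lt_min hρ (by positivity)
  have hle : ρ' ≤ ρ := min_le_left _ _
  have hsmall : ∀ x : ℝ, 0 ≤ x → x < ρ' → b / a * x ^ 2 ≤ (ρ / 2) ^ 2 ∧ x ^ 2 < ρ ^ 2 :=
    fun x hx h => by
      have h1 : x * (2 * C) ≤ ρ := (le_div_iff₀ (by positivity)).1 (h.le.trans (min_le_right _ _))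
      constructor
      · rw [← hC2, ← mul_pow]
        exact pow_le_pow_left₀ (by positivity) (by linarith) 2
      · exact pow_lt_pow_left₀ (h.trans_le hle) hx two_ne_zero
  refine ⟨ρ', C, lam / 2, hρ'0, hC, half_pos hV.lam_pos, fun t₀ ht₀ => ⟨?_, ?_⟩⟩
  · intro I y hI hy hn herr
    have hIu : UniqueDiffOn ℝ I := by
      rcases hI with rfl | ⟨T, -, rfl⟩
      · exact uniqueDiffOn_Ici t₀
      · exact uniqueDiffOn_Ico t₀ T
    have hI1 : ∀ t ∈ I, Set.Icc t₀ t ⊆ I := by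
      rcases hI with rfl | ⟨T, -, rfl⟩
      · exact fun t _ => Set.Icc_subset_Ici_self
      · exact fun t ht s hs => ⟨hs.1, hs.2.trans_lt ht.2⟩
    have hI2 : ∀ t ∈ I, t₀ ≤ t := by
      rcases hI with rfl | ⟨T, -, rfl⟩
      · exact fun t ht => ht
      · exact fun t ht => ht.1
    have ht₀I : t₀ ∈ I := by
      rcases hI with rfl | ⟨T, hT, rfl⟩
      · exact Set.mem_Ici.2 le_rfl
      · exact ⟨le_rfl, hT⟩
    have hmu := muTilde_ne_zero hS ht₀ (hy.mem t₀ ht₀I) hn (herr.trans_le hle)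
    have e0 : y.err P K D I t₀ ^ 2 = totalSq P K (prm D t₀, y.toLoop P K D I t₀) :=
      errNorm_sq hmu _ _ _ _
    obtain ⟨s1, s2⟩ := hsmall _ (errNorm_nonneg _ _ _ _ _ _) herr
    have hloop := hy.isLoop hIu ρ
    intro t ht
    obtain ⟨d1, d2, d3⟩ := hV.loop_decay hS ht₀ hI1 hI2 hloop (nearState_iff.1 hn)
      (e0 ▸ s1) (e0 ▸ s2) t ht
    have hreg := (inTube_of_nearZ hS (prm_mem D (ht₀.trans (hI2 t ht))) (hloop.adm t ht)
      (hloop.rot t ht) d1 d2.le).1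
    have e1 : y.err P K D I t ^ 2 = totalSq P K (prm D t, y.toLoop P K D I t) :=
      errNorm_sq (fun j => (hreg j).1) _ _ _ _
    refine ⟨nearState_iff.2 d1, le_of_sq_decay (errNorm_nonneg _ _ _ _ _ _)
      (errNorm_nonneg _ _ _ _ _ _) hC.le ?_⟩
    rw [e1, hC2]
    exact d3.trans_eq (by rw [← e0])
  · intro r qc wc R η hm hn herr
    have hmu := muTilde_ne_zero hS ht₀ hm hn (herr.trans_le hle)
    have e0 := errNorm_sq hmu qc wc R η
    obtain ⟨s1, s2⟩ := hsmall _ (errNorm_nonneg _ _ _ _ _ _) herr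
    rw [e0] at s1 s2
    have hp := prm_mem D ht₀
    have hadm : Admissible (relState P K D t₀ r qc wc R η).1 := ⟨hm.1, hm.2.1, hm.2.2.1⟩
    have hrot : Regular P K (prm D t₀, (relState P K D t₀ r qc wc R η).1) →
        ∀ j, (relState P K D t₀ r qc wc R η).rot j ∈ SO3 := fun h j =>
      mul_mem (SO3.transpose_mem (RDes_mem h j)) (hm.2.2.2 j)
    have hnz := nearState_iff (η := η).1 hn
    have hreg := (inTube_of_nearZ hS hp hadm hrot hnz s2.le).1
    obtain ⟨z, hz0, hz⟩ := exists_isLoop (k₁ := kR / ε ^ 2) (k₂ := kOm / ε) hS ht₀ hadm (hrot hreg)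
    have hdec := hV.loop_decay hS ht₀ (fun t _ => Set.Icc_subset_Ici_self) (fun t ht => ht) hz
      (by rwa [hz0]) (by rwa [hz0]) (by rwa [hz0])
    have htube : ∀ t ∈ Set.Ici t₀, Regular P K (prm D t, (z t).1) ∧
        InTube P K ρ (prm D t, z t) := fun t ht =>
      inTube_of_nearZ hS (prm_mem D (ht₀.trans ht)) (hz.adm t ht) (hz.rot t ht) (hdec t ht).1
        (hdec t ht).2.1.le
    have hrod : (Motion.ofLoop P K D (Set.Ici t₀) z).rod t₀ = r := by
      change (xR (z t₀).1.1 + D.x t₀, vR (z t₀).1.1 + D.v t₀, qR (z t₀).1.1, wR (z t₀).1.1) = r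
      rw [hz0]
      exact Prod.ext (sub_add_cancel _ _) (Prod.ext (sub_add_cancel _ _) rfl)
    have hqc : (Motion.ofLoop P K D (Set.Ici t₀) z).qcs t₀ = qc := by
      change (z t₀).1.2.1 = qc
      rw [hz0]; rfl
    have hwc : (Motion.ofLoop P K D (Set.Ici t₀) z).wcs t₀ = wc := by
      change (z t₀).1.2.2 = wc
      rw [hz0]; rfl
    have hreg0 := (htube t₀ (Set.mem_Ici.2 le_rfl)).1
    refine ⟨Motion.ofLoop P K D (Set.Ici t₀) z, Motion.isSolution_ofLoop (uniqueDiffOn_Ici t₀)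
      (fun t ht => (htube t ht).1) hz.adm (fun t ht => hz.rot t ht (htube t ht).1)
      (fun t ht => hz.dyn t ht (htube t ht).1 (htube t ht).2), hrod, hqc, hwc, funext fun j => ?_,
      fun j => ?_⟩
    · change (Motion.ofLoop P K D (Set.Ici t₀) z).R j t₀ = R j
      rw [Motion.R_ofLoop, Motion.Rd, hrod, hqc, hwc, hz0]
      change RDes P K D j t₀ r qc wc * ((RDes P K D j t₀ r qc wc)ᵀ * R j) = R j
      rw [← mul_assoc, SO3.mul_transpose (RDes_mem hreg j), one_mul]
    · rw [Motion.eOm_ofLoop hreg0, hz0]; rfl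

end Stability

end

end RodTransport

theorem corollary4p3 (P : RodTransport.Params) (D : RodTransport.Desired)
    (hbdd : D.Bounded) (hnd : D.Nondegenerate P) :
    ∃ K : RodTransport.Gains, ∀ kR kOm : ℝ, 0 < kR → 0 < kOm →
      ∃ δ : ℝ, 0 < δ ∧ ∀ ε : ℝ, 0 < ε → ε < δ →
        RodTransport.ExponentiallyStable P K D kR kOm ε := by
  obtain ⟨K, k, B, hkx, hkv, hkq, hkw, hkqc, hkwc, hB, hk⟩ := RodTransport.exists_gains hbdd
  obtain ⟨ρ, S, hS⟩ := RodTransport.exists_isTube (P := P) K hbdd hnd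
  -- The bound `1` is arbitrary: a Lyapunov function exists for every `ε > 0`, with constants
  -- depending on `ε`.
  refine ⟨K, fun kR kOm hkR hkOm => ⟨1, one_pos, fun ε hε _ => ?_⟩⟩
  obtain ⟨V, a, b, lam, hV⟩ := RodTransport.exists_isLyapunov hkx hkv hkq hkw hkqc hkwc hB hk hS
    (div_pos hkR (pow_pos hε 2)) (div_pos hkOm hε)
  exact RodTransport.exponentiallyStable hS hV
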